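/- **Conventions.** Let $k$ be a complete valued field, i.e. a field complete for a multiplicative norm $|\cdot|$ satisfying the usual triangle inequality (Archimedean or not). $\mathrm{Ban}_k$ is the category of complete normed $k$-vector spaces (usual triangle inequality) and bounded linear maps, with the completed projective tensor product $\hat\otimes$; $\mathrm{IndBan}_k$ is its ind-completion, $\mathrm{Hom}(\text{"colim"}_iX_i,\text{"colim"}_jY_j)=\lim_i\mathrm{colim}_j\mathrm{Hom}(X_i,Y_j)$, with the induced symmetric monoidal structure, again written $\hat\otimes$. An object is *flat* if tensoring with it preserves kernels. A *pre-braiding* of $V$ is an endomorphism $c$ of $V\hat\otimes V$ with $(c\otimes 1)(1\otimes c)(c\otimes 1)=(1\otimes c)(c\otimes 1)(1\otimes c)$; it is a braiding if it is invertible. A *pre-braided Hopf algebra* is an algebra and coalgebra $R$ with a pre-braiding $\tilde c$ which commutes with $\mu,\eta,\Delta,\varepsilon$ in the usual sense, such that $\Delta\mu=(\mu\otimes\mu)(1\otimes\tilde c\otimes1)(\Delta\otimes\Delta)$, $\Delta\eta=\eta\otimes\eta$, $\varepsilon\mu=\varepsilon\otimes\varepsilon$, $\varepsilon\eta=1$,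 and which has an antipode. For $r>0$ let $k\{t/r\}$ be the space of power series $\sum a_nt^n$ with $\sum|a_n|r^n<\infty$; let $k\{t\}^\dagger=\text{"colim"}_{r>1}k\{t/r\}$ and $k\{t/0\}^\dagger=\text{"colim"}_{r>0}k\{t/r\}$, with multiplication of power series and comultiplication $t^n\mapsto t^n\otimes t^n$. The first is a bialgebra with counit $t^n\mapsto1$; the second has no counit. A *dagger-0 grading* of $R$ is a coassociative coaction $\rho_0\colon R\to k\{t/0\}^\dagger\hat\otimes R$ which is induced, through $k\{t\}^\dagger\to k\{t/0\}^\dagger$, by a coassociative counital coaction $\rho\colon R\to k\{t\}^\dagger\hat\otimes R$. Its pieces are $R(n)=\mathrm{Eq}(\rho_0,\,t^n\otimes\mathrm{id})$. A pre-braided Hopf algebra is dagger-0 graded if, for $\rho_0$ and for $\rho$, its $\mu,\eta,\Delta,\varepsilon$ and antipode are colinear and $\tilde c$ interchanges degrees, i.e. is colinear up to the flip for the coactions on $R\hat\otimes R$ of the tensor square of $k\{t/0\}^\dagger$, respectively $k\{t\}^\dagger$. Let $(V,c)$ be flat and pre-braided. A flat dagger-0 graded pre-braided Hopf algebra $R$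 with a morphism $i\colon V\to R$ *satisfies (N)* if $\eta$ identifies $k$ with $R(0)$, if $i$ identifies $V$ both with $R(1)$ and with the primitive subspace $P(R)=\mathrm{Eq}(\Delta,\,\eta\otimes1+1\otimes\eta)$, if $\tilde c(i\otimes i)=(i\otimes i)c$, and if the same descriptions of $k$ and $V$ hold for the pieces defined by $\rho$. $R$ is *generated by $V$* if every morphism of algebras $f\colon A'\to R$ through which $i$ factors is an epimorphism in $\mathrm{IndBan}_k$; it is *densely generated by $V$* if for every such $f$ and all $a,b\colon R\to Z$ with $af=bf$, where $Z$ is an ind-Banach space with injective transition maps (for example a Banach space), $a=b$. A *dagger-0 Nichols algebra* of $V$ is an $R$ satisfying (N) and generated by $V$. For a finite-dimensional Banach space $V$ with a pre-braiding $c$ of norm at most $1$ and $r>0$ let $T_r(V)$ be the space of sequences $(x_n)$, $x_n\in V^{\hat\otimes n}$, with $\sum\|x_n\|r^n<\infty$. With concatenation, the pre-braiding induced by $c$, the projection $\varepsilon$ to degree $0$, the coaction $x\mapsto t^n\otimes x$ for $x\in V^{\hat\otimes n}$, and the maps $\Delta\colon T_r(V)\to T_{r/2}(V)\hat\otimes T_{r/2}(V)$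 determined by $\Delta(v)=1\otimes v+v\otimes1$ and $\Delta\mu=(\mu\otimes\mu)(1\otimes \tilde c\otimes 1)(\Delta\otimes\Delta)$, these give $T_0(V)^\dagger=\text{"colim"}_{r>0}T_r(V)$. Let $\mathcal I(V)$ be the set of families $(I_r)_{r>0}$ of homogeneous two-sided ideals $I_r\subset T_r(V)$, concentrated in degrees $\ge2$, such that $T_r(V)\to T_s(V)$ maps $I_r$ into $I_s$ for $s\le r$, and $\Delta(I_r)$ lies in the closure of $I_{r/2}\otimes T_{r/2}(V)+T_{r/2}(V)\otimes I_{r/2}$. Let $I_r(V)$ be the sum of all $I_r$ with $(I_r)_{r>0}\in\mathcal I(V)$. **Proposition.** Let $V$ be a finite-dimensional Banach space with a pre-braiding $c$ of norm at most $1$. Then: 1. A dagger-0 Nichols algebra of $V$ exists, and one whose pre-braiding is a braiding if $c$ is invertible. 2. The family $(I_r(V))_{r>0}$ belongs to $\mathcal I(V)$ (so it is its largest element), and each $I_r(V)$ is closed. 3. The structure of $T_0(V)^\dagger$ (multiplication, unit, comultiplication, counit, pre-braiding, coaction of $k\{t\}^\dagger$ and the map from $V$) descends to $\text{"colim"}_{r>0}T_r(V)/I_r(V)$.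 With the descended structure this is a flat dagger-0 graded pre-braided Hopf algebra which satisfies (N) and is densely generated by $V$. Its pre-braiding is a braiding if $c$ is invertible with $\|c^{-1}\|\le1$. -/

import Mathlib

open CategoryTheory MonoidalCategory

universe u

noncomputable section

/-! ### Banach spaces over a complete valued field -/

/-- A Banach space over the valued field `k`: a complete normed space with a specified norm
satisfying the (weak) triangle inequality. -/
structure Ban (k : Type u) [NormedField k] : Type (u + 1) where
  carrier : Type u
  [grp : NormedAddCommGroup carrier]
  [mod : NormedSpace k carrier]
  [cpl : CompleteSpace carrier]

namespace Ban

variable {k : Type u} [NormedField k]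

instance : CoeSort (Ban k) (Type u) := ⟨Ban.carrier⟩

instance (V : Ban k) : NormedAddCommGroup V := V.grp
instance (V : Ban k) : NormedSpace k V := V.mod
instance (V : Ban k) : CompleteSpace V := V.cpl

/-- `f` is bounded by `C`, that is, its operator norm is at most `C` (for `C ≥ 0`). -/
def BoundedBy {V W : Ban k} (f : V →ₗ[k] W) (C : ℝ) : Prop := ∀ x, ‖f x‖ ≤ C * ‖x‖

/-- Bounded linear maps. -/
@[ext]
structure Hom (V W : Ban k) where
  lin : V →ₗ[k] W
  bdd : ∃ C : ℝ, BoundedBy lin C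

instance : Category (Ban k) where
  Hom := Hom
  id V := ⟨LinearMap.id, 1, fun x => by simp⟩
  comp {U V W} f g := ⟨g.lin ∘ₗ f.lin, by
    obtain ⟨C, hC⟩ := f.bdd
    obtain ⟨D, hD⟩ := g.bdd
    refine ⟨|D| * C, fun x => ?_⟩
    calc ‖g.lin (f.lin x)‖ ≤ D * ‖f.lin x‖ := hD _
      _ ≤ |D| * ‖f.lin x‖ := by gcongr; exact le_abs_self D
      _ ≤ |D| * (C * ‖x‖) := by gcongr; exact hC x
      _ = |D| * C * ‖x‖ := by ring⟩

instance {V W : Ban k} : CoeFun (V ⟶ W) (fun _ => V → W) := ⟨fun f => f.lin⟩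

/-- Construct a morphism from a linear map with a bound. -/
def ofLin {V W : Ban k} (f : V →ₗ[k] W) (h : ∃ C : ℝ, BoundedBy f C) : V ⟶ W := ⟨f, h⟩

@[simp] lemma ofLin_apply {V W : Ban k} (f : V →ₗ[k] W) (h) (x : V) :
    (ofLin f h : V ⟶ W) x = f x := rfl

@[simp] lemma id_apply {V : Ban k} (x : V) : (𝟙 V : V ⟶ V) x = x := rfl

@[simp] lemma comp_apply {U V W : Ban k} (f : U ⟶ V) (g : V ⟶ W) (x : U) :
    (f ≫ g) x = g (f x) := rfl

lemma hom_ext {V W : Ban k} {f g : V ⟶ W} (h : ∀ x, f x = g x) : f = g :=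
  Hom.ext (LinearMap.ext h)

/-- `f` has norm at most `C`. -/
def NormLE {V W : Ban k} (f : V ⟶ W) (C : ℝ) : Prop := ∀ x, ‖f x‖ ≤ C * ‖x‖

lemma exists_normLE {V W : Ban k} (f : V ⟶ W) : ∃ C : ℝ, 0 ≤ C ∧ NormLE f C := by
  obtain ⟨C, hC⟩ := f.bdd
  exact ⟨|C|, abs_nonneg C, fun x => (hC x).trans (by gcongr; exact le_abs_self C)⟩

lemma NormLE.comp {U V W : Ban k} {f : U ⟶ V} {g : V ⟶ W} {C D : ℝ} (hf : NormLE f C)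
    (hg : NormLE g D) (hD : 0 ≤ D) : NormLE (f ≫ g) (D * C) := fun x =>
  (hg _).trans (by rw [mul_assoc]; exact mul_le_mul_of_nonneg_left (hf x) hD)

lemma NormLE.comp_one {U V W : Ban k} {f : U ⟶ V} {g : V ⟶ W} (hf : NormLE f 1)
    (hg : NormLE g 1) : NormLE (f ≫ g) 1 := by simpa using hf.comp hg zero_le_one

lemma NormLE.mono {V W : Ban k} {f : V ⟶ W} {C D : ℝ} (hf : NormLE f C) (h : C ≤ D) :
    NormLE f D := fun x => (hf x).trans (by gcongr)

lemma normLE_id (V : Ban k) : NormLE (𝟙 V) 1 := fun x => by simp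

lemma hom_continuous {V W : Ban k} (f : V ⟶ W) : Continuous f := by
  obtain ⟨C, _, hC⟩ := exists_normLE f
  exact AddMonoidHomClass.continuous_of_bound f.lin C hC

instance (V W : Ban k) : Zero (V ⟶ W) := ⟨⟨0, 0, fun x => by simp⟩⟩
instance (V W : Ban k) : Add (V ⟶ W) := ⟨fun f g => ⟨f.lin + g.lin, by
  obtain ⟨C, hC⟩ := f.bdd
  obtain ⟨D, hD⟩ := g.bdd
  exact ⟨C + D, fun x => (norm_add_le _ _).trans (by
    rw [add_mul]; exact add_le_add (hC x) (hD x))⟩⟩⟩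
instance (V W : Ban k) : Neg (V ⟶ W) := ⟨fun f => ⟨-f.lin, by
  obtain ⟨C, hC⟩ := f.bdd
  exact ⟨C, fun x => by simpa using hC x⟩⟩⟩

@[simp] lemma zero_apply {V W : Ban k} (x : V) : (0 : V ⟶ W) x = 0 := rfl
@[simp] lemma add_apply {V W : Ban k} (f g : V ⟶ W) (x : V) : (f + g) x = f x + g x := rfl
@[simp] lemma neg_apply {V W : Ban k} (f : V ⟶ W) (x : V) : (-f) x = -f x := rfl

instance (V W : Ban k) : AddCommGroup (V ⟶ W) where
  add_assoc f g h := hom_ext fun x => add_assoc _ _ _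
  zero_add f := hom_ext fun x => zero_add _
  add_zero f := hom_ext fun x => add_zero _
  neg_add_cancel f := hom_ext fun x => neg_add_cancel _
  add_comm f g := hom_ext fun x => add_comm _ _
  nsmul := nsmulRec
  zsmul := zsmulRec

instance : Preadditive (Ban k) where
  add_comp _ _ _ f f' g := hom_ext fun x => map_add g.lin _ _
  comp_add _ _ _ f g g' := hom_ext fun x => rfl

/-! ### The completed projective tensor product -/

/-- The algebraic tensor product, to be equipped with the projective seminorm. -/
def AlgTensor (V W : Ban k) : Type u := TensorProduct k V W

instance (V W : Ban k) : AddCommGroup (AlgTensor V W) :=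
  inferInstanceAs (AddCommGroup (TensorProduct k V W))
instance (V W : Ban k) : Module k (AlgTensor V W) :=
  inferInstanceAs (Module k (TensorProduct k V W))

/-- The elementary tensor `v ⊗ w` in the algebraic tensor product. -/
def algTmul {V W : Ban k} (v : V) (w : W) : AlgTensor V W := TensorProduct.tmul k v w

/-- The linear map out of the algebraic tensor product induced by a bilinear map. -/
def algLift {V W Z : Ban k} (B : V →ₗ[k] W →ₗ[k] Z) : AlgTensor V W →ₗ[k] Z :=
  (TensorProduct.lift B : TensorProduct k V W →ₗ[k] Z)

lemma algLift_tmul {V W Z : Ban k} (B : V →ₗ[k] W →ₗ[k] Z) (v : V) (w : W) :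
    algLift B (algTmul v w) = B v w := TensorProduct.lift.tmul v w

lemma smul_algTmul {V W : Ban k} (a : k) (v : V) (w : W) :
    algTmul (a • v) w = a • algTmul v w := TensorProduct.smul_tmul' a v w

/-- The value `∑ x_i ⊗ y_i` of a formal sum of pairs. -/
def tensorVal {V W : Ban k} (l : List (V × W)) : AlgTensor V W :=
  (l.map fun p => algTmul p.1 p.2).sum

lemma tensorVal_cons {V W : Ban k} (p : V × W) (l : List (V × W)) :
    tensorVal (p :: l) = algTmul p.1 p.2 + tensorVal l := by
  simp [tensorVal]

/-- The cost `∑ ‖x_i‖ ‖y_i‖` of a formal sum of pairs. -/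
def tensorCost {V W : Ban k} (l : List (V × W)) : ℝ := (l.map fun p => ‖p.1‖ * ‖p.2‖).sum

lemma tensorCost_nonneg {V W : Ban k} (l : List (V × W)) : 0 ≤ tensorCost l :=
  List.sum_nonneg fun a ha => by
    obtain ⟨p, -, rfl⟩ := List.mem_map.1 ha
    positivity

lemma tensorVal_append {V W : Ban k} (l m : List (V × W)) :
    tensorVal (l ++ m) = tensorVal l + tensorVal m := by
  simp only [tensorVal, List.map_append]
  exact List.sum_append

lemma tensorCost_append {V W : Ban k} (l m : List (V × W)) :
    tensorCost (l ++ m) = tensorCost l + tensorCost m := by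
  simp [tensorCost]

lemma tensorVal_smul {V W : Ban k} (a : k) (l : List (V × W)) :
    tensorVal (l.map fun p => (a • p.1, p.2)) = a • tensorVal l := by
  induction l with
  | nil => exact (smul_zero a).symm
  | cons p l ih => rw [List.map_cons, tensorVal_cons, tensorVal_cons, ih, smul_add, smul_algTmul]

lemma tensorCost_smul {V W : Ban k} (a : k) (l : List (V × W)) :
    tensorCost (l.map fun p => (a • p.1, p.2)) = ‖a‖ * tensorCost l := by
  induction l with
  | nil => simp [tensorCost]
  | cons p l ih =>
    simp only [tensorCost, List.map_cons, List.sum_cons] at ih ⊢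
    rw [ih, norm_smul]; ring

lemma exists_tensorVal {V W : Ban k} (z : AlgTensor V W) : ∃ l, tensorVal l = z := by
  induction z using TensorProduct.induction_on with
  | zero => exact ⟨[], rfl⟩
  | tmul x y => exact ⟨[(x, y)], by rw [tensorVal_cons]; exact add_zero _⟩
  | add x y hx hy =>
    obtain ⟨l, hl⟩ := hx
    obtain ⟨m, hm⟩ := hy
    exact ⟨l ++ m, by rw [tensorVal_append, hl, hm]; rfl⟩

/-- The projective seminorm
`‖z‖ = inf {∑ ‖x_i‖ ‖y_i‖ : z = ∑ x_i ⊗ y_i}`. -/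
def projNorm {V W : Ban k} (z : AlgTensor V W) : ℝ :=
  sInf {s | ∃ l : List (V × W), tensorVal l = z ∧ tensorCost l = s}

lemma projNorm_le {V W : Ban k} (l : List (V × W)) :
    projNorm (tensorVal l) ≤ tensorCost l :=
  csInf_le ⟨0, by rintro _ ⟨m, -, rfl⟩; exact tensorCost_nonneg m⟩ ⟨l, rfl, rfl⟩

lemma le_projNorm {V W : Ban k} (z : AlgTensor V W) (s : ℝ)
    (h : ∀ l, tensorVal l = z → s ≤ tensorCost l) : s ≤ projNorm z := by
  obtain ⟨l, hl⟩ := exists_tensorVal z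
  refine le_csInf ⟨_, l, hl, rfl⟩ ?_
  rintro _ ⟨m, hm, rfl⟩
  exact h m hm

lemma projNorm_zero {V W : Ban k} : projNorm (0 : AlgTensor V W) ≤ 0 :=
  (projNorm_le ([] : List (V × W))).trans_eq (by simp [tensorCost])

lemma projNorm_nonneg {V W : Ban k} (z : AlgTensor V W) : 0 ≤ projNorm z :=
  le_projNorm z 0 fun l _ => tensorCost_nonneg l

lemma projNorm_smul_le {V W : Ban k} (a : k) (z : AlgTensor V W) :
    projNorm (a • z) ≤ ‖a‖ * projNorm z := by
  rcases eq_or_ne a 0 with rfl | ha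
  · rw [zero_smul, norm_zero, zero_mul]
    exact projNorm_zero
  · have ha' : 0 < ‖a‖ := norm_pos_iff.2 ha
    rw [← div_le_iff₀' ha']
    refine le_projNorm z _ fun l hl => ?_
    rw [div_le_iff₀' ha', ← tensorCost_smul, ← hl, ← tensorVal_smul]
    exact projNorm_le _

instance (V W : Ban k) : SeminormedAddCommGroup (AlgTensor V W) :=
  AddGroupSeminorm.toSeminormedAddCommGroup
    { toFun := projNorm
      map_zero' := le_antisymm projNorm_zero (projNorm_nonneg _)
      add_le' := fun x y => by
        rw [← sub_le_iff_le_add']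
        refine le_projNorm y _ fun m hm => ?_
        rw [sub_le_comm]
        refine le_projNorm x _ fun l hl => ?_
        rw [sub_le_iff_le_add, ← tensorCost_append, ← hl, ← hm, ← tensorVal_append]
        exact projNorm_le _
      neg' := fun x => by
        have h : ∀ y : AlgTensor V W, projNorm (-y) ≤ projNorm y := fun y => by
          simpa using projNorm_smul_le (-1 : k) y
        exact le_antisymm (h x) (by simpa using h (-x)) }

lemma algTensor_norm_def {V W : Ban k} (z : AlgTensor V W) : ‖z‖ = projNorm z := rfl

instance (V W : Ban k) : NormedSpace k (AlgTensor V W) where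
  norm_smul_le a z := projNorm_smul_le a z

/-- The completed projective tensor product `V ⊗̂ W`. -/
def tensor (V W : Ban k) : Ban k := ⟨UniformSpace.Completion (AlgTensor V W)⟩

/-- The canonical map from the algebraic tensor product to `V ⊗̂ W`. -/
def toTensor (V W : Ban k) : AlgTensor V W →ₗ[k] tensor V W :=
  (UniformSpace.Completion.toComplₗᵢ (𝕜 := k) (E := AlgTensor V W)).toLinearMap

lemma norm_toTensor {V W : Ban k} (z : AlgTensor V W) : ‖toTensor V W z‖ = ‖z‖ :=
  UniformSpace.Completion.norm_coe z

lemma denseRange_toTensor (V W : Ban k) : DenseRange (toTensor V W) :=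
  UniformSpace.Completion.denseRange_coe

/-- The elementary tensor `v ⊗ w ∈ V ⊗̂ W`. -/
def tmul {V W : Ban k} (v : V) (w : W) : tensor V W :=
  toTensor V W (algTmul v w)

lemma norm_tmul_le {V W : Ban k} (v : V) (w : W) : ‖tmul v w‖ ≤ ‖v‖ * ‖w‖ := by
  rw [tmul, norm_toTensor, algTensor_norm_def]
  simpa [tensorVal, tensorCost] using projNorm_le [(v, w)]

lemma tmul_add {V W : Ban k} (v : V) (w w' : W) : tmul v (w + w') = tmul v w + tmul v w' := by
  rw [tmul, tmul, tmul, ← map_add]; exact congrArg _ (TensorProduct.tmul_add v w w')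
lemma add_tmul {V W : Ban k} (v v' : V) (w : W) : tmul (v + v') w = tmul v w + tmul v' w := by
  rw [tmul, tmul, tmul, ← map_add]; exact congrArg _ (TensorProduct.add_tmul v v' w)
lemma tmul_smul {V W : Ban k} (a : k) (v : V) (w : W) : tmul v (a • w) = a • tmul v w := by
  rw [tmul, tmul, ← map_smul]; exact congrArg _ (TensorProduct.tmul_smul a v w)
lemma smul_tmul {V W : Ban k} (a : k) (v : V) (w : W) : tmul (a • v) w = a • tmul v w := by
  rw [tmul, tmul, ← map_smul, smul_algTmul]

/-- Morphisms out of `V ⊗̂ W` agreeing on elementary tensors are equal. -/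
lemma tensor_ext {V W Z : Ban k} {f g : tensor V W ⟶ Z}
    (h : ∀ v w, f (tmul v w) = g (tmul v w)) : f = g := by
  refine hom_ext fun x => ?_
  refine congrFun ((denseRange_toTensor V W).equalizer (hom_continuous f) (hom_continuous g)
    (funext fun z => ?_)) x
  have : f.lin ∘ₗ toTensor V W = g.lin ∘ₗ toTensor V W :=
    TensorProduct.ext' (M := V) (N := W) fun v w => h v w
  exact LinearMap.congr_fun this z

/-- A bilinear map of norm at most `C`. -/
def BilinBound {V W Z : Ban k} (B : V →ₗ[k] W →ₗ[k] Z) (C : ℝ) : Prop :=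
  ∀ v w, ‖B v w‖ ≤ C * ‖v‖ * ‖w‖

lemma lift_bound {V W Z : Ban k} (B : V →ₗ[k] W →ₗ[k] Z) {C : ℝ} (hC : 0 ≤ C)
    (hB : BilinBound B C) (z : AlgTensor V W) :
    ‖algLift B z‖ ≤ C * ‖toTensor V W z‖ := by
  rw [norm_toTensor, algTensor_norm_def]
  have key : ∀ l : List (V × W), ‖algLift B (tensorVal l)‖ ≤ C * tensorCost l := by
    intro l
    induction l with
    | nil => simp [tensorCost, tensorVal]
    | cons p l ih =>
      have h3 : tensorCost (p :: l) = ‖p.1‖ * ‖p.2‖ + tensorCost l := by simp [tensorCost]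
      rw [tensorVal_cons, h3, map_add, algLift_tmul, mul_add]
      refine (norm_add_le _ _).trans (add_le_add ?_ ih)
      rw [← mul_assoc]; exact hB _ _
  rcases hC.eq_or_lt with rfl | hC'
  · obtain ⟨l, rfl⟩ := exists_tensorVal z
    simpa using key l
  · rw [← div_le_iff₀' hC']
    refine le_projNorm z _ fun l hl => ?_
    rw [div_le_iff₀' hC', ← hl]
    exact key l

/-- The universal property of `V ⊗̂ W`: bounded bilinear maps extend to bounded linear maps. -/
def lift {V W Z : Ban k} (B : V →ₗ[k] W →ₗ[k] Z) (hB : ∃ C : ℝ, 0 ≤ C ∧ BilinBound B C) :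
    tensor V W ⟶ Z :=
  ⟨((algLift B).extendOfNorm (toTensor V W)).toLinearMap, by
    obtain ⟨C, hC, h⟩ := hB
    exact ⟨C, LinearMap.norm_extendOfNorm_apply_le (denseRange_toTensor V W) C
      (lift_bound B hC h)⟩⟩

lemma normLE_lift {V W Z : Ban k} (B : V →ₗ[k] W →ₗ[k] Z) (hB) {C : ℝ} (hC : 0 ≤ C)
    (h : BilinBound B C) : NormLE (lift B hB) C :=
  LinearMap.norm_extendOfNorm_apply_le (denseRange_toTensor V W) C (lift_bound B hC h)

@[simp] lemma lift_tmul {V W Z : Ban k} (B : V →ₗ[k] W →ₗ[k] Z) (hB) (v : V) (w : W) :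
    lift B hB (tmul v w) = B v w := by
  obtain ⟨C, hC, h⟩ := hB
  exact (LinearMap.extendOfNorm_eq (denseRange_toTensor V W)
    ⟨C, lift_bound B hC h⟩ _).trans (algLift_tmul B v w)

/-- `w ↦ v ⊗ w` as a morphism. -/
def tmulLeft {V W : Ban k} (v : V) : W ⟶ tensor V W :=
  ofLin ⟨⟨fun w => tmul v w, tmul_add v⟩, fun a w => tmul_smul a v w⟩ ⟨‖v‖, norm_tmul_le v⟩

/-- `v ↦ v ⊗ w` as a morphism. -/
def tmulRight {V W : Ban k} (w : W) : V ⟶ tensor V W :=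
  ofLin ⟨⟨fun v => tmul v w, fun v v' => add_tmul v v' w⟩, fun a v => smul_tmul a v w⟩
    ⟨‖w‖, fun v => (norm_tmul_le v w).trans_eq (mul_comm _ _)⟩

@[simp] lemma tmulLeft_apply {V W : Ban k} (v : V) (w : W) : tmulLeft v w = tmul v w := rfl
@[simp] lemma tmulRight_apply {V W : Ban k} (v : V) (w : W) : tmulRight w v = tmul v w := rfl

lemma tensor_ext_left {U V W Z : Ban k} {f g : tensor (tensor U V) W ⟶ Z}
    (h : ∀ u v w, f (tmul (tmul u v) w) = g (tmul (tmul u v) w)) : f = g :=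
  tensor_ext fun x w => congrArg (fun φ : tensor U V ⟶ Z => φ x)
    (show tmulRight w ≫ f = tmulRight w ≫ g from tensor_ext fun u v => h u v w)

lemma tensor_ext_right {U V W Z : Ban k} {f g : tensor U (tensor V W) ⟶ Z}
    (h : ∀ u v w, f (tmul u (tmul v w)) = g (tmul u (tmul v w))) : f = g :=
  tensor_ext fun u x => congrArg (fun φ : tensor V W ⟶ Z => φ x)
    (show tmulLeft u ≫ f = tmulLeft u ≫ g from tensor_ext fun v w => h u v w)

lemma tensor_ext_four {T U V W Z : Ban k} {f g : tensor (tensor (tensor T U) V) W ⟶ Z}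
    (h : ∀ t u v w, f (tmul (tmul (tmul t u) v) w) = g (tmul (tmul (tmul t u) v) w)) : f = g :=
  tensor_ext fun x w => congrArg (fun φ : tensor (tensor T U) V ⟶ Z => φ x)
    (show tmulRight w ≫ f = tmulRight w ≫ g from tensor_ext_left fun t u v => h t u v w)

/-- The tensor product of two morphisms. -/
def map {V V' W W' : Ban k} (f : V ⟶ V') (g : W ⟶ W') : tensor V W ⟶ tensor V' W' :=
  lift (LinearMap.mk₂ k (fun v w => tmul (f v) (g w))
    (fun v v' w => by rw [← add_tmul, ← map_add])
    (fun a v w => by rw [← smul_tmul, ← map_smul])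
    (fun v w w' => by rw [← tmul_add, ← map_add])
    (fun a v w => by rw [← tmul_smul, ← map_smul])) (by
      obtain ⟨C, hC, hf⟩ := exists_normLE f
      obtain ⟨D, hD, hg⟩ := exists_normLE g
      refine ⟨C * D, by positivity, fun v w => (norm_tmul_le _ _).trans ?_⟩
      calc ‖f v‖ * ‖g w‖ ≤ (C * ‖v‖) * (D * ‖w‖) := by gcongr; exacts [hf v, hg w]
        _ = _ := by ring)

@[simp] lemma map_tmul {V V' W W' : Ban k} (f : V ⟶ V') (g : W ⟶ W') (v : V) (w : W) :
    map f g (tmul v w) = tmul (f v) (g w) := by simp [map]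

lemma NormLE.map {V V' W W' : Ban k} {f : V ⟶ V'} {g : W ⟶ W'} {C D : ℝ} (hC : 0 ≤ C)
    (hD : 0 ≤ D) (hf : NormLE f C) (hg : NormLE g D) : NormLE (map f g) (C * D) :=
  normLE_lift _ _ (by positivity) fun v w => (norm_tmul_le _ _).trans (by
    calc ‖f v‖ * ‖g w‖ ≤ (C * ‖v‖) * (D * ‖w‖) := by gcongr; exacts [hf v, hg w]
      _ = _ := by ring)

/-- The associator. -/
def assocHom (U V W : Ban k) : tensor (tensor U V) W ⟶ tensor U (tensor V W) :=
  lift (LinearMap.mk₂ k (fun x w => map (𝟙 U) (tmulRight w) x)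
    (fun x x' w => map_add _ _ _)
    (fun a x w => map_smul _ _ _)
    (fun x w w' => by
      have : map (𝟙 U) (tmulRight (V := V) (w + w')) =
        map (𝟙 U) (tmulRight w) + map (𝟙 U) (tmulRight w') :=
          tensor_ext fun u v => by simp [tmul_add]
      rw [this]; rfl)
    (fun a x w => by
      have : map (𝟙 U) (tmulRight (V := V) (a • w)) =
        map (𝟙 U) (tmulRight w) ≫ ofLin (a • LinearMap.id) ⟨‖a‖, fun x => by
          simp [norm_smul]⟩ :=
          tensor_ext fun u v => by simp [tmul_smul]
      rw [this]; rfl))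
    ⟨1, zero_le_one, fun x w => by
      have h : NormLE (tmulRight (V := V) w) ‖w‖ :=
        fun v => (norm_tmul_le v w).trans_eq (mul_comm _ _)
      refine ((normLE_id U).map zero_le_one (norm_nonneg w) h x).trans_eq ?_
      ring⟩

@[simp] lemma assocHom_tmul {U V W : Ban k} (u : U) (v : V) (w : W) :
    assocHom U V W (tmul (tmul u v) w) = tmul u (tmul v w) := by simp [assocHom]

lemma normLE_assocHom (U V W : Ban k) : NormLE (assocHom U V W) 1 :=
  normLE_lift _ _ zero_le_one fun x w => by
    have h : NormLE (tmulRight (V := V) w) ‖w‖ :=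
      fun v => (norm_tmul_le v w).trans_eq (mul_comm _ _)
    refine ((normLE_id U).map zero_le_one (norm_nonneg w) h x).trans_eq ?_
    ring

/-- The symmetry `v ⊗ w ↦ w ⊗ v`. -/
def swap (V W : Ban k) : tensor V W ⟶ tensor W V :=
  lift (LinearMap.mk₂ k (fun v w => tmul w v) (fun _ _ _ => tmul_add _ _ _)
    (fun _ _ _ => tmul_smul _ _ _) (fun _ _ _ => add_tmul _ _ _) (fun _ _ _ => smul_tmul _ _ _))
    ⟨1, zero_le_one, fun v w => (norm_tmul_le w v).trans_eq (by ring)⟩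

@[simp] lemma swap_tmul {V W : Ban k} (v : V) (w : W) : swap V W (tmul v w) = tmul w v := by
  simp [swap]

lemma normLE_swap (V W : Ban k) : NormLE (swap V W) 1 :=
  normLE_lift _ _ zero_le_one fun v w => (norm_tmul_le w v).trans_eq (by ring)

/-- The inverse of the associator. -/
def assocInv (U V W : Ban k) : tensor U (tensor V W) ⟶ tensor (tensor U V) W :=
  swap U (tensor V W) ≫ map (swap V W) (𝟙 U) ≫ assocHom W V U ≫ swap W (tensor V U) ≫
    map (swap V U) (𝟙 W)

@[simp] lemma assocInv_tmul {U V W : Ban k} (u : U) (v : V) (w : W) :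
    assocInv U V W (tmul u (tmul v w)) = tmul (tmul u v) w := by simp [assocInv]

lemma normLE_assocInv (U V W : Ban k) : NormLE (assocInv U V W) 1 := by
  have h : ∀ A B C : Ban k, NormLE (map (swap A B) (𝟙 C)) 1 := fun A B C => by
    simpa using (normLE_swap A B).map zero_le_one zero_le_one (normLE_id C)
  exact (normLE_swap _ _).comp_one ((h _ _ _).comp_one ((normLE_assocHom _ _ _).comp_one
    ((normLE_swap _ _).comp_one (h _ _ _))))

lemma map_id (V W : Ban k) : map (𝟙 V) (𝟙 W) = 𝟙 (tensor V W) :=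
  tensor_ext fun _ _ => by simp

lemma map_comp {V V' V'' W W' W'' : Ban k} (f : V ⟶ V') (f' : V' ⟶ V'') (g : W ⟶ W')
    (g' : W' ⟶ W'') : map f g ≫ map f' g' = map (f ≫ f') (g ≫ g') :=
  tensor_ext fun _ _ => by simp

lemma assocHom_naturality {U U' V V' W W' : Ban k} (f : U ⟶ U') (g : V ⟶ V') (h : W ⟶ W') :
    map (map f g) h ≫ assocHom U' V' W' = assocHom U V W ≫ map f (map g h) :=
  tensor_ext_left fun _ _ _ => by simp

lemma swap_naturality {V V' W W' : Ban k} (f : V ⟶ V') (g : W ⟶ W') :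
    map f g ≫ swap V' W' = swap V W ≫ map g f :=
  tensor_ext fun a v => by simp

lemma swap_swap (V W : Ban k) : swap V W ≫ swap W V = 𝟙 _ := tensor_ext fun _ _ => by simp

lemma pentagon_aux (U V W X : Ban k) :
    map (assocHom U V W) (𝟙 X) ≫ assocHom U (tensor V W) X ≫ map (𝟙 U) (assocHom V W X) =
      assocHom (tensor U V) W X ≫ assocHom U V (tensor W X) :=
  tensor_ext_four fun _ _ _ _ => by simp

lemma hexagon_aux (X Y Z : Ban k) :
    assocHom X Y Z ≫ swap X (tensor Y Z) ≫ assocHom Y Z X =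
      map (swap X Y) (𝟙 Z) ≫ assocHom Y X Z ≫ map (𝟙 Y) (swap X Z) :=
  tensor_ext_left fun _ _ _ => by simp

lemma hexagon_aux' (X Y Z : Ban k) :
    assocInv X Y Z ≫ swap (tensor X Y) Z ≫ assocInv Z X Y =
      map (𝟙 X) (swap Y Z) ≫ assocInv X Z Y ≫ map (swap X Z) (𝟙 Y) :=
  tensor_ext_right fun _ _ _ => by simp

variable [CompleteSpace k]

/-- The field `k` as a Banach space. -/
def unit (k : Type u) [NormedField k] [CompleteSpace k] : Ban k := ⟨k⟩

/-- The element of `unit k` given by a scalar. -/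
def scalar (a : k) : unit k := a

/-- The scalar underlying an element of `unit k`. -/
def toScalar (a : unit k) : k := a

/-- Scalar multiplication `k ⊗̂ V ⟶ V`. -/
def lunitHom (V : Ban k) : tensor (unit k) V ⟶ V :=
  lift (LinearMap.lsmul k V : k →ₗ[k] V →ₗ[k] V)
    ⟨1, zero_le_one, fun a v => by
      rw [one_mul]; exact (norm_smul_le (toScalar a) v)⟩

@[simp] lemma lunitHom_tmul {V : Ban k} (a : unit k) (v : V) :
    lunitHom V (tmul a v) = toScalar a • v := lift_tmul _ _ _ _

lemma normLE_lunitHom (V : Ban k) : NormLE (lunitHom V) 1 :=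
  normLE_lift _ _ zero_le_one fun a v => by
    rw [one_mul]; exact (norm_smul_le (toScalar a) v)

lemma lunitHom_one {V : Ban k} (v : V) : lunitHom V (tmul (scalar 1) v) = v :=
  (lunitHom_tmul _ _).trans (one_smul k v)

lemma tmul_unit {V : Ban k} (a : unit k) (v : V) :
    tmul (scalar 1) (toScalar a • v) = tmul a v := by
  rw [tmul_smul, ← smul_tmul]
  congr 1
  exact mul_one (toScalar a)

lemma tmul_unit' {V : Ban k} (a : unit k) (v : V) :
    tmul (toScalar a • v) (scalar 1) = tmul v a := by
  rw [smul_tmul, ← tmul_smul]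
  congr 1
  exact mul_one (toScalar a)

lemma lunitHom_naturality {V W : Ban k} (f : V ⟶ W) :
    map (𝟙 (unit k)) f ≫ lunitHom W = lunitHom V ≫ f :=
  tensor_ext fun a v => by
    rw [comp_apply, comp_apply, map_tmul, lunitHom_tmul, lunitHom_tmul, id_apply]
    exact (map_smul f.lin _ _).symm

lemma triangle_aux (V W : Ban k) :
    assocHom V (unit k) W ≫ map (𝟙 V) (lunitHom W) = map (swap _ _ ≫ lunitHom V) (𝟙 W) :=
  tensor_ext_left fun v a w => by
    rw [comp_apply, assocHom_tmul, map_tmul, map_tmul, comp_apply, swap_tmul, lunitHom_tmul,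
      lunitHom_tmul, id_apply, id_apply, tmul_smul, smul_tmul]

/-- Banach spaces form a symmetric monoidal category under `⊗̂`. -/
instance : MonoidalCategoryStruct (Ban k) where
  tensorObj := tensor
  tensorHom := map
  whiskerLeft X _ _ f := map (𝟙 X) f
  whiskerRight f Y := map f (𝟙 Y)
  tensorUnit := unit k
  associator U V W :=
    { hom := assocHom U V W
      inv := assocInv U V W
      hom_inv_id := tensor_ext_left fun u v w => by simp
      inv_hom_id := tensor_ext_right fun u v w => by simp }
  leftUnitor V :=
    { hom := lunitHom V
      inv := tmulLeft (scalar 1)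
      hom_inv_id := tensor_ext fun a v => by
        rw [comp_apply, lunitHom_tmul, tmulLeft_apply, tmul_unit, id_apply]
      inv_hom_id := hom_ext fun v => lunitHom_one v }
  rightUnitor V :=
    { hom := swap _ _ ≫ lunitHom V
      inv := tmulRight (scalar 1)
      hom_inv_id := tensor_ext fun v a => by
        rw [comp_apply, comp_apply, swap_tmul, lunitHom_tmul, tmulRight_apply, tmul_unit', id_apply]
      inv_hom_id := hom_ext fun v => by
        rw [comp_apply, comp_apply, tmulRight_apply, swap_tmul, lunitHom_one, id_apply] }

instance : MonoidalCategory (Ban k) := MonoidalCategory.ofTensorHom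
  (id_tensorHom_id := map_id)
  (id_tensorHom := fun _ _ _ _ => rfl)
  (tensorHom_id := fun _ _ => rfl)
  (tensorHom_comp_tensorHom := fun f f' g g' => map_comp f g f' g')
  (associator_naturality := assocHom_naturality)
  (leftUnitor_naturality := lunitHom_naturality)
  (rightUnitor_naturality := fun {X Y} f => by
    have h := swap_naturality f (𝟙 (unit k))
    have h' := lunitHom_naturality f
    change map f (𝟙 (unit k)) ≫ swap _ _ ≫ lunitHom Y = (swap _ _ ≫ lunitHom X) ≫ f
    rw [← Category.assoc, h, Category.assoc, h', Category.assoc])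
  (pentagon := pentagon_aux)
  (triangle := triangle_aux)

instance : SymmetricCategory (Ban k) where
  braiding V W := ⟨swap V W, swap W V, swap_swap V W, swap_swap W V⟩
  braiding_naturality_right X _ _ f := swap_naturality (𝟙 X) f
  braiding_naturality_left f Z := swap_naturality f (𝟙 Z)
  hexagon_forward := hexagon_aux
  hexagon_reverse := hexagon_aux'
  symmetry := swap_swap

lemma normLE_whiskerLeft (V : Ban k) {W W' : Ban k} {g : W ⟶ W'} (hg : NormLE g 1) :
    NormLE (V ◁ g) 1 :=
  ((normLE_id V).map zero_le_one zero_le_one hg).mono (mul_one 1).le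
lemma normLE_whiskerRight {V V' : Ban k} {f : V ⟶ V'} (hf : NormLE f 1) (W : Ban k) :
    NormLE (f ▷ W) 1 :=
  (hf.map zero_le_one zero_le_one (normLE_id W)).mono (mul_one 1).le
lemma normLE_associator_hom (U V W : Ban k) : NormLE (α_ U V W).hom 1 := normLE_assocHom U V W
lemma normLE_associator_inv (U V W : Ban k) : NormLE (α_ U V W).inv 1 := normLE_assocInv U V W
lemma normLE_leftUnitor_hom (V : Ban k) : NormLE (λ_ V).hom 1 := normLE_lunitHom V
lemma normLE_rightUnitor_hom (V : Ban k) : NormLE (ρ_ V).hom 1 :=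
  (normLE_swap _ _).comp_one (normLE_lunitHom V)
lemma normLE_leftUnitor_inv (V : Ban k) : NormLE (λ_ V).inv 1 := fun v =>
  (norm_tmul_le _ _).trans_eq (congrArg (· * ‖v‖) (norm_one (α := k)))
lemma normLE_rightUnitor_inv (V : Ban k) : NormLE (ρ_ V).inv 1 := fun v =>
  (norm_tmul_le _ _).trans_eq (by
    rw [mul_comm]; exact congrArg (· * ‖v‖) (norm_one (α := k)))

end Ban

/-! ### Rescaling and contracting coproducts -/

/-- A positive real number, in an arbitrary universe.  Radii are ordered by reverse inequality,
so that there is a morphism `r ⟶ s` of the associated category precisely when `s ≤ r`. -/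
@[ext]
structure Radius : Type u where
  val : ℝ
  pos : 0 < val

namespace Radius

instance : Preorder Radius.{u} where
  le r s := s.val ≤ r.val
  le_refl r := le_refl r.val
  le_trans _ _ _ h h' := le_trans (α := ℝ) h' h

lemma le_def {r s : Radius.{u}} : r ≤ s ↔ s.val ≤ r.val := Iff.rfl

instance : Nonempty Radius.{u} := ⟨⟨1, one_pos⟩⟩

instance : IsDirectedOrder Radius.{u} where
  directed r s := ⟨⟨min r.val s.val, lt_min r.pos s.pos⟩, min_le_left r.val s.val,
    min_le_right r.val s.val⟩

/-- `r / 2`. -/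
def half (r : Radius.{u}) : Radius.{u} := ⟨r.val / 2, half_pos r.pos⟩

/-- `√ r`. -/
def sqrt (r : Radius.{u}) : Radius.{u} := ⟨Real.sqrt r.val, Real.sqrt_pos.2 r.pos⟩

lemma half_mono {r s : Radius.{u}} (h : r ≤ s) : r.half ≤ s.half :=
  div_le_div_of_nonneg_right (le_def.1 h) zero_le_two

lemma sqrt_mono {r s : Radius.{u}} (h : r ≤ s) : r.sqrt ≤ s.sqrt := Real.sqrt_le_sqrt h

lemma pow_pos (r : Radius.{u}) (n : ℕ) : 0 < r.val ^ n := _root_.pow_pos r.pos n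

lemma sqrt_mul (r : Radius.{u}) : r.sqrt.val * r.sqrt.val = r.val :=
  Real.mul_self_sqrt r.pos.le

lemma half_add (r : Radius.{u}) : r.half.val + r.half.val = r.val := add_halves _

end Radius

namespace Ban

variable {k : Type u} [NormedField k]

/-- The space `V` with its norm multiplied by `a > 0`. -/
def Scaled (a : ℝ) (_ : 0 < a) (V : Ban k) : Type u := V

/-- The element of `V` underlying an element of the rescaled space. -/
def Scaled.out {a : ℝ} {ha : 0 < a} {V : Ban k} (x : Scaled a ha V) : V := x

section Scaled

variable (a : ℝ) (ha : 0 < a) (V : Ban k)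

instance : AddCommGroup (Scaled a ha V) := inferInstanceAs (AddCommGroup V)

instance : NormedAddCommGroup (Scaled a ha V) :=
  AddGroupNorm.toNormedAddCommGroup
    { toFun := fun x => a * ‖x.out‖
      map_zero' := (congrArg (a * ·) (norm_zero (E := V))).trans (mul_zero a)
      add_le' := fun x y => by
        rw [← mul_add]; exact mul_le_mul_of_nonneg_left (norm_add_le (E := V) x y) ha.le
      neg' := fun x => congrArg (a * ·) (norm_neg (E := V) x)
      eq_zero_of_map_eq_zero' := fun x h =>
        norm_eq_zero (E := V).1 ((mul_eq_zero.1 h).resolve_left ha.ne') }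

lemma norm_scaled (x : Scaled a ha V) : ‖x‖ = a * ‖x.out‖ := rfl

instance : Module k (Scaled a ha V) := inferInstanceAs (Module k V)

instance : NormedSpace k (Scaled a ha V) where
  norm_smul_le c x := by
    rw [norm_scaled, norm_scaled, mul_left_comm]
    exact mul_le_mul_of_nonneg_left (norm_smul_le c x.out) ha.le

instance : CompleteSpace (Scaled a ha V) := by
  have hd : ∀ x y : Scaled a ha V, dist x y = a * dist x.out y.out :=
    fun x y => by rw [dist_eq_norm, dist_eq_norm]; rfl
  refine Metric.complete_of_cauchySeq_tendsto fun x hx => ?_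
  have hc : CauchySeq (fun n => (x n).out) := by
    rw [Metric.cauchySeq_iff'] at hx ⊢
    intro ε hε
    obtain ⟨N, hN⟩ := hx (a * ε) (by positivity)
    refine ⟨N, fun n hn => ?_⟩
    have := hN n hn
    rw [hd] at this
    exact lt_of_mul_lt_mul_left this ha.le
  obtain ⟨l, hl⟩ := cauchySeq_tendsto_of_complete hc
  have hl' := (tendsto_iff_dist_tendsto_zero.1 hl).const_mul a
  rw [mul_zero] at hl'
  refine ⟨(show Scaled a ha V from l), tendsto_iff_dist_tendsto_zero.2 ?_⟩
  exact hl'.congr fun n => (hd _ _).symm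

end Scaled

/-- `V_a`: the Banach space `V` with its norm rescaled by `a > 0`. -/
def scale (a : ℝ) (ha : 0 < a) (V : Ban k) : Ban k := ⟨Scaled a ha V⟩

/-- The contracting coproduct of a sequence of Banach spaces: the sequences `(v_n)` with
`∑ ‖v_n‖ < ∞`, with norm `∑ ‖v_n‖`. -/
def coprod (E : ℕ → Ban k) : Ban k := ⟨lp (fun n => (E n : Type u)) 1⟩

/-- The contracting coproduct of the spaces `(E n)_{r ^ n}`: the sequences `(v_n)` with
`∑ ‖v_n‖ r ^ n < ∞`. -/
def geom (r : Radius.{u}) (E : ℕ → Ban k) : Ban k :=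
  coprod fun n => scale (r.val ^ n) (r.pow_pos n) (E n)

section geom

variable {r : Radius.{u}} {E : ℕ → Ban k}

/-- The `n`-th component of an element of `geom r E`. -/
def coeff (n : ℕ) (x : geom r E) : E n :=
  ((show lp (fun n => (scale (r.val ^ n) (r.pow_pos n) (E n) : Type u)) 1 from x) : ∀ _, _) n

lemma coeff_add (n : ℕ) (x y : geom r E) : coeff n (x + y) = coeff n x + coeff n y := rfl
lemma coeff_smul (n : ℕ) (a : k) (x : geom r E) : coeff n (a • x) = a • coeff n x := rfl

lemma geom_hasSum_norm (x : geom r E) : HasSum (fun n => r.val ^ n * ‖coeff n x‖) ‖x‖ := by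
  have h := lp.hasSum_norm (E := fun n => (scale (r.val ^ n) (r.pow_pos n) (E n) : Type u))
    (p := 1) (by simp) x
  simp only [ENNReal.toReal_one, Real.rpow_one] at h
  exact h

/-- The inclusion of the `n`-th summand. -/
def incl (r : Radius.{u}) (E : ℕ → Ban k) (n : ℕ) : E n ⟶ geom r E :=
  ofLin (V := E n) (W := geom r E)
    (lp.lsingle (𝕜 := k) (E := fun n => (scale (r.val ^ n) (r.pow_pos n) (E n) : Type u)) 1 n)
    ⟨r.val ^ n, fun x => (lp.norm_single (E := fun n =>
      (scale (r.val ^ n) (r.pow_pos n) (E n) : Type u)) (by simp) n x).le⟩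

lemma normLE_incl (n : ℕ) : NormLE (incl r E n) (r.val ^ n) := fun x =>
  (lp.norm_single (E := fun n =>
      (scale (r.val ^ n) (r.pow_pos n) (E n) : Type u)) (by simp) n x).le

lemma coeff_incl_self (n : ℕ) (x : E n) : coeff n (incl r E n x) = x :=
  lp.single_apply_self (E := fun n => (scale (r.val ^ n) (r.pow_pos n) (E n) : Type u)) 1 n x

lemma coeff_incl_ne {m n : ℕ} (h : m ≠ n) (x : E n) : coeff m (incl r E n x) = 0 :=
  lp.single_apply_ne (E := fun n => (scale (r.val ^ n) (r.pow_pos n) (E n) : Type u)) 1 n x h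

lemma hasSum_incl (x : geom r E) : HasSum (fun n => incl r E n (coeff n x)) x :=
  lp.hasSum_single (E := fun n => (scale (r.val ^ n) (r.pow_pos n) (E n) : Type u))
    (p := 1) (by simp) x

/-- Morphisms out of `geom r E` agreeing on every summand are equal. -/
lemma geom_ext {X : Ban k} {f g : geom r E ⟶ X} (h : ∀ n, incl r E n ≫ f = incl r E n ≫ g) :
    f = g := hom_ext fun x => by
  have hf := (hasSum_incl x).map f.lin (hom_continuous f)
  have hg := (hasSum_incl x).map g.lin (hom_continuous g)
  have hfg : f.lin ∘ (fun n => incl r E n (coeff n x)) =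
      g.lin ∘ (fun n => incl r E n (coeff n x)) :=
    funext fun n => congrArg (fun φ : E n ⟶ X => φ (coeff n x)) (h n)
  rw [hfg] at hf
  exact hf.unique hg

lemma desc_norm_le {X : Ban k} {f : ∀ n, E n ⟶ X} {C : ℝ}
    (hf : ∀ n, NormLE (f n) (C * r.val ^ n)) (x : geom r E) (n : ℕ) :
    ‖f n (coeff n x)‖ ≤ C * (r.val ^ n * ‖coeff n x‖) := by
  rw [← mul_assoc]; exact hf n _

lemma desc_summable {X : Ban k} {f : ∀ n, E n ⟶ X}
    (hf : ∃ C : ℝ, ∀ n, NormLE (f n) (C * r.val ^ n)) (x : geom r E) :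
    Summable fun n => f n (coeff n x) := by
  obtain ⟨C, hC⟩ := hf
  exact Summable.of_norm_bounded ((geom_hasSum_norm x).summable.mul_left C) (desc_norm_le hC x)

lemma desc_bound {X : Ban k} {f : ∀ n, E n ⟶ X} {C : ℝ}
    (hf : ∀ n, NormLE (f n) (C * r.val ^ n)) (x : geom r E) :
    ‖∑' n, f n (coeff n x)‖ ≤ C * ‖x‖ :=
  tsum_of_norm_bounded ((geom_hasSum_norm x).mul_left C) (desc_norm_le hf x)

/-- The universal property: a family of maps `f n : E n ⟶ X` with `‖f n‖ ≤ C r ^ n` extends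
to the contracting coproduct. -/
def desc {X : Ban k} (f : ∀ n, E n ⟶ X) (hf : ∃ C : ℝ, ∀ n, NormLE (f n) (C * r.val ^ n)) :
    geom r E ⟶ X :=
  ofLin
    { toFun := fun x => ∑' n, f n (coeff n x)
      map_add' := fun x y => by
        rw [← (desc_summable hf x).tsum_add (desc_summable hf y)]
        exact tsum_congr fun n => map_add (f n).lin _ _
      map_smul' := fun a x => by
        rw [RingHom.id_apply, ← (desc_summable hf x).tsum_const_smul a]
        exact tsum_congr fun n => map_smul (f n).lin _ _ }
    (by obtain ⟨C, hC⟩ := hf; exact ⟨C, desc_bound hC⟩)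

lemma normLE_desc {X : Ban k} (f : ∀ n, E n ⟶ X)
    (hf : ∃ C : ℝ, ∀ n, NormLE (f n) (C * r.val ^ n)) {C : ℝ}
    (hC : ∀ n, NormLE (f n) (C * r.val ^ n)) : NormLE (desc f hf) C := desc_bound hC

@[simp] lemma desc_incl {X : Ban k} (f : ∀ n, E n ⟶ X)
    (hf : ∃ C : ℝ, ∀ n, NormLE (f n) (C * r.val ^ n)) (n : ℕ) (x : E n) :
    desc f hf (incl r E n x) = f n x := by
  refine (tsum_eq_single n fun m hm => ?_).trans ?_
  · rw [coeff_incl_ne hm, map_zero]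
  · rw [coeff_incl_self]

section two

variable {s : Radius.{u}} {F : ℕ → Ban k} {X : Ban k} (f : ∀ m n, tensor (E m) (F n) ⟶ X)
  (C : ℝ)

lemma descAux_bound (hC : 0 ≤ C)
    (hf : ∀ m n, NormLE (f m n) (C * r.val ^ m * s.val ^ n)) (m : ℕ) (a : E m) (n : ℕ) :
    NormLE (tmulLeft a ≫ f m n) (C * r.val ^ m * ‖a‖ * s.val ^ n) := fun y =>
  (hf m n _).trans (by
    have h0 : 0 ≤ C * r.val ^ m * s.val ^ n :=
      mul_nonneg (mul_nonneg hC (r.pow_pos m).le) (s.pow_pos n).le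
    exact (mul_le_mul_of_nonneg_left (norm_tmul_le a y) h0).trans_eq (by ring))

/-- For fixed `a ∈ E m`, the map `y ↦ ∑ n, f m n (a ⊗ y n)`. -/
def descAux (hC : 0 ≤ C)
    (hf : ∀ m n, NormLE (f m n) (C * r.val ^ m * s.val ^ n)) (m : ℕ) (a : E m) : geom s F ⟶ X :=
  desc (fun n => tmulLeft a ≫ f m n) ⟨_, descAux_bound f C hC hf m a⟩

lemma normLE_descAux (hC : 0 ≤ C)
    (hf : ∀ m n, NormLE (f m n) (C * r.val ^ m * s.val ^ n)) (m : ℕ) (a : E m) :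
    NormLE (descAux f C hC hf m a) (C * r.val ^ m * ‖a‖) :=
  normLE_desc _ _ (descAux_bound f C hC hf m a)

/-- For fixed `y`, the map `a ↦ ∑ n, f m n (a ⊗ y n)`. -/
def descAux' (hC : 0 ≤ C)
    (hf : ∀ m n, NormLE (f m n) (C * r.val ^ m * s.val ^ n)) (y : geom s F) (m : ℕ) : E m ⟶ X :=
  ofLin
    { toFun := fun a => descAux f C hC hf m a y
      map_add' := fun a b => by
        have : descAux f C hC hf m (a + b) = descAux f C hC hf m a + descAux f C hC hf m b :=
          geom_ext fun n => hom_ext fun y => by simp [descAux, add_tmul]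
        rw [this]; rfl
      map_smul' := fun c a => by
        have : descAux f C hC hf m (c • a) = descAux f C hC hf m a ≫
            ofLin (c • LinearMap.id) ⟨‖c‖, fun x => by simp [norm_smul]⟩ :=
          geom_ext fun n => hom_ext fun y => by simp [descAux, smul_tmul]
        rw [this]; rfl }
    ⟨C * r.val ^ m * ‖y‖, fun a => (normLE_descAux f C hC hf m a y).trans_eq (by ring)⟩

lemma normLE_descAux' (hC : 0 ≤ C)
    (hf : ∀ m n, NormLE (f m n) (C * r.val ^ m * s.val ^ n)) (y : geom s F) (m : ℕ) :
    NormLE (descAux' f C hC hf y m) (C * ‖y‖ * r.val ^ m) := fun a =>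
  (normLE_descAux f C hC hf m a y).trans_eq (by ring)

/-- The map `x ↦ ∑ m, ∑ n, f m n (x m ⊗ y n)`. -/
def descBilin (hC : 0 ≤ C)
    (hf : ∀ m n, NormLE (f m n) (C * r.val ^ m * s.val ^ n)) (y : geom s F) : geom r E ⟶ X :=
  desc (descAux' f C hC hf y) ⟨_, normLE_descAux' f C hC hf y⟩

lemma normLE_descBilin (hC : 0 ≤ C)
    (hf : ∀ m n, NormLE (f m n) (C * r.val ^ m * s.val ^ n)) (y : geom s F) : NormLE (descBilin f C hC hf y) (C * ‖y‖) :=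
  normLE_desc _ _ (normLE_descAux' f C hC hf y)

/-- A family of maps `f m n` out of `E m ⊗̂ F n`, of norm at most `C r ^ m s ^ n`, extends to the
completed tensor product of the contracting coproducts. -/
def desc₂ (hC : 0 ≤ C)
    (hf : ∀ m n, NormLE (f m n) (C * r.val ^ m * s.val ^ n)) : tensor (geom r E) (geom s F) ⟶ X :=
  lift (LinearMap.mk₂ k (fun x y => descBilin f C hC hf y x)
    (fun x x' y => map_add _ _ _) (fun c x y => map_smul _ _ _)
    (fun x y y' => by
      have : descBilin f C hC hf (y + y') = descBilin f C hC hf y + descBilin f C hC hf y' :=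
        geom_ext fun n => hom_ext fun a => by simp [descBilin, descAux']
      rw [this]; rfl)
    (fun c x y => by
      have : descBilin f C hC hf (c • y) = descBilin f C hC hf y ≫
          ofLin (c • LinearMap.id) ⟨‖c‖, fun x => by simp [norm_smul]⟩ :=
        geom_ext fun n => hom_ext fun a => by simp [descBilin, descAux']
      rw [this]; rfl))
    ⟨C, hC, fun x y => (normLE_descBilin f C hC hf y x).trans_eq (by ring)⟩

lemma desc₂_incl (hC : 0 ≤ C)
    (hf : ∀ m n, NormLE (f m n) (C * r.val ^ m * s.val ^ n)) (m n : ℕ) (x : E m) (y : F n) :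
    desc₂ f C hC hf (tmul (incl r E m x) (incl s F n y)) = f m n (tmul x y) := by
  simp [desc₂, descBilin, descAux', descAux]

lemma normLE_desc₂ (hC : 0 ≤ C)
    (hf : ∀ m n, NormLE (f m n) (C * r.val ^ m * s.val ^ n)) : NormLE (desc₂ f C hC hf) C :=
  normLE_lift _ _ hC fun x y => (normLE_descBilin f C hC hf y x).trans_eq (by ring)

end two

/-- Morphisms out of a completed tensor product of contracting coproducts agreeing on every pair of
summands are equal. -/
lemma geom_ext₂ {s : Radius.{u}} {F : ℕ → Ban k} {X : Ban k}
    {f g : tensor (geom r E) (geom s F) ⟶ X}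
    (h : ∀ m n a b, f (tmul (incl r E m a) (incl s F n b)) =
      g (tmul (incl r E m a) (incl s F n b))) : f = g := by
  refine tensor_ext fun x y => ?_
  have h1 : tmulLeft x ≫ f = tmulLeft x ≫ g := geom_ext fun n => hom_ext fun b => by
    have h2 : tmulRight (incl s F n b) ≫ f = tmulRight (incl s F n b) ≫ g :=
      geom_ext fun m => hom_ext fun a => h m n a b
    exact congrArg (fun φ : geom r E ⟶ X => φ x) h2
  exact congrArg (fun φ : geom s F ⟶ X => φ y) h1

end geom

end Ban

/-! ### Ind-completions -/

/-- An object of the ind-completion of `C`: a small filtered diagram in `C`, regarded as a formal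
colimit. -/
structure IndObj (C : Type (u + 1)) [LargeCategory C] : Type (u + 1) where
  I : Type u
  [cat : SmallCategory I]
  [filt : IsFiltered I]
  F : I ⥤ C

attribute [instance] IndObj.cat IndObj.filt

namespace IndObj

variable {C : Type (u + 1)} [LargeCategory C]

/-- The `i`-th term of an ind-object. -/
abbrev at' (X : IndObj C) (i : X.I) : C := X.F.obj i

/-- The germs of morphisms from an object `A` to an ind-object `Y`: the elements of the filtered
colimit `colim_j Hom(A, Y j)`. -/
def Germ (A : C) (Y : IndObj C) : Type u :=
  Quot fun p q : Σ j, A ⟶ Y.at' j => ∃ w : p.1 ⟶ q.1, p.2 ≫ Y.F.map w = q.2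

namespace Germ

variable {A B : C} {Y : IndObj C}

/-- The germ of a morphism to the `j`-th term. -/
def mk (j : Y.I) (f : A ⟶ Y.at' j) : Germ A Y := Quot.mk _ ⟨j, f⟩

lemma mk_map {j j' : Y.I} (w : j ⟶ j') (f : A ⟶ Y.at' j) :
    mk j' (f ≫ Y.F.map w) = mk j f := (Quot.sound ⟨w, rfl⟩).symm

lemma mk_eq {j j' l : Y.I} {f : A ⟶ Y.at' j} {g : A ⟶ Y.at' j'} (w : j ⟶ l) (w' : j' ⟶ l)
    (h : f ≫ Y.F.map w = g ≫ Y.F.map w') : mk j f = mk j' g := by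
  rw [← mk_map w f, h, mk_map]

lemma ind {P : Germ A Y → Prop} (h : ∀ j f, P (mk j f)) (x : Germ A Y) : P x :=
  Quot.ind (fun p => h p.1 p.2) x

/-- Precomposition of a germ. -/
def precomp (a : B ⟶ A) (x : Germ A Y) : Germ B Y :=
  Quot.lift (fun p => mk p.1 (a ≫ p.2))
    (fun p q ⟨w, h⟩ => by rw [← h, ← Category.assoc, mk_map]) x

@[simp] lemma precomp_mk (a : B ⟶ A) (j : Y.I) (f : A ⟶ Y.at' j) :
    (mk j f).precomp a = mk j (a ≫ f) := rfl

@[simp] lemma precomp_id (x : Germ A Y) : x.precomp (𝟙 A) = x := by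
  induction x using ind with | h j f => rw [precomp_mk, Category.id_comp]

lemma precomp_comp {B' : C} (b : B' ⟶ B) (a : B ⟶ A) (x : Germ A Y) :
    x.precomp (b ≫ a) = (x.precomp a).precomp b := by
  induction x using ind with | h j f => simp only [precomp_mk, Category.assoc]

end Germ

/-- Morphisms of ind-objects: the elements of `lim_i colim_j Hom(X i, Y j)`. -/
@[ext]
structure Hom (X Y : IndObj C) : Type u where
  app : ∀ i : X.I, Germ (X.at' i) Y
  compat : ∀ {i i' : X.I} (w : i ⟶ i'), (app i').precomp (X.F.map w) = app i

namespace Germ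

variable {A B : C} {X Y Z : IndObj C}

/-- Composition of a germ with a morphism of ind-objects. -/
def bind (x : Germ A Y) (g : Hom Y Z) : Germ A Z :=
  Quot.lift (fun p => (g.app p.1).precomp p.2)
    (fun p q ⟨w, h⟩ => by rw [← h, precomp_comp, g.compat]) x

@[simp] lemma bind_mk (j : Y.I) (f : A ⟶ Y.at' j) (g : Hom Y Z) :
    (mk j f).bind g = (g.app j).precomp f := rfl

lemma exists_rep₂ (x y : Germ A Y) : ∃ j f g, x = mk j f ∧ y = mk j g := by
  induction x using ind with | h j f => _
  induction y using ind with | h j' g => _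
  exact ⟨_, _, _, (mk_map (IsFiltered.leftToMax j j') f).symm,
    (mk_map (IsFiltered.rightToMax j j') g).symm⟩

lemma exists_rep₃ (x y z : Germ A Y) : ∃ j f g h, x = mk j f ∧ y = mk j g ∧ z = mk j h := by
  obtain ⟨j, f, g, rfl, rfl⟩ := exists_rep₂ x y
  induction z using ind with | h j' h => _
  exact ⟨_, _, _, _, (mk_map (IsFiltered.leftToMax j j') f).symm,
    (mk_map (IsFiltered.leftToMax j j') g).symm, (mk_map (IsFiltered.rightToMax j j') h).symm⟩

lemma bind_precomp (a : B ⟶ A) (x : Germ A Y) (g : Hom Y Z) :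
    (x.precomp a).bind g = (x.bind g).precomp a := by
  induction x using ind with | h j f => rw [precomp_mk, bind_mk, bind_mk, precomp_comp]

end Germ

/-- The ind-category. -/
instance : LargeCategory (IndObj C) where
  Hom := Hom
  id X := ⟨fun i => Germ.mk i (𝟙 _), fun {i i'} w => by
    rw [Germ.precomp_mk, Category.comp_id, ← Germ.mk_map w, Category.id_comp]⟩
  comp f g := ⟨fun i => (f.app i).bind g, fun w => by rw [← Germ.bind_precomp, f.compat]⟩
  id_comp f := Hom.ext (funext fun i => Germ.precomp_id _)
  comp_id f := Hom.ext (funext fun i => by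
    show (f.app i).bind _ = f.app i
    generalize f.app i = x
    induction x using Germ.ind with | h j a => rw [Germ.bind_mk, Germ.precomp_mk, Category.comp_id])
  assoc f g h := Hom.ext (funext fun i => by
    show ((f.app i).bind g).bind h = (f.app i).bind _
    generalize f.app i = x
    induction x using Germ.ind with | h j a => rw [Germ.bind_mk, Germ.bind_precomp]; rfl)

lemma hom_ext {X Y : IndObj C} {f g : X ⟶ Y} (h : ∀ i, f.app i = g.app i) : f = g :=
  Hom.ext (funext h)

lemma comp_app {X Y Z : IndObj C} (f : X ⟶ Y) (g : Y ⟶ Z) (i : X.I) :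
    (f ≫ g).app i = (f.app i).bind g := rfl

lemma id_app (X : IndObj C) (i : X.I) : (𝟙 X : X ⟶ X).app i = Germ.mk i (𝟙 _) := rfl

/-- The morphism of ind-objects given by a compatible family of morphisms `X i ⟶ Y (φ i)`. -/
def ofLevel {X Y : IndObj C} (φ : X.I → Y.I) (τ : ∀ i, X.at' i ⟶ Y.at' (φ i))
    (h : ∀ {i i' : X.I} (w : i ⟶ i'), ∃ w' : φ i ⟶ φ i', X.F.map w ≫ τ i' = τ i ≫ Y.F.map w') :
    X ⟶ Y :=
  ⟨fun i => Germ.mk (φ i) (τ i), fun w => by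
    obtain ⟨w', hw⟩ := h w
    rw [Germ.precomp_mk, hw, Germ.mk_map]⟩

lemma ofLevel_app {X Y : IndObj C} (φ : X.I → Y.I) (τ : ∀ i, X.at' i ⟶ Y.at' (φ i)) (h)
    (i : X.I) : (ofLevel φ τ h).app i = Germ.mk (φ i) (τ i) := rfl

/-- The constant ind-object. -/
def const (A : C) : IndObj C := ⟨Discrete PUnit.{u + 1}, (Functor.const _).obj A⟩

/-- The morphism from a constant ind-object given by a morphism to some term. -/
def ofConst {A : C} {Y : IndObj C} (j : Y.I) (f : A ⟶ Y.at' j) : const A ⟶ Y :=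
  ⟨fun _ => Germ.mk j f, fun _ => congrArg (Germ.mk j) (Category.id_comp f)⟩

/-- The embedding of `C` in its ind-completion, on morphisms. -/
def constMap {A B : C} (f : A ⟶ B) : const A ⟶ const B :=
  ofConst (Y := const B) ⟨⟨⟩⟩ f

section Preadditive

variable [Preadditive C] {A B : C} {X Y Z : IndObj C}

namespace Germ

lemma add_aux {j j' l l' : Y.I} (f : A ⟶ Y.at' j) (g : A ⟶ Y.at' j') (w : j ⟶ l) (v : j' ⟶ l)
    (w' : j ⟶ l') (v' : j' ⟶ l') :
    mk l (f ≫ Y.F.map w + g ≫ Y.F.map v) = mk l' (f ≫ Y.F.map w' + g ≫ Y.F.map v') := by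
  obtain ⟨s, a, b, h, h'⟩ := IsFiltered.bowtie w w' v v'
  rw [← mk_map a, ← mk_map b]
  simp only [Preadditive.add_comp, Category.assoc, ← Functor.map_comp, h, h']

/-- Addition of germs. -/
def add (x y : Germ A Y) : Germ A Y :=
  Quot.lift₂ (fun p q => mk (IsFiltered.max p.1 q.1)
      (p.2 ≫ Y.F.map (IsFiltered.leftToMax p.1 q.1) + q.2 ≫ Y.F.map (IsFiltered.rightToMax p.1 q.1)))
    (fun p q q' ⟨w, h⟩ => by
      rw [← h, Category.assoc, ← Functor.map_comp]; exact add_aux _ _ _ _ _ _)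
    (fun p p' q ⟨w, h⟩ => by
      rw [← h, Category.assoc, ← Functor.map_comp]; exact add_aux _ _ _ _ _ _) x y

instance : Add (Germ A Y) := ⟨add⟩
instance : Zero (Germ A Y) := ⟨mk (IsFiltered.nonempty (C := Y.I)).some 0⟩
instance : Neg (Germ A Y) := ⟨Quot.lift (fun p => mk p.1 (-p.2)) fun p q ⟨w, h⟩ => by
  rw [← h, ← Preadditive.neg_comp, mk_map]⟩

lemma mk_add (j : Y.I) (f g : A ⟶ Y.at' j) : mk j f + mk j g = mk j (f + g) := by
  refine (add_aux f g _ _ (𝟙 j) (𝟙 j)).trans ?_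
  simp

lemma mk_zero (j : Y.I) : mk j (0 : A ⟶ Y.at' j) = 0 := by
  show _ = mk (IsFiltered.nonempty (C := Y.I)).some 0
  rw [← mk_map (IsFiltered.leftToMax j (IsFiltered.nonempty (C := Y.I)).some),
    ← mk_map (IsFiltered.rightToMax j (IsFiltered.nonempty (C := Y.I)).some),
    Limits.zero_comp, Limits.zero_comp]

lemma mk_neg (j : Y.I) (f : A ⟶ Y.at' j) : -mk j f = mk j (-f) := rfl

instance : AddCommGroup (Germ A Y) where
  add_assoc x y z := by
    obtain ⟨j, f, g, h, rfl, rfl, rfl⟩ := exists_rep₃ x y z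
    simp only [mk_add, add_assoc]
  zero_add x := by
    induction x using ind with | h j f => rw [← mk_zero j, mk_add, zero_add]
  add_zero x := by
    induction x using ind with | h j f => rw [← mk_zero j, mk_add, add_zero]
  neg_add_cancel x := by
    induction x using ind with | h j f => rw [mk_neg, mk_add, neg_add_cancel, mk_zero]
  add_comm x y := by
    obtain ⟨j, f, g, rfl, rfl⟩ := exists_rep₂ x y
    rw [mk_add, mk_add, add_comm]
  nsmul := nsmulRec
  zsmul := zsmulRec

lemma precomp_add (a : B ⟶ A) (x y : Germ A Y) :
    (x + y).precomp a = x.precomp a + y.precomp a := by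
  obtain ⟨j, f, g, rfl, rfl⟩ := exists_rep₂ x y
  simp only [mk_add, precomp_mk, Preadditive.comp_add]

lemma precomp_neg (a : B ⟶ A) (x : Germ A Y) : (-x).precomp a = -x.precomp a := by
  induction x using ind with | h j f => simp only [mk_neg, precomp_mk, Preadditive.comp_neg]

lemma precomp_zero (a : B ⟶ A) : (0 : Germ A Y).precomp a = 0 :=
  (congrArg (mk _) Limits.comp_zero).trans (mk_zero _)

lemma add_precomp (a b : B ⟶ A) (x : Germ A Y) :
    x.precomp (a + b) = x.precomp a + x.precomp b := by
  induction x using ind with | h j f => simp only [mk_add, precomp_mk, Preadditive.add_comp]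

end Germ

instance : Zero (X ⟶ Y) := ⟨fun _ => 0, fun _ => Germ.precomp_zero _⟩
instance : Add (X ⟶ Y) := ⟨fun f g => ⟨fun i => f.app i + g.app i, fun w => by
  rw [Germ.precomp_add, f.compat, g.compat]⟩⟩
instance : Neg (X ⟶ Y) := ⟨fun f => ⟨fun i => -f.app i, fun w => by
  rw [Germ.precomp_neg, f.compat]⟩⟩

instance : AddCommGroup (X ⟶ Y) where
  add_assoc f g h := hom_ext fun i => add_assoc (f.app i) _ _
  zero_add f := hom_ext fun i => zero_add (f.app i)
  add_zero f := hom_ext fun i => add_zero (f.app i)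
  neg_add_cancel f := hom_ext fun i => neg_add_cancel (f.app i)
  add_comm f g := hom_ext fun i => add_comm (f.app i) _
  nsmul := nsmulRec
  zsmul := zsmulRec

instance : Preadditive (IndObj C) where
  add_comp X Y Z f f' g := hom_ext fun i => by
    show (f.app i + f'.app i).bind g = (f.app i).bind g + (f'.app i).bind g
    obtain ⟨j, a, b, h, h'⟩ := Germ.exists_rep₂ (f.app i) (f'.app i)
    rw [h, h', Germ.mk_add]
    exact Germ.add_precomp _ _ _
  comp_add X Y Z f g g' := hom_ext fun i => by
    show (f.app i).bind (g + g') = (f.app i).bind g + (f.app i).bind g'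
    generalize f.app i = x
    induction x using Germ.ind with | h j a => exact Germ.precomp_add _ _ _

end Preadditive

section Monoidal

variable [MonoidalCategory C]

lemma tensorHom_id_comp {A X B Y Y' : C} (f : A ⟶ X) (g : B ⟶ Y) (w : Y ⟶ Y') :
    (f ⊗ₘ g) ≫ (𝟙 X ⊗ₘ w) = f ⊗ₘ g ≫ w := by
  rw [tensorHom_comp_tensorHom, Category.comp_id]
lemma tensorHom_comp_id {A X B Y X' : C} (f : A ⟶ X) (g : B ⟶ Y) (w : X ⟶ X') :
    (f ⊗ₘ g) ≫ (w ⊗ₘ 𝟙 Y) = f ≫ w ⊗ₘ g := by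
  rw [tensorHom_comp_tensorHom, Category.comp_id]
lemma lunit_aux {X Y : C} (f : X ⟶ Y) : (𝟙 (𝟙_ C) ⊗ₘ f) ≫ (λ_ Y).hom = (λ_ X).hom ≫ f := by
  rw [id_tensorHom, leftUnitor_naturality]
lemma lunit_aux' {X Y : C} (f : X ⟶ Y) : f ≫ (λ_ Y).inv = (λ_ X).inv ≫ (𝟙 (𝟙_ C) ⊗ₘ f) := by
  rw [id_tensorHom, leftUnitor_inv_naturality]
lemma runit_aux {X Y : C} (f : X ⟶ Y) : (f ⊗ₘ 𝟙 (𝟙_ C)) ≫ (ρ_ Y).hom = (ρ_ X).hom ≫ f := by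
  rw [tensorHom_id, rightUnitor_naturality]
lemma runit_aux' {X Y : C} (f : X ⟶ Y) : f ≫ (ρ_ Y).inv = (ρ_ X).inv ≫ (f ⊗ₘ 𝟙 (𝟙_ C)) := by
  rw [tensorHom_id, rightUnitor_inv_naturality]
lemma pentagon_aux (W X Y Z : C) :
    ((α_ W X Y).hom ⊗ₘ 𝟙 Z) ≫ (α_ W (X ⊗ Y) Z).hom ≫ (𝟙 W ⊗ₘ (α_ X Y Z).hom) =
      (α_ (W ⊗ X) Y Z).hom ≫ (α_ W X (Y ⊗ Z)).hom := by
  rw [id_tensorHom, tensorHom_id, pentagon]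
lemma triangle_aux (X Y : C) :
    (α_ X (𝟙_ C) Y).hom ≫ (𝟙 X ⊗ₘ (λ_ Y).hom) = (ρ_ X).hom ⊗ₘ 𝟙 Y := by
  rw [id_tensorHom, tensorHom_id, triangle]

/-- `(colim X i) ⊗ (colim Y j) = colim (X i ⊗ Y j)`. -/
def tensor (X Y : IndObj C) : IndObj C where
  I := X.I × Y.I
  F := { obj := fun p => X.at' p.1 ⊗ Y.at' p.2
         map := fun w => X.F.map w.1 ⊗ₘ Y.F.map w.2
         map_id := fun p => by simp
         map_comp := fun v w => by simp }

namespace Germ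

variable {A A' B B' : C} {X X' Y Y' : IndObj C}

/-- The tensor product of germs. -/
def tensor (x : Germ A X) (y : Germ B Y) : Germ (A ⊗ B) (X.tensor Y) :=
  Quot.lift₂ (fun p q => mk (Y := X.tensor Y) (p.1, q.1) (p.2 ⊗ₘ q.2))
    (fun p q q' ⟨w, h⟩ => by
      rw [← h]
      refine Eq.trans ?_ (congrArg (mk (Y := X.tensor Y) (p.1, q'.1)) (tensorHom_id_comp p.2 q.2 _))
      exact (mk_map (Y := X.tensor Y) (Prod.mkHom (𝟙 p.1) w) (p.2 ⊗ₘ q.2)).symm.trans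
        (by simp [IndObj.tensor]))
    (fun p p' q ⟨w, h⟩ => by
      rw [← h]
      refine Eq.trans ?_ (congrArg (mk (Y := X.tensor Y) (p'.1, q.1)) (tensorHom_comp_id p.2 q.2 _))
      exact (mk_map (Y := X.tensor Y) (Prod.mkHom w (𝟙 q.1)) (p.2 ⊗ₘ q.2)).symm.trans
        (by simp [IndObj.tensor])) x y

lemma tensor_mk (i : X.I) (f : A ⟶ X.at' i) (j : Y.I) (g : B ⟶ Y.at' j) :
    (mk i f).tensor (mk j g) = mk (Y := X.tensor Y) (i, j) (f ⊗ₘ g) := rfl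

lemma tensor_precomp (a : A' ⟶ A) (b : B' ⟶ B) (x : Germ A X) (y : Germ B Y) :
    (x.tensor y).precomp (a ⊗ₘ b) = (x.precomp a).tensor (y.precomp b) := by
  induction x using ind with | h i f => _
  induction y using ind with | h j g => _
  exact congrArg (mk (Y := X.tensor Y) (i, j)) (tensorHom_comp_tensorHom _ _ _ _)

end Germ

/-- The tensor product of morphisms. -/
def tensorMap {X X' Y Y' : IndObj C} (f : X ⟶ X') (g : Y ⟶ Y') : X.tensor Y ⟶ X'.tensor Y' :=
  ⟨fun p => (f.app p.1).tensor (g.app p.2), fun w =>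
    (Germ.tensor_precomp _ _ _ _).trans (by rw [f.compat, g.compat])⟩

lemma tensorMap_app {X X' Y Y' : IndObj C} (f : X ⟶ X') (g : Y ⟶ Y') (p : X.I × Y.I) :
    (tensorMap f g).app p = (f.app p.1).tensor (g.app p.2) := rfl

lemma Germ.tensor_bind {A B : C} {X X' Y Y' : IndObj C} (f : X ⟶ X') (g : Y ⟶ Y')
    (x : Germ A X) (y : Germ B Y) :
    (x.tensor y).bind (tensorMap f g) = (x.bind f).tensor (y.bind g) := by
  induction x using ind with | h i a => _
  induction y using ind with | h j b => _
  exact tensor_precomp _ _ _ _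

instance : MonoidalCategoryStruct (IndObj C) where
  tensorObj := tensor
  tensorHom := tensorMap
  whiskerLeft X _ _ f := tensorMap (𝟙 X) f
  whiskerRight f Y := tensorMap f (𝟙 Y)
  tensorUnit := const (𝟙_ C)
  associator X Y Z :=
    { hom := ofLevel (X := (X.tensor Y).tensor Z) (Y := X.tensor (Y.tensor Z))
        (fun p => (p.1.1, p.1.2, p.2)) (fun _ => (α_ _ _ _).hom)
        fun w => ⟨(w.1.1, w.1.2, w.2), associator_naturality _ _ _⟩
      inv := ofLevel (X := X.tensor (Y.tensor Z)) (Y := (X.tensor Y).tensor Z)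
        (fun p => ((p.1, p.2.1), p.2.2)) (fun _ => (α_ _ _ _).inv)
        fun w => ⟨((w.1, w.2.1), w.2.2), associator_inv_naturality _ _ _⟩
      hom_inv_id := hom_ext fun _ => congrArg (Germ.mk _) (Iso.hom_inv_id _)
      inv_hom_id := hom_ext fun _ => congrArg (Germ.mk _) (Iso.inv_hom_id _) }
  leftUnitor X :=
    { hom := ofLevel (X := (const (𝟙_ C)).tensor X) (Y := X) Prod.snd (fun _ => (λ_ _).hom)
        fun w => ⟨w.2, lunit_aux _⟩
      inv := ofLevel (X := X) (Y := (const (𝟙_ C)).tensor X) (fun i => (⟨⟨⟩⟩, i))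
        (fun _ => (λ_ _).inv) fun w => ⟨(𝟙 _, w), lunit_aux' _⟩
      hom_inv_id := hom_ext fun _ => congrArg (Germ.mk _) (Iso.hom_inv_id _)
      inv_hom_id := hom_ext fun _ => congrArg (Germ.mk _) (Iso.inv_hom_id _) }
  rightUnitor X :=
    { hom := ofLevel (X := X.tensor (const (𝟙_ C))) (Y := X) Prod.fst (fun _ => (ρ_ _).hom)
        fun w => ⟨w.1, runit_aux _⟩
      inv := ofLevel (X := X) (Y := X.tensor (const (𝟙_ C))) (fun i => (i, ⟨⟨⟩⟩))
        (fun _ => (ρ_ _).inv) fun w => ⟨(w, 𝟙 _), runit_aux' _⟩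
      hom_inv_id := hom_ext fun _ => congrArg (Germ.mk _) (Iso.hom_inv_id _)
      inv_hom_id := hom_ext fun _ => congrArg (Germ.mk _) (Iso.inv_hom_id _) }

lemma tensorHom_app {X X' Y Y' : IndObj C} (f : X ⟶ X') (g : Y ⟶ Y') (p : X.I × Y.I) :
    (f ⊗ₘ g).app p = (f.app p.1).tensor (g.app p.2) := rfl

instance : MonoidalCategory (IndObj C) := MonoidalCategory.ofTensorHom
  (id_tensorHom_id := fun X Y => hom_ext fun p => congrArg (Germ.mk _) (id_tensorHom_id _ _))
  (id_tensorHom := fun _ _ _ _ => rfl)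
  (tensorHom_id := fun _ _ => rfl)
  (tensorHom_comp_tensorHom := fun f f' g g' => hom_ext fun p => Germ.tensor_bind _ _ _ _)
  (associator_naturality := fun {X₁ X₂ X₃ Y₁ Y₂ Y₃} f g h => hom_ext fun p => by
    show (((f.app p.1.1).tensor (g.app p.1.2)).tensor (h.app p.2)).bind _ =
      Germ.precomp _ ((f.app p.1.1).tensor ((g.app p.1.2).tensor (h.app p.2)))
    generalize f.app p.1.1 = x, g.app p.1.2 = y, h.app p.2 = z
    induction x using Germ.ind with | h i a => _
    induction y using Germ.ind with | h j b => _
    induction z using Germ.ind with | h l c => _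
    exact congrArg (Germ.mk _) (associator_naturality _ _ _))
  (leftUnitor_naturality := fun {X Y} f => hom_ext fun p => by
    show Germ.bind (Germ.tensor (Germ.mk _ (𝟙 _)) (f.app p.2)) _ = Germ.precomp _ (f.app p.2)
    generalize f.app p.2 = x
    induction x using Germ.ind with | h i a => _
    exact congrArg (Germ.mk i) (lunit_aux a))
  (rightUnitor_naturality := fun {X Y} f => hom_ext fun p => by
    show Germ.bind (Germ.tensor (f.app p.1) (Germ.mk _ (𝟙 _))) _ = Germ.precomp _ (f.app p.1)
    generalize f.app p.1 = x
    induction x using Germ.ind with | h i a => _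
    exact congrArg (Germ.mk i) (runit_aux a))
  (pentagon := fun W X Y Z => hom_ext fun p => congrArg (Germ.mk _)
    (pentagon_aux (W.at' p.1.1.1) (X.at' p.1.1.2) (Y.at' p.1.2) (Z.at' p.2)))
  (triangle := fun X Y => hom_ext fun p => congrArg (Germ.mk _) (triangle_aux (X.at' p.1.1) (Y.at' p.2)))

variable [SymmetricCategory C]

/-- The symmetry of the ind-category. -/
def swap (X Y : IndObj C) : X ⊗ Y ⟶ Y ⊗ X :=
  ofLevel (X := X.tensor Y) (Y := Y.tensor X) (fun p => (p.2, p.1)) (fun _ => (β_ _ _).hom)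
    fun w => ⟨(w.2, w.1), BraidedCategory.braiding_naturality _ _⟩

lemma hexagon_aux (X Y Z : C) : (α_ X Y Z).hom ≫ (β_ X (Y ⊗ Z)).hom ≫ (α_ Y Z X).hom =
    ((β_ X Y).hom ⊗ₘ 𝟙 Z) ≫ (α_ Y X Z).hom ≫ (𝟙 Y ⊗ₘ (β_ X Z).hom) := by
  rw [id_tensorHom, tensorHom_id, BraidedCategory.hexagon_forward]
lemma hexagon_aux' (X Y Z : C) : (α_ X Y Z).inv ≫ (β_ (X ⊗ Y) Z).hom ≫ (α_ Z X Y).inv =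
    (𝟙 X ⊗ₘ (β_ Y Z).hom) ≫ (α_ X Z Y).inv ≫ ((β_ X Z).hom ⊗ₘ 𝟙 Y) := by
  rw [id_tensorHom, tensorHom_id, BraidedCategory.hexagon_reverse]

lemma swap_swap (X Y : IndObj C) : swap X Y ≫ swap Y X = 𝟙 _ :=
  hom_ext fun _ => congrArg (Germ.mk _) (SymmetricCategory.symmetry _ _)

lemma swap_naturality {X X' Y Y' : IndObj C} (f : X ⟶ X') (g : Y ⟶ Y') :
    (f ⊗ₘ g) ≫ swap X' Y' = swap X Y ≫ (g ⊗ₘ f) := hom_ext fun p => by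
  show ((f.app p.1).tensor (g.app p.2)).bind _ = Germ.precomp _ ((g.app p.2).tensor (f.app p.1))
  generalize f.app p.1 = x, g.app p.2 = y
  induction x using Germ.ind with | h i a => _
  induction y using Germ.ind with | h j b => _
  exact congrArg (Germ.mk _) (BraidedCategory.braiding_naturality _ _)

instance : SymmetricCategory (IndObj C) where
  braiding X Y := ⟨swap X Y, swap Y X, swap_swap X Y, swap_swap Y X⟩
  braiding_naturality_right X _ _ f := swap_naturality (𝟙 X) f
  braiding_naturality_left f Z := swap_naturality f (𝟙 Z)
  hexagon_forward X Y Z := hom_ext fun p => congrArg (Germ.mk _)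
    (hexagon_aux (X.at' p.1.1) (Y.at' p.1.2) (Z.at' p.2))
  hexagon_reverse X Y Z := hom_ext fun p => congrArg (Germ.mk _)
    (hexagon_aux' (X.at' p.1) (Y.at' p.2.1) (Z.at' p.2.2))
  symmetry := swap_swap

/-- `const (V ⊗ W)` is isomorphic to `const V ⊗ const W`. -/
def constTensor (A B : C) : const A ⊗ const B ≅ const (A ⊗ B) where
  hom := ofLevel (X := (const A).tensor (const B)) (Y := const (A ⊗ B)) (fun _ => ⟨⟨⟩⟩)
    (fun _ => 𝟙 (A ⊗ B)) fun _ => ⟨𝟙 _, congrArg (· ≫ 𝟙 (A ⊗ B)) (id_tensorHom_id A B)⟩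
  inv := ofLevel (X := const (A ⊗ B)) (Y := (const A).tensor (const B)) (fun _ => (⟨⟨⟩⟩, ⟨⟨⟩⟩))
    (fun _ => 𝟙 (A ⊗ B)) fun _ => ⟨𝟙 _, congrArg (𝟙 (A ⊗ B) ≫ ·) (id_tensorHom_id A B).symm⟩
  hom_inv_id := hom_ext fun ⟨⟨⟨⟩⟩, ⟨⟨⟩⟩⟩ => congrArg
    (Germ.mk (Y := (const A).tensor (const B)) (⟨⟨⟩⟩, ⟨⟨⟩⟩)) (Category.comp_id (𝟙 (A ⊗ B)))
  inv_hom_id := hom_ext fun ⟨⟨⟩⟩ => congrArg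
    (Germ.mk (Y := const (A ⊗ B)) ⟨⟨⟩⟩) (Category.comp_id (𝟙 (A ⊗ B)))

end Monoidal

end IndObj

/-! ### Pre-braided Hopf algebras, gradings and Nichols algebras -/

section Generic

universe v w

open scoped MonObj ComonObj

variable {D : Type w} [Category.{v} D] [MonoidalCategory D]

/-- A pre-braiding: an endomorphism of `V ⊗ V` satisfying the hexagon (Yang-Baxter) axiom. -/
def IsPreBraiding {V : D} (c : V ⊗ V ⟶ V ⊗ V) : Prop :=
  c ▷ V ≫ (α_ V V V).hom ≫ V ◁ c ≫ (α_ V V V).inv ≫ c ▷ V =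
    (α_ V V V).hom ≫ V ◁ c ≫ (α_ V V V).inv ≫ c ▷ V ≫ (α_ V V V).hom ≫ V ◁ c ≫ (α_ V V V).inv

/-- `id ⊗ c ⊗ id` on a fourfold tensor product. -/
def middle (X : D) {Y Y' Z Z' : D} (c : Y ⊗ Y' ⟶ Z ⊗ Z') (X' : D) :
    (X ⊗ Y) ⊗ (Y' ⊗ X') ⟶ (X ⊗ Z) ⊗ (Z' ⊗ X') :=
  (α_ X Y (Y' ⊗ X')).hom ≫ X ◁ ((α_ Y Y' X').inv ≫ c ▷ X' ≫ (α_ Z Z' X').hom) ≫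
    (α_ X Z (Z' ⊗ X')).inv

/-- The axioms of a pre-braided bialgebra, for an algebra and coalgebra `A` and
`c : A ⊗ A ⟶ A ⊗ A`. -/
structure IsPreBraidedBialgebra (A : D) [MonObj A] [ComonObj A] (c : A ⊗ A ⟶ A ⊗ A) : Prop where
  preBraiding : IsPreBraiding c
  one_braid : η[A] ▷ A ≫ c = (λ_ A).hom ≫ (ρ_ A).inv ≫ A ◁ η[A]
  braid_one : A ◁ η[A] ≫ c = (ρ_ A).hom ≫ (λ_ A).inv ≫ η[A] ▷ A
  mul_braid : μ[A] ▷ A ≫ c =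
    (α_ A A A).hom ≫ A ◁ c ≫ (α_ A A A).inv ≫ c ▷ A ≫ (α_ A A A).hom ≫ A ◁ μ[A]
  braid_mul : A ◁ μ[A] ≫ c =
    (α_ A A A).inv ≫ c ▷ A ≫ (α_ A A A).hom ≫ A ◁ c ≫ (α_ A A A).inv ≫ μ[A] ▷ A
  counit_braid : c ≫ ε[A] ▷ A ≫ (λ_ A).hom = A ◁ ε[A] ≫ (ρ_ A).hom
  braid_counit : c ≫ A ◁ ε[A] ≫ (ρ_ A).hom = ε[A] ▷ A ≫ (λ_ A).hom
  comul_braid : Δ[A] ▷ A ≫ (α_ A A A).hom ≫ A ◁ c ≫ (α_ A A A).inv ≫ c ▷ A ≫ (α_ A A A).hom =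
    c ≫ A ◁ Δ[A]
  braid_comul : A ◁ Δ[A] ≫ (α_ A A A).inv ≫ c ▷ A ≫ (α_ A A A).hom ≫ A ◁ c ≫ (α_ A A A).inv =
    c ≫ Δ[A] ▷ A
  mul_comul : μ[A] ≫ Δ[A] = (Δ[A] ⊗ₘ Δ[A]) ≫ middle A c A ≫ (μ[A] ⊗ₘ μ[A])
  one_comul : η[A] ≫ Δ[A] = (λ_ (𝟙_ D)).inv ≫ (η[A] ⊗ₘ η[A])
  one_counit : η[A] ≫ ε[A] = 𝟙 (𝟙_ D)
  mul_counit : μ[A] ≫ ε[A] = (ε[A] ⊗ₘ ε[A]) ≫ (λ_ (𝟙_ D)).hom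

/-- `f` is a homomorphism of `C`-comodules. -/
def IsColinear {C A B : D} (ρ : A ⟶ C ⊗ A) (σ : B ⟶ C ⊗ B) (f : A ⟶ B) : Prop :=
  f ≫ σ = ρ ≫ C ◁ f

/-- The coaction of a bialgebra `C` on the unit object. -/
def unitCoact (C : D) [MonObj C] : 𝟙_ D ⟶ C ⊗ 𝟙_ D := (λ_ (𝟙_ D)).inv ≫ η[C] ▷ 𝟙_ D

/-- `i : W ⟶ A` exhibits `W` as the homogeneous piece `A(x)` of degree `x`, that is, as the
equaliser of the coaction and `x ⊗ id`. -/
def IsPiece {C : D} (x : 𝟙_ D ⟶ C) {A W : D} (ρ : A ⟶ C ⊗ A) (i : W ⟶ A) : Prop :=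
  ∃ h : i ≫ ρ = i ≫ ((λ_ A).inv ≫ x ▷ A), Nonempty (Limits.IsLimit (Limits.Fork.ofι i h))

/-- `i : V ⟶ A` generates the algebra `A` when tested against the objects satisfying `P`: for every
morphism of algebras `f : A' ⟶ A` through which `i` factors, morphisms from `A` to an object
satisfying `P` are determined by their composites with `f`. -/
def GeneratesAgainst (P : D → Prop) {A V : D} [MonObj A] (i : V ⟶ A) : Prop :=
  ∀ (A' : D) [MonObj A'] (f : A' ⟶ A) [IsMonHom f] (g : V ⟶ A'), g ≫ f = i →
    ∀ Z : D, P Z → ∀ a b : A ⟶ Z, f ≫ a = f ≫ b → a = b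

/-- `i : V ⟶ A` generates the algebra `A`: every morphism of algebras `f : A' ⟶ A` through which
`i` factors is an epimorphism. -/
def Generates {A V : D} [MonObj A] (i : V ⟶ A) : Prop :=
  ∀ (A' : D) [MonObj A'] (f : A' ⟶ A) [IsMonHom f] (g : V ⟶ A'), g ≫ f = i → Epi f

section Symmetric

variable [SymmetricCategory D]

/-- The coaction of `C ⊗ C` on `A ⊗ B`. -/
def coact₂ {C A B : D} (ρ : A ⟶ C ⊗ A) (σ : B ⟶ C ⊗ B) : A ⊗ B ⟶ (C ⊗ C) ⊗ (A ⊗ B) :=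
  (ρ ⊗ₘ σ) ≫ middle C (β_ A C).hom B

/-- The (diagonal) coaction of a bialgebra `C` on `A ⊗ B`. -/
def tensorCoact {C A B : D} [MonObj C] (ρ : A ⟶ C ⊗ A) (σ : B ⟶ C ⊗ B) : A ⊗ B ⟶ C ⊗ (A ⊗ B) :=
  coact₂ ρ σ ≫ μ[C] ▷ (A ⊗ B)

/-- The axioms of a pre-braided Hopf algebra `A` graded over the bialgebra `C` with comultiplication
`δ`, except for the compatibility of the coaction with the counit of `C`.  The pre-braiding
exchanges the two tensor factors, and so it exchanges their degrees: it is a homomorphism of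
`C ⊗ C`-comodules from `A ⊗ A` to `A ⊗ A` with its coaction twisted by the flip of `C ⊗ C`. -/
structure IsGradedHopf (C : D) [MonObj C] (δ : C ⟶ C ⊗ C) (A : D) [MonObj A] [ComonObj A]
    (c : A ⊗ A ⟶ A ⊗ A) (ρ : A ⟶ C ⊗ A) : Prop where
  bialgebra : IsPreBraidedBialgebra A c
  coassoc : ρ ≫ δ ▷ A ≫ (α_ C C A).hom = ρ ≫ C ◁ ρ
  one_colinear : IsColinear (unitCoact C) ρ η[A]
  mul_colinear : IsColinear (tensorCoact ρ ρ) ρ μ[A]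
  counit_colinear : IsColinear ρ (unitCoact C) ε[A]
  comul_colinear : IsColinear ρ (tensorCoact ρ ρ) Δ[A]
  braid_colinear : c ≫ coact₂ ρ ρ = coact₂ ρ ρ ≫ ((β_ C C).hom ⊗ₘ c)
  antipode : ∃ S : A ⟶ A, Δ[A] ≫ S ▷ A ≫ μ[A] = ε[A] ≫ η[A] ∧
    Δ[A] ≫ A ◁ S ≫ μ[A] = ε[A] ≫ η[A] ∧ IsColinear ρ ρ S

variable [Preadditive D]

/-- An object is flat if tensoring with it preserves kernels. -/
def IsFlat (R : D) : Prop :=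
  ∀ {X Y : D} (f : X ⟶ Y), Limits.PreservesLimit (Limits.parallelPair f 0) (tensorLeft R)

/-- `i : W ⟶ A` exhibits `W` as the subspace of primitive elements, the equaliser of `Δ` and
`η ⊗ id + id ⊗ η`. -/
def IsPrimitives {A W : D} [MonObj A] [ComonObj A] (i : W ⟶ A) : Prop :=
  ∃ h : i ≫ Δ[A] = i ≫ ((λ_ A).inv ≫ η[A] ▷ A + (ρ_ A).inv ≫ A ◁ η[A]),
    Nonempty (Limits.IsLimit (Limits.Fork.ofι i h))

/-- The axioms of a Nichols algebra of `(V, c)`, except for generation and for the compatibility of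
the coaction with the counit: `R` is a flat pre-braided Hopf algebra graded over the bialgebra `C`
(with comultiplication `δ` and distinguished grouplike element `x`), such that `R(0) ≅ k` (through
the unit of `R`) and `P(R) = R(x) ≅ V` (through `i`) as pre-braided objects. -/
structure IsNicholsOver (C : D) [MonObj C] (δ : C ⟶ C ⊗ C) (x : 𝟙_ D ⟶ C) {V : D}
    (c : V ⊗ V ⟶ V ⊗ V) (R : D) [MonObj R] [ComonObj R] (braid : R ⊗ R ⟶ R ⊗ R)
    (ρ : R ⟶ C ⊗ R) (i : V ⟶ R) : Prop where
  flat_base : IsFlat V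
  preBraiding : IsPreBraiding c
  grouplike : x ≫ δ = (λ_ (𝟙_ D)).inv ≫ (x ⊗ₘ x)
  flat : IsFlat R
  hopf : IsGradedHopf C δ R braid ρ
  piece_zero : IsPiece η[C] ρ η[R]
  piece_one : IsPiece x ρ i
  primitives : IsPrimitives i
  incl_braid : (i ⊗ₘ i) ≫ braid = c ≫ (i ⊗ₘ i)

end Symmetric

end Generic

/-! ### Overconvergent colimits -/

namespace Radius

/-- The minimum of two radii. -/
def inf (r s : Radius.{u}) : Radius.{u} := ⟨min r.val s.val, lt_min r.pos s.pos⟩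

lemma le_inf_left (r s : Radius.{u}) : r ≤ inf r s := min_le_left r.val s.val
lemma le_inf_right (r s : Radius.{u}) : s ≤ inf r s := min_le_right r.val s.val
lemma inf_mono {r r' s s' : Radius.{u}} (h : r ≤ r') (h' : s ≤ s') : inf r s ≤ inf r' s' :=
  min_le_min (le_def.1 h) (le_def.1 h')

end Radius

/-- The radii greater than `a`, with the reversed order. -/
abbrev Above (a : ℝ) : Type u := {r : Radius.{u} // a < r.val}

namespace Above

variable {a : ℝ}

/-- A radius greater than `a`. -/
def base (a : ℝ) : Above.{u} a :=
  ⟨⟨|a| + 1, by positivity⟩, (le_abs_self a).trans_lt (lt_add_one _)⟩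

/-- The minimum of two radii. -/
def inf (r s : Above.{u} a) : Above.{u} a := ⟨r.1.inf s.1, lt_min r.2 s.2⟩

instance : Nonempty (Above.{u} a) := ⟨base a⟩

instance : IsDirectedOrder (Above.{u} a) where
  directed r s := ⟨inf r s, Radius.le_inf_left _ _, Radius.le_inf_right _ _⟩

/-- `r / 2`, as a radius greater than `0`. -/
def half (r : Above.{u} 0) : Above.{u} 0 := ⟨r.1.half, half_pos r.2⟩

/-- `√ r`, for `0 ≤ a ≤ 1`. -/
def sqrt (h0 : 0 ≤ a) (h1 : a ≤ 1) (r : Above.{u} a) : Above.{u} a :=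
  ⟨r.1.sqrt, Real.lt_sqrt_of_sq_lt ((by nlinarith : a ^ 2 ≤ a).trans_lt r.2)⟩

end Above

namespace Ban

variable {k : Type u} [NormedField k]

/-- The ind-object `colim_{r > a} F r`. -/
def dagger (a : ℝ) (F : Radius.{u} ⥤ Ban k) : IndObj (Ban k) :=
  ⟨Above.{u} a, Monotone.functor (f := Subtype.val) (fun _ _ h => h) ⋙ F⟩

/-- The natural map `geom r E ⟶ geom s E` for `s ≤ r`. -/
def res (E : ℕ → Ban k) {r s : Radius.{u}} (h : r ≤ s) : geom r E ⟶ geom s E :=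
  desc (incl s E) ⟨1, fun n => (normLE_incl n).mono (by
    rw [one_mul]; exact pow_le_pow_left₀ s.pos.le h n)⟩

@[simp] lemma res_incl (E : ℕ → Ban k) {r s : Radius.{u}} (h : r ≤ s) (n : ℕ) (x : E n) :
    res E h (incl r E n x) = incl s E n x := desc_incl _ _ _ _

/-- The system of the spaces `geom r E` with the natural maps. -/
def geomFunctor (E : ℕ → Ban k) : Radius.{u} ⥤ Ban k where
  obj r := geom r E
  map w := res E (leOfHom w)
  map_id r := geom_ext fun n => hom_ext fun x => by simp
  map_comp v w := geom_ext fun n => hom_ext fun x => by simp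

@[simp] lemma geomFunctor_map (E : ℕ → Ban k) {r s : Radius.{u}} (w : r ⟶ s) :
    (geomFunctor E).map w = res E (leOfHom w) := rfl

lemma normLE_tensorHom {V V' W W' : Ban k} [CompleteSpace k] {f : V ⟶ V'} {g : W ⟶ W'} {C D : ℝ}
    (hC : 0 ≤ C) (hD : 0 ≤ D) (hf : NormLE f C) (hg : NormLE g D) : NormLE (f ⊗ₘ g) (C * D) :=
  hf.map hC hD hg

lemma normLE_incl_tensor [CompleteSpace k] (r s : Radius.{u}) (E F : ℕ → Ban k) (m n : ℕ) :
    NormLE (incl r E m ⊗ₘ incl s F n) (r.val ^ m * s.val ^ n) :=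
  normLE_tensorHom (r.pow_pos m).le (s.pow_pos n).le (normLE_incl m) (normLE_incl n)

variable [CompleteSpace k]

/-- The elementary tensor `x ⊗ y`, as an element of the monoidal product. -/
def otm {V W : Ban k} (x : V) (y : W) : (V ⊗ W : Ban k) := tmul x y

section otm

variable {U V V' W W' Z : Ban k}

lemma ext₂ {f g : V ⊗ W ⟶ Z} (h : ∀ x y, f (otm x y) = g (otm x y)) : f = g := tensor_ext h

@[simp] lemma otm_smul (a : k) (x : V) (y : W) : otm x (a • y) = a • otm x y := tmul_smul a x y
@[simp] lemma smul_otm (a : k) (x : V) (y : W) : otm (a • x) y = a • otm x y := smul_tmul a x y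
@[simp] lemma tensorHom_otm (f : V ⟶ V') (g : W ⟶ W') (x : V) (y : W) :
    (f ⊗ₘ g) (otm x y) = otm (f x) (g y) := map_tmul f g x y
@[simp] lemma whiskerLeft_otm (g : W ⟶ W') (x : V) (y : W) :
    (V ◁ g) (otm x y) = otm x (g y) := map_tmul (𝟙 V) g x y
@[simp] lemma whiskerRight_otm (f : V ⟶ V') (x : V) (y : W) :
    (f ▷ W) (otm x y) = otm (f x) y := map_tmul f (𝟙 W) x y
@[simp] lemma associator_otm (x : U) (y : V) (z : W) :
    (α_ U V W).hom (otm (otm x y) z) = otm x (otm y z) := assocHom_tmul x y z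
@[simp] lemma associator_inv_otm (x : U) (y : V) (z : W) :
    (α_ U V W).inv (otm x (otm y z)) = otm (otm x y) z := assocInv_tmul x y z
@[simp] lemma braiding_otm (x : V) (y : W) : (β_ V W).hom (otm x y) = otm y x := swap_tmul x y
@[simp] lemma leftUnitor_otm (a : k) (y : V) :
    (λ_ V).hom (otm (V := 𝟙_ (Ban k)) (scalar a) y) = a • y := lunitHom_tmul (scalar a) y
@[simp] lemma leftUnitor_inv_apply (y : V) :
    (λ_ V).inv y = otm (V := 𝟙_ (Ban k)) (scalar 1) y := rfl
@[simp] lemma rightUnitor_otm (a : k) (y : V) :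
    (ρ_ V).hom (otm (W := 𝟙_ (Ban k)) y (scalar a)) = a • y :=
  (congrArg (lunitHom V) (swap_tmul y (scalar a))).trans (lunitHom_tmul (scalar a) y)
@[simp] lemma rightUnitor_inv_apply (y : V) :
    (ρ_ V).inv y = otm (W := 𝟙_ (Ban k)) y (scalar 1) := rfl

lemma geom_ext_otm {r s : Radius.{u}} {E F : ℕ → Ban k} {f g : geom r E ⊗ geom s F ⟶ Z}
    (h : ∀ m n a b, f (otm (incl r E m a) (incl s F n b)) =
      g (otm (incl r E m a) (incl s F n b))) : f = g := geom_ext₂ h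

end otm

/-- The inclusion of `E n` in `colim_{r > a} geom r E`. -/
def single (a : ℝ) (E : ℕ → Ban k) (n : ℕ) : IndObj.const (E n) ⟶ dagger a (geomFunctor E) :=
  IndObj.ofConst (Y := dagger a (geomFunctor E)) (Above.base a) (incl (Above.base a).1 E n)

section Algebra

variable {E : ℕ → Ban k} (m : ∀ i j, E i ⊗ E j ⟶ E (i + j)) (hm : ∀ i j, NormLE (m i j) 1)

/-- The multiplication on contracting coproducts induced by a graded multiplication of norm at
most `1`. -/
def geomMul {r s q : Radius.{u}} (hr : r ≤ q) (hs : s ≤ q) : geom r E ⊗ geom s E ⟶ geom q E :=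
  desc₂ (fun i j => m i j ≫ incl q E (i + j)) 1 zero_le_one fun i j =>
    ((hm i j).comp (normLE_incl (i + j)) (q.pow_pos _).le).mono (by
      rw [mul_one, one_mul, pow_add]
      exact mul_le_mul (pow_le_pow_left₀ q.pos.le hr i) (pow_le_pow_left₀ q.pos.le hs j)
        (q.pow_pos j).le (r.pow_pos i).le)

@[simp] lemma geomMul_incl {r s q : Radius.{u}} (hr : r ≤ q) (hs : s ≤ q) (i j : ℕ) (x : E i)
    (y : E j) : geomMul m hm hr hs (otm (incl r E i x) (incl s E j y)) =
      incl q E (i + j) (m i j (otm x y)) :=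
  desc₂_incl _ _ _ _ _ _ _ _

lemma normLE_geomMul {r s q : Radius.{u}} (hr : r ≤ q) (hs : s ≤ q) :
    NormLE (geomMul m hm hr hs) 1 := normLE_desc₂ _ _ _ _

lemma geomMul_res {r s q r' s' q' : Radius.{u}} (hr : r ≤ q) (hs : s ≤ q) (hr' : r' ≤ q')
    (hs' : s' ≤ q') (h : r ≤ r') (h' : s ≤ s') (h'' : q ≤ q') :
    (res E h ⊗ₘ res E h') ≫ geomMul m hm hr' hs' = geomMul m hm hr hs ≫ res E h'' :=
  geom_ext_otm fun i j x y => by simp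

/-- The multiplication on `colim_{r > a} geom r E`. -/
def daggerMul (a : ℝ) :
    dagger a (geomFunctor E) ⊗ dagger a (geomFunctor E) ⟶ dagger a (geomFunctor E) :=
  IndObj.ofLevel (X := (dagger a (geomFunctor E)).tensor (dagger a (geomFunctor E)))
    (Y := dagger a (geomFunctor E)) (fun p => p.1.inf p.2)
    (fun p => geomMul m hm (r := p.1.1) (s := p.2.1) (q := p.1.1.inf p.2.1)
      (Radius.le_inf_left _ _) (Radius.le_inf_right _ _))
    fun w => ⟨homOfLE (X := Above.{u} a) (Radius.inf_mono (leOfHom (X := Above.{u} a) w.1)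
      (leOfHom (X := Above.{u} a) w.2)), geomMul_res m hm _ _ _ _ (leOfHom (X := Above.{u} a) w.1)
        (leOfHom (X := Above.{u} a) w.2) (Radius.inf_mono (leOfHom (X := Above.{u} a) w.1)
          (leOfHom (X := Above.{u} a) w.2))⟩

end Algebra

/-! ### The graded bialgebras `k{t}†` and `k{t/0}†` -/

/-- The coefficient spaces `k · t ^ n`. -/
abbrev diskPow (k : Type u) [NormedField k] [CompleteSpace k] : ℕ → Ban k := fun _ => 𝟙_ (Ban k)

/-- `k{t/a}† = colim_{r > a} k{t/r}`, where `k{t/r}` is the space of power series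
`∑ a_n t ^ n` with `∑ |a_n| r ^ n < ∞`. -/
def diskAlg (k : Type u) [NormedField k] [CompleteSpace k] (a : ℝ) : IndObj (Ban k) :=
  dagger a (geomFunctor (diskPow k))

/-- `k{t/r} ⟶ k{t/√r} ⊗ k{t/√r}`, `t ^ n ↦ t ^ n ⊗ t ^ n`. -/
def diskComulAux (r : Radius.{u}) :
    geom r (diskPow k) ⟶ geom r.sqrt (diskPow k) ⊗ geom r.sqrt (diskPow k) :=
  desc (fun n => (λ_ (𝟙_ (Ban k))).inv ≫ (incl r.sqrt (diskPow k) n ⊗ₘ incl r.sqrt (diskPow k) n))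
    ⟨1, fun n => ((normLE_leftUnitor_inv _).comp (normLE_incl_tensor _ _ _ _ n n)
      (mul_pos (r.sqrt.pow_pos n) (r.sqrt.pow_pos n)).le).mono (by
        rw [mul_one, one_mul, ← mul_pow, r.sqrt_mul])⟩

@[simp] lemma diskComulAux_incl (r : Radius.{u}) (n : ℕ) (x : 𝟙_ (Ban k)) :
    diskComulAux r (incl r (diskPow k) n x) =
      otm (incl r.sqrt (diskPow k) n (scalar 1)) (incl r.sqrt (diskPow k) n x) :=
  (desc_incl _ _ _ _).trans (by simp)

lemma diskComulAux_res {r s : Radius.{u}} (h : r ≤ s) :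
    res (diskPow k) h ≫ diskComulAux s = diskComulAux r ≫
      (res (diskPow k) (Radius.sqrt_mono h) ⊗ₘ res (diskPow k) (Radius.sqrt_mono h)) :=
  geom_ext fun n => hom_ext fun x => by simp

/-- The comultiplication `t ^ n ↦ t ^ n ⊗ t ^ n` of `k{t/a}†`, for `0 ≤ a ≤ 1`. -/
def diskComul (a : ℝ) (h0 : 0 ≤ a) (h1 : a ≤ 1) :
    diskAlg k a ⟶ diskAlg k a ⊗ diskAlg k a :=
  IndObj.ofLevel (X := diskAlg k a) (Y := (diskAlg k a).tensor (diskAlg k a))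
    (fun r => (r.sqrt h0 h1, r.sqrt h0 h1)) (fun r => diskComulAux r.1)
    fun w => ⟨(homOfLE (X := Above.{u} a) (Radius.sqrt_mono (leOfHom (X := Above.{u} a) w)),
      homOfLE (X := Above.{u} a) (Radius.sqrt_mono (leOfHom (X := Above.{u} a) w))),
      diskComulAux_res (leOfHom (X := Above.{u} a) w)⟩

/-- `k{t/r} ⟶ k`, `t ^ n ↦ 1`, for `1 ≤ r`. -/
def diskCounitAux (r : Radius.{u}) (h : 1 ≤ r.val) : geom r (diskPow k) ⟶ 𝟙_ (Ban k) :=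
  desc (fun _ => 𝟙 _) ⟨1, fun n => (normLE_id _).mono (by rw [one_mul]; exact one_le_pow₀ h)⟩

@[simp] lemma diskCounitAux_incl (r : Radius.{u}) (h : 1 ≤ r.val) (n : ℕ) (x : 𝟙_ (Ban k)) :
    diskCounitAux r h (incl r (diskPow k) n x) = x := desc_incl _ _ _ _

lemma diskCounitAux_res {r s : Radius.{u}} (hr : 1 ≤ r.val) (hs : 1 ≤ s.val) (h : r ≤ s) :
    res (diskPow k) h ≫ diskCounitAux s hs = diskCounitAux r hr ≫ 𝟙 _ :=
  geom_ext fun n => hom_ext fun x => by simp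

/-- The counit `t ^ n ↦ 1` of `k{t}†`. -/
def diskCounit : diskAlg k 1 ⟶ 𝟙_ (IndObj (Ban k)) :=
  IndObj.ofLevel (X := diskAlg k 1) (Y := IndObj.const (𝟙_ (Ban k))) (fun _ => ⟨⟨⟩⟩)
    (fun r => diskCounitAux r.1 r.2.le)
    fun w => ⟨𝟙 _, diskCounitAux_res _ _ (leOfHom (X := Above.{u} 1) w)⟩


/-- The monomial `t ^ n`. -/
def monom (r : Radius.{u}) (n : ℕ) : geom r (diskPow k) := incl r (diskPow k) n (scalar 1)

lemma unit_ext {X : Ban k} {f g : 𝟙_ (Ban k) ⟶ X} (h : f (scalar 1) = g (scalar 1)) : f = g :=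
  hom_ext fun a => by
    have ha : a = toScalar a • (scalar 1 : 𝟙_ (Ban k)) := (mul_one (toScalar a)).symm
    rw [ha]
    exact (map_smul f.lin _ _).trans ((congrArg _ h).trans (map_smul g.lin _ _).symm)

section monom

variable {r s q : Radius.{u}} {X Y : Ban k}

lemma disk_ext {f g : geom r (diskPow k) ⟶ X} (h : ∀ n, f (monom r n) = g (monom r n)) : f = g :=
  geom_ext fun n => unit_ext (h n)

lemma disk_ext_left {f g : geom r (diskPow k) ⊗ Y ⟶ X}
    (h : ∀ n y, f (otm (monom r n) y) = g (otm (monom r n) y)) : f = g :=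
  ext₂ fun x y => congrArg (fun φ : geom r (diskPow k) ⟶ X => φ x)
    (show tmulRight y ≫ f = tmulRight y ≫ g from disk_ext fun n => h n y)

lemma disk_ext₂ {f g : geom r (diskPow k) ⊗ geom s (diskPow k) ⟶ X}
    (h : ∀ m n, f (otm (monom r m) (monom s n)) = g (otm (monom r m) (monom s n))) : f = g :=
  disk_ext_left fun m y => congrArg (fun φ : geom s (diskPow k) ⟶ X => φ y)
    (show tmulLeft (monom r m) ≫ f = tmulLeft (monom r m) ≫ g from disk_ext fun n => h m n)

lemma disk_ext₃ {f g : (geom r (diskPow k) ⊗ geom s (diskPow k)) ⊗ geom q (diskPow k) ⟶ X}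
    (h : ∀ l m n, f (otm (otm (monom r l) (monom s m)) (monom q n)) =
      g (otm (otm (monom r l) (monom s m)) (monom q n))) : f = g :=
  ext₂ fun x y => congrArg (fun φ : geom r (diskPow k) ⊗ geom s (diskPow k) ⟶ X => φ x)
    (show tmulRight y ≫ f = tmulRight y ≫ g from disk_ext₂ fun l m =>
      congrArg (fun φ : geom q (diskPow k) ⟶ X => φ y)
        (show tmulLeft (otm (monom r l) (monom s m)) ≫ f = tmulLeft (otm (monom r l) (monom s m)) ≫ g
          from disk_ext fun n => h l m n))

@[simp] lemma res_monom (h : r ≤ s) (n : ℕ) : res (diskPow k) h (monom r n) = monom s n :=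
  res_incl _ _ _ _

lemma normLE_diskMul (_ _ : ℕ) : NormLE (λ_ (𝟙_ (Ban k))).hom 1 := normLE_leftUnitor_hom _

/-- The multiplication `k{t/r} ⊗ k{t/s} ⟶ k{t/q}`, for `q ≤ r, s`. -/
def diskMulAux (hr : r ≤ q) (hs : s ≤ q) :
    geom r (diskPow k) ⊗ geom s (diskPow k) ⟶ geom q (diskPow k) :=
  geomMul (E := diskPow k) (fun _ _ => (λ_ (𝟙_ (Ban k))).hom) normLE_diskMul hr hs

@[simp] lemma diskMulAux_monom (hr : r ≤ q) (hs : s ≤ q) (m n : ℕ) :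
    diskMulAux hr hs (otm (monom r m) (monom (k := k) s n)) = monom q (m + n) :=
  (geomMul_incl _ _ _ _ _ _ _ _).trans (congrArg _ ((leftUnitor_otm _ _).trans (one_smul _ _)))

@[simp] lemma diskComulAux_monom (n : ℕ) :
    diskComulAux r (monom (k := k) r n) = otm (monom _ n) (monom _ n) := diskComulAux_incl _ _ _

@[simp] lemma diskCounitAux_monom (h : 1 ≤ r.val) (n : ℕ) :
    diskCounitAux r h (monom (k := k) r n) = scalar 1 := diskCounitAux_incl _ _ _ _

lemma incl_zero_scalar : incl r (diskPow k) 0 (scalar 1) = monom r 0 := rfl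

end monom

/-- The multiplication of `k{t/a}†`. -/
def diskMul (a : ℝ) : diskAlg k a ⊗ diskAlg k a ⟶ diskAlg k a :=
  daggerMul (E := diskPow k) (fun _ _ => (λ_ (𝟙_ (Ban k))).hom) normLE_diskMul a

section laws

variable {r s q l r' s' q' : Radius.{u}}

lemma unit_disk_ext {X : Ban k} {f g : 𝟙_ (Ban k) ⊗ geom r (diskPow k) ⟶ X}
    (h : ∀ n, f (otm (scalar 1 : 𝟙_ (Ban k)) (monom r n)) = g (otm (scalar 1) (monom r n))) :
    f = g :=
  ext₂ fun x y => congrArg (fun φ : 𝟙_ (Ban k) ⟶ X => φ x)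
    (show tmulRight y ≫ f = tmulRight y ≫ g from unit_ext
      (congrArg (fun φ : geom r (diskPow k) ⟶ X => φ y)
        (show tmulLeft (scalar 1) ≫ f = tmulLeft (scalar 1) ≫ g from disk_ext h)))

lemma disk_unit_ext {X : Ban k} {f g : geom r (diskPow k) ⊗ 𝟙_ (Ban k) ⟶ X}
    (h : ∀ n, f (otm (monom r n) (scalar 1 : 𝟙_ (Ban k))) = g (otm (monom r n) (scalar 1))) :
    f = g :=
  disk_ext_left fun n y => congrArg (fun φ : 𝟙_ (Ban k) ⟶ X => φ y)
    (show tmulLeft (monom r n) ≫ f = tmulLeft (monom r n) ≫ g from unit_ext (h n))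

lemma disk_one_mul (hr : r ≤ q) (hs : s ≤ q) (h : q ≤ l) (h' : s ≤ l) :
    ((incl r (diskPow k) 0 ⊗ₘ 𝟙 (geom s (diskPow k))) ≫ diskMulAux hr hs) ≫ res (diskPow k) h =
      (λ_ _).hom ≫ res (diskPow k) h' :=
  unit_disk_ext fun n => by simp [incl_zero_scalar]

lemma disk_mul_one (hr : r ≤ q) (hs : s ≤ q) (h : q ≤ l) (h' : r ≤ l) :
    ((𝟙 (geom r (diskPow k)) ⊗ₘ incl s (diskPow k) 0) ≫ diskMulAux hr hs) ≫ res (diskPow k) h =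
      (ρ_ _).hom ≫ res (diskPow k) h' :=
  disk_unit_ext fun n => by simp [incl_zero_scalar]

lemma disk_mul_assoc {q₁ q₂ q₃ q₄ : Radius.{u}} (h₁ : r ≤ q₁) (h₂ : s ≤ q₁) (h₃ : q₁ ≤ q₂)
    (h₄ : q ≤ q₂) (h₅ : s ≤ q₃) (h₆ : q ≤ q₃) (h₇ : r ≤ q₄) (h₈ : q₃ ≤ q₄) (h : q₂ ≤ l)
    (h' : q₄ ≤ l) :
    ((diskMulAux h₁ h₂ ⊗ₘ 𝟙 _) ≫ diskMulAux h₃ h₄) ≫ res (diskPow k) h =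
      ((α_ _ _ _).hom ≫ (𝟙 _ ⊗ₘ diskMulAux h₅ h₆) ≫ diskMulAux h₇ h₈) ≫ res (diskPow k) h' :=
  disk_ext₃ fun i j n => by simp [add_assoc]

lemma disk_counit_comul (h : 1 ≤ r.sqrt.val) (h₁ : r.sqrt ≤ l) (h₂ : r ≤ l) :
    (diskComulAux r ≫ (diskCounitAux r.sqrt h ⊗ₘ 𝟙 _)) ≫ (𝟙 (𝟙_ (Ban k)) ⊗ₘ res (diskPow k) h₁) =
      (λ_ _).inv ≫ (𝟙 (𝟙_ (Ban k)) ⊗ₘ res (diskPow k) h₂) :=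
  disk_ext fun n => by simp

lemma disk_comul_counit (h : 1 ≤ r.sqrt.val) (h₁ : r.sqrt ≤ l) (h₂ : r ≤ l) :
    (diskComulAux r ≫ (𝟙 _ ⊗ₘ diskCounitAux r.sqrt h)) ≫ (res (diskPow k) h₁ ⊗ₘ 𝟙 (𝟙_ (Ban k))) =
      (ρ_ _).inv ≫ (res (diskPow k) h₂ ⊗ₘ 𝟙 (𝟙_ (Ban k))) :=
  disk_ext fun n => by simp

lemma disk_comul_assoc (h₁ : r.sqrt ≤ l) (h₂ : r.sqrt.sqrt ≤ l) :
    (diskComulAux (k := k) r ≫ (𝟙 _ ⊗ₘ diskComulAux r.sqrt)) ≫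
        (res _ h₁ ⊗ₘ (res _ h₂ ⊗ₘ res _ h₂)) =
      (diskComulAux r ≫ (diskComulAux r.sqrt ⊗ₘ 𝟙 _) ≫ (α_ _ _ _).hom) ≫
        (res _ h₂ ⊗ₘ (res _ h₂ ⊗ₘ res _ h₁)) :=
  disk_ext fun n => by simp

lemma disk_mul_comul (hr : r ≤ q) (hs : s ≤ q) (hr' : r.sqrt ≤ q') (hs' : s.sqrt ≤ q')
    (h : q.sqrt ≤ l) (h' : q' ≤ l) :
    (diskMulAux (k := k) hr hs ≫ diskComulAux q) ≫ (res _ h ⊗ₘ res _ h) =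
      ((diskComulAux r ⊗ₘ diskComulAux s) ≫ tensorμ _ _ _ _ ≫
        (diskMulAux hr' hs' ⊗ₘ diskMulAux hr' hs')) ≫ (res _ h' ⊗ₘ res _ h') :=
  disk_ext₂ fun i j => by simp [tensorμ]

lemma disk_one_comul (h : r.sqrt ≤ l) (h' : r ≤ l) :
    (incl r (diskPow k) 0 ≫ diskComulAux r) ≫ (res _ h ⊗ₘ res _ h) =
      ((λ_ (𝟙_ (Ban k))).inv ≫ (incl r (diskPow k) 0 ⊗ₘ incl r (diskPow k) 0)) ≫
        (res _ h' ⊗ₘ res _ h') :=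
  unit_ext (by simp [incl_zero_scalar])

lemma disk_mul_counit (hr : r ≤ q) (hs : s ≤ q) (h₁ : 1 ≤ r.val) (h₂ : 1 ≤ s.val)
    (h₃ : 1 ≤ q.val) :
    diskMulAux hr hs ≫ diskCounitAux (k := k) q h₃ =
      (diskCounitAux r h₁ ⊗ₘ diskCounitAux s h₂) ≫ (λ_ (𝟙_ (Ban k))).hom :=
  disk_ext₂ fun i j => by simp

lemma disk_one_counit (h : 1 ≤ r.val) : incl r (diskPow k) 0 ≫ diskCounitAux r h = 𝟙 _ :=
  unit_ext (by simp)

end laws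

section instances

variable (k) (a : ℝ)

/-- `k{t/a}†` is an algebra. -/
instance : MonObj (diskAlg k a) where
  one := single a (diskPow k) 0
  mul := diskMul a
  one_mul := IndObj.hom_ext fun p => IndObj.Germ.mk_eq (Y := diskAlg k a)
    (j := (Above.base a).inf p.2) (j' := p.2) (l := (Above.base a).inf p.2) (𝟙 _)
    (homOfLE (X := Above.{u} a) (Radius.le_inf_right _ _))
    (disk_one_mul (Radius.le_inf_left _ _) (Radius.le_inf_right _ _) le_rfl
      (Radius.le_inf_right _ _))
  mul_one := IndObj.hom_ext fun p => IndObj.Germ.mk_eq (Y := diskAlg k a)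
    (j := Above.inf p.1 (Above.base a)) (j' := p.1) (l := Above.inf p.1 (Above.base a)) (𝟙 _)
    (homOfLE (X := Above.{u} a) (Radius.le_inf_left _ _))
    (disk_mul_one (Radius.le_inf_left _ _) (Radius.le_inf_right _ _) le_rfl
      (Radius.le_inf_left _ _))
  mul_assoc := IndObj.hom_ext fun p => IndObj.Germ.mk_eq (Y := diskAlg k a)
    (j := (Above.inf p.1.1 p.1.2).inf p.2) (j' := Above.inf p.1.1 (Above.inf p.1.2 p.2))
    (l := ((Above.inf p.1.1 p.1.2).inf p.2).inf (Above.inf p.1.1 (Above.inf p.1.2 p.2)))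
    (homOfLE (X := Above.{u} a) (Radius.le_inf_left _ _))
    (homOfLE (X := Above.{u} a) (Radius.le_inf_right _ _))
    (disk_mul_assoc (Radius.le_inf_left _ _) (Radius.le_inf_right _ _) (Radius.le_inf_left _ _)
      (Radius.le_inf_right _ _) (Radius.le_inf_left _ _) (Radius.le_inf_right _ _)
      (Radius.le_inf_left _ _) (Radius.le_inf_right _ _) (Radius.le_inf_left _ _)
      (Radius.le_inf_right _ _))

/-- `√ r`, as a radius greater than `1`. -/
abbrev sqrt₁ (r : Above.{u} 1) : Above.{u} 1 := r.sqrt zero_le_one le_rfl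

/-- `k{t}†` is a coalgebra. -/
instance : ComonObj (diskAlg k 1) where
  counit := diskCounit
  comul := diskComul 1 zero_le_one le_rfl
  counit_comul := IndObj.hom_ext fun r => IndObj.Germ.mk_eq (Y := (IndObj.const (𝟙_ (Ban k))).tensor (diskAlg k 1))
    (j := (⟨⟨⟩⟩, sqrt₁ r)) (j' := (⟨⟨⟩⟩, r)) (l := (⟨⟨⟩⟩, Above.inf (sqrt₁ r) r))
    (𝟙 _, homOfLE (X := Above.{u} 1) (Radius.le_inf_left _ _))
    (𝟙 _, homOfLE (X := Above.{u} 1) (Radius.le_inf_right _ _))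
    (disk_counit_comul (sqrt₁ r).2.le (Radius.le_inf_left _ _) (Radius.le_inf_right _ _))
  comul_counit := IndObj.hom_ext fun r => IndObj.Germ.mk_eq (Y := (diskAlg k 1).tensor (IndObj.const (𝟙_ (Ban k))))
    (j := (sqrt₁ r, ⟨⟨⟩⟩)) (j' := (r, ⟨⟨⟩⟩)) (l := (Above.inf (sqrt₁ r) r, ⟨⟨⟩⟩))
    (homOfLE (X := Above.{u} 1) (Radius.le_inf_left _ _), 𝟙 _)
    (homOfLE (X := Above.{u} 1) (Radius.le_inf_right _ _), 𝟙 _)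
    (disk_comul_counit (sqrt₁ r).2.le (Radius.le_inf_left _ _) (Radius.le_inf_right _ _))
  comul_assoc := IndObj.hom_ext fun r =>
    let l := Above.inf (sqrt₁ r) (sqrt₁ (sqrt₁ r))
    let w₁ : sqrt₁ r ⟶ l := homOfLE (Radius.le_inf_left _ _)
    let w₂ : sqrt₁ (sqrt₁ r) ⟶ l := homOfLE (Radius.le_inf_right _ _)
    IndObj.Germ.mk_eq (Y := (diskAlg k 1).tensor ((diskAlg k 1).tensor (diskAlg k 1)))
      (j := (sqrt₁ r, sqrt₁ (sqrt₁ r), sqrt₁ (sqrt₁ r)))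
      (j' := (sqrt₁ (sqrt₁ r), sqrt₁ (sqrt₁ r), sqrt₁ r)) (l := (l, l, l))
      (w₁, w₂, w₂) (w₂, w₂, w₁)
      (disk_comul_assoc (Radius.le_inf_left _ _) (Radius.le_inf_right _ _))

/-- `k{t}†` is a bialgebra. -/
instance : BimonObj (diskAlg k 1) where
  mul_comul := IndObj.hom_ext fun p =>
    let i := sqrt₁ (Above.inf p.1 p.2)
    let j := Above.inf (sqrt₁ p.1) (sqrt₁ p.2)
    let w : i ⟶ Above.inf i j := homOfLE (Radius.le_inf_left _ _)
    let w' : j ⟶ Above.inf i j := homOfLE (Radius.le_inf_right _ _)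
    IndObj.Germ.mk_eq (Y := (diskAlg k 1).tensor (diskAlg k 1)) (j := (i, i)) (j' := (j, j))
      (l := (Above.inf i j, Above.inf i j)) (w, w) (w', w')
      (disk_mul_comul (Radius.le_inf_left _ _) (Radius.le_inf_right _ _) (Radius.le_inf_left _ _)
        (Radius.le_inf_right _ _) (Radius.le_inf_left _ _) (Radius.le_inf_right _ _))
  one_comul := IndObj.hom_ext fun _ =>
    let i := Above.base 1
    let w : sqrt₁ i ⟶ Above.inf (sqrt₁ i) i := homOfLE (Radius.le_inf_left _ _)
    let w' : i ⟶ Above.inf (sqrt₁ i) i := homOfLE (Radius.le_inf_right _ _)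
    IndObj.Germ.mk_eq (Y := (diskAlg k 1).tensor (diskAlg k 1)) (j := (sqrt₁ i, sqrt₁ i)) (j' := (i, i))
      (l := (Above.inf (sqrt₁ i) i, Above.inf (sqrt₁ i) i)) (w, w) (w', w')
      (disk_one_comul (Radius.le_inf_left _ _) (Radius.le_inf_right _ _))
  mul_counit := IndObj.hom_ext fun p => congrArg (IndObj.Germ.mk (Y := IndObj.const (𝟙_ (Ban k))) ⟨⟨⟩⟩)
    (disk_mul_counit (Radius.le_inf_left _ _) (Radius.le_inf_right _ _) p.1.2.le p.2.2.le
      (Above.inf p.1 p.2).2.le)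
  one_counit := IndObj.hom_ext fun ⟨⟨⟩⟩ => congrArg (IndObj.Germ.mk (Y := IndObj.const (𝟙_ (Ban k))) ⟨⟨⟩⟩)
    (disk_one_counit (Above.base 1).2.le)

end instances

end Ban

namespace Ban

variable {k : Type u} [NormedField k] [CompleteSpace k]

/-- The generalised element `t` of `k{t/a}†`. -/
def diskT (k : Type u) [NormedField k] [CompleteSpace k] (a : ℝ) :
    𝟙_ (IndObj (Ban k)) ⟶ diskAlg k a := single a (diskPow k) 1

/-- The natural map `k{t}† ⟶ k{t/0}†`. -/
def diskRes (k : Type u) [NormedField k] [CompleteSpace k] : diskAlg k 1 ⟶ diskAlg k 0 :=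
  IndObj.ofLevel (X := diskAlg k 1) (Y := diskAlg k 0)
    (fun r => ⟨r.1, zero_lt_one.trans r.2⟩) (fun _ => 𝟙 _)
    fun w => ⟨homOfLE (X := Above.{u} 0) (leOfHom (X := Above.{u} 1) w),
      (Category.comp_id _).trans (Category.id_comp _).symm⟩

/-- The axioms of a dagger-0 Nichols algebra of `(V, c)` except for generation, for a grading `ρ`
over `k{t/0}†` presented through `k{t}†`.  The bialgebra `k{t/0}†` has no counit, because
`t ^ n ↦ 1` is not bounded on `k{t/r}` for `r < 1`; what takes the place of the counit axiom for
gradings over `k{t/0}†` is that they come from a (counital) coaction of the bialgebra `k{t}†`. -/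
structure IsDaggerZeroNicholsUngenerated {V : IndObj (Ban k)} (c : V ⊗ V ⟶ V ⊗ V)
    (R : IndObj (Ban k)) [MonObj R] [ComonObj R] (braid : R ⊗ R ⟶ R ⊗ R)
    (ρ : R ⟶ diskAlg k 1 ⊗ R) (i : V ⟶ R) : Prop where
  counital : ρ ≫ ComonObj.counit ▷ R = (λ_ R).inv
  over_one : IsNicholsOver (diskAlg k 1) ComonObj.comul (diskT k 1) c R braid ρ i
  over_zero : IsNicholsOver (diskAlg k 0) (diskComul 0 le_rfl zero_le_one) (diskT k 0) c R braid
    (ρ ≫ diskRes k ▷ R) i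

/-! ### The dagger tensor algebra -/

/-- The tensor power `V ^ ⊗ n`. -/
def tpow (V : Ban k) : ℕ → Ban k
  | 0 => 𝟙_ (Ban k)
  | n + 1 => tpow V n ⊗ V

/-- The concatenation `V ^ ⊗ m ⊗ V ^ ⊗ n ⟶ V ^ ⊗ (m + n)`. -/
def concat (V : Ban k) (m : ℕ) : ∀ n, tpow V m ⊗ tpow V n ⟶ tpow V (m + n)
  | 0 => (ρ_ (tpow V m)).hom
  | n + 1 => (α_ (tpow V m) (tpow V n) V).inv ≫ concat V m n ▷ V

lemma normLE_concat (V : Ban k) (m : ℕ) : ∀ n, NormLE (concat V m n) 1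
  | 0 => normLE_rightUnitor_hom _
  | n + 1 => (normLE_associator_inv _ _ _).comp_one (normLE_whiskerRight (normLE_concat V m n) V)

section braid

variable {V : Ban k} (c : V ⊗ V ⟶ V ⊗ V)

/-- The map `c_n : V ^ ⊗ n ⊗ V ⟶ V ⊗ V ^ ⊗ n` induced by `c`. -/
def braidOne : ∀ n, tpow V n ⊗ V ⟶ V ⊗ tpow V n
  | 0 => (λ_ V).hom ≫ (ρ_ V).inv
  | n + 1 => (α_ (tpow V n) V V).hom ≫ tpow V n ◁ c ≫ (α_ (tpow V n) V V).inv ≫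
      braidOne n ▷ V ≫ (α_ V (tpow V n) V).hom

/-- The map `c_{n,m} : V ^ ⊗ n ⊗ V ^ ⊗ m ⟶ V ^ ⊗ m ⊗ V ^ ⊗ n` induced by `c`. -/
def braidPow (n : ℕ) : ∀ m, tpow V n ⊗ tpow V m ⟶ tpow V m ⊗ tpow V n
  | 0 => (ρ_ (tpow V n)).hom ≫ (λ_ (tpow V n)).inv
  | m + 1 => (α_ (tpow V n) (tpow V m) V).inv ≫ braidPow n m ▷ V ≫
      (α_ (tpow V m) (tpow V n) V).hom ≫ tpow V m ◁ braidOne c n ≫ (α_ (tpow V m) V (tpow V n)).inv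

variable {c}

lemma normLE_braidOne (hc : NormLE c 1) : ∀ n, NormLE (braidOne c n) 1
  | 0 => (normLE_leftUnitor_hom _).comp_one (normLE_rightUnitor_inv _)
  | n + 1 => (normLE_associator_hom _ _ _).comp_one ((normLE_whiskerLeft _ hc).comp_one
      ((normLE_associator_inv _ _ _).comp_one ((normLE_whiskerRight (normLE_braidOne hc n) V).comp_one
        (normLE_associator_hom _ _ _))))

lemma normLE_braidPow (hc : NormLE c 1) (n : ℕ) : ∀ m, NormLE (braidPow c n m) 1
  | 0 => (normLE_rightUnitor_hom _).comp_one (normLE_leftUnitor_inv _)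
  | m + 1 => (normLE_associator_inv _ _ _).comp_one
      ((normLE_whiskerRight (normLE_braidPow hc n m) V).comp_one
        ((normLE_associator_hom _ _ _).comp_one ((normLE_whiskerLeft _ (normLE_braidOne hc n)).comp_one
          (normLE_associator_inv _ _ _))))

lemma normLE_middle (X X' : Ban k) {Y Y' Z Z' : Ban k} {f : Y ⊗ Y' ⟶ Z ⊗ Z'} (hf : NormLE f 1) :
    NormLE (middle X f X') 1 :=
  (normLE_associator_hom _ _ _).comp_one ((normLE_whiskerLeft _ ((normLE_associator_inv _ _ _).comp_one
    ((normLE_whiskerRight hf _).comp_one (normLE_associator_hom _ _ _)))).comp_one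
      (normLE_associator_inv _ _ _))

end braid

/-- The Banach tensor algebra `T_r(V)`, the contracting coproduct of the spaces `V_r ^ ⊗ n`. -/
abbrev tens (V : Ban k) (r : Radius.{u}) : Ban k := geom r (tpow V)

/-- The multiplication of `T_r(V)`. -/
def tensMul (V : Ban k) (r : Radius.{u}) : tens V r ⊗ tens V r ⟶ tens V r :=
  geomMul (concat V) (normLE_concat V) le_rfl le_rfl

/-- The pre-braiding `T_r(V) ⊗ T_s(V) ⟶ T_s(V) ⊗ T_r(V)` induced by `c`. -/
def tensBraid {V : Ban k} {c : V ⊗ V ⟶ V ⊗ V} (hc : NormLE c 1) (r s : Radius.{u}) :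
    tens V r ⊗ tens V s ⟶ tens V s ⊗ tens V r :=
  desc₂ (fun m n => braidPow c m n ≫ (incl s (tpow V) n ⊗ₘ incl r (tpow V) m)) 1 zero_le_one
    fun m n => ((normLE_braidPow hc m n).comp (normLE_incl_tensor _ _ _ _ n m)
      (mul_pos (s.pow_pos n) (r.pow_pos m)).le).mono (by linarith)

lemma normLE_tensBraid {V : Ban k} {c : V ⊗ V ⟶ V ⊗ V} (hc : NormLE c 1) (r s : Radius.{u}) :
    NormLE (tensBraid hc r s) 1 := normLE_desc₂ _ _ _ _

/-- The inclusion of the generators `V` in `T_r(V)`. -/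
def tensGen (V : Ban k) (r : Radius.{u}) : V ⟶ tens V r := (λ_ V).inv ≫ incl r (tpow V) 1

lemma normLE_tensGen (V : Ban k) (r : Radius.{u}) : NormLE (tensGen V r) r.val := by
  simpa [tensGen] using (normLE_leftUnitor_inv V).comp (normLE_incl (r := r) (E := tpow V) 1)
    (r.pow_pos 1).le

/-- The unit of `T_r(V)`. -/
def tensOne (V : Ban k) (r : Radius.{u}) : 𝟙_ (Ban k) ⟶ tens V r := incl r (tpow V) 0

lemma normLE_tensOne (V : Ban k) (r : Radius.{u}) : NormLE (tensOne V r) 1 := by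
  have h := normLE_incl (r := r) (E := tpow V) 0
  rw [pow_zero] at h
  exact h

/-- The counit of `T_r(V)`, the projection to the component of degree `0`. -/
def tensCounit (V : Ban k) (r : Radius.{u}) : tens V r ⟶ 𝟙_ (Ban k) :=
  desc (fun n => match n with
    | 0 => 𝟙 _
    | _ + 1 => 0) ⟨1, fun n => match n with
    | 0 => (normLE_id _).mono (by simp)
    | n + 1 => fun x => by
      rw [zero_apply, norm_zero]; have := r.pow_pos (n + 1); positivity⟩

/-- `v ↦ 1 ⊗ v + v ⊗ 1`. -/
def comulGen (V : Ban k) (r : Radius.{u}) : V ⟶ tens V r ⊗ tens V r :=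
  (λ_ V).inv ≫ (tensOne V r ⊗ₘ tensGen V r) + (ρ_ V).inv ≫ (tensGen V r ⊗ₘ tensOne V r)

lemma normLE_comulGen (V : Ban k) (r : Radius.{u}) : NormLE (comulGen V r) (2 * r.val) :=
  fun x => by
    have h₁ := (normLE_leftUnitor_inv V).comp (normLE_tensorHom zero_le_one r.pos.le
      (normLE_tensOne V r) (normLE_tensGen V r)) (by linarith [r.pos]) x
    have h₂ := (normLE_rightUnitor_inv V).comp (normLE_tensorHom r.pos.le zero_le_one
      (normLE_tensGen V r) (normLE_tensOne V r)) (by linarith [r.pos]) x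
    exact (norm_add_le _ _).trans (by linarith)

section comul

variable {V : Ban k} {c : V ⊗ V ⟶ V ⊗ V} (hc : NormLE c 1)

/-- From `f : U ⟶ T_r(V) ⊗ T_r(V)`, the composition of `f ⊗ Δ_1`, `id ⊗ c ⊗ id` and `μ ⊗ μ`. -/
def comulStep (r : Radius.{u}) {U : Ban k} (f : U ⟶ tens V r ⊗ tens V r) :
    U ⊗ V ⟶ tens V r ⊗ tens V r :=
  (f ⊗ₘ comulGen V r) ≫ middle (tens V r) (tensBraid hc r r) (tens V r) ≫
    (tensMul V r ⊗ₘ tensMul V r)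

/-- `1 ↦ 1 ⊗ 1`. -/
def comulOne (V : Ban k) (r : Radius.{u}) : 𝟙_ (Ban k) ⟶ tens V r ⊗ tens V r :=
  (λ_ (𝟙_ (Ban k))).inv ≫ (tensOne V r ⊗ₘ tensOne V r)

/-- The comultiplication `Δ_n` on `V ^ ⊗ n`, defined recursively: `Δ_{n + 1}` is the composition of
`Δ_n ⊗ Δ_1`, `id ⊗ c ⊗ id` and `μ ⊗ μ`. -/
def comulPow (r : Radius.{u}) : ∀ n, tpow V n ⟶ tens V r ⊗ tens V r
  | 0 => comulOne V r
  | n + 1 => comulStep hc r (comulPow r n)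

lemma normLE_comulPow (r : Radius.{u}) : ∀ n, NormLE (comulPow hc r n) ((2 * r.val) ^ n)
  | 0 => ((normLE_leftUnitor_inv _).comp (normLE_tensorHom zero_le_one zero_le_one
      (normLE_tensOne V r) (normLE_tensOne V r)) (by norm_num)).mono (by norm_num)
  | n + 1 => by
    have hr : 0 ≤ 2 * r.val := by linarith [r.pos]
    have h₁ := normLE_tensorHom (pow_nonneg hr n) hr (normLE_comulPow r n) (normLE_comulGen V r)
    have h₂ := normLE_tensorHom zero_le_one zero_le_one
      (normLE_geomMul (concat V) (normLE_concat V) (le_refl r) (le_refl r))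
      (normLE_geomMul (concat V) (normLE_concat V) (le_refl r) (le_refl r))
    rw [mul_one] at h₂
    have h₃ := (normLE_middle (tens V r) (tens V r) (normLE_tensBraid hc r r)).comp_one h₂
    exact (h₁.comp h₃ zero_le_one).mono (by rw [one_mul, pow_succ])

/-- The comultiplication `T_r(V) ⟶ T_{r/2}(V) ⊗ T_{r/2}(V)`. -/
def tensComul (r : Radius.{u}) : tens V r ⟶ tens V r.half ⊗ tens V r.half :=
  desc (comulPow hc r.half) ⟨1, fun n => (normLE_comulPow hc r.half n).mono (by
    rw [one_mul, two_mul, r.half_add])⟩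

end comul

/-- `T_r(V) ⟶ k{t/s} ⊗ T_q(V)`, `x ↦ t ^ n ⊗ x` for `x ∈ V ^ ⊗ n`, if `s q ≤ r`. -/
def tensCoact (V : Ban k) (r s q : Radius.{u}) (h : s.val * q.val ≤ r.val) :
    tens V r ⟶ geom s (diskPow k) ⊗ tens V q :=
  desc (fun n => (λ_ (tpow V n)).inv ≫ (incl s (diskPow k) n ⊗ₘ incl q (tpow V) n))
    ⟨1, fun n => ((normLE_leftUnitor_inv _).comp (normLE_incl_tensor _ _ _ _ n n)
      (mul_pos (s.pow_pos n) (q.pow_pos n)).le).mono (by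
        rw [mul_one, one_mul, ← mul_pow]
        exact pow_le_pow_left₀ (mul_pos s.pos q.pos).le h n)⟩

/-- The dagger tensor algebra `T_0(V)† = colim_{r > 0} T_r(V)`. -/
def tensDagger (V : Ban k) : IndObj (Ban k) := dagger 0 (geomFunctor (tpow V))


lemma middle_naturality {X X' Y Y' Z Z' X₁ X₁' Y₁ Y₁' Z₁ Z₁' : Ban k} (f : X ⟶ X₁) (f' : X' ⟶ X₁')
    (g : Y ⟶ Y₁) (g' : Y' ⟶ Y₁') (h : Z ⟶ Z₁) (h' : Z' ⟶ Z₁') (c : Y ⊗ Y' ⟶ Z ⊗ Z')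
    (c₁ : Y₁ ⊗ Y₁' ⟶ Z₁ ⊗ Z₁') (H : (g ⊗ₘ g') ≫ c₁ = c ≫ (h ⊗ₘ h')) :
    ((f ⊗ₘ g) ⊗ₘ (g' ⊗ₘ f')) ≫ middle X₁ c₁ X₁' = middle X c X' ≫ ((f ⊗ₘ h) ⊗ₘ (h' ⊗ₘ f')) := by
  simp only [middle, Category.assoc, ← id_tensorHom, ← tensorHom_id]
  rw [associator_naturality_assoc, ← associator_inv_naturality, tensorHom_comp_tensorHom_assoc,
    tensorHom_comp_tensorHom_assoc, associator_inv_naturality_assoc,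
    tensorHom_comp_tensorHom_assoc, H, Category.comp_id, Category.id_comp]
  simp only [Category.assoc, ← associator_naturality, tensorHom_comp_tensorHom_assoc]
  simp

end Ban

namespace Ban

variable {k : Type u} [NormedField k] [CompleteSpace k]

section structure_maps

variable (V : Ban k) {c : V ⊗ V ⟶ V ⊗ V} (hc : NormLE c 1)

lemma tensBraid_incl (r s : Radius.{u}) (m n : ℕ) (x : tpow V m) (y : tpow V n) :
    tensBraid hc r s (otm (incl r (tpow V) m x) (incl s (tpow V) n y)) =
      (incl s (tpow V) n ⊗ₘ incl r (tpow V) m) (braidPow c m n (otm x y)) :=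
  desc₂_incl _ _ _ _ _ _ _ _

lemma incl_tensor_res {r s r' s' : Radius.{u}} (h : r ≤ r') (h' : s ≤ s') (m n : ℕ) :
    (incl r (tpow V) m ⊗ₘ incl s (tpow V) n) ≫ (res _ h ⊗ₘ res _ h') =
      incl r' (tpow V) m ⊗ₘ incl s' (tpow V) n := ext₂ fun x y => by simp

lemma tensBraid_res {r s r' s' : Radius.{u}} (h : r ≤ r') (h' : s ≤ s') :
    (res _ h ⊗ₘ res _ h') ≫ tensBraid hc r' s' = tensBraid hc r s ≫ (res _ h' ⊗ₘ res _ h) :=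
  geom_ext_otm fun m n x y => by
    simp only [comp_apply, tensorHom_otm, res_incl, tensBraid_incl]
    rw [← incl_tensor_res V h' h]
    rfl

lemma tensGen_res {r s : Radius.{u}} (h : r ≤ s) : tensGen V r ≫ res _ h = tensGen V s :=
  hom_ext fun x => res_incl _ h _ _

lemma tensOne_res {r s : Radius.{u}} (h : r ≤ s) : tensOne V r ≫ res _ h = tensOne V s :=
  hom_ext fun x => res_incl _ h _ _

lemma comulGen_res {r s : Radius.{u}} (h : r ≤ s) :
    comulGen V r ≫ (res _ h ⊗ₘ res _ h) = comulGen V s := by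
  simp only [comulGen, Preadditive.add_comp, Category.assoc, tensorHom_comp_tensorHom, tensGen_res,
    tensOne_res]

lemma comulOne_res {r s : Radius.{u}} (h : r ≤ s) :
    comulOne V r ≫ (res _ h ⊗ₘ res _ h) = comulOne V s := by
  simp only [comulOne, Category.assoc, tensorHom_comp_tensorHom, tensOne_res]

lemma comulStep_res {r s : Radius.{u}} (h : r ≤ s) {U : Ban k} {f : U ⟶ tens V r ⊗ tens V r}
    {g : U ⟶ tens V s ⊗ tens V s} (H : f ≫ (res _ h ⊗ₘ res _ h) = g) :
    comulStep hc r f ≫ (res _ h ⊗ₘ res _ h) = comulStep hc s g := by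
  have hm : (res _ h ⊗ₘ res _ h) ≫ tensMul V s = tensMul V r ≫ res _ h :=
    geomMul_res (concat V) (normLE_concat V) _ _ _ _ h h h
  have hb := middle_naturality (res (tpow V) h) (res (tpow V) h) (res (tpow V) h) (res (tpow V) h)
    (res (tpow V) h) (res (tpow V) h) _ _ (tensBraid_res V hc h h)
  simp only [comulStep, Category.assoc, tensorHom_comp_tensorHom, ← hm, ← H, ← comulGen_res V h]
  rw [← tensorHom_comp_tensorHom, ← tensorHom_comp_tensorHom, Category.assoc,
    ← Category.assoc (middle _ _ _), ← hb, Category.assoc]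

lemma comulPow_res {r s : Radius.{u}} (h : r ≤ s) : ∀ n,
    comulPow hc r n ≫ (res _ h ⊗ₘ res _ h) = comulPow hc s n
  | 0 => comulOne_res V h
  | n + 1 => comulStep_res V hc h (comulPow_res h n)

lemma tensComul_res {r s : Radius.{u}} (h : r ≤ s) :
    res _ h ≫ tensComul hc s =
      tensComul hc r ≫ (res _ (Radius.half_mono h) ⊗ₘ res _ (Radius.half_mono h)) :=
  geom_ext fun n => hom_ext fun x => by
    simp only [comp_apply, res_incl, tensComul, desc_incl]
    rw [← comp_apply, comulPow_res]

lemma tensCounit_res {r s : Radius.{u}} (h : r ≤ s) :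
    res _ h ≫ tensCounit V s = tensCounit V r ≫ 𝟙 _ :=
  geom_ext fun n => hom_ext fun x => by simp [tensCounit]

lemma tensCoact_res {r r' s s' q q' : Radius.{u}} (h : r ≤ r') (hs : s ≤ s') (hq : q ≤ q')
    (H) (H') :
    res _ h ≫ tensCoact V r' s' q' H' = tensCoact V r s q H ≫ (res _ hs ⊗ₘ res _ hq) :=
  geom_ext fun n => hom_ext fun x => by simp [tensCoact]

/-- The multiplication of `T_0(V)†`. -/
def daggerTensMul : tensDagger V ⊗ tensDagger V ⟶ tensDagger V :=
  daggerMul (concat V) (normLE_concat V) 0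

/-- The unit of `T_0(V)†`. -/
def daggerTensOne : 𝟙_ (IndObj (Ban k)) ⟶ tensDagger V := single 0 (tpow V) 0

/-- The inclusion of `V` in `T_0(V)†`. -/
def daggerTensGen : IndObj.const V ⟶ tensDagger V :=
  IndObj.constMap (λ_ V).inv ≫ single 0 (tpow V) 1

/-- The counit of `T_0(V)†`. -/
def daggerTensCounit : tensDagger V ⟶ 𝟙_ (IndObj (Ban k)) :=
  IndObj.ofLevel (X := tensDagger V) (Y := IndObj.const (𝟙_ (Ban k))) (fun _ => ⟨⟨⟩⟩)
    (fun r => tensCounit V r.1) fun w => ⟨𝟙 _, tensCounit_res V (leOfHom (X := Above.{u} 0) w)⟩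

/-- The comultiplication of `T_0(V)†`. -/
def daggerTensComul : tensDagger V ⟶ tensDagger V ⊗ tensDagger V :=
  IndObj.ofLevel (X := tensDagger V) (Y := (tensDagger V).tensor (tensDagger V))
    (fun r => (Above.half r, Above.half r)) (fun r => tensComul hc r.1)
    fun w =>
      ⟨(homOfLE (X := Above.{u} 0) (Radius.half_mono (leOfHom (X := Above.{u} 0) w)),
        homOfLE (X := Above.{u} 0) (Radius.half_mono (leOfHom (X := Above.{u} 0) w))),
      tensComul_res V hc (leOfHom (X := Above.{u} 0) w)⟩

/-- The pre-braiding of `T_0(V)†`. -/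
def daggerTensBraid : tensDagger V ⊗ tensDagger V ⟶ tensDagger V ⊗ tensDagger V :=
  IndObj.ofLevel (X := (tensDagger V).tensor (tensDagger V))
    (Y := (tensDagger V).tensor (tensDagger V))
    (fun p => (p.2, p.1)) (fun p => tensBraid hc p.1.1 p.2.1)
    fun w => ⟨(w.2, w.1), tensBraid_res V hc (leOfHom (X := Above.{u} 0) w.1)
      (leOfHom (X := Above.{u} 0) w.2)⟩

/-- The radius `2`. -/
def two : Above.{u} 1 := ⟨⟨2, two_pos⟩, one_lt_two⟩

/-- The coaction `x ↦ t ^ n ⊗ x`, for `x ∈ V ^ ⊗ n`, of `k{t}†` on `T_0(V)†`, which is induced by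
the maps `T_r(V) ⟶ k{t/2} ⊗ T_{r/2}(V)`. -/
def daggerTensCoact : tensDagger V ⟶ diskAlg k 1 ⊗ tensDagger V :=
  IndObj.ofLevel (X := tensDagger V) (Y := (diskAlg k 1).tensor (tensDagger V))
    (fun r => (two, Above.half r))
    (fun r => tensCoact V r.1 two.1 r.1.half (mul_div_cancel₀ r.1.val two_ne_zero).le)
    fun w => ⟨(homOfLE (X := Above.{u} 1) le_rfl,
      homOfLE (X := Above.{u} 0) (Radius.half_mono (leOfHom (X := Above.{u} 0) w))),
      tensCoact_res V (leOfHom (X := Above.{u} 0) w) le_rfl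
        (Radius.half_mono (leOfHom (X := Above.{u} 0) w)) _ _⟩

end structure_maps

/-! ### Quotients -/

section quot

variable {U V W : Ban k}

/-- The quotient of `V` by the closure of a subspace. -/
def quot (V : Ban k) (S : Submodule k V) : Ban k :=
  haveI : IsClosed (S.topologicalClosure : Set V) := S.isClosed_topologicalClosure
  ⟨V ⧸ S.topologicalClosure⟩

/-- The projection to the quotient. -/
def quotπ (V : Ban k) (S : Submodule k V) : V ⟶ quot V S :=
  ofLin (W := quot V S) S.topologicalClosure.mkQ
    ⟨1, fun x => by rw [one_mul]; exact Submodule.Quotient.norm_mk_le _ x⟩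

lemma quot_exists (S : Submodule k V) (x : quot V S) {ε : ℝ} (hε : 0 < ε) :
    ∃ y, quotπ V S y = x ∧ ‖y‖ < ‖x‖ + ε :=
  Submodule.Quotient.norm_mk_lt (S := S.topologicalClosure) x hε

lemma normLE_quotπ (S : Submodule k V) : NormLE (quotπ V S) 1 := fun x => by
  rw [one_mul]; exact Submodule.Quotient.norm_mk_le (S := S.topologicalClosure) x

lemma quot_ext {S : Submodule k V} {f g : quot V S ⟶ W} (h : quotπ V S ≫ f = quotπ V S ≫ g) :
    f = g := hom_ext fun x => by
  obtain ⟨y, rfl, -⟩ := quot_exists S x one_pos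
  exact congrArg (fun φ : V ⟶ W => φ y) h

lemma closure_le (f : V ⟶ W) {S : Submodule k V} {T : Submodule k W} (h : ∀ x ∈ S, f x ∈ T) :
    S.topologicalClosure ≤ T.topologicalClosure.comap f.lin := fun _ hx =>
  map_mem_closure (hom_continuous f) hx h

/-- The map of quotients induced by a morphism. -/
def quotMap (f : V ⟶ W) {S : Submodule k V} {T : Submodule k W} (h : ∀ x ∈ S, f x ∈ T) :
    quot V S ⟶ quot W T :=
  ofLin (V := quot V S) (W := quot W T)
    (S.topologicalClosure.mapQ T.topologicalClosure f.lin (closure_le f h)) (by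
      obtain ⟨C, hC, hf⟩ := exists_normLE f
      refine ⟨C, fun x => le_of_forall_pos_le_add fun ε hε => ?_⟩
      obtain ⟨y, rfl, hy⟩ := quot_exists S x (show 0 < ε / (C + 1) by positivity)
      have h₁ : ‖quotπ W T (f y)‖ ≤ C * ‖y‖ := by
        simpa using ((normLE_quotπ T) (f y)).trans (by rw [one_mul]; exact hf y)
      refine h₁.trans ((mul_le_mul_of_nonneg_left hy.le hC).trans ?_)
      rw [mul_add]
      have h₂ : C * (ε / (C + 1)) ≤ ε := by
        rw [mul_div_assoc', div_le_iff₀ (by positivity)]; nlinarith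
      linarith)

lemma quotπ_map (f : V ⟶ W) {S : Submodule k V} {T : Submodule k W} (h : ∀ x ∈ S, f x ∈ T) :
    quotπ V S ≫ quotMap f h = f ≫ quotπ W T := rfl

end quot

/-! ### The Nichols algebra of a finite-dimensional Banach space -/

section nichols

variable {V : Ban k} {c : V ⊗ V ⟶ V ⊗ V} (hc : NormLE c 1)

/-- The families `(I_r)` of homogeneous two-sided ideals `I_r` of `T_r(V)` concentrated in degrees
at least `2`, compatible with the maps `T_r(V) ⟶ T_s(V)` for `s ≤ r` and such that `Δ` maps `I_r`
to the closure of `I_{r/2} ⊗ T_{r/2}(V) + T_{r/2}(V) ⊗ I_{r/2}`. -/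
structure IsCoidealFamily (I : ∀ r : Radius.{u}, Submodule k (tens V r)) : Prop where
  mul_left : ∀ r (x y : tens V r), y ∈ I r → tensMul V r (otm x y) ∈ I r
  mul_right : ∀ r (x y : tens V r), x ∈ I r → tensMul V r (otm x y) ∈ I r
  homogeneous : ∀ r, ∀ x ∈ I r, ∀ n, incl r (tpow V) n (coeff n x) ∈ I r
  coeff_zero : ∀ r, ∀ x ∈ I r, coeff 0 x = 0
  coeff_one : ∀ r, ∀ x ∈ I r, coeff 1 x = 0
  res_mem : ∀ {r s : Radius.{u}} (h : r ≤ s), ∀ x ∈ I r, res (tpow V) h x ∈ I s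
  comul_mem : ∀ r, ∀ x ∈ I r, tensComul hc r x ∈ (Submodule.span k
    {z | ∃ a b : tens V r.half, (a ∈ I r.half ∨ b ∈ I r.half) ∧ z = otm a b}).topologicalClosure

/-- The sum `I_r(V)` of the ideals `I_r` over all families as above. -/
def maxIdeal (r : Radius.{u}) : Submodule k (tens V r) :=
  sSup {W | ∃ I : ∀ r, Submodule k (tens V r), IsCoidealFamily hc I ∧ I r = W}

lemma maxIdeal_res {r s : Radius.{u}} (h : r ≤ s) (x : tens V r) (hx : x ∈ maxIdeal hc r) :
    res (tpow V) h x ∈ maxIdeal hc s := by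
  have : maxIdeal hc r ≤ (maxIdeal hc s).comap (res (tpow V) h).lin := sSup_le (by
    rintro _ ⟨I, hI, rfl⟩ y hy
    have hm : I s ≤ maxIdeal hc s := le_sSup ⟨I, hI, rfl⟩
    exact hm (hI.res_mem h y hy))
  exact this hx

/-- The system of the quotients `T_r(V) / I_r(V)`. -/
def nicholsFunctor : Radius.{u} ⥤ Ban k where
  obj r := quot (tens V r) (maxIdeal hc r)
  map w := quotMap (res (tpow V) (leOfHom w)) (maxIdeal_res hc (leOfHom w))
  map_id r := quot_ext ((quotπ_map _ _).trans
    ((congrArg (· ≫ _) ((geomFunctor (tpow V)).map_id r)).trans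
      ((Category.id_comp _).trans (Category.comp_id _).symm)))
  map_comp {_ _ q} v w := quot_ext ((quotπ_map _ _).trans
    (congrArg (· ≫ quotπ _ (maxIdeal hc q)) ((geomFunctor (tpow V)).map_comp v w)))

/-- `T_0(V)† / I(V) = colim_{r > 0} T_r(V) / I_r(V)`. -/
def nicholsDagger : IndObj (Ban k) := dagger 0 (nicholsFunctor hc)

/-- The projection `T_0(V)† ⟶ T_0(V)† / I(V)`. -/
def nicholsπ : tensDagger V ⟶ nicholsDagger hc :=
  IndObj.ofLevel (X := tensDagger V) (Y := nicholsDagger hc) id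
    (fun r => quotπ (tens V r.1) (maxIdeal hc r.1)) fun w => ⟨w, rfl⟩

/-- The morphism induced by `c` on the constant ind-object. -/
def constBraid (c : V ⊗ V ⟶ V ⊗ V) :
    IndObj.const V ⊗ IndObj.const V ⟶ IndObj.const V ⊗ IndObj.const V :=
  (IndObj.constTensor V V).hom ≫ IndObj.constMap c ≫ (IndObj.constTensor V V).inv

/-- An ind-object whose transition maps are monomorphisms. -/
def IsMonomorphic (Z : IndObj (Ban k)) : Prop := ∀ {i j : Z.I} (w : i ⟶ j), Mono (Z.F.map w)

end nichols

end Ban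

end

noncomputable section

/-! ### Shuffles, symmetrizers and half twists in a ring with braid relations -/

namespace BraidWord

section defs

variable {A : Type*} [Ring A] (s : ℕ → A)

/-- The braid relations. -/
structure Rels : Prop where
  comm : ∀ i j, i + 2 ≤ j → s i * s j = s j * s i
  braid : ∀ i, s i * s (i + 1) * s i = s (i + 1) * s i * s (i + 1)

/-- The block of the `p` letters from position `a` on moves past one letter. -/
def mv (a : ℕ) : ℕ → A
  | 0 => 1
  | p + 1 => mv a p * s (a + p)

/-- The block of the `p` letters from position `a` on moves past the next `q` letters. -/
def br (a p : ℕ) : ℕ → A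
  | 0 => 1
  | q + 1 => mv s (a + q) p * br a p q

/-- The component of bidegree `(p, q)` of the comultiplication of the tensor algebra. -/
def sh (a : ℕ) : ℕ → ℕ → A
  | 0, _ => 1
  | _ + 1, 0 => 1
  | p + 1, q + 1 => sh a (p + 1) q + mv s (a + p) (q + 1) * sh a p (q + 1)

/-- The braided symmetrizer. -/
def sym : ℕ → ℕ → A
  | _, 0 => 1
  | a, n + 1 => sym (a + 1) n * sh s a 1 n

/-- The half twist. -/
def tw (a : ℕ) : ℕ → A
  | 0 => 1
  | p + 1 => mv s a p * tw a p

lemma mv_succ (a p : ℕ) : mv s a (p + 1) = mv s a p * s (a + p) := rfl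
lemma sh_succ (a p q : ℕ) : sh s a (p + 1) (q + 1) =
    sh s a (p + 1) q + mv s (a + p) (q + 1) * sh s a p (q + 1) := by rw [sh]
@[simp] lemma mv_zero (a : ℕ) : mv s a 0 = 1 := rfl
@[simp] lemma br_zero (a p : ℕ) : br s a p 0 = 1 := rfl
@[simp] lemma sh_zero_left (a q : ℕ) : sh s a 0 q = 1 := by simp [sh]
@[simp] lemma sh_zero_right (a p : ℕ) : sh s a p 0 = 1 := by cases p <;> simp [sh]
@[simp] lemma sym_zero (a : ℕ) : sym s a 0 = 1 := by simp [sym]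
@[simp] lemma sym_one (a : ℕ) : sym s a 1 = 1 := by simp [sym]
@[simp] lemma tw_zero (a : ℕ) : tw s a 0 = 1 := rfl
@[simp] lemma br_zero_left (a q : ℕ) : br s a 0 q = 1 := by
  induction q with
  | zero => rfl
  | succ q ih => simp [br, ih]
@[simp] lemma br_one_right (a p : ℕ) : br s a p 1 = mv s a p := by simp [br]

end defs

section parametric

variable {A A' : Type*} [Ring A] [Ring A'] {s : ℕ → A} {s' : ℕ → A'} {Q : A → A' → Prop}
  {a a' : ℕ}

lemma mv_rel (h1 : Q 1 1) (hm : ∀ {x x' y y'}, Q x x' → Q y y' → Q (x * y) (x' * y')) :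
    ∀ {p : ℕ}, (∀ i < p, Q (s (a + i)) (s' (a' + i))) → Q (mv s a p) (mv s' a' p)
  | 0, _ => h1
  | p + 1, h => hm (mv_rel h1 hm fun i hi => h i (by lia)) (h p (by lia))

lemma br_rel (h1 : Q 1 1) (hm : ∀ {x x' y y'}, Q x x' → Q y y' → Q (x * y) (x' * y')) {p : ℕ} :
    ∀ {q : ℕ}, (∀ i, i + 1 < p + q → Q (s (a + i)) (s' (a' + i))) → Q (br s a p q) (br s' a' p q)
  | 0, _ => h1
  | q + 1, h => hm (mv_rel h1 hm fun i hi => by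
      simpa only [add_assoc] using h (q + i) (by lia)) (br_rel h1 hm fun i hi => h i (by lia))

lemma tw_rel (h1 : Q 1 1) (hm : ∀ {x x' y y'}, Q x x' → Q y y' → Q (x * y) (x' * y')) :
    ∀ {p : ℕ}, (∀ i, i + 1 < p → Q (s (a + i)) (s' (a' + i))) → Q (tw s a p) (tw s' a' p)
  | 0, _ => h1
  | p + 1, h => hm (mv_rel h1 hm fun i hi => h i (by lia)) (tw_rel h1 hm fun i hi => h i (by lia))

lemma sh_rel (h1 : Q 1 1) (hm : ∀ {x x' y y'}, Q x x' → Q y y' → Q (x * y) (x' * y'))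
    (ha : ∀ {x x' y y'}, Q x x' → Q y y' → Q (x + y) (x' + y')) :
    ∀ {p q : ℕ}, (∀ i, i + 1 < p + q → Q (s (a + i)) (s' (a' + i))) → Q (sh s a p q) (sh s' a' p q)
  | 0, q, _ => by simpa using h1
  | p + 1, 0, _ => by simpa using h1
  | p + 1, q + 1, h => by
      rw [sh, sh]
      exact ha (sh_rel h1 hm ha fun i hi => h i (by lia))
        (hm (mv_rel h1 hm fun i hi => by simpa only [add_assoc] using h (p + i) (by lia))
          (sh_rel h1 hm ha fun i hi => h i (by lia)))

lemma sym_rel (h1 : Q 1 1) (hm : ∀ {x x' y y'}, Q x x' → Q y y' → Q (x * y) (x' * y'))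
    (ha : ∀ {x x' y y'}, Q x x' → Q y y' → Q (x + y) (x' + y')) :
    ∀ {n a a' : ℕ}, (∀ i, i + 1 < n → Q (s (a + i)) (s' (a' + i))) → Q (sym s a n) (sym s' a' n)
  | 0, _, _, _ => by simpa using h1
  | n + 1, a, a', h => by
      rw [sym, sym]
      refine hm (sym_rel h1 hm ha fun i hi => ?_) (sh_rel h1 hm ha fun i hi => h i (by lia))
      simpa only [add_assoc, add_comm 1] using h (i + 1) (by lia)

end parametric

section slides

variable {A : Type*} [Ring A] {s : ℕ → A} (hs : Rels s)

/-- The relation `z x = x' z` between `x` and `x'`. -/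
def Slide (z x x' : A) : Prop := z * x = x' * z

lemma Slide.one {z : A} : Slide z 1 1 := by simp [Slide]
lemma Slide.mul {z x x' y y' : A} (h : Slide z x x') (h' : Slide z y y') :
    Slide z (x * y) (x' * y') := by
  simp only [Slide] at *; rw [← mul_assoc, h, mul_assoc, h', mul_assoc]
lemma Slide.add {z x x' y y' : A} (h : Slide z x x') (h' : Slide z y y') :
    Slide z (x + y) (x' + y') := by
  simp only [Slide] at *; rw [mul_add, add_mul, h', h]

/-- `x` commutes with `mv s a p` if it commutes with the generators involved. -/
lemma comm_mv {x : A} {a p : ℕ} (h : ∀ i < p, x * s (a + i) = s (a + i) * x) :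
    x * mv s a p = mv s a p * x :=
  mv_rel (Q := Slide x) Slide.one Slide.mul h

lemma comm_br {x : A} {a p q : ℕ} (h : ∀ i, i + 1 < p + q → x * s (a + i) = s (a + i) * x) :
    x * br s a p q = br s a p q * x :=
  br_rel (Q := Slide x) Slide.one Slide.mul h

lemma comm_sh {x : A} {a p q : ℕ} (h : ∀ i, i + 1 < p + q → x * s (a + i) = s (a + i) * x) :
    x * sh s a p q = sh s a p q * x :=
  sh_rel (Q := Slide x) Slide.one Slide.mul Slide.add h

lemma comm_sym {x : A} {a n : ℕ} (h : ∀ i, i + 1 < n → x * s (a + i) = s (a + i) * x) :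
    x * sym s a n = sym s a n * x :=
  sym_rel (Q := Slide x) Slide.one Slide.mul Slide.add h

lemma comm_tw {x : A} {a n : ℕ} (h : ∀ i, i + 1 < n → x * s (a + i) = s (a + i) * x) :
    x * tw s a n = tw s a n * x :=
  tw_rel (Q := Slide x) Slide.one Slide.mul h

lemma mv_add (a p q : ℕ) : mv s a (p + q) = mv s a p * mv s (a + p) q := by
  induction q with
  | zero => simp
  | succ q ih => rw [← add_assoc, mv, ih, mv, mul_assoc, add_assoc]

lemma br_add_right (a p q r : ℕ) : br s a p (q + r) = br s (a + q) p r * br s a p q := by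
  induction r with
  | zero => simp
  | succ r ih => rw [← add_assoc, br, ih, br, mul_assoc, add_assoc]

include hs

lemma comm_of {i j : ℕ} (h : i + 2 ≤ j ∨ j + 2 ≤ i) : s i * s j = s j * s i :=
  h.elim (hs.comm i j) fun h => (hs.comm j i h).symm

lemma gen_comm_mv {i a p : ℕ} (h : i + 2 ≤ a ∨ a + p + 1 ≤ i) :
    s i * mv s a p = mv s a p * s i :=
  comm_mv fun j hj => comm_of hs (by lia)

lemma mv_slide {a p i : ℕ} (h : a ≤ i) (h' : i + 1 < a + p) :
    mv s a p * s i = s (i + 1) * mv s a p := by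
  induction p with
  | zero => lia
  | succ p ih =>
    rcases Nat.lt_or_ge (i + 1) (a + p) with h1 | h1
    · rw [mv, mul_assoc, ← hs.comm i (a + p) (by lia), ← mul_assoc, ih h1, mul_assoc]
    · obtain ⟨p, rfl⟩ : ∃ p', p = p' + 1 := ⟨p - 1, by lia⟩
      obtain rfl : i = a + p := by lia
      rw [mv, mv, ← add_assoc, mul_assoc, mul_assoc, ← mul_assoc (s (a + p)), hs.braid, ← mul_assoc,
        ← mul_assoc, ← gen_comm_mv hs (by lia)]
      simp only [mul_assoc]

lemma br_slide_left {a p q i : ℕ} (h : a ≤ i) (h' : i + 1 < a + p) :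
    br s a p q * s i = s (i + q) * br s a p q := by
  induction q with
  | zero => simp
  | succ q ih =>
    rw [br, mul_assoc, ih, ← mul_assoc, mv_slide hs (by lia) (by lia), mul_assoc, add_assoc]

lemma mv_mv_slide (b p : ℕ) : mv s (b + 1) p * mv s b p * s (b + p) =
    s b * (mv s (b + 1) p * mv s b p) := by
  induction p with
  | zero => simp
  | succ p ih =>
    have e : b + 1 + p = b + p + 1 := by lia
    have h : mv s (b + 1) (p + 1) * mv s b (p + 1) =
        mv s (b + 1) p * mv s b p * (s (b + p + 1) * s (b + p)) := by
      rw [mv, mv, mul_assoc, ← mul_assoc _ (mv s b p), gen_comm_mv hs (by lia), e]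
      simp only [mul_assoc]
    rw [h, ← mul_assoc (s b), ← ih, ← add_assoc, mul_assoc, ← hs.braid]
    simp only [mul_assoc]

lemma br_slide_right {a p q i : ℕ} (h : a ≤ i) (h' : i + 1 < a + q) :
    br s a p q * s (i + p) = s i * br s a p q := by
  induction q with
  | zero => lia
  | succ q ih =>
    rcases Nat.lt_or_ge (i + 1) (a + q) with h1 | h1
    · rw [br, mul_assoc, ih h1, ← mul_assoc, ← gen_comm_mv hs (by lia), mul_assoc]
    · obtain ⟨q, rfl⟩ : ∃ q', q = q' + 1 := ⟨q - 1, by lia⟩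
      obtain rfl : i = a + q := by lia
      have hc := comm_br (x := s (a + q + p)) (a := a) (p := p) (q := q)
        fun j hj => comm_of hs (by lia)
      rw [br, br, ← mul_assoc, mul_assoc, ← hc, ← mul_assoc, ← add_assoc, mv_mv_slide hs, mul_assoc]

lemma br_add_left (a p q r : ℕ) : br s a (p + q) r = br s a p r * br s (a + p) q r := by
  induction r with
  | zero => simp
  | succ r ih =>
    rw [br, br, br, ih, mv_add]
    have := comm_mv (x := br s a p r) (a := a + r + p) (p := q) fun j hj => by
      exact (comm_br fun i hi => comm_of hs (by lia)).symm
    rw [show a + p + r = a + r + p by lia, mul_assoc, ← mul_assoc (mv s (a + r + p) q), ← this]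
    simp only [mul_assoc]

lemma br_sh_left (a p q r : ℕ) :
    br s a (p + q) r * sh s a p q = sh s (a + r) p q * br s a (p + q) r :=
  sh_rel (Q := Slide _) Slide.one Slide.mul Slide.add fun i hi => by
    have := br_slide_left hs (a := a) (p := p + q) (q := r) (i := a + i) (by lia) (by lia)
    rwa [show a + i + r = a + r + i by lia] at this

lemma br_sh_right (a p q r : ℕ) :
    br s a p (q + r) * sh s (a + p) q r = sh s a q r * br s a p (q + r) :=
  sh_rel (Q := Slide _) Slide.one Slide.mul Slide.add fun i hi => by
    have := br_slide_right hs (a := a) (p := p) (q := q + r) (i := a + i) (by lia) (by lia)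
    rwa [show a + i + p = a + p + i by lia] at this

lemma br_br_right (a p q r : ℕ) :
    br s a p (q + r) * br s (a + p) q r = br s a q r * br s a p (q + r) :=
  br_rel (Q := Slide _) Slide.one Slide.mul fun i hi => by
    have := br_slide_right hs (a := a) (p := p) (q := q + r) (i := a + i) (by lia) (by lia)
    rwa [show a + i + p = a + p + i by lia] at this

lemma yangBaxter (p q r : ℕ) :
    br s 0 q r * br s q p r * br s 0 p q = br s r p q * br s 0 p r * br s p q r := by
  have h : br s 0 p (q + r) * br s p q r = br s 0 q r * br s 0 p (q + r) := by
    simpa using br_br_right hs 0 p q r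
  have e₁ : br s 0 p (q + r) = br s q p r * br s 0 p q := by simpa using br_add_right 0 p q r
  have e₂ : br s 0 p (q + r) = br s r p q * br s 0 p r := by
    simpa [add_comm] using br_add_right (s := s) 0 p r q
  rw [← e₂, h, e₁, mul_assoc]

lemma br_sym_left (a p q : ℕ) :
    br s a p q * sym s a p = sym s (a + q) p * br s a p q :=
  sym_rel (Q := Slide _) Slide.one Slide.mul Slide.add fun i hi => by
    have := br_slide_left hs (a := a) (p := p) (q := q) (i := a + i) (by lia) (by lia)
    rwa [show a + i + q = a + q + i by lia] at this

lemma br_sym_right (a p q : ℕ) :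
    br s a p q * sym s (a + p) q = sym s a q * br s a p q :=
  sym_rel (Q := Slide _) Slide.one Slide.mul Slide.add fun i hi => by
    have := br_slide_right hs (a := a) (p := p) (q := q) (i := a + i) (by lia) (by lia)
    rwa [show a + i + p = a + p + i by lia] at this

lemma br_tw_left (a p q : ℕ) :
    br s a p q * tw s a p = tw s (a + q) p * br s a p q :=
  tw_rel (Q := Slide _) Slide.one Slide.mul fun i hi => by
    have := br_slide_left hs (a := a) (p := p) (q := q) (i := a + i) (by lia) (by lia)
    rwa [show a + i + q = a + q + i by lia] at this

lemma sh_coassoc (a : ℕ) : ∀ N p q r : ℕ, p + q + r = N →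
    sh s a p q * sh s a (p + q) r = sh s (a + p) q r * sh s a p (q + r)
  | _, 0, q, r, _ => by simp
  | _, p + 1, 0, r, _ => by simp
  | _, p + 1, q + 1, 0, _ => by simp
  | 0, p + 1, q + 1, r + 1, h => by lia
  | N + 1, p + 1, q + 1, r + 1, h => by
    have h1 := sh_coassoc a N (p + 1) (q + 1) r (by lia)
    have h2 := sh_coassoc a N (p + 1) q (r + 1) (by lia)
    have h3 := sh_coassoc a N p (q + 1) (r + 1) (by lia)
    have e1 : p + 1 + q = p + (q + 1) := by lia
    have e2 : p + 1 + (q + 1) = p + (q + 1) + 1 := by lia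
    have e3 : q + 1 + (r + 1) = q + 1 + r + 1 := by lia
    have c1 : sh s a (p + 1) q * mv s (a + (p + (q + 1))) (r + 1) =
        mv s (a + (p + (q + 1))) (r + 1) * sh s a (p + 1) q :=
      (comm_sh fun i hi => (gen_comm_mv hs (by lia)).symm).symm
    have c2 : mv s (a + p) (q + 1) * mv s (a + (p + (q + 1))) (r + 1) =
        mv s (a + p) (q + 1 + r + 1) := by
      rw [← add_assoc a, ← mv_add, ← add_assoc]
    have c3 : sh s (a + p + 1) (q + 1) (r + 1) * mv s (a + p) (q + 1 + r + 1) =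
        mv s (a + p) (q + 1 + r + 1) * sh s (a + p) (q + 1) (r + 1) := by
      refine (sh_rel (Q := Slide (mv s (a + p) (q + 1 + r + 1))) Slide.one Slide.mul Slide.add
        fun i hi => ?_).symm
      have := mv_slide hs (a := a + p) (p := q + 1 + r + 1) (i := a + p + i) (by lia) (by lia)
      rwa [show a + p + i + 1 = a + p + 1 + i by lia] at this
    have c4 : sh s a p (q + 1) * mv s (a + (p + (q + 1))) (r + 1) =
        mv s (a + (p + (q + 1))) (r + 1) * sh s a p (q + 1) :=
      (comm_sh fun i hi => (gen_comm_mv hs (by lia)).symm).symm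
    have hL : sh s a (p + 1) (q + 1) * mv s (a + (p + (q + 1))) (r + 1) =
        mv s (a + (p + (q + 1))) (r + 1) * sh s a (p + 1) q +
          mv s (a + p) (q + 1 + r + 1) * sh s a p (q + 1) := by
      rw [sh_succ, add_mul, c1, mul_assoc, c4, ← mul_assoc, c2]
    have hR : sh s (a + p + 1) (q + 1) (r + 1) = sh s (a + p + 1) (q + 1) r +
        mv s (a + (p + (q + 1))) (r + 1) * sh s (a + p + 1) q (r + 1) := by
      rw [sh_succ, show a + (p + (q + 1)) = a + p + 1 + q by lia]
    calc sh s a (p + 1) (q + 1) * sh s a (p + 1 + (q + 1)) (r + 1)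
        = sh s a (p + 1) (q + 1) * sh s a (p + 1 + (q + 1)) r +
          (mv s (a + (p + (q + 1))) (r + 1) * (sh s a (p + 1) q * sh s a (p + 1 + q) (r + 1)) +
          mv s (a + p) (q + 1 + r + 1) * (sh s a p (q + 1) * sh s a (p + (q + 1)) (r + 1))) := by
          rw [e2, sh_succ s a (p + (q + 1)), mul_add, ← mul_assoc _ (mv s _ _), hL, add_mul,
            mul_assoc, mul_assoc, e1]
      _ = sh s (a + (p + 1)) (q + 1) (r + 1) * sh s a (p + 1) (q + 1 + (r + 1)) := by
          rw [h1, h2, h3, e3, sh_succ s a p (q + 1 + r), mul_add, ← add_assoc a,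
            ← mul_assoc (mv s (a + p) (q + 1 + r + 1)), ← c3, mul_assoc, hR, add_mul,
            show q + (r + 1) = q + 1 + r by lia]
          simp only [add_mul, mul_assoc]; abel

lemma sym_add : ∀ (a p q : ℕ), sym s a (p + q) = sym s (a + p) q * sym s a p * sh s a p q
  | a, 0, q => by simp
  | a, p + 1, q => by
    have h := sh_coassoc hs a _ 1 p q rfl
    rw [show p + 1 + q = p + q + 1 by lia, sym, sym_add (a + 1) p q, mul_assoc, ← h, sym,
      add_comm 1 p, show a + 1 + p = a + (p + 1) by lia]
    simp only [mul_assoc]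

omit hs in
lemma sh_one_left (a m : ℕ) : sh s a 1 (m + 1) = sh s a 1 m + mv s a (m + 1) := by
  rw [sh]; simp

/-- Multiplying a word by a letter on the right, in terms of symmetrizers. -/
def symR (s : ℕ → A) : ℕ → ℕ → A
  | _, 0 => 1
  | a, m + 1 => symR s (a + 1) m + mv s a (m + 1)

lemma sym_succ_right : ∀ a m : ℕ, sym s a (m + 1) = symR s a m * sym s a m
  | a, 0 => by simp [symR]
  | a, m + 1 => by
    have h : mv s a (m + 1) * sym s a (m + 1) = sym s (a + 1) (m + 1) * mv s a (m + 1) :=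
      sym_rel (Q := Slide (mv s a (m + 1))) Slide.one Slide.mul Slide.add fun i hi => by
        have := mv_slide hs (a := a) (p := m + 1) (i := a + i) (by lia) (by lia)
        rwa [show a + i + 1 = a + 1 + i by lia] at this
    rw [sym, sh_one_left, mul_add, ← h, sym_succ_right (a + 1) m, mul_assoc, ← sym, symR, add_mul]

end slides

section opposite

open MulOpposite

variable {A : Type*} [Ring A] {s : ℕ → A}

lemma Rels.op (hs : Rels s) : Rels fun i => op (s i) where
  comm i j h := by rw [← op_mul, ← op_mul, hs.comm i j h]
  braid i := by simp only [← op_mul, ← mul_assoc, hs.braid]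

lemma symR_eq (a m : ℕ) : symR s a m = unop (sh (fun i => op (s i)) a m 1) := by
  have key : ∀ m a, sh (fun i => op (s i)) a (m + 1) 1 =
      sh (fun i => op (s i)) (a + 1) m 1 + op (mv s a (m + 1)) := by
    intro m
    induction m with
    | zero => intro a; simp [sh, mv, add_comm]
    | succ m ih =>
      intro a
      have e : a + 1 + m = a + (m + 1) := by lia
      have e' (i : ℕ) : mv (fun i => op (s i)) i (0 + 1) = op (s i) := by simp [mv]
      rw [sh, ih, sh_zero_right, mul_add, e', sh, sh_zero_right, e', e, mv_succ s a (m + 1), op_mul,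
        ← add_assoc, zero_add]
  induction m generalizing a with
  | zero => simp [symR]
  | succ m ih => rw [key, symR, ih]; simp

/-- The symmetrizer is invariant under the reversal of words in the generators. -/
lemma sym_op (hs : Rels s) (a n : ℕ) : unop (sym (fun i => op (s i)) a n) = sym s a n := by
  induction n with
  | zero => simp
  | succ n ih =>
    have h := sym_add hs.op a n 1
    rw [sym_one, one_mul] at h
    rw [sym_succ_right hs, symR_eq, h, unop_mul, ih]

/-- The component of bidegree `(p, q)` of the multiplication of the shuffle algebra. -/
def unsh (s : ℕ → A) (a p q : ℕ) : A := unop (sh (fun i => op (s i)) a p q)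

lemma sym_add' (hs : Rels s) (a p q : ℕ) :
    sym s a (p + q) = unsh s a p q * (sym s a p * sym s (a + p) q) := by
  rw [← sym_op hs, sym_add hs.op, unop_mul, unop_mul, sym_op hs, sym_op hs]; rfl

end opposite

section pascal

variable {A M : Type*} [Ring A] [AddCommGroup M] {s : ℕ → A}

open Finset

/-- The recursion for sums of shuffles. -/
lemma sum_sh_succ (F : A → ℕ → ℕ → M) (hF : ∀ x y p q, F (x + y) p q = F x p q + F y p q)
    (a n : ℕ) :
    ∑ x ∈ antidiagonal (n + 1), F (sh s a x.1 x.2) x.1 x.2 =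
      ∑ x ∈ antidiagonal n, (F (sh s a x.1 x.2) x.1 (x.2 + 1) +
        F (mv s (a + x.1) x.2 * sh s a x.1 x.2) (x.1 + 1) x.2) := by
  rw [sum_add_distrib]
  have e1 := Nat.sum_antidiagonal_succ (n := n) (f := fun x => F (sh s a x.1 x.2) x.1 x.2)
  cases n with
  | zero => simp [Nat.sum_antidiagonal_succ]
  | succ n =>
    rw [e1, Nat.sum_antidiagonal_succ' (n := n), Nat.sum_antidiagonal_succ (n := n),
      Nat.sum_antidiagonal_succ' (n := n)]
    simp only [sh, hF, sum_add_distrib, sh_zero_left, sh_zero_right, mv_zero, mul_one]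
    abel

end pascal

section hopf

variable {A : Type*} [Ring A] {s : ℕ → A} (hs : Rels s)

open Finset

include hs

/-- Shuffles of a concatenation. -/
lemma sum_sh_add {M : Type*} [AddCommGroup M] (g : ℕ → ℕ → A →+ M) (m n : ℕ) :
    ∑ x ∈ antidiagonal (m + n), g x.1 x.2 (sh s 0 x.1 x.2) =
      ∑ x ∈ antidiagonal m, ∑ y ∈ antidiagonal n,
        g (x.1 + y.1) (x.2 + y.2)
          (br s x.1 x.2 y.1 * (sh s m y.1 y.2 * sh s 0 x.1 x.2)) := by
  induction n generalizing g with
  | zero => simp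
  | succ n ih =>
    rw [← add_assoc, sum_sh_succ (fun x p q => g p q x) (fun x y p q => map_add _ _ _)]
    have := ih fun p q => g p (q + 1) + (g (p + 1) q).comp (AddMonoidHom.mulLeft (mv s p q))
    simp only [AddMonoidHom.add_apply, AddMonoidHom.comp_apply, AddMonoidHom.coe_mulLeft] at this
    simp only [zero_add]
    rw [this]
    refine sum_congr rfl fun x hx => ?_
    rw [HasAntidiagonal.mem_antidiagonal] at hx
    rw [sum_sh_succ (fun z p q => g (x.1 + p) (x.2 + q) (br s x.1 x.2 p * (z * sh s 0 x.1 x.2)))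
      (fun z y p q => by rw [add_mul, mul_add, map_add])]
    refine sum_congr rfl fun y hy => ?_
    rw [← add_assoc, ← add_assoc]
    congr 2
    rw [br, mul_assoc (mv s _ _), mul_assoc (mv s _ _), ← mul_assoc (br s x.1 x.2 y.1) (mv s _ _)]
    have hc : br s x.1 x.2 y.1 * mv s (m + y.1) y.2 = mv s (m + y.1) y.2 * br s x.1 x.2 y.1 :=
      (comm_br fun i hi => (gen_comm_mv hs (by lia)).symm).symm
    rw [hc, mv_add, show m + y.1 = x.1 + y.1 + x.2 by lia]
    simp only [mul_assoc]

lemma sum_tw_left (n : ℕ) : ∑ x ∈ antidiagonal (n + 1),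
    (-1) ^ x.1 * (tw s 0 x.1 * sh s 0 x.1 x.2) = 0 := by
  have key : ∀ n, ∑ x ∈ antidiagonal (n + 1), (-1) ^ x.1 * (tw s 0 x.1 * sh s 0 x.1 x.2) =
      (1 - mv s 0 n) * ∑ x ∈ antidiagonal n, (-1) ^ x.1 * (tw s 0 x.1 * sh s 0 x.1 x.2) := by
    intro n
    rw [sum_sh_succ (fun z p q => (-1) ^ p * (tw s 0 p * z)) (fun x y p q => by
      rw [mul_add, mul_add]), sub_mul, one_mul, sum_add_distrib, sub_eq_add_neg]
    congr 1
    rw [← neg_mul, mul_sum]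
    refine sum_congr rfl fun x hx => ?_
    rw [HasAntidiagonal.mem_antidiagonal] at hx
    have hc : tw s 0 x.1 * mv s (0 + x.1) x.2 = mv s (0 + x.1) x.2 * tw s 0 x.1 :=
      (comm_tw fun i hi => (gen_comm_mv hs (by lia)).symm).symm
    have hcm : (-1 : A) ^ x.1 * mv s 0 n = mv s 0 n * (-1) ^ x.1 :=
      ((Commute.neg_one_left _).pow_left _).eq
    rw [tw, ← mul_assoc (mv s 0 x.1 * _), mul_assoc (mv s 0 x.1), hc, ← mul_assoc (mv s 0 x.1),
      ← mv_add, hx, pow_succ', mul_assoc, mul_assoc (mv s 0 n) (tw s 0 x.1), ← mul_assoc _ (mv s 0 n), hcm]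
    simp only [mul_assoc, neg_mul, one_mul]
  induction n with
  | zero => rw [key]; simp
  | succ n ih => rw [key, ih, mul_zero]

lemma sum_tw_right (n : ℕ) : ∑ x ∈ antidiagonal (n + 1),
    (-1) ^ x.2 * (tw s x.1 x.2 * sh s 0 x.1 x.2) = 0 := by
  rw [sum_sh_succ (fun z p q => (-1) ^ q * (tw s p q * z)) (fun x y p q => by
      rw [mul_add, mul_add])]
  refine sum_eq_zero fun x _ => ?_
  have h : mv s x.1 x.2 * tw s x.1 x.2 = tw s (x.1 + 1) x.2 * mv s x.1 x.2 := by
    simpa using br_tw_left hs x.1 x.2 1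
  rw [tw, h, zero_add, pow_succ', ← mul_assoc (tw s (x.1 + 1) x.2)]
  simp

/-- The half twist preserves the kernel of the symmetrizer. -/
lemma exists_sym_tw (n : ℕ) : ∃ K : A, sym s 0 n * tw s 0 n = K * sym s 0 n := by
  induction n using Nat.strong_induction_on with
  | _ n ih =>
  cases n with
  | zero => exact ⟨1, by simp⟩
  | succ n =>
    let H : AddSubgroup A :=
      { carrier := {x | ∃ K, sym s 0 (n + 1) * x = K * sym s 0 (n + 1)}
        zero_mem' := ⟨0, by simp⟩
        add_mem' := by
          rintro x y ⟨K, hK⟩ ⟨L, hL⟩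
          exact ⟨K + L, by rw [mul_add, add_mul, hK, hL]⟩
        neg_mem' := by
          rintro x ⟨K, hK⟩
          exact ⟨-K, by rw [mul_neg, neg_mul, hK]⟩ }
    have hsign : ∀ (m : ℕ) (x : A), x ∈ H → (-1) ^ m * x ∈ H := fun m x hx => by
      rcases neg_one_pow_eq_or A m with h | h
      · rwa [h, one_mul]
      · rw [h, neg_one_mul]; exact H.neg_mem hx
    have hz := sum_tw_left hs n
    rw [Nat.sum_antidiagonal_succ', sh_zero_right, mul_one] at hz
    have h2 : (-1) ^ (n + 1) * tw s 0 (n + 1) ∈ H := by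
      rw [eq_neg_of_add_eq_zero_left hz]
      refine H.neg_mem (H.sum_mem fun x hx => hsign _ _ ?_)
      rw [HasAntidiagonal.mem_antidiagonal] at hx
      obtain ⟨p, q⟩ := x
      obtain rfl : p + q = n := hx
      obtain ⟨K, hK⟩ := ih p (by lia)
      refine ⟨unsh s 0 p (q + 1) * K, ?_⟩
      have c1 : tw s 0 p * sym s p (q + 1) = sym s p (q + 1) * tw s 0 p :=
        comm_sym fun i hi => (comm_tw fun j hj => comm_of hs (by lia)).symm
      have c2 : sym s 0 p * sym s p (q + 1) = sym s p (q + 1) * sym s 0 p :=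
        comm_sym fun i hi => (comm_sym fun j hj => comm_of hs (by lia)).symm
      have e := sym_add hs 0 p (q + 1)
      have e' := sym_add' hs 0 p (q + 1)
      rw [zero_add] at e e'
      have h : sym s 0 p * sym s p (q + 1) * tw s 0 p = K * (sym s p (q + 1) * sym s 0 p) := by
        rw [mul_assoc, ← c1, ← mul_assoc, hK, mul_assoc, c2]
      calc sym s 0 (p + (q + 1)) * (tw s 0 p * sh s 0 p (q + 1))
          = unsh s 0 p (q + 1) * K * (sym s p (q + 1) * sym s 0 p * sh s 0 p (q + 1)) := by
            rw [e', ← mul_assoc _ (tw s 0 p), mul_assoc (unsh s 0 p (q + 1)), h]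
            simp only [mul_assoc]
        _ = _ := by rw [← e]; rfl
    have := hsign (n + 1) _ h2
    rwa [← mul_assoc, ← pow_add, Even.neg_one_pow ⟨n + 1, rfl⟩, one_mul] at this

end hopf

end BraidWord

/-! ### Words and their realizations in a monoidal category -/

section Formal

universe v w

variable {D : Type w} [Category.{v} D] [MonoidalCategory D] [Preadditive D]

/-- Tensor powers `W n` of an object, with the actions of the generators of the braid monoids. -/
structure Words (D : Type w) [Category.{v} D] [MonoidalCategory D] [Preadditive D] where
  W : ℕ → D
  u : 𝟙_ D ≅ W 0
  g : ∀ {p q n : ℕ}, p + q = n → (W p ⊗ W q ≅ W n)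
  s : ∀ n : ℕ, ℕ → (W n ⟶ W n)
  rels : ∀ n, BraidWord.Rels (A := End (W n)) (s n)
  assoc : ∀ {p q r m n N : ℕ} (h₁ : p + q = m) (h₂ : m + r = N) (h₃ : q + r = n) (h₄ : p + n = N),
    (g h₁).hom ▷ W r ≫ (g h₂).hom = (α_ _ _ _).hom ≫ W p ◁ (g h₃).hom ≫ (g h₄).hom
  unit_left : ∀ n, u.hom ▷ W n ≫ (g (zero_add n)).hom = (λ_ _).hom
  unit_right : ∀ n, W n ◁ u.hom ≫ (g (add_zero n)).hom = (ρ_ _).hom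
  s_left : ∀ {p q n i : ℕ} (h : p + q = n), i + 1 < p →
    s p i ▷ W q ≫ (g h).hom = (g h).hom ≫ s n i
  s_right : ∀ {p q n i : ℕ} (h : p + q = n), i + 1 < q →
    W p ◁ s q i ≫ (g h).hom = (g h).hom ≫ s n (p + i)

namespace Words

variable (K : Words D)

/-- The block of `p` letters from position `a` on moves past the next `q` letters. -/
def br (n a p q : ℕ) : K.W n ⟶ K.W n := BraidWord.br (A := End (K.W n)) (K.s n) a p q
/-- The `(p, q)`-component of the comultiplication of the subword from position `a` on. -/
def sh (n a p q : ℕ) : K.W n ⟶ K.W n := BraidWord.sh (A := End (K.W n)) (K.s n) a p q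
/-- The symmetrizer on the `m` letters from position `a` on. -/
def sym (n a m : ℕ) : K.W n ⟶ K.W n := BraidWord.sym (A := End (K.W n)) (K.s n) a m
/-- The half twist on the `m` letters from position `a` on. -/
def tw (n a m : ℕ) : K.W n ⟶ K.W n := BraidWord.tw (A := End (K.W n)) (K.s n) a m

section transport

variable {K} [MonoidalPreadditive D] {p q n : ℕ} (h : p + q = n)

/-- `y` is the action of `x` on the first factor. -/
def LRel (x : End (K.W p)) (y : End (K.W n)) : Prop :=
  End.asHom x ▷ K.W q ≫ (K.g h).hom = (K.g h).hom ≫ End.asHom y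
/-- `y` is the action of `x` on the second factor. -/
def RRel (x : End (K.W q)) (y : End (K.W n)) : Prop :=
  K.W p ◁ End.asHom x ≫ (K.g h).hom = (K.g h).hom ≫ End.asHom y

omit [MonoidalPreadditive D] in
lemma LRel.one : LRel (K := K) h 1 1 := by
  show 𝟙 _ ▷ _ ≫ _ = _ ≫ 𝟙 _
  simp
omit [MonoidalPreadditive D] in
lemma LRel.mul {x x' y y'} (hx : LRel (K := K) h x x') (hy : LRel h y y') :
    LRel h (x * y) (x' * y') := by
  show (End.asHom y ≫ End.asHom x) ▷ _ ≫ _ = _ ≫ End.asHom y' ≫ End.asHom x'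
  unfold LRel at hx hy
  rw [comp_whiskerRight, Category.assoc, hx, reassoc_of% hy]
lemma LRel.add {x x' y y'} (hx : LRel (K := K) h x x') (hy : LRel h y y') :
    LRel h (x + y) (x' + y') := by
  show (End.asHom x + End.asHom y) ▷ _ ≫ _ = _ ≫ (End.asHom x' + End.asHom y')
  unfold LRel at hx hy
  rw [MonoidalPreadditive.add_whiskerRight, Preadditive.add_comp, hx, hy, Preadditive.comp_add]
omit [MonoidalPreadditive D] in
lemma RRel.one : RRel (K := K) h 1 1 := by
  show _ ◁ 𝟙 _ ≫ _ = _ ≫ 𝟙 _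
  simp
omit [MonoidalPreadditive D] in
lemma RRel.mul {x x' y y'} (hx : RRel (K := K) h x x') (hy : RRel h y y') :
    RRel h (x * y) (x' * y') := by
  show _ ◁ (End.asHom y ≫ End.asHom x) ≫ _ = _ ≫ End.asHom y' ≫ End.asHom x'
  unfold RRel at hx hy
  rw [whiskerLeft_comp, Category.assoc, hx, reassoc_of% hy]
lemma RRel.add {x x' y y'} (hx : RRel (K := K) h x x') (hy : RRel h y y') :
    RRel h (x + y) (x' + y') := by
  show _ ◁ (End.asHom x + End.asHom y) ≫ _ = _ ≫ (End.asHom x' + End.asHom y')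
  unfold RRel at hx hy
  rw [MonoidalPreadditive.whiskerLeft_add, Preadditive.add_comp, hx, hy, Preadditive.comp_add]

variable {a b c : ℕ}

omit [MonoidalPreadditive D] in
lemma br_left (hb : a + b + c ≤ p) :
    K.br p a b c ▷ K.W q ≫ (K.g h).hom = (K.g h).hom ≫ K.br n a b c :=
  BraidWord.br_rel (Q := LRel (K := K) h) (LRel.one h) (LRel.mul h) fun i hi =>
    K.s_left h (by lia)
omit [MonoidalPreadditive D] in
lemma br_right (hb : a + b + c ≤ q) :
    K.W p ◁ K.br q a b c ≫ (K.g h).hom = (K.g h).hom ≫ K.br n (p + a) b c :=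
  BraidWord.br_rel (Q := RRel (K := K) h) (RRel.one h) (RRel.mul h) fun i hi => by
    rw [add_assoc]; exact K.s_right h (by lia)
omit [MonoidalPreadditive D] in
lemma tw_left (hb : a + b ≤ p) :
    K.tw p a b ▷ K.W q ≫ (K.g h).hom = (K.g h).hom ≫ K.tw n a b :=
  BraidWord.tw_rel (Q := LRel (K := K) h) (LRel.one h) (LRel.mul h) fun i hi =>
    K.s_left h (by lia)
omit [MonoidalPreadditive D] in
lemma tw_right (hb : a + b ≤ q) :
    K.W p ◁ K.tw q a b ≫ (K.g h).hom = (K.g h).hom ≫ K.tw n (p + a) b :=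
  BraidWord.tw_rel (Q := RRel (K := K) h) (RRel.one h) (RRel.mul h) fun i hi => by
    rw [add_assoc]; exact K.s_right h (by lia)
lemma sh_left (hb : a + b + c ≤ p) :
    K.sh p a b c ▷ K.W q ≫ (K.g h).hom = (K.g h).hom ≫ K.sh n a b c :=
  BraidWord.sh_rel (Q := LRel (K := K) h) (LRel.one h) (LRel.mul h) (LRel.add h) fun i hi =>
    K.s_left h (by lia)
lemma sh_right (hb : a + b + c ≤ q) :
    K.W p ◁ K.sh q a b c ≫ (K.g h).hom = (K.g h).hom ≫ K.sh n (p + a) b c :=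
  BraidWord.sh_rel (Q := RRel (K := K) h) (RRel.one h) (RRel.mul h) (RRel.add h) fun i hi => by
    rw [add_assoc]; exact K.s_right h (by lia)
lemma sym_left (hb : a + b ≤ p) :
    K.sym p a b ▷ K.W q ≫ (K.g h).hom = (K.g h).hom ≫ K.sym n a b :=
  BraidWord.sym_rel (Q := LRel (K := K) h) (LRel.one h) (LRel.mul h) (LRel.add h) fun i hi =>
    K.s_left h (by lia)
lemma sym_right (hb : a + b ≤ q) :
    K.W p ◁ K.sym q a b ≫ (K.g h).hom = (K.g h).hom ≫ K.sym n (p + a) b :=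
  BraidWord.sym_rel (Q := RRel (K := K) h) (RRel.one h) (RRel.mul h) (RRel.add h) fun i hi => by
    rw [add_assoc]; exact K.s_right h (by lia)

omit [MonoidalPreadditive D] in
lemma left_inv {x : K.W p ⟶ K.W p} {x' : K.W n ⟶ K.W n}
    (hx : x ▷ K.W q ≫ (K.g h).hom = (K.g h).hom ≫ x') :
    (K.g h).inv ≫ x ▷ K.W q = x' ≫ (K.g h).inv := by
  rw [Iso.inv_comp_eq, ← Category.assoc, ← hx, Category.assoc, Iso.hom_inv_id, Category.comp_id]
omit [MonoidalPreadditive D] in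
lemma right_inv {x : K.W q ⟶ K.W q} {x' : K.W n ⟶ K.W n}
    (hx : K.W p ◁ x ≫ (K.g h).hom = (K.g h).hom ≫ x') :
    (K.g h).inv ≫ K.W p ◁ x = x' ≫ (K.g h).inv := by
  rw [Iso.inv_comp_eq, ← Category.assoc, ← hx, Category.assoc, Iso.hom_inv_id, Category.comp_id]

end transport

lemma assoc_inv {p q r m n N : ℕ} (h₁ : p + q = m) (h₂ : m + r = N) (h₃ : q + r = n)
    (h₄ : p + n = N) :
    (K.g h₂).inv ≫ (K.g h₁).inv ▷ K.W r ≫ (α_ _ _ _).hom =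
      (K.g h₄).inv ≫ K.W p ◁ (K.g h₃).inv := by
  rw [Iso.inv_comp_eq, ← cancel_epi ((K.g h₁).hom ▷ K.W r)]
  rw [← comp_whiskerRight_assoc, Iso.hom_inv_id, id_whiskerRight, Category.id_comp,
    ← Category.assoc, K.assoc h₁ h₂ h₃ h₄]
  simp

end Words

/-! #### Tensor powers of families of maps -/

namespace Words

variable (K : Words D) {R : D} (j : ∀ n, K.W n ⟶ R)

/-- The map `W n ⟶ R ⊗ R` on words of length `n = p + q`, and `0` if `n ≠ p + q`. -/
def J2 (n p q : ℕ) : K.W n ⟶ R ⊗ R :=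
  if h : p + q = n then (K.g h).inv ≫ (j p ⊗ₘ j q) else 0

/-- The map `W n ⟶ (R ⊗ R) ⊗ R` on words of length `n = p + q + r`. -/
def J3 (n p q r : ℕ) : K.W n ⟶ (R ⊗ R) ⊗ R :=
  if h : p + q + r = n then (K.g h).inv ≫ (K.J2 j (p + q) p q ⊗ₘ j r) else 0

/-- The map `W n ⟶ R ⊗ (R ⊗ R)` on words of length `n = p + q + r`. -/
def J3' (n p q r : ℕ) : K.W n ⟶ R ⊗ (R ⊗ R) :=
  if h : p + (q + r) = n then (K.g h).inv ≫ (j p ⊗ₘ K.J2 j (q + r) q r) else 0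

/-- The map `W n ⟶ (R ⊗ R) ⊗ (R ⊗ R)` on words of length `n = a + b + c + d`. -/
def J4 (n a b c d : ℕ) : K.W n ⟶ (R ⊗ R) ⊗ (R ⊗ R) :=
  if h : (a + b) + (c + d) = n then (K.g h).inv ≫ (K.J2 j (a + b) a b ⊗ₘ K.J2 j (c + d) c d)
  else 0

lemma J2_pos {n p q : ℕ} (h : p + q = n) : K.J2 j n p q = (K.g h).inv ≫ (j p ⊗ₘ j q) :=
  dif_pos h

lemma J3_pos {n m p q r : ℕ} (h : p + q = m) (h' : m + r = n) :
    K.J3 j n p q r = (K.g h').inv ≫ (K.J2 j m p q ⊗ₘ j r) := by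
  subst h; exact dif_pos h'

lemma J3'_pos {n m p q r : ℕ} (h : q + r = m) (h' : p + m = n) :
    K.J3' j n p q r = (K.g h').inv ≫ (j p ⊗ₘ K.J2 j m q r) := by
  subst h; exact dif_pos h'

lemma J4_pos {n m m' a b c d : ℕ} (h : a + b = m) (h' : c + d = m') (h'' : m + m' = n) :
    K.J4 j n a b c d = (K.g h'').inv ≫ (K.J2 j m a b ⊗ₘ K.J2 j m' c d) := by
  subst h; subst h'; exact dif_pos h''

lemma J3_assoc (n p q r : ℕ) : K.J3 j n p q r ≫ (α_ _ _ _).hom = K.J3' j n p q r := by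
  by_cases h : p + q + r = n
  · rw [K.J3_pos j rfl h, K.J3'_pos j rfl (show p + (q + r) = n by lia), K.J2_pos j rfl,
      K.J2_pos j rfl, Category.assoc]
    have e₁ : ((K.g (rfl : p + q = _)).inv ≫ (j p ⊗ₘ j q)) ⊗ₘ j r =
        (K.g rfl).inv ▷ K.W r ≫ ((j p ⊗ₘ j q) ⊗ₘ j r) := by
      rw [← tensorHom_id, tensorHom_comp_tensorHom, Category.id_comp]
    have e₂ : j p ⊗ₘ ((K.g (rfl : q + r = _)).inv ≫ (j q ⊗ₘ j r)) =
        K.W p ◁ (K.g rfl).inv ≫ (j p ⊗ₘ (j q ⊗ₘ j r)) := by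
      rw [← id_tensorHom, tensorHom_comp_tensorHom, Category.id_comp]
    rw [e₁, e₂, Category.assoc, associator_naturality, ← Category.assoc, ← Category.assoc,
      Category.assoc (K.g h).inv, K.assoc_inv rfl h rfl (by lia), Category.assoc]
  · rw [J3, J3', dif_neg h, dif_neg (by lia), Limits.zero_comp]

lemma J3'_assoc (n p q r : ℕ) : K.J3' j n p q r ≫ (α_ _ _ _).inv = K.J3 j n p q r := by
  rw [Iso.comp_inv_eq, J3_assoc]

/-- `μ` is concatenation of words. -/
def IsMul (μ : R ⊗ R ⟶ R) : Prop := ∀ {n p q : ℕ}, p + q = n → K.J2 j n p q ≫ μ = j n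
/-- `c` is the braiding of words. -/
def IsBraid (c : R ⊗ R ⟶ R ⊗ R) : Prop :=
  ∀ n p q : ℕ, p + q = n → K.J2 j n p q ≫ c = K.br n 0 p q ≫ K.J2 j n q p
/-- `Δ` is given by braided shuffles. -/
def IsComul (Δ : R ⟶ R ⊗ R) : Prop :=
  ∀ n, j n ≫ Δ = ∑ x ∈ Finset.HasAntidiagonal.antidiagonal n, K.sh n 0 x.1 x.2 ≫ K.J2 j n x.1 x.2
/-- `η` is the empty word. -/
def IsOne (η : 𝟙_ D ⟶ R) : Prop := η = K.u.hom ≫ j 0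
/-- `ε` is the projection to words of length `0`. -/
def IsCounit (ε : R ⟶ 𝟙_ D) : Prop := j 0 ≫ ε = K.u.inv ∧ ∀ n, j (n + 1) ≫ ε = 0
/-- `S` is the signed half twist. -/
def IsAntipode (S : R ⟶ R) : Prop := ∀ n, j n ≫ S = (-1 : ℤ) ^ n • K.tw n 0 n ≫ j n

section rules

variable {K j}

lemma IsBraid.J2 {c : R ⊗ R ⟶ R ⊗ R} (hc : K.IsBraid j c) (n p q : ℕ) :
    K.J2 j n p q ≫ c = K.br n 0 p q ≫ K.J2 j n q p := by
  by_cases h : p + q = n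
  · exact hc n p q h
  · rw [Words.J2, Words.J2, dif_neg h, dif_neg (by lia), Limits.zero_comp, Limits.comp_zero]

variable [MonoidalPreadditive D]

omit [MonoidalPreadditive D] in
lemma IsBraid.J3_left {c : R ⊗ R ⟶ R ⊗ R} (hc : K.IsBraid j c) (n p q r : ℕ) :
    K.J3 j n p q r ≫ c ▷ R = K.br n 0 p q ≫ K.J3 j n q p r := by
  by_cases h : p + q + r = n
  · rw [K.J3_pos j rfl h, K.J3_pos j (add_comm q p) h, Category.assoc, ← tensorHom_id,
      tensorHom_comp_tensorHom, Category.comp_id, hc.J2, ← Category.assoc,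
      ← left_inv h (br_left h (by lia)), Category.assoc, ← tensorHom_id,
      tensorHom_comp_tensorHom, Category.id_comp]
  · rw [Words.J3, Words.J3, dif_neg h, dif_neg (by lia), Limits.zero_comp, Limits.comp_zero]

omit [MonoidalPreadditive D] in
lemma IsBraid.J3_right {c : R ⊗ R ⟶ R ⊗ R} (hc : K.IsBraid j c) (n p q r : ℕ) :
    K.J3' j n p q r ≫ R ◁ c = K.br n p q r ≫ K.J3' j n p r q := by
  by_cases h : p + (q + r) = n
  · rw [K.J3'_pos j rfl h, K.J3'_pos j (add_comm r q) h, Category.assoc, ← id_tensorHom,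
      tensorHom_comp_tensorHom, Category.comp_id, hc.J2, ← Category.assoc]
    have := right_inv h (br_right (K := K) h (a := 0) (b := q) (c := r) (by lia))
    rw [add_zero] at this
    rw [← this, Category.assoc, ← id_tensorHom, tensorHom_comp_tensorHom, Category.id_comp]
  · rw [Words.J3', Words.J3', dif_neg h, dif_neg (by lia), Limits.zero_comp, Limits.comp_zero]

omit [MonoidalPreadditive D] in
lemma IsMul.J3_left {μ : R ⊗ R ⟶ R} (hμ : K.IsMul j μ) {n m p q r : ℕ} (h : p + q = m) :
    K.J3 j n p q r ≫ μ ▷ R = K.J2 j n m r := by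
  subst h
  by_cases h : p + q + r = n
  · rw [K.J3_pos j rfl h, K.J2_pos j h, Category.assoc, ← tensorHom_id, tensorHom_comp_tensorHom,
      Category.comp_id, hμ rfl]
  · rw [show K.J3 j n p q r = 0 from dif_neg h, show K.J2 j n (p + q) r = 0 from dif_neg h,
      Limits.zero_comp]

omit [MonoidalPreadditive D] in
lemma IsMul.J3_right {μ : R ⊗ R ⟶ R} (hμ : K.IsMul j μ) {n m p q r : ℕ} (h : q + r = m) :
    K.J3' j n p q r ≫ R ◁ μ = K.J2 j n p m := by
  subst h
  by_cases h : p + (q + r) = n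
  · rw [K.J3'_pos j rfl h, K.J2_pos j h, Category.assoc, ← id_tensorHom, tensorHom_comp_tensorHom,
      Category.comp_id, hμ rfl]
  · rw [show K.J3' j n p q r = 0 from dif_neg h, show K.J2 j n p (q + r) = 0 from dif_neg h,
      Limits.zero_comp]

lemma sum_tensorHom {X Y X' Y' : D} {ι : Type*} (t : Finset ι) (f : ι → (X ⟶ Y)) (g : X' ⟶ Y') :
    (∑ i ∈ t, f i) ⊗ₘ g = ∑ i ∈ t, (f i ⊗ₘ g) := by
  simp only [MonoidalCategory.tensorHom_def, sum_whiskerRight, Preadditive.sum_comp]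

lemma tensorHom_sum {X Y X' Y' : D} {ι : Type*} (t : Finset ι) (f : ι → (X ⟶ Y)) (g : X' ⟶ Y') :
    g ⊗ₘ (∑ i ∈ t, f i) = ∑ i ∈ t, (g ⊗ₘ f i) := by
  simp only [MonoidalCategory.tensorHom_def, whiskerLeft_sum, Preadditive.comp_sum]

lemma IsComul.J2_left {Δ : R ⟶ R ⊗ R} (hΔ : K.IsComul j Δ) (n m r : ℕ) :
    K.J2 j n m r ≫ Δ ▷ R =
      ∑ x ∈ Finset.HasAntidiagonal.antidiagonal m, K.sh n 0 x.1 x.2 ≫ K.J3 j n x.1 x.2 r := by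
  by_cases h : m + r = n
  · rw [K.J2_pos j h, Category.assoc, ← tensorHom_id, tensorHom_comp_tensorHom,
      Category.comp_id, hΔ, sum_tensorHom, Preadditive.comp_sum]
    refine Finset.sum_congr rfl fun x hx => ?_
    rw [Finset.HasAntidiagonal.mem_antidiagonal] at hx
    rw [K.J3_pos j hx h, ← Category.assoc (K.sh n _ _ _), ← left_inv h (sh_left h (by lia)), Category.assoc,
      ← tensorHom_id, tensorHom_comp_tensorHom, Category.id_comp]
  · rw [Words.J2, dif_neg h, Limits.zero_comp, Finset.sum_eq_zero]
    intro x hx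
    rw [Finset.HasAntidiagonal.mem_antidiagonal] at hx
    rw [Words.J3, dif_neg (by lia), Limits.comp_zero]

lemma IsComul.J2_right {Δ : R ⟶ R ⊗ R} (hΔ : K.IsComul j Δ) (n p m : ℕ) :
    K.J2 j n p m ≫ R ◁ Δ =
      ∑ x ∈ Finset.HasAntidiagonal.antidiagonal m, K.sh n p x.1 x.2 ≫ K.J3' j n p x.1 x.2 := by
  by_cases h : p + m = n
  · rw [K.J2_pos j h, Category.assoc, ← id_tensorHom, tensorHom_comp_tensorHom,
      Category.comp_id, hΔ, tensorHom_sum, Preadditive.comp_sum]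
    refine Finset.sum_congr rfl fun x hx => ?_
    rw [Finset.HasAntidiagonal.mem_antidiagonal] at hx
    have := right_inv h (sh_right (K := K) h (a := 0) (b := x.1) (c := x.2) (by lia))
    rw [add_zero] at this
    rw [K.J3'_pos j hx h, ← Category.assoc (K.sh n _ _ _), ← this, Category.assoc,
      ← id_tensorHom, tensorHom_comp_tensorHom, Category.id_comp]
  · rw [Words.J2, dif_neg h, Limits.zero_comp, Finset.sum_eq_zero]
    intro x hx
    rw [Finset.HasAntidiagonal.mem_antidiagonal] at hx
    rw [Words.J3', dif_neg (by lia), Limits.comp_zero]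

omit [MonoidalPreadditive D] in
lemma IsOne.left {η : 𝟙_ D ⟶ R} (hη : K.IsOne j η) (n : ℕ) :
    j n ≫ (λ_ R).inv ≫ η ▷ R = K.J2 j n 0 n := by
  rw [K.J2_pos j (zero_add n), leftUnitor_inv_naturality_assoc, whisker_exchange, hη,
    comp_whiskerRight, Category.assoc]
  rw [← cancel_epi (λ_ (K.W n)).hom, Iso.hom_inv_id_assoc, ← K.unit_left, Category.assoc,
    Iso.hom_inv_id_assoc, MonoidalCategory.tensorHom_def]

omit [MonoidalPreadditive D] in
lemma IsOne.right {η : 𝟙_ D ⟶ R} (hη : K.IsOne j η) (n : ℕ) :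
    j n ≫ (ρ_ R).inv ≫ R ◁ η = K.J2 j n n 0 := by
  rw [K.J2_pos j (add_zero n), rightUnitor_inv_naturality_assoc, ← whisker_exchange, hη,
    MonoidalCategory.whiskerLeft_comp, Category.assoc]
  rw [← cancel_epi (ρ_ (K.W n)).hom, Iso.hom_inv_id_assoc, ← K.unit_right, Category.assoc,
    Iso.hom_inv_id_assoc, tensorHom_def', whisker_exchange]

end rules

end Words

end Formal

section Formal

universe v w

variable {D : Type w} [Category.{v} D] [MonoidalCategory D] [Preadditive D]

namespace Words

section four

variable {K : Words D} {R : D} {j : ∀ n, K.W n ⟶ R}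

lemma J4_assoc {n a b c d M : ℕ} (hM : b + (c + d) = M) (hn : a + M = n) :
    K.J4 j n a b c d ≫ (α_ R R (R ⊗ R)).hom = (K.g hn).inv ≫ (j a ⊗ₘ K.J3' j M b c d) := by
  rw [K.J4_pos j rfl rfl (by lia), K.J2_pos j (rfl : a + b = _), K.J3'_pos j rfl hM,
    Category.assoc]
  have e₁ : ((K.g (rfl : a + b = _)).inv ≫ (j a ⊗ₘ j b)) ⊗ₘ K.J2 j (c + d) c d =
      (K.g rfl).inv ▷ K.W (c + d) ≫ ((j a ⊗ₘ j b) ⊗ₘ K.J2 j (c + d) c d) := by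
    rw [← tensorHom_id, tensorHom_comp_tensorHom, Category.id_comp]
  have e₂ : j a ⊗ₘ ((K.g hM).inv ≫ (j b ⊗ₘ K.J2 j (c + d) c d)) =
      K.W a ◁ (K.g hM).inv ≫ (j a ⊗ₘ (j b ⊗ₘ K.J2 j (c + d) c d)) := by
    rw [← id_tensorHom, tensorHom_comp_tensorHom, Category.id_comp]
  rw [e₁, e₂, Category.assoc, associator_naturality, ← Category.assoc, ← Category.assoc,
    Category.assoc (K.g _).inv, K.assoc_inv rfl (by lia) hM hn, Category.assoc]

variable [MonoidalPreadditive D]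

omit [MonoidalPreadditive D] in
lemma IsBraid.J4 {c : R ⊗ R ⟶ R ⊗ R} (hc : K.IsBraid j c) {n p q r s : ℕ}
    (h : (p + q) + (r + s) = n) :
    K.J4 j n p q r s ≫ middle R c R = K.br n p q r ≫ K.J4 j n p r q s := by
  have hM : q + (r + s) = q + r + s := by lia
  have hn : p + (q + r + s) = n := by lia
  rw [middle, ← Category.assoc, J4_assoc hM hn, Category.assoc, ← Category.assoc (_ ⊗ₘ _),
    ← id_tensorHom, tensorHom_comp_tensorHom, Category.comp_id, ← Category.assoc (J3' ..),
    J3'_assoc, ← Category.assoc (J3 ..), hc.J3_left, Category.assoc, J3_assoc]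
  have := right_inv hn (br_right (K := K) hn (a := 0) (b := q) (c := r) (by lia))
  rw [add_zero] at this
  have e : j p ⊗ₘ (K.br (q + r + s) 0 q r ≫ K.J3' j (q + r + s) r q s) =
      K.W p ◁ K.br (q + r + s) 0 q r ≫ (j p ⊗ₘ K.J3' j (q + r + s) r q s) := by
    rw [← id_tensorHom, tensorHom_comp_tensorHom, Category.id_comp]
  rw [e, Category.assoc, ← Category.assoc, this, Category.assoc, ← Category.assoc (K.g hn).inv,
    ← J4_assoc (by lia) hn, Category.assoc, Iso.hom_inv_id, Category.comp_id]

omit [MonoidalPreadditive D] in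
lemma IsMul.J4 {μ : R ⊗ R ⟶ R} (hμ : K.IsMul j μ) {n p q r s : ℕ}
    (h : (p + q) + (r + s) = n) :
    K.J4 j n p q r s ≫ (μ ⊗ₘ μ) = K.J2 j n (p + q) (r + s) := by
  rw [K.J4_pos j rfl rfl h, K.J2_pos j h, Category.assoc, tensorHom_comp_tensorHom, hμ rfl, hμ rfl]

/-- The sum of the braided shuffles of a word of length `n`. -/
def shuffle (K : Words D) {R : D} (j : ∀ n, K.W n ⟶ R) (n : ℕ) : K.W n ⟶ R ⊗ R :=
  ∑ x ∈ Finset.HasAntidiagonal.antidiagonal n, K.sh n 0 x.1 x.2 ≫ K.J2 j n x.1 x.2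

lemma shuffle_tensor {n m m' : ℕ} (h : m + m' = n) :
    (K.g h).inv ≫ (K.shuffle j m ⊗ₘ K.shuffle j m') =
      ∑ x ∈ Finset.HasAntidiagonal.antidiagonal m,
        ∑ y ∈ Finset.HasAntidiagonal.antidiagonal m',
          K.sh n 0 x.1 x.2 ≫ K.sh n m y.1 y.2 ≫ K.J4 j n x.1 x.2 y.1 y.2 := by
  rw [shuffle, shuffle, sum_tensorHom, Preadditive.comp_sum]
  refine Finset.sum_congr rfl fun x hx => ?_
  rw [tensorHom_sum, Preadditive.comp_sum]
  refine Finset.sum_congr rfl fun y hy => ?_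
  rw [Finset.HasAntidiagonal.mem_antidiagonal] at hx hy
  have h₁ := left_inv h (sh_left (K := K) h (a := 0) (b := x.1) (c := x.2) (by lia))
  have h₂ := right_inv h (sh_right (K := K) h (a := 0) (b := y.1) (c := y.2) (by lia))
  rw [add_zero] at h₂
  rw [K.J4_pos j hx hy h, ← tensorHom_comp_tensorHom, MonoidalCategory.tensorHom_def,
    ← Category.assoc, ← Category.assoc, h₁, Category.assoc (K.sh n 0 _ _), h₂]
  simp only [Category.assoc]

/-- Shuffles are multiplicative up to the braiding. -/
lemma shuffle_mul {c : R ⊗ R ⟶ R ⊗ R} (hc : K.IsBraid j c) {μ : R ⊗ R ⟶ R} (hμ : K.IsMul j μ)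
    {n m m' : ℕ} (h : m + m' = n) :
    (K.g h).inv ≫ (K.shuffle j m ⊗ₘ K.shuffle j m') ≫ middle R c R ≫ (μ ⊗ₘ μ) =
      K.shuffle j n := by
  subst h
  have key := BraidWord.sum_sh_add (A := End (K.W (m + m'))) (K.rels (m + m'))
    (fun p q => Preadditive.rightComp (K.W (m + m')) (K.J2 j (m + m') p q)) m m'
  rw [← Category.assoc, shuffle_tensor rfl]
  simp only [Preadditive.sum_comp, Category.assoc]
  refine Eq.trans (Finset.sum_congr rfl fun x hx => Finset.sum_congr rfl fun y hy => ?_) key.symm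
  rw [Finset.HasAntidiagonal.mem_antidiagonal] at hx hy
  rw [← Category.assoc (K.J4 ..), hc.J4 (by lia), Category.assoc, hμ.J4 (by lia)]
  simp only [← Category.assoc]
  rfl

/-- `Δ` is multiplicative up to the braiding, on words. -/
lemma IsComul.mul {Δ : R ⟶ R ⊗ R} (hΔ : K.IsComul j Δ) {c : R ⊗ R ⟶ R ⊗ R} (hc : K.IsBraid j c)
    {μ : R ⊗ R ⟶ R} (hμ : K.IsMul j μ) {n m m' : ℕ} (h : m + m' = n) :
    K.J2 j n m m' ≫ (Δ ⊗ₘ Δ) ≫ middle R c R ≫ (μ ⊗ₘ μ) =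
      ∑ x ∈ Finset.HasAntidiagonal.antidiagonal n, K.sh n 0 x.1 x.2 ≫ K.J2 j n x.1 x.2 := by
  rw [K.J2_pos j h, Category.assoc, ← Category.assoc (_ ⊗ₘ _), tensorHom_comp_tensorHom, hΔ, hΔ]
  exact shuffle_mul hc hμ h

end four

end Words

end Formal

section Formal

universe v w

variable {D : Type w} [Category.{v} D] [MonoidalCategory D] [Preadditive D]

namespace Words

/-- Morphisms from the first three tensor powers of `R` to objects satisfying `P` are determined
by their restrictions to words. -/
structure Separating (K : Words D) {R : D} (j : ∀ n, K.W n ⟶ R) (P : D → Prop) : Prop where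
  unit : P (𝟙_ D)
  self : P R
  tensor : ∀ {X Y}, P X → P Y → P (X ⊗ Y)
  ext₁ : ∀ {Z}, P Z → ∀ {f g : R ⟶ Z}, (∀ n, j n ≫ f = j n ≫ g) → f = g
  ext₂ : ∀ {Z}, P Z → ∀ {f g : R ⊗ R ⟶ Z},
    (∀ p q, (j p ⊗ₘ j q) ≫ f = (j p ⊗ₘ j q) ≫ g) → f = g
  ext₃ : ∀ {Z}, P Z → ∀ {f g : (R ⊗ R) ⊗ R ⟶ Z},
    (∀ p q r, ((j p ⊗ₘ j q) ⊗ₘ j r) ≫ f = ((j p ⊗ₘ j q) ⊗ₘ j r) ≫ g) → f = g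

section relations

variable (K : Words D) (n : ℕ)

lemma br_zero_left (a q : ℕ) : K.br n a 0 q = 𝟙 _ := BraidWord.br_zero_left (A := End (K.W n)) ..
lemma br_zero_right (a p : ℕ) : K.br n a p 0 = 𝟙 _ := BraidWord.br_zero (A := End (K.W n)) ..
lemma sh_zero_left (a q : ℕ) : K.sh n a 0 q = 𝟙 _ := BraidWord.sh_zero_left (A := End (K.W n)) ..
lemma sh_zero_right (a p : ℕ) : K.sh n a p 0 = 𝟙 _ := BraidWord.sh_zero_right (A := End (K.W n)) ..

lemma tw_zero (a : ℕ) : K.tw n a 0 = 𝟙 _ := BraidWord.tw_zero (A := End (K.W n)) ..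

lemma br_add_left (p q r : ℕ) : K.br n 0 (p + q) r = K.br n p q r ≫ K.br n 0 p r := by
  have := BraidWord.br_add_left (A := End (K.W n)) (K.rels n) 0 p q r
  rwa [zero_add] at this

lemma br_add_right (p q r : ℕ) : K.br n 0 p (q + r) = K.br n 0 p q ≫ K.br n q p r := by
  have := BraidWord.br_add_right (A := End (K.W n)) (s := K.s n) 0 p q r
  rwa [zero_add] at this

lemma yangBaxter (p q r : ℕ) : K.br n 0 p q ≫ K.br n q p r ≫ K.br n 0 q r =
    K.br n p q r ≫ K.br n 0 p r ≫ K.br n r p q := by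
  have := BraidWord.yangBaxter (A := End (K.W n)) (K.rels n) p q r
  exact this

lemma sh_br_left (p q r : ℕ) : K.sh n 0 p q ≫ K.br n p q r ≫ K.br n 0 p r =
    K.br n 0 (p + q) r ≫ K.sh n r p q := by
  have := BraidWord.br_sh_left (A := End (K.W n)) (K.rels n) 0 p q r
  rw [zero_add] at this
  rw [← br_add_left]
  exact this

lemma sh_br_right (p q r : ℕ) : K.sh n p q r ≫ K.br n 0 p q ≫ K.br n q p r =
    K.br n 0 p (q + r) ≫ K.sh n 0 q r := by
  have := BraidWord.br_sh_right (A := End (K.W n)) (K.rels n) 0 p q r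
  rw [zero_add] at this
  rw [← br_add_right]
  exact this

lemma sh_coassoc (p q r : ℕ) (h : p + q + r = n) :
    K.sh n 0 p (q + r) ≫ K.sh n p q r = K.sh n 0 (p + q) r ≫ K.sh n 0 p q := by
  have := BraidWord.sh_coassoc (A := End (K.W n)) (K.rels n) 0 n p q r h
  rw [zero_add] at this
  exact this.symm

lemma sum_tw_left : ∑ x ∈ Finset.HasAntidiagonal.antidiagonal (n + 1),
    (-1 : ℤ) ^ x.1 • (K.sh (n + 1) 0 x.1 x.2 ≫ K.tw (n + 1) 0 x.1) = 0 := by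
  refine Eq.trans (Finset.sum_congr rfl fun x hx => ?_)
    (BraidWord.sum_tw_left (A := End (K.W (n + 1))) (K.rels (n + 1)) n)
  refine (zsmul_eq_mul (α := End (K.W (n + 1))) _ _).trans ?_
  rw [Int.cast_pow, Int.cast_neg, Int.cast_one]
  rfl

lemma sum_tw_right : ∑ x ∈ Finset.HasAntidiagonal.antidiagonal (n + 1),
    (-1 : ℤ) ^ x.2 • (K.sh (n + 1) 0 x.1 x.2 ≫ K.tw (n + 1) x.1 x.2) = 0 := by
  refine Eq.trans (Finset.sum_congr rfl fun x hx => ?_)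
    (BraidWord.sum_tw_right (A := End (K.W (n + 1))) (K.rels (n + 1)) n)
  refine (zsmul_eq_mul (α := End (K.W (n + 1))) _ _).trans ?_
  rw [Int.cast_pow, Int.cast_neg, Int.cast_one]
  rfl

end relations

section bialgebra

variable {K : Words D} {R : D} {j : ∀ n, K.W n ⟶ R} {P : D → Prop}

lemma Separating.extJ2 (hP : K.Separating j P) {Z} (hZ : P Z) {f g : R ⊗ R ⟶ Z}
    (h : ∀ n p q, p + q = n → K.J2 j n p q ≫ f = K.J2 j n p q ≫ g) : f = g :=
  hP.ext₂ hZ fun p q => by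
    have := h _ p q rfl
    rw [K.J2_pos j rfl, Category.assoc, Category.assoc] at this
    exact (cancel_epi _).1 this

lemma Separating.extJ3 (hP : K.Separating j P) {Z} (hZ : P Z) {f g : (R ⊗ R) ⊗ R ⟶ Z}
    (h : ∀ n p q r, p + q + r = n → K.J3 j n p q r ≫ f = K.J3 j n p q r ≫ g) : f = g :=
  hP.ext₃ hZ fun p q r => by
    have := h _ p q r rfl
    have e₁ : ((K.g (rfl : p + q = _)).inv ≫ (j p ⊗ₘ j q)) ⊗ₘ j r =
        (K.g rfl).inv ▷ K.W r ≫ ((j p ⊗ₘ j q) ⊗ₘ j r) := by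
      rw [← tensorHom_id, tensorHom_comp_tensorHom, Category.id_comp]
    rw [K.J3_pos j rfl rfl, K.J2_pos j rfl, e₁, Category.assoc, Category.assoc, Category.assoc, Category.assoc, cancel_epi, cancel_epi] at this
    exact this

section counit

omit [Preadditive D] in
lemma tensorHom_unit {X Y Z Z' : D} (f : X ⟶ Y) (e : Y ⟶ 𝟙_ D) (g : Z ⟶ Z') :
    (f ⊗ₘ g) ≫ e ▷ Z' ≫ (λ_ Z').hom = (f ≫ e) ▷ Z ≫ (λ_ Z).hom ≫ g := by
  rw [← Category.assoc, ← tensorHom_id, tensorHom_comp_tensorHom, Category.comp_id,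
    MonoidalCategory.tensorHom_def, Category.assoc, leftUnitor_naturality]

omit [Preadditive D] in
lemma tensorHom_unit' {X Y Z Z' : D} (f : X ⟶ Y) (e : Y ⟶ 𝟙_ D) (g : Z ⟶ Z') :
    (g ⊗ₘ f) ≫ Z' ◁ e ≫ (ρ_ Z').hom = Z ◁ (f ≫ e) ≫ (ρ_ Z).hom ≫ g := by
  rw [← Category.assoc, ← id_tensorHom, tensorHom_comp_tensorHom, Category.comp_id,
    MonoidalCategory.tensorHom_def', Category.assoc, rightUnitor_naturality]

variable [MonoidalPreadditive D]

omit [MonoidalPreadditive D] in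
lemma IsCounit.J2_left {ε : R ⟶ 𝟙_ D} (hε : K.IsCounit j ε) (n : ℕ) :
    K.J2 j n 0 n ≫ ε ▷ R ≫ (λ_ R).hom = j n := by
  rw [K.J2_pos j (zero_add n), Category.assoc, tensorHom_unit, hε.1, Iso.inv_comp_eq,
    ← K.unit_left n, ← Category.assoc, ← Category.assoc, ← comp_whiskerRight]
  simp

omit [MonoidalPreadditive D] in
lemma IsCounit.J2_right {ε : R ⟶ 𝟙_ D} (hε : K.IsCounit j ε) (n : ℕ) :
    K.J2 j n n 0 ≫ R ◁ ε ≫ (ρ_ R).hom = j n := by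
  rw [K.J2_pos j (add_zero n), Category.assoc, tensorHom_unit', hε.1, Iso.inv_comp_eq,
    ← K.unit_right n, ← Category.assoc, ← Category.assoc, ← MonoidalCategory.whiskerLeft_comp]
  simp

lemma IsCounit.J2_left_zero {ε : R ⟶ 𝟙_ D} (hε : K.IsCounit j ε) {n p q : ℕ} (hp : p ≠ 0) :
    K.J2 j n p q ≫ ε ▷ R = 0 := by
  by_cases h : p + q = n
  · obtain ⟨p, rfl⟩ := Nat.exists_eq_succ_of_ne_zero hp
    rw [K.J2_pos j h, Category.assoc, ← tensorHom_id, tensorHom_comp_tensorHom, hε.2,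
      MonoidalPreadditive.zero_tensor, Limits.comp_zero]
  · rw [J2, dif_neg h, Limits.zero_comp]

lemma IsCounit.J2_right_zero {ε : R ⟶ 𝟙_ D} (hε : K.IsCounit j ε) {n p q : ℕ} (hq : q ≠ 0) :
    K.J2 j n p q ≫ R ◁ ε = 0 := by
  by_cases h : p + q = n
  · obtain ⟨q, rfl⟩ := Nat.exists_eq_succ_of_ne_zero hq
    rw [K.J2_pos j h, Category.assoc, ← id_tensorHom, tensorHom_comp_tensorHom, hε.2,
      MonoidalPreadditive.tensor_zero, Limits.comp_zero]
  · rw [J2, dif_neg h, Limits.zero_comp]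

lemma IsCounit.comul_left {ε : R ⟶ 𝟙_ D} (hε : K.IsCounit j ε) {Δ : R ⟶ R ⊗ R}
    (hΔ : K.IsComul j Δ) (n : ℕ) : j n ≫ Δ ≫ ε ▷ R ≫ (λ_ R).hom = j n := by
  rw [← Category.assoc, hΔ, Preadditive.sum_comp, Finset.sum_eq_single (0, n)]
  · rw [Category.assoc, hε.J2_left, sh_zero_left, Category.id_comp]
  · intro x hx hne
    rw [Finset.HasAntidiagonal.mem_antidiagonal] at hx
    have : x.1 ≠ 0 := fun h => hne (Prod.ext h (by simp only; lia))
    rw [Category.assoc, ← Category.assoc (J2 ..), hε.J2_left_zero this, Limits.zero_comp,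
      Limits.comp_zero]
  · intro h
    exact (h (by simp [Finset.HasAntidiagonal.mem_antidiagonal])).elim

lemma IsCounit.comul_right {ε : R ⟶ 𝟙_ D} (hε : K.IsCounit j ε) {Δ : R ⟶ R ⊗ R}
    (hΔ : K.IsComul j Δ) (n : ℕ) : j n ≫ Δ ≫ R ◁ ε ≫ (ρ_ R).hom = j n := by
  rw [← Category.assoc, hΔ, Preadditive.sum_comp, Finset.sum_eq_single (n, 0)]
  · rw [Category.assoc, hε.J2_right, sh_zero_right, Category.id_comp]
  · intro x hx hne
    rw [Finset.HasAntidiagonal.mem_antidiagonal] at hx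
    have : x.2 ≠ 0 := fun h => hne (Prod.ext (by simp only; lia) h)
    rw [Category.assoc, ← Category.assoc (J2 ..), hε.J2_right_zero this, Limits.zero_comp,
      Limits.comp_zero]
  · intro h
    exact (h (by simp [Finset.HasAntidiagonal.mem_antidiagonal])).elim

end counit

lemma zsmul_whiskerRight [MonoidalPreadditive D] {X Y : D} (n : ℤ) (f : X ⟶ Y) (Z : D) :
    (n • f) ▷ Z = n • f ▷ Z :=
  map_zsmul (⟨⟨fun f => f ▷ Z, MonoidalPreadditive.zero_whiskerRight⟩,
    fun _ _ => MonoidalPreadditive.add_whiskerRight ..⟩ : (X ⟶ Y) →+ (X ⊗ Z ⟶ Y ⊗ Z)) n f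

lemma whiskerLeft_zsmul [MonoidalPreadditive D] {X Y : D} (n : ℤ) (f : X ⟶ Y) (Z : D) :
    Z ◁ (n • f) = n • Z ◁ f :=
  map_zsmul (⟨⟨fun f => Z ◁ f, MonoidalPreadditive.whiskerLeft_zero⟩,
    fun _ _ => MonoidalPreadditive.whiskerLeft_add ..⟩ : (X ⟶ Y) →+ (Z ⊗ X ⟶ Z ⊗ Y)) n f

/-- Concatenation of words gives an algebra. -/
abbrev monObj (hP : K.Separating j P) {μ : R ⊗ R ⟶ R} {η : 𝟙_ D ⟶ R} (hμ : K.IsMul j μ)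
    (hη : K.IsOne j η) : MonObj R where
  one := η
  mul := μ
  one_mul := by
    rw [← cancel_epi (λ_ R).inv, Iso.inv_hom_id]
    refine hP.ext₁ hP.self fun n => ?_
    rw [Category.comp_id]
    refine Eq.trans ?_ (hμ (zero_add n))
    rw [← hη.left]
    simp only [Category.assoc]
  mul_one := by
    rw [← cancel_epi (ρ_ R).inv, Iso.inv_hom_id]
    refine hP.ext₁ hP.self fun n => ?_
    rw [Category.comp_id]
    refine Eq.trans ?_ (hμ (add_zero n))
    rw [← hη.right]
    simp only [Category.assoc]
  mul_assoc := hP.extJ3 hP.self fun n p q r h => by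
    rw [← Category.assoc, hμ.J3_left rfl, ← Category.assoc, J3_assoc, ← Category.assoc,
      hμ.J3_right rfl, hμ (by lia), hμ (by lia)]

variable [MonoidalPreadditive D]

/-- Braided shuffles give a coalgebra. -/
abbrev comonObj (hP : K.Separating j P) {Δ : R ⟶ R ⊗ R} {ε : R ⟶ 𝟙_ D} (hΔ : K.IsComul j Δ)
    (hε : K.IsCounit j ε) : ComonObj R where
  counit := ε
  comul := Δ
  counit_comul := by
    rw [← cancel_mono (λ_ R).hom, Iso.inv_hom_id]
    refine hP.ext₁ hP.self fun n => ?_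
    rw [Category.assoc, hε.comul_left hΔ, Category.comp_id]
  comul_counit := by
    rw [← cancel_mono (ρ_ R).hom, Iso.inv_hom_id]
    refine hP.ext₁ hP.self fun n => ?_
    rw [Category.assoc, hε.comul_right hΔ, Category.comp_id]
  comul_assoc := hP.ext₁ (hP.tensor hP.self (hP.tensor hP.self hP.self)) fun N => by
    have h₁ : j N ≫ Δ ≫ R ◁ Δ = ∑ x ∈ Finset.HasAntidiagonal.antidiagonal N,
        ∑ y ∈ Finset.HasAntidiagonal.antidiagonal x.2,
          K.sh N 0 x.1 x.2 ≫ K.sh N x.1 y.1 y.2 ≫ K.J3' j N x.1 y.1 y.2 := by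
      rw [← Category.assoc, hΔ, Preadditive.sum_comp]
      refine Finset.sum_congr rfl fun x hx => ?_
      rw [Category.assoc, hΔ.J2_right, Preadditive.comp_sum]
    have h₂ : j N ≫ Δ ≫ Δ ▷ R ≫ (α_ R R R).hom = ∑ x ∈ Finset.HasAntidiagonal.antidiagonal N,
        ∑ y ∈ Finset.HasAntidiagonal.antidiagonal x.1,
          K.sh N 0 x.1 x.2 ≫ K.sh N 0 y.1 y.2 ≫ K.J3' j N y.1 y.2 x.2 := by
      rw [← Category.assoc, hΔ, Preadditive.sum_comp]
      refine Finset.sum_congr rfl fun x hx => ?_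
      rw [Category.assoc, ← Category.assoc (J2 ..), hΔ.J2_left, Preadditive.sum_comp,
        Preadditive.comp_sum]
      simp only [Category.assoc, J3_assoc]
    rw [h₁, h₂]
    rw [Finset.sum_sigma', Finset.sum_sigma']
    refine Finset.sum_bij' (fun x _ => ⟨(x.1.1 + x.2.1, x.2.2), (x.1.1, x.2.1)⟩)
      (fun x _ => ⟨(x.2.1, x.2.2 + x.1.2), (x.2.2, x.1.2)⟩) ?_ ?_ ?_ ?_ ?_
    · rintro ⟨⟨a, b⟩, ⟨p, q⟩⟩ h
      simp only [Finset.mem_sigma, Finset.HasAntidiagonal.mem_antidiagonal] at h ⊢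
      lia
    · rintro ⟨⟨a, b⟩, ⟨p, q⟩⟩ h
      simp only [Finset.mem_sigma, Finset.HasAntidiagonal.mem_antidiagonal] at h ⊢
      lia
    · rintro ⟨⟨a, b⟩, ⟨p, q⟩⟩ h
      simp only [Finset.mem_sigma, Finset.HasAntidiagonal.mem_antidiagonal] at h ⊢
      obtain ⟨h₁, rfl⟩ := h
      rfl
    · rintro ⟨⟨a, b⟩, ⟨p, q⟩⟩ h
      simp only [Finset.mem_sigma, Finset.HasAntidiagonal.mem_antidiagonal] at h ⊢
      obtain ⟨h₁, rfl⟩ := h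
      rfl
    · rintro ⟨⟨a, b⟩, ⟨p, q⟩⟩ h
      simp only [Finset.mem_sigma, Finset.HasAntidiagonal.mem_antidiagonal] at h ⊢
      obtain ⟨h₁, rfl⟩ := h
      have e := K.sh_coassoc N a p q (by lia)
      rw [← Category.assoc, e, Category.assoc]

open scoped MonObj ComonObj in
theorem isPreBraidedBialgebra (hP : K.Separating j P) [MonObj R] [ComonObj R] {c : R ⊗ R ⟶ R ⊗ R}
    (hμ : K.IsMul j μ[R]) (hη : K.IsOne j η[R]) (hΔ : K.IsComul j Δ[R]) (hε : K.IsCounit j ε[R])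
    (hc : K.IsBraid j c) : IsPreBraidedBialgebra R c where
  preBraiding := hP.extJ3 (hP.tensor (hP.tensor hP.self hP.self) hP.self) fun n p q r h => by
    have L : ∀ (p q r : ℕ) {Z} (f : _ ⟶ Z),
        K.J3 j n p q r ≫ c ▷ R ≫ f = K.br n 0 p q ≫ K.J3 j n q p r ≫ f := fun p q r Z f => by
      rw [← Category.assoc, hc.J3_left, Category.assoc]
    have M : ∀ (p q r : ℕ) {Z} (f : _ ⟶ Z), K.J3 j n p q r ≫ (α_ R R R).hom ≫ R ◁ c ≫
        (α_ R R R).inv ≫ f = K.br n p q r ≫ K.J3 j n p r q ≫ f := fun p q r Z f => by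
      rw [← Category.assoc, J3_assoc, ← Category.assoc, hc.J3_right, Category.assoc,
        ← Category.assoc (J3' ..), J3'_assoc]
    have M' : ∀ (p q r : ℕ), K.J3 j n p q r ≫ (α_ R R R).hom ≫ R ◁ c ≫
        (α_ R R R).inv = K.br n p q r ≫ K.J3 j n p r q := fun p q r => by
      simpa using M p q r (𝟙 _)
    rw [L, M, hc.J3_left, M, L, M']
    have e := K.yangBaxter n p q r
    simp only [← Category.assoc] at e ⊢
    rw [e]
  one_braid := by
    rw [← cancel_epi (λ_ R).inv, Iso.inv_hom_id_assoc]
    refine hP.ext₁ (hP.tensor hP.self hP.self) fun n => ?_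
    rw [← Category.assoc (λ_ R).inv, ← Category.assoc, hη.left, hη.right, hc.J2, br_zero_left,
      Category.id_comp]
  braid_one := by
    rw [← cancel_epi (ρ_ R).inv, Iso.inv_hom_id_assoc]
    refine hP.ext₁ (hP.tensor hP.self hP.self) fun n => ?_
    rw [← Category.assoc (ρ_ R).inv, ← Category.assoc, hη.left, hη.right, hc.J2, br_zero_right,
      Category.id_comp]
  mul_braid := hP.extJ3 (hP.tensor hP.self hP.self) fun n p q r h => by
    rw [← Category.assoc, hμ.J3_left rfl, hc.J2, ← Category.assoc, J3_assoc, ← Category.assoc,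
      hc.J3_right, Category.assoc, ← Category.assoc (J3' ..), J3'_assoc, ← Category.assoc (J3 ..),
      hc.J3_left, Category.assoc, ← Category.assoc (J3 ..), J3_assoc, hμ.J3_right rfl]
    rw [br_add_left, Category.assoc]
  braid_mul := by
    rw [← cancel_epi (α_ R R R).hom, Iso.hom_inv_id_assoc]
    refine hP.extJ3 (hP.tensor hP.self hP.self) fun n p q r h => ?_
    rw [← Category.assoc, J3_assoc, ← Category.assoc, hμ.J3_right rfl, hc.J2, ← Category.assoc,
      hc.J3_left, Category.assoc, ← Category.assoc (J3 ..), J3_assoc, ← Category.assoc (J3' ..),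
      hc.J3_right, Category.assoc, ← Category.assoc (J3' ..), J3'_assoc, hμ.J3_left rfl]
    rw [br_add_right, Category.assoc]
  counit_braid := hP.extJ2 hP.self fun n p q h => by
    rw [← Category.assoc, hc.J2, Category.assoc]
    by_cases hq : q = 0
    · subst hq
      obtain rfl : p = n := by lia
      rw [hε.J2_left, hε.J2_right, br_zero_right, Category.id_comp]
    · rw [← Category.assoc (J2 ..), hε.J2_left_zero hq, ← Category.assoc (J2 ..),
        hε.J2_right_zero hq]
      simp
  braid_counit := hP.extJ2 hP.self fun n p q h => by
    rw [← Category.assoc, hc.J2, Category.assoc]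
    by_cases hp : p = 0
    · subst hp
      obtain rfl : q = n := by lia
      rw [hε.J2_left, hε.J2_right, br_zero_left, Category.id_comp]
    · rw [← Category.assoc (J2 ..), hε.J2_right_zero hp, ← Category.assoc (J2 ..),
        hε.J2_left_zero hp]
      simp
  comul_braid := hP.extJ2 (hP.tensor hP.self (hP.tensor hP.self hP.self)) fun n m r h => by
    rw [← Category.assoc, hΔ.J2_left, ← Category.assoc (J2 ..), hc.J2, Category.assoc, hΔ.J2_right,
      Preadditive.sum_comp, Preadditive.comp_sum]
    refine Finset.sum_congr rfl fun x hx => ?_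
    rw [Finset.HasAntidiagonal.mem_antidiagonal] at hx
    rw [Category.assoc, ← Category.assoc (J3 ..), J3_assoc, ← Category.assoc (J3' ..),
      hc.J3_right, Category.assoc, ← Category.assoc (J3' ..), J3'_assoc, ← Category.assoc (J3 ..),
      hc.J3_left, Category.assoc, J3_assoc]
    have e := K.sh_br_left n x.1 x.2 r
    rw [hx] at e
    simp only [← Category.assoc] at e ⊢
    rw [e]
  braid_comul := hP.extJ2 (hP.tensor (hP.tensor hP.self hP.self) hP.self) fun n p m h => by
    rw [← Category.assoc, hΔ.J2_right, ← Category.assoc (J2 ..), hc.J2, Category.assoc, hΔ.J2_left,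
      Preadditive.sum_comp, Preadditive.comp_sum]
    refine Finset.sum_congr rfl fun x hx => ?_
    rw [Finset.HasAntidiagonal.mem_antidiagonal] at hx
    rw [Category.assoc, ← Category.assoc (J3' ..), J3'_assoc, ← Category.assoc (J3 ..),
      hc.J3_left, Category.assoc, ← Category.assoc (J3 ..), J3_assoc, ← Category.assoc (J3' ..),
      hc.J3_right, Category.assoc, J3'_assoc]
    have e := K.sh_br_right n p x.1 x.2
    rw [hx] at e
    simp only [← Category.assoc] at e ⊢
    rw [e]
  mul_comul := hP.extJ2 (hP.tensor hP.self hP.self) fun n p q h => by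
    rw [hΔ.mul hc hμ h, ← Category.assoc, hμ h, hΔ]
  one_comul := by
    have := hη.left 0
    rw [hη, Category.assoc, hΔ, ← hη, Finset.Nat.antidiagonal_zero, Finset.sum_singleton]
    rw [sh_zero_right, Category.id_comp, ← hη.left, ← Category.assoc, ← hη, leftUnitor_inv_naturality_assoc,
      MonoidalCategory.tensorHom_def']
  one_counit := by rw [hη, Category.assoc, hε.1, Iso.hom_inv_id]
  mul_counit := hP.extJ2 hP.unit fun n p q h => by
    rw [MonoidalCategory.tensorHom_def, Category.assoc, ← Category.assoc, hμ h]
    by_cases hp : p = 0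
    · subst hp
      obtain rfl : q = n := by lia
      rw [leftUnitor_naturality, ← Category.assoc (_ ▷ _), ← Category.assoc, hε.J2_left]
    · obtain ⟨n, rfl⟩ : ∃ m, n = m + 1 := ⟨n - 1, by lia⟩
      rw [← Category.assoc, hε.J2_left_zero hp, Limits.zero_comp, hε.2]

theorem antipode_left (hP : K.Separating j P) {μ : R ⊗ R ⟶ R} {η : 𝟙_ D ⟶ R}
    {Δ : R ⟶ R ⊗ R} {ε : R ⟶ 𝟙_ D} {S : R ⟶ R} (hμ : K.IsMul j μ) (hη : K.IsOne j η)
    (hΔ : K.IsComul j Δ) (hε : K.IsCounit j ε) (hS : K.IsAntipode j S) :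
    Δ ≫ S ▷ R ≫ μ = ε ≫ η := hP.ext₁ hP.self fun n => by
  rw [← Category.assoc, hΔ, Preadditive.sum_comp]
  have e : ∀ x ∈ Finset.HasAntidiagonal.antidiagonal n,
      (K.sh n 0 x.1 x.2 ≫ K.J2 j n x.1 x.2) ≫ S ▷ R ≫ μ =
        ((-1 : ℤ) ^ x.1 • (K.sh n 0 x.1 x.2 ≫ K.tw n 0 x.1)) ≫ j n := fun x hx => by
    rw [Finset.HasAntidiagonal.mem_antidiagonal] at hx
    have h₁ := left_inv hx (tw_left (K := K) hx (a := 0) (b := x.1) (by lia))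
    have : K.J2 j n x.1 x.2 ≫ S ▷ R = (-1 : ℤ) ^ x.1 • (K.tw n 0 x.1 ≫ K.J2 j n x.1 x.2) := by
      rw [K.J2_pos j hx, ← Category.assoc (K.tw ..), ← h₁, MonoidalCategory.tensorHom_def',
        Category.assoc, Category.assoc, Category.assoc, ← comp_whiskerRight, hS,
        zsmul_whiskerRight, Preadditive.comp_zsmul, Preadditive.comp_zsmul, comp_whiskerRight,
        whisker_exchange_assoc]
    rw [Category.assoc, ← Category.assoc (J2 ..), this, Preadditive.zsmul_comp, Category.assoc,
      hμ hx, Preadditive.comp_zsmul, Preadditive.zsmul_comp, Category.assoc]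
  rw [Finset.sum_congr rfl e, ← Preadditive.sum_comp]
  rcases n with _ | n
  · rw [← Category.assoc, hε.1, hη, Iso.inv_hom_id_assoc]
    simp [sh_zero_left, tw_zero]
  · rw [K.sum_tw_left, Limits.zero_comp, ← Category.assoc, hε.2, Limits.zero_comp]

theorem antipode_right (hP : K.Separating j P) {μ : R ⊗ R ⟶ R} {η : 𝟙_ D ⟶ R}
    {Δ : R ⟶ R ⊗ R} {ε : R ⟶ 𝟙_ D} {S : R ⟶ R} (hμ : K.IsMul j μ) (hη : K.IsOne j η)
    (hΔ : K.IsComul j Δ) (hε : K.IsCounit j ε) (hS : K.IsAntipode j S) :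
    Δ ≫ R ◁ S ≫ μ = ε ≫ η := hP.ext₁ hP.self fun n => by
  rw [← Category.assoc, hΔ, Preadditive.sum_comp]
  have e : ∀ x ∈ Finset.HasAntidiagonal.antidiagonal n,
      (K.sh n 0 x.1 x.2 ≫ K.J2 j n x.1 x.2) ≫ R ◁ S ≫ μ =
        ((-1 : ℤ) ^ x.2 • (K.sh n 0 x.1 x.2 ≫ K.tw n x.1 x.2)) ≫ j n := fun x hx => by
    rw [Finset.HasAntidiagonal.mem_antidiagonal] at hx
    have h₁ := right_inv hx (tw_right (K := K) hx (a := 0) (b := x.2) (by lia))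
    rw [add_zero] at h₁
    have : K.J2 j n x.1 x.2 ≫ R ◁ S = (-1 : ℤ) ^ x.2 • (K.tw n x.1 x.2 ≫ K.J2 j n x.1 x.2) := by
      rw [K.J2_pos j hx, ← Category.assoc (K.tw ..), ← h₁, MonoidalCategory.tensorHom_def,
        Category.assoc, Category.assoc, Category.assoc, ← MonoidalCategory.whiskerLeft_comp, hS,
        whiskerLeft_zsmul, Preadditive.comp_zsmul, Preadditive.comp_zsmul,
        MonoidalCategory.whiskerLeft_comp, ← whisker_exchange_assoc]
    rw [Category.assoc, ← Category.assoc (J2 ..), this, Preadditive.zsmul_comp, Category.assoc,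
      hμ hx, Preadditive.comp_zsmul, Preadditive.zsmul_comp, Category.assoc]
  rw [Finset.sum_congr rfl e, ← Preadditive.sum_comp]
  rcases n with _ | n
  · rw [← Category.assoc, hε.1, hη, Iso.inv_hom_id_assoc]
    simp [sh_zero_left, tw_zero]
  · rw [K.sum_tw_right, Limits.zero_comp, ← Category.assoc, hε.2, Limits.zero_comp]

end bialgebra

end Words

end Formal

section Formal

universe v w

open scoped MonObj ComonObj

variable {D : Type w} [Category.{v} D] [MonoidalCategory D]

lemma middle_natural {X X' Y Y' Z Z' X₁ X₁' Y₁ Y₁' Z₁ Z₁' : D} (f : X ⟶ X₁) (f' : X' ⟶ X₁')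
    (g : Y ⟶ Y₁) (g' : Y' ⟶ Y₁') (h : Z ⟶ Z₁) (h' : Z' ⟶ Z₁') (c : Y ⊗ Y' ⟶ Z ⊗ Z')
    (c₁ : Y₁ ⊗ Y₁' ⟶ Z₁ ⊗ Z₁') (H : (g ⊗ₘ g') ≫ c₁ = c ≫ (h ⊗ₘ h')) :
    ((f ⊗ₘ g) ⊗ₘ (g' ⊗ₘ f')) ≫ middle X₁ c₁ X₁' = middle X c X' ≫ ((f ⊗ₘ h) ⊗ₘ (h' ⊗ₘ f')) := by
  simp only [middle, Category.assoc, ← id_tensorHom, ← tensorHom_id]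
  rw [associator_naturality_assoc, ← associator_inv_naturality, tensorHom_comp_tensorHom_assoc,
    tensorHom_comp_tensorHom_assoc, associator_inv_naturality_assoc,
    tensorHom_comp_tensorHom_assoc, H, Category.comp_id, Category.id_comp]
  simp only [Category.assoc, ← associator_naturality, tensorHom_comp_tensorHom_assoc]
  simp

/-- `f` takes values in the elements of degree `n`, where `x n` is the grouplike element of
degree `n`. -/
def IsHomogeneous {C A X : D} (x : ℕ → (𝟙_ D ⟶ C)) (ρ : A ⟶ C ⊗ A) (n : ℕ) (f : X ⟶ A) : Prop :=
  f ≫ ρ = (λ_ X).inv ≫ (x n ⊗ₘ f)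

namespace IsHomogeneous

variable {C A B X Y : D} {x : ℕ → (𝟙_ D ⟶ C)} {ρ : A ⟶ C ⊗ A} {σ : B ⟶ C ⊗ B} {n : ℕ}

lemma comp {f : X ⟶ A} (hf : IsHomogeneous x ρ n f) (g : Y ⟶ X) :
    IsHomogeneous x ρ n (g ≫ f) := by
  unfold IsHomogeneous at *
  rw [Category.assoc, hf, leftUnitor_inv_naturality_assoc, ← id_tensorHom,
    tensorHom_comp_tensorHom, Category.id_comp]

lemma colinear {f : X ⟶ A} (hf : IsHomogeneous x ρ n f) {g : A ⟶ B}
    (hg : IsHomogeneous x σ n (f ≫ g)) : f ≫ g ≫ σ = f ≫ ρ ≫ C ◁ g := by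
  unfold IsHomogeneous at *
  rw [← Category.assoc, hg, ← Category.assoc f, hf, Category.assoc, ← id_tensorHom,
    tensorHom_comp_tensorHom, Category.comp_id]

lemma coassoc {δ : C ⟶ C ⊗ C} (hδ : x n ≫ δ = (λ_ (𝟙_ D)).inv ≫ (x n ⊗ₘ x n)) {f : X ⟶ A}
    (hf : IsHomogeneous x ρ n f) :
    f ≫ ρ ≫ δ ▷ A ≫ (α_ C C A).hom = f ≫ ρ ≫ C ◁ ρ := by
  unfold IsHomogeneous at *
  rw [← Category.assoc, hf, ← Category.assoc f, hf, Category.assoc, Category.assoc,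
    ← id_tensorHom, tensorHom_comp_tensorHom, Category.comp_id, hf, ← tensorHom_id,
    ← Category.assoc (_ ⊗ₘ _), tensorHom_comp_tensorHom, Category.comp_id, hδ]
  have e₁ : x n ⊗ₘ ((λ_ X).inv ≫ (x n ⊗ₘ f)) = 𝟙_ D ◁ (λ_ X).inv ≫ (x n ⊗ₘ (x n ⊗ₘ f)) := by
    rw [← id_tensorHom, tensorHom_comp_tensorHom, Category.id_comp]
  have e₂ : ((λ_ (𝟙_ D)).inv ≫ (x n ⊗ₘ x n)) ⊗ₘ f =
      (λ_ (𝟙_ D)).inv ▷ X ≫ ((x n ⊗ₘ x n) ⊗ₘ f) := by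
    rw [← tensorHom_id, tensorHom_comp_tensorHom, Category.id_comp]
  rw [e₁, e₂, Category.assoc, associator_naturality]
  simp only [← Category.assoc]
  congr 1
  monoidal

section Preadditive

variable [Preadditive D] [MonoidalPreadditive D]

lemma zero : IsHomogeneous x ρ n (0 : X ⟶ A) := by
  unfold IsHomogeneous
  rw [Limits.zero_comp, MonoidalPreadditive.tensor_zero, Limits.comp_zero]

lemma sum {I : Type*} (t : Finset I) {f : I → (X ⟶ A)} (hf : ∀ i ∈ t, IsHomogeneous x ρ n (f i)) :
    IsHomogeneous x ρ n (∑ i ∈ t, f i) := by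
  unfold IsHomogeneous at *
  rw [Preadditive.sum_comp, Words.tensorHom_sum, Preadditive.comp_sum]
  exact Finset.sum_congr rfl hf

lemma zsmul {f : X ⟶ A} (hf : IsHomogeneous x ρ n f) (m : ℤ) : IsHomogeneous x ρ n (m • f) := by
  unfold IsHomogeneous at *
  rw [Preadditive.zsmul_comp, hf, MonoidalCategory.tensorHom_def, MonoidalCategory.tensorHom_def,
    Words.whiskerLeft_zsmul, Preadditive.comp_zsmul, Preadditive.comp_zsmul]

end Preadditive

section Symmetric

variable [SymmetricCategory D]

lemma coact₂ {p q : ℕ} {f : X ⟶ A} {g : Y ⟶ B} (hf : IsHomogeneous x ρ p f)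
    (hg : IsHomogeneous x σ q g) : (f ⊗ₘ g) ≫ coact₂ ρ σ =
      (λ_ (X ⊗ Y)).inv ≫ (((λ_ (𝟙_ D)).inv ≫ (x p ⊗ₘ x q)) ⊗ₘ (f ⊗ₘ g)) := by
  unfold IsHomogeneous at *
  rw [_root_.coact₂, ← Category.assoc, tensorHom_comp_tensorHom, hf, hg,
    ← tensorHom_comp_tensorHom, Category.assoc]
  have e₂ : ((λ_ (𝟙_ D)).inv ≫ (x p ⊗ₘ x q)) ⊗ₘ (f ⊗ₘ g) =
      (λ_ (𝟙_ D)).inv ▷ (X ⊗ Y) ≫ ((x p ⊗ₘ x q) ⊗ₘ (f ⊗ₘ g)) := by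
    rw [← tensorHom_id, tensorHom_comp_tensorHom, Category.id_comp]
  have nat : ((x p ⊗ₘ f) ⊗ₘ (x q ⊗ₘ g)) ≫ middle C (β_ A C).hom B =
      middle (𝟙_ D) (β_ X (𝟙_ D)).hom Y ≫ ((x p ⊗ₘ x q) ⊗ₘ (f ⊗ₘ g)) :=
    middle_natural _ _ _ _ _ _ _ _ (BraidedCategory.braiding_naturality _ _)
  have nat' : ((λ_ X).inv ⊗ₘ (λ_ Y).inv) ≫ middle (𝟙_ D) (β_ X (𝟙_ D)).hom Y =
      (λ_ (X ⊗ Y)).inv ≫ (λ_ (𝟙_ D)).inv ▷ (X ⊗ Y) := by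
    rw [middle, braiding_tensorUnit_right]
    monoidal
  rw [e₂, nat, ← Category.assoc, nat', Category.assoc]

lemma tensor [MonObj C] (hx : ∀ p q, (x p ⊗ₘ x q) ≫ μ[C] = (λ_ (𝟙_ D)).hom ≫ x (p + q)) {p q : ℕ}
    {f : X ⟶ A} {g : Y ⟶ B} (hf : IsHomogeneous x ρ p f) (hg : IsHomogeneous x σ q g) :
    IsHomogeneous x (tensorCoact ρ σ) (p + q) (f ⊗ₘ g) := by
  unfold IsHomogeneous
  rw [tensorCoact, ← Category.assoc, hf.coact₂ hg, Category.assoc, ← tensorHom_id,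
    tensorHom_comp_tensorHom, Category.assoc, hx, Iso.inv_hom_id_assoc, Category.comp_id]

end Symmetric

end IsHomogeneous

namespace Words

variable [Preadditive D] [MonoidalPreadditive D] [SymmetricCategory D]
variable {K : Words D} {R : D} {j : ∀ n, K.W n ⟶ R} {P : D → Prop}

theorem isGradedHopf (hP : K.Separating j P) [MonObj R] [ComonObj R] {c : R ⊗ R ⟶ R ⊗ R}
    {S : R ⟶ R}
    (hμ : K.IsMul j μ[R]) (hη : K.IsOne j η[R]) (hΔ : K.IsComul j Δ[R]) (hε : K.IsCounit j ε[R])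
    (hc : K.IsBraid j c) (hS : K.IsAntipode j S) {C : D} [MonObj C] (hC : P C) {δ : C ⟶ C ⊗ C}
    {x : ℕ → (𝟙_ D ⟶ C)} (hx₀ : x 0 = η[C])
    (hx : ∀ p q, (x p ⊗ₘ x q) ≫ μ[C] = (λ_ (𝟙_ D)).hom ≫ x (p + q))
    (hδ : ∀ n, x n ≫ δ = (λ_ (𝟙_ D)).inv ≫ (x n ⊗ₘ x n)) {ρ : R ⟶ C ⊗ R}
    (hρ : ∀ n, IsHomogeneous x ρ n (j n)) : IsGradedHopf C δ R c ρ := by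
  have hJ : ∀ n p q, IsHomogeneous x (tensorCoact ρ ρ) n (K.J2 j n p q) := fun n p q => by
    by_cases h : p + q = n
    · rw [K.J2_pos j h]
      have := (hρ p).tensor hx (hρ q)
      rw [h] at this
      exact this.comp _
    · rw [J2, dif_neg h]
      exact .zero
  have hu : IsHomogeneous x (unitCoact C) 0 (𝟙 (𝟙_ D)) := by
    unfold IsHomogeneous
    rw [Category.id_comp, unitCoact, hx₀, tensorHom_id]
  exact
  { bialgebra := isPreBraidedBialgebra hP hμ hη hΔ hε hc
    coassoc := hP.ext₁ (hP.tensor hC (hP.tensor hC hP.self)) fun n => (hρ n).coassoc (hδ n)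
    one_colinear := by
      have := (hρ 0).comp K.u.hom
      rw [← hη] at this
      have h := hu.colinear (σ := ρ) (g := η[R]) (by rw [Category.id_comp]; exact this)
      rwa [Category.id_comp, Category.id_comp] at h
    mul_colinear := hP.extJ2 (hP.tensor hC hP.self) fun n p q h => (hJ n p q).colinear (by
      rw [hμ h]; exact hρ n)
    counit_colinear := hP.ext₁ (hP.tensor hC hP.unit) fun n => (hρ n).colinear (by
      rcases n with _ | n
      · rw [hε.1, ← Category.comp_id K.u.inv]
        exact hu.comp _
      · rw [hε.2]
        exact .zero)
    comul_colinear := hP.ext₁ (hP.tensor hC (hP.tensor hP.self hP.self)) fun n =>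
      (hρ n).colinear (by
        rw [hΔ]
        exact .sum _ fun y _ => (hJ n _ _).comp _)
    braid_colinear := hP.extJ2 (hP.tensor (hP.tensor hC hC) (hP.tensor hP.self hP.self))
      fun n p q h => by
        have key : ∀ p q, p + q = n → K.J2 j n p q ≫ coact₂ ρ ρ = (λ_ _).inv ≫
            (((λ_ (𝟙_ D)).inv ≫ (x p ⊗ₘ x q)) ⊗ₘ K.J2 j n p q) := fun p q h => by
          rw [K.J2_pos j h, Category.assoc, (hρ p).coact₂ (hρ q), leftUnitor_inv_naturality_assoc,
            ← id_tensorHom, tensorHom_comp_tensorHom, Category.id_comp]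
        have e : ((λ_ (𝟙_ D)).inv ≫ (x p ⊗ₘ x q)) ≫ (β_ C C).hom =
            (λ_ (𝟙_ D)).inv ≫ (x q ⊗ₘ x p) := by
          rw [Category.assoc, BraidedCategory.braiding_naturality, braiding_tensorUnit_right,
            ← unitors_equal]
          simp
        rw [← Category.assoc, hc.J2, Category.assoc, key q p (by lia), ← Category.assoc (K.J2 j n p q),
          key p q h, Category.assoc, tensorHom_comp_tensorHom, hc.J2, e,
          leftUnitor_inv_naturality_assoc, ← id_tensorHom, tensorHom_comp_tensorHom,
          Category.id_comp]
    antipode := ⟨S, antipode_left hP hμ hη hΔ hε hS, antipode_right hP hμ hη hΔ hε hS,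
      hP.ext₁ (hP.tensor hC hP.self) fun n => (hρ n).colinear (by
        rw [hS]
        exact ((hρ n).comp _).zsmul _)⟩ }

end Words

end Formal

section Formal

universe v w

open scoped MonObj ComonObj

variable {D : Type w} [Category.{v} D] [MonoidalCategory D]

namespace Words

variable [Preadditive D] {K : Words D} {R : D} {j : ∀ n, K.W n ⟶ R} {P : D → Prop}

/-- The map `s : R ⟶ W d` is the projection to words of length `d`. -/
structure IsProj (K : Words D) {R : D} (j : ∀ n, K.W n ⟶ R) (d : ℕ) (s : R ⟶ K.W d) : Prop where
  self : j d ≫ s = 𝟙 _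
  ne : ∀ n, n ≠ d → j n ≫ s = 0

/-- The maps `σ n : R ⟶ W n` are jointly monic and restrict to the symmetrizers. -/
structure IsSymmetrizer (K : Words D) {R : D} (j : ∀ n, K.W n ⟶ R) (σ : ∀ n, R ⟶ K.W n) :
    Prop where
  self : ∀ n, j n ≫ σ n = K.sym n 0 n
  ne : ∀ m n, m ≠ n → j m ≫ σ n = 0
  mono : ∀ {Z} (f g : Z ⟶ R), (∀ n, f ≫ σ n = g ≫ σ n) → f = g

lemma sym_zero (K : Words D) (n a : ℕ) : K.sym n a 0 = 𝟙 _ :=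
  BraidWord.sym_zero (A := End (K.W n)) ..
lemma sym_one (K : Words D) (n a : ℕ) : K.sym n a 1 = 𝟙 _ :=
  BraidWord.sym_one (A := End (K.W n)) ..
lemma sym_add (K : Words D) (p q : ℕ) : K.sh (p + q) 0 p q ≫ K.sym (p + q) 0 p ≫
    K.sym (p + q) p q = K.sym (p + q) 0 (p + q) := by
  have := BraidWord.sym_add (A := End (K.W (p + q))) (K.rels (p + q)) 0 p q
  rw [zero_add] at this
  exact this.symm

lemma IsSymmetrizer.isProj_zero {σ : ∀ n, R ⟶ K.W n} (hσ : K.IsSymmetrizer j σ) :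
    K.IsProj j 0 (σ 0) := ⟨by rw [hσ.self, sym_zero], fun n => hσ.ne n 0⟩

lemma IsSymmetrizer.isProj_one {σ : ∀ n, R ⟶ K.W n} (hσ : K.IsSymmetrizer j σ) :
    K.IsProj j 1 (σ 1) := ⟨by rw [hσ.self, sym_one], fun n => hσ.ne n 1⟩

theorem isPiece [MonoidalPreadditive D] (hP : K.Separating j P) {C : D} {x : ℕ → (𝟙_ D ⟶ C)}
    {ρ : R ⟶ C ⊗ R} (hρ : ∀ n, IsHomogeneous x ρ n (j n)) {d : ℕ} {t : C ⟶ 𝟙_ D}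
    (ht : x d ≫ t = 𝟙 _) (ht' : ∀ n, n ≠ d → x n ≫ t = 0) {s : R ⟶ K.W d}
    (hs : K.IsProj j d s) {W : D} (w : W ≅ K.W d) : IsPiece (x d) ρ (w.hom ≫ j d) := by
  have hp : ρ ≫ t ▷ R ≫ (λ_ R).hom = s ≫ j d := hP.ext₁ hP.self fun n => by
    have h := hρ n
    unfold IsHomogeneous at h
    rw [← Category.assoc, h, Category.assoc, tensorHom_unit]
    by_cases hn : n = d
    · subst hn
      rw [ht, ← Category.assoc (j n), hs.self]
      simp
    · rw [ht' n hn, ← Category.assoc (j n), hs.ne n hn]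
      simp
  have hi : (w.hom ≫ j d) ≫ ρ = (w.hom ≫ j d) ≫ (λ_ R).inv ≫ x d ▷ R := by
    have h := (hρ d).comp w.hom
    unfold IsHomogeneous at h
    rw [h, leftUnitor_inv_naturality_assoc, whisker_exchange, MonoidalCategory.tensorHom_def]
  refine ⟨hi, ⟨Limits.Fork.IsLimit.mk' _ fun e => ⟨e.ι ≫ s ≫ w.inv, ?_, ?_⟩⟩⟩
  · have h := e.condition
    have h' : e.ι ≫ ρ ≫ t ▷ R ≫ (λ_ R).hom = e.ι := by
      rw [← Category.assoc, h]
      simp only [Category.assoc]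
      rw [← comp_whiskerRight_assoc, ht]
      simp
    rw [hp] at h'
    simp only [Limits.Fork.ι_ofι, Category.assoc, Iso.inv_hom_id_assoc]
    exact h'
  · intro m hm
    rw [← hm, Limits.Fork.ι_ofι, Category.assoc, Category.assoc, ← Category.assoc (j d), hs.self,
      Category.id_comp, Iso.hom_inv_id, Category.comp_id]

theorem isPrimitives [MonoidalPreadditive D] (hP : K.Separating j P) (hW : ∀ n, P (K.W n))
    [MonObj R] [ComonObj R] (hη : K.IsOne j η[R]) (hΔ : K.IsComul j Δ[R]) {σ : ∀ n, R ⟶ K.W n}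
    (hσ : K.IsSymmetrizer j σ) {V : D} (w : V ≅ K.W 1) : IsPrimitives (w.hom ≫ j 1) := by
  have hσΔ : ∀ p q n (h : p + q = n), Δ[R] ≫ (σ p ⊗ₘ σ q) ≫ (K.g h).hom = σ n := by
    rintro p q _ rfl
    refine hP.ext₁ (hW _) fun n => ?_
    rw [← Category.assoc, hΔ, Preadditive.sum_comp]
    by_cases hn : n = p + q
    · subst hn
      rw [Finset.sum_eq_single (p, q), hσ.self, K.J2_pos j rfl, Category.assoc, Category.assoc,
        ← Category.assoc (_ ⊗ₘ _), tensorHom_comp_tensorHom, hσ.self, hσ.self,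
        MonoidalCategory.tensorHom_def, Category.assoc]
      · have h₁ := sym_left (K := K) (rfl : p + q = _) (a := 0) (b := p) (by lia)
        have h₂ := sym_right (K := K) (rfl : p + q = _) (a := 0) (b := q) (by lia)
        rw [add_zero] at h₂
        rw [h₂, ← Category.assoc (_ ▷ _), h₁, Category.assoc, Iso.inv_hom_id_assoc, sym_add]
      · intro y hy hne
        rw [Finset.HasAntidiagonal.mem_antidiagonal] at hy
        have : y.1 ≠ p := fun h => hne (Prod.ext h (by simp only; lia))
        rw [K.J2_pos j hy, Category.assoc, Category.assoc, ← Category.assoc (_ ⊗ₘ _),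
          tensorHom_comp_tensorHom, hσ.ne _ _ this, MonoidalPreadditive.zero_tensor]
        simp
      · intro h
        exact (h (by simp [Finset.HasAntidiagonal.mem_antidiagonal])).elim
    · rw [hσ.ne _ _ hn]
      refine Finset.sum_eq_zero fun y hy => ?_
      rw [Finset.HasAntidiagonal.mem_antidiagonal] at hy
      rw [K.J2_pos j hy, Category.assoc, Category.assoc, ← Category.assoc (_ ⊗ₘ _),
          tensorHom_comp_tensorHom]
      by_cases h1 : y.1 = p
      · rw [hσ.ne y.2 q (by lia), MonoidalPreadditive.tensor_zero]
        simp
      · rw [hσ.ne _ _ h1, MonoidalPreadditive.zero_tensor]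
        simp
  have hησ : ∀ n, n ≠ 0 → η[R] ≫ σ n = 0 := fun n hn => by
    rw [hη, Category.assoc, hσ.ne _ _ hn.symm, Limits.comp_zero]
  have hησ₀ : η[R] ≫ σ 0 = K.u.hom := by
    rw [hη, Category.assoc, hσ.isProj_zero.self, Category.comp_id]
  have hl : ∀ p q n (h : p + q = n), p ≠ 0 →
      ((λ_ R).inv ≫ η[R] ▷ R) ≫ (σ p ⊗ₘ σ q) ≫ (K.g h).hom = 0 := fun p q n h hp => by
    rw [← tensorHom_id, Category.assoc, ← Category.assoc (_ ⊗ₘ _), tensorHom_comp_tensorHom,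
      hησ p hp, MonoidalPreadditive.zero_tensor]
    simp
  have hr : ∀ p q n (h : p + q = n), q ≠ 0 →
      ((ρ_ R).inv ≫ R ◁ η[R]) ≫ (σ p ⊗ₘ σ q) ≫ (K.g h).hom = 0 := fun p q n h hq => by
    rw [← id_tensorHom, Category.assoc, ← Category.assoc (_ ⊗ₘ _), tensorHom_comp_tensorHom,
      hησ q hq, MonoidalPreadditive.tensor_zero]
    simp
  have hl₀ : ((λ_ R).inv ≫ η[R] ▷ R) ≫ (σ 0 ⊗ₘ σ 0) ≫ (K.g (zero_add 0)).hom = σ 0 := by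
    rw [← tensorHom_id, Category.assoc, ← Category.assoc (_ ⊗ₘ _), tensorHom_comp_tensorHom,
      hησ₀, Category.id_comp, MonoidalCategory.tensorHom_def', Category.assoc, K.unit_left,
      leftUnitor_naturality, Iso.inv_hom_id_assoc]
  have hr₀ : ((ρ_ R).inv ≫ R ◁ η[R]) ≫ (σ 0 ⊗ₘ σ 0) ≫ (K.g (zero_add 0)).hom = σ 0 := by
    rw [← id_tensorHom, Category.assoc, ← Category.assoc (_ ⊗ₘ _), tensorHom_comp_tensorHom,
      hησ₀, Category.id_comp, MonoidalCategory.tensorHom_def, Category.assoc, K.unit_right,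
      rightUnitor_naturality, Iso.inv_hom_id_assoc]
  have hi : (w.hom ≫ j 1) ≫ Δ[R] =
      (w.hom ≫ j 1) ≫ ((λ_ R).inv ≫ η[R] ▷ R + (ρ_ R).inv ≫ R ◁ η[R]) := by
    rw [Category.assoc, Category.assoc, hΔ, Preadditive.comp_add, hη.left, hη.right]
    congr 1
    rw [Finset.Nat.sum_antidiagonal_succ, Finset.Nat.antidiagonal_zero, Finset.sum_singleton,
      sh_zero_left, Category.id_comp]
    simp [sh_zero_right]
  refine ⟨hi, ⟨Limits.Fork.IsLimit.mk' _ fun e => ⟨e.ι ≫ σ 1 ≫ w.inv, ?_, ?_⟩⟩⟩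
  · have h := e.condition
    simp only [Limits.Fork.ι_ofι, Category.assoc, Iso.inv_hom_id_assoc]
    have h₀ : ∀ p q n (h : p + q = n), e.ι ≫ σ n =
        e.ι ≫ ((λ_ R).inv ≫ η[R] ▷ R) ≫ (σ p ⊗ₘ σ q) ≫ (K.g h).hom +
        e.ι ≫ ((ρ_ R).inv ≫ R ◁ η[R]) ≫ (σ p ⊗ₘ σ q) ≫ (K.g h).hom := fun p q n h' => by
      rw [← hσΔ p q n h', ← Category.assoc, h, Category.assoc, ← Preadditive.comp_add,
        ← Preadditive.add_comp]
    refine hσ.mono _ _ fun n => ?_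
    rw [Category.assoc, Category.assoc]
    by_cases h1 : n = 1
    · subst h1
      rw [hσ.isProj_one.self, Category.comp_id]
    · rw [hσ.ne 1 n (Ne.symm h1), Limits.comp_zero, Limits.comp_zero]
      symm
      rcases n with _ | n
      · have h := h₀ 0 0 0 rfl
        rw [hl₀, hr₀] at h
        exact left_eq_add.1 h
      · refine (h₀ 1 n (n + 1) (add_comm _ _)).trans ?_
        rw [hl _ _ _ _ one_ne_zero, hr _ _ _ _ (by lia)]
        simp
  · intro m hm
    rw [← hm, Limits.Fork.ι_ofι, Category.assoc, Category.assoc, ← Category.assoc (j 1),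
      hσ.isProj_one.self, Category.id_comp, Iso.hom_inv_id, Category.comp_id]

/-- Maps which agree on the subalgebra generated by words of length `1` agree on words. -/
theorem agree_of_agree [MonObj R] (hμ : K.IsMul j μ[R]) (hη : K.IsOne j η[R]) {V A : D}
    (w : V ≅ K.W 1) [MonObj A] (f : A ⟶ R) [IsMonHom f] (g : V ⟶ A) (hg : g ≫ f = w.hom ≫ j 1)
    {Z : D} {a b : R ⟶ Z} (h : f ≫ a = f ≫ b) (n : ℕ) : j n ≫ a = j n ≫ b := by
  have key : ∃ k : K.W n ⟶ A, k ≫ f = j n := by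
    induction n with
    | zero =>
      refine ⟨K.u.inv ≫ η[A], ?_⟩
      rw [Category.assoc, IsMonHom.one_hom, hη, Iso.inv_hom_id_assoc]
    | succ n ih =>
      obtain ⟨k, hk⟩ := ih
      refine ⟨(K.g rfl).inv ≫ (k ⊗ₘ (w.inv ≫ g)) ≫ μ[A], ?_⟩
      rw [Category.assoc, Category.assoc, IsMonHom.mul_hom, ← Category.assoc (_ ⊗ₘ _),
        tensorHom_comp_tensorHom, hk, Category.assoc, hg, Iso.inv_hom_id_assoc, ← hμ rfl,
        K.J2_pos j rfl, Category.assoc]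
  obtain ⟨k, hk⟩ := key
  rw [← hk, Category.assoc, h, Category.assoc]

theorem incl_braid {c : R ⊗ R ⟶ R ⊗ R} (hc : K.IsBraid j c) {V : D} (w : V ≅ K.W 1)
    {c₀ : V ⊗ V ⟶ V ⊗ V} (h₀ : c₀ ≫ (w.hom ⊗ₘ w.hom) ≫ (K.g (rfl : 1 + 1 = 2)).hom =
      (w.hom ⊗ₘ w.hom) ≫ (K.g rfl).hom ≫ K.s 2 0) :
    ((w.hom ≫ j 1) ⊗ₘ (w.hom ≫ j 1)) ≫ c = c₀ ≫ ((w.hom ≫ j 1) ⊗ₘ (w.hom ≫ j 1)) := by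
  have e : (w.hom ≫ j 1) ⊗ₘ (w.hom ≫ j 1) = (w.hom ⊗ₘ w.hom) ≫ (K.g rfl).hom ≫ K.J2 j 2 1 1 := by
    rw [K.J2_pos j (rfl : 1 + 1 = 2), Iso.hom_inv_id_assoc, tensorHom_comp_tensorHom]
  have hs : K.br 2 0 1 1 = K.s 2 0 := by
    rw [br]
    simp [BraidWord.mv_succ]
  rw [e, Category.assoc, Category.assoc, hc.J2, hs, ← Category.assoc (K.g rfl).hom,
    ← Category.assoc, ← h₀, Category.assoc, Category.assoc]

variable [MonoidalPreadditive D] [SymmetricCategory D]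

theorem isNicholsOver (hP : K.Separating j P) (hW : ∀ n, P (K.W n)) [MonObj R] [ComonObj R]
    {c : R ⊗ R ⟶ R ⊗ R} {S : R ⟶ R}
    (hμ : K.IsMul j μ[R]) (hη : K.IsOne j η[R]) (hΔ : K.IsComul j Δ[R]) (hε : K.IsCounit j ε[R])
    (hc : K.IsBraid j c) (hS : K.IsAntipode j S) {σ : ∀ n, R ⟶ K.W n} (hσ : K.IsSymmetrizer j σ)
    {C : D} [MonObj C] (hC : P C) {δ : C ⟶ C ⊗ C} {x : ℕ → (𝟙_ D ⟶ C)} (hx₀ : x 0 = η[C])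
    (hx : ∀ p q, (x p ⊗ₘ x q) ≫ μ[C] = (λ_ (𝟙_ D)).hom ≫ x (p + q))
    (hδ : ∀ n, x n ≫ δ = (λ_ (𝟙_ D)).inv ≫ (x n ⊗ₘ x n)) {t : ℕ → (C ⟶ 𝟙_ D)}
    (ht : ∀ n, x n ≫ t n = 𝟙 _) (ht' : ∀ m n, m ≠ n → x m ≫ t n = 0) {ρ : R ⟶ C ⊗ R}
    (hρ : ∀ n, IsHomogeneous x ρ n (j n)) {V : D} (w : V ≅ K.W 1) {c₀ : V ⊗ V ⟶ V ⊗ V}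
    (h₀ : c₀ ≫ (w.hom ⊗ₘ w.hom) ≫ (K.g (rfl : 1 + 1 = 2)).hom =
      (w.hom ⊗ₘ w.hom) ≫ (K.g rfl).hom ≫ K.s 2 0)
    (hc₀ : IsPreBraiding c₀) (hV : IsFlat V) (hR : IsFlat R) :
    IsNicholsOver C δ (x 1) c₀ R c ρ (w.hom ≫ j 1) where
  flat_base := hV
  preBraiding := hc₀
  grouplike := hδ 1
  flat := hR
  hopf := isGradedHopf hP hμ hη hΔ hε hc hS hC hx₀ hx hδ hρ
  piece_zero := by
    have := isPiece hP hρ (ht 0) (fun n => ht' n 0) hσ.isProj_zero K.u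
    rwa [hx₀, ← hη] at this
  piece_one := isPiece hP hρ (ht 1) (fun n => ht' n 1) hσ.isProj_one w
  primitives := isPrimitives hP hW hη hΔ hσ w
  incl_braid := incl_braid hc w h₀

end Words

end Formal

section Formal

universe v w

variable {D : Type w} [Category.{v} D] [MonoidalCategory D]

/-! ### Tensor powers of an object -/

/-- Objects `T n` with isomorphisms `T 0 ≅ 𝟙` and `T (n + 1) ≅ T n ⊗ V`. -/
structure TensorPowers (V : D) where
  T : ℕ → D
  o : 𝟙_ D ≅ T 0
  e : ∀ n, T n ⊗ V ≅ T (n + 1)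

namespace TensorPowers

variable {V : D} (X : TensorPowers V)

/-- Concatenation of words. -/
def catIso (m : ℕ) : ∀ n, X.T m ⊗ X.T n ≅ X.T (m + n)
  | 0 => whiskerLeftIso (X.T m) X.o.symm ≪≫ ρ_ (X.T m)
  | n + 1 => whiskerLeftIso (X.T m) (X.e n).symm ≪≫ (α_ (X.T m) (X.T n) V).symm ≪≫
      whiskerRightIso (catIso m n) V ≪≫ X.e (m + n)

/-- Words of lengths `p` and `q` form words of length `n = p + q`. -/
def cat {p q n : ℕ} (h : p + q = n) : X.T p ⊗ X.T q ≅ X.T n :=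
  X.catIso p q ≪≫ eqToIso (congrArg X.T h)

lemma cat_rfl (p q : ℕ) : (X.cat (rfl : p + q = _)).hom = (X.catIso p q).hom :=
  Category.comp_id _

lemma cat_zero (p : ℕ) : (X.cat (add_zero p)).hom = X.T p ◁ X.o.inv ≫ (ρ_ _).hom :=
  X.cat_rfl p 0

lemma cat_succ {p q n : ℕ} (h : p + q = n) : (X.cat (show p + (q + 1) = n + 1 by lia)).hom =
    X.T p ◁ (X.e q).inv ≫ (α_ _ _ _).inv ≫ (X.cat h).hom ▷ V ≫ (X.e n).hom := by
  subst h
  refine (X.cat_rfl p (q + 1)).trans ?_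
  rw [cat_rfl]
  rfl

lemma cat_assoc {p q r m n N : ℕ} (h₁ : p + q = m) (h₂ : m + r = N) (h₃ : q + r = n)
    (h₄ : p + n = N) : (X.cat h₁).hom ▷ X.T r ≫ (X.cat h₂).hom =
      (α_ _ _ _).hom ≫ X.T p ◁ (X.cat h₃).hom ≫ (X.cat h₄).hom := by
  induction r generalizing n N with
  | zero =>
    obtain rfl : q = n := h₃
    obtain rfl : m = N := h₂
    rw [cat_zero, cat_zero, ← whisker_exchange_assoc, rightUnitor_naturality]
    simp
  | succ r ih =>
    obtain rfl : q + (r + 1) = n := h₃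
    obtain rfl : m + (r + 1) = N := h₂
    have h₄' : p + (q + r) = m + r := by lia
    rw [X.cat_succ (rfl : m + r = m + r), X.cat_succ (rfl : q + r = q + r), X.cat_succ h₄']
    have := congrArg (· ▷ V) (ih rfl rfl h₄')
    simp only [comp_whiskerRight] at this
    rw [← whisker_exchange_assoc, associator_inv_naturality_left_assoc, reassoc_of% this]
    simp

lemma unit_left (n : ℕ) : X.o.hom ▷ X.T n ≫ (X.cat (zero_add n)).hom = (λ_ _).hom := by
  induction n with
  | zero =>
    rw [show (X.cat (zero_add 0)).hom = _ from X.cat_zero 0, ← whisker_exchange_assoc,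
      rightUnitor_naturality, ← unitors_equal, leftUnitor_naturality_assoc]
    simp
  | succ n ih =>
    rw [X.cat_succ (zero_add n), ← whisker_exchange_assoc, associator_inv_naturality_left_assoc,
      ← comp_whiskerRight_assoc, ih]
    simp

lemma unit_right (n : ℕ) : X.T n ◁ X.o.hom ≫ (X.cat (add_zero n)).hom = (ρ_ _).hom := by
  rw [cat_zero]
  simp

/-- A letter is a word of length `1`. -/
def letter : V ≅ X.T 1 := (λ_ V).symm ≪≫ whiskerRightIso X.o V ≪≫ X.e 0

lemma cat_letter (n : ℕ) : X.T n ◁ X.letter.hom ≫ (X.cat (rfl : n + 1 = _)).hom = (X.e n).hom := by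
  rw [show (X.cat (rfl : n + 1 = _)).hom = _ from X.cat_succ (add_zero n), cat_zero, letter]
  simp

section braid

variable (c : V ⊗ V ⟶ V ⊗ V)

/-- The last two letters of a word. -/
def lastTwo (n : ℕ) : X.T n ⊗ (V ⊗ V) ≅ X.T (n + 2) :=
  (α_ _ _ _).symm ≪≫ whiskerRightIso (X.e n) V ≪≫ X.e (n + 1)

variable [Preadditive D]

/-- The action of `c` on the letters `i`, `i + 1` of words of length `n` (and `0` if there are no
such letters). -/
def braidLetter : ∀ n : ℕ, ℕ → (X.T n ⟶ X.T n)
  | 0, _ => 0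
  | 1, _ => 0
  | n + 2, i => if i = n then (X.lastTwo n).inv ≫ X.T n ◁ c ≫ (X.lastTwo n).hom
      else (X.e (n + 1)).inv ≫ braidLetter (n + 1) i ▷ V ≫ (X.e (n + 1)).hom

lemma braidLetter_last (n : ℕ) : X.braidLetter c (n + 2) n =
    (X.lastTwo n).inv ≫ X.T n ◁ c ≫ (X.lastTwo n).hom := by rw [braidLetter, if_pos rfl]

lemma braidLetter_succ {n i : ℕ} (h : i + 1 < n) : X.braidLetter c (n + 1) i =
    (X.e n).inv ≫ X.braidLetter c n i ▷ V ≫ (X.e n).hom := by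
  obtain ⟨n, rfl⟩ : ∃ m, n = m + 1 := ⟨n - 1, by lia⟩
  rw [braidLetter, if_neg (by lia)]

variable [MonoidalPreadditive D]

lemma braidLetter_eq_zero : ∀ {n i : ℕ}, n ≤ i + 1 → X.braidLetter c n i = 0
  | 0, _, _ => rfl
  | 1, _, _ => rfl
  | n + 2, i, h => by
    rw [braidLetter, if_neg (by lia), braidLetter_eq_zero (by lia),
      MonoidalPreadditive.zero_whiskerRight, Limits.zero_comp, Limits.comp_zero]

lemma braidLetter_comm : ∀ {n i l : ℕ}, i + 2 ≤ l →
    X.braidLetter c n i ≫ X.braidLetter c n l = X.braidLetter c n l ≫ X.braidLetter c n i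
  | 0, _, _, _ => by simp [braidLetter]
  | 1, _, _, _ => by simp [braidLetter]
  | n + 2, i, l, h => by
    rcases lt_trichotomy l n with hl | rfl | hl
    · rw [X.braidLetter_succ c (show i + 1 < n + 1 by lia), X.braidLetter_succ c
        (show l + 1 < n + 1 by lia)]
      have := congrArg (· ▷ V) (braidLetter_comm (n := n + 1) h)
      simp only [comp_whiskerRight] at this
      simp [reassoc_of% this]
    · rw [X.braidLetter_succ c (show i + 1 < l + 1 by lia), X.braidLetter_succ c
        (show i + 1 < l by lia), braidLetter_last, lastTwo]
      simp only [Category.assoc, Iso.trans_inv, Iso.trans_hom, Iso.symm_hom, Iso.symm_inv,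
        whiskerRightIso_hom, whiskerRightIso_inv, comp_whiskerRight, hom_inv_whiskerRight_assoc,
        Iso.hom_inv_id_assoc]
      rw [associator_naturality_left_assoc, ← whisker_exchange_assoc,
        associator_inv_naturality_left_assoc]
    · rw [X.braidLetter_eq_zero c (show n + 2 ≤ l + 1 by lia), Limits.zero_comp, Limits.comp_zero]

variable {c}

lemma braidLetter_braid (hc : IsPreBraiding c) : ∀ {n i : ℕ},
    X.braidLetter c n i ≫ X.braidLetter c n (i + 1) ≫ X.braidLetter c n i =
      X.braidLetter c n (i + 1) ≫ X.braidLetter c n i ≫ X.braidLetter c n (i + 1)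
  | 0, _ => by simp [braidLetter]
  | 1, _ => by simp [braidLetter]
  | n + 2, i => by
    rcases lt_trichotomy (i + 1) n with hl | rfl | hl
    · rw [X.braidLetter_succ c (show i + 1 < n + 1 by lia), X.braidLetter_succ c
        (show i + 1 + 1 < n + 1 by lia)]
      have := congrArg (· ▷ V) (braidLetter_braid hc (n := n + 1) (i := i))
      simp only [comp_whiskerRight] at this
      simp [reassoc_of% this]
    · have h₁ : X.braidLetter c (i + 1 + 2) i =
          ((X.e (i + 2)).inv ≫ (X.e (i + 1)).inv ▷ V ≫ (X.e i).inv ▷ V ▷ V ≫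
            (α_ (X.T i) V V).hom ▷ V ≫ (α_ _ _ _).hom) ≫ X.T i ◁ (c ▷ V) ≫
            ((α_ _ _ _).inv ≫ (α_ (X.T i) V V).inv ▷ V ≫ (X.e i).hom ▷ V ▷ V ≫
              (X.e (i + 1)).hom ▷ V ≫ (X.e (i + 2)).hom) := by
        rw [X.braidLetter_succ c (show i + 1 < i + 2 by lia), braidLetter_last, lastTwo]
        simp
      have h₂ : X.braidLetter c (i + 1 + 2) (i + 1) =
          ((X.e (i + 2)).inv ≫ (X.e (i + 1)).inv ▷ V ≫ (X.e i).inv ▷ V ▷ V ≫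
            (α_ (X.T i) V V).hom ▷ V ≫ (α_ _ _ _).hom) ≫
            X.T i ◁ ((α_ _ _ _).hom ≫ V ◁ c ≫ (α_ _ _ _).inv) ≫
            ((α_ _ _ _).inv ≫ (α_ (X.T i) V V).inv ▷ V ≫ (X.e i).hom ▷ V ▷ V ≫
              (X.e (i + 1)).hom ▷ V ≫ (X.e (i + 2)).hom) := by
        rw [braidLetter_last, lastTwo]
        have : (X.e i).inv ▷ (V ⊗ V) ≫ (X.T i ⊗ V) ◁ c ≫ (X.e i).hom ▷ (V ⊗ V) =
            X.T (i + 1) ◁ c := by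
          rw [← whisker_exchange_assoc, inv_hom_whiskerRight, Category.comp_id]
        rw [← this]
        simp
      have h₃ : ∀ {Z} (f : _ ⟶ Z), (α_ _ _ _).inv ≫ (α_ (X.T i) V V).inv ▷ V ≫
          (X.e i).hom ▷ V ▷ V ≫ (X.e (i + 1)).hom ▷ V ≫ (X.e (i + 2)).hom ≫
          (X.e (i + 2)).inv ≫ (X.e (i + 1)).inv ▷ V ≫ (X.e i).inv ▷ V ▷ V ≫
            (α_ (X.T i) V V).hom ▷ V ≫ (α_ _ _ _).hom ≫ f = f := fun f => by
        simp
      rw [h₁, h₂]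
      have := congrArg (X.T i ◁ ·) hc
      simp only [Category.assoc, MonoidalCategory.whiskerLeft_comp] at this ⊢
      simp only [h₃]
      rw [reassoc_of% this]
    · rw [X.braidLetter_eq_zero c (show n + 2 ≤ i + 1 + 1 by lia)]
      simp

omit [MonoidalPreadditive D] in
lemma braidLetter_left {p q n i : ℕ} (h : p + q = n) (hi : i + 1 < p) :
    X.braidLetter c p i ▷ X.T q ≫ (X.cat h).hom = (X.cat h).hom ≫ X.braidLetter c n i := by
  induction q generalizing n with
  | zero =>
    obtain rfl : p = n := h
    rw [cat_zero, ← whisker_exchange_assoc]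
    simp
  | succ q ih =>
    obtain ⟨n, rfl⟩ : ∃ m, n = m + 1 := ⟨n - 1, by lia⟩
    have h' : p + q = n := by lia
    have := congrArg (· ▷ V) (ih h')
    simp only [comp_whiskerRight] at this
    rw [X.cat_succ h', X.braidLetter_succ c (show i + 1 < n by lia), ← whisker_exchange_assoc,
      associator_inv_naturality_left_assoc, reassoc_of% this]
    simp

omit [MonoidalPreadditive D] in
lemma braidLetter_right {p q n i : ℕ} (h : p + q = n) (hi : i + 1 < q) :
    X.T p ◁ X.braidLetter c q i ≫ (X.cat h).hom = (X.cat h).hom ≫ X.braidLetter c n (p + i) := by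
  induction q generalizing n with
  | zero => lia
  | succ q ih =>
    obtain ⟨n, rfl⟩ : ∃ m, n = m + 1 := ⟨n - 1, by lia⟩
    have h' : p + q = n := by lia
    by_cases hq : i + 1 < q
    · have := congrArg (· ▷ V) (ih h' hq)
      simp only [comp_whiskerRight] at this
      rw [X.cat_succ h', X.braidLetter_succ c (show p + i + 1 < n by lia), X.braidLetter_succ c hq]
      simp only [MonoidalCategory.whiskerLeft_comp, Category.assoc, whiskerLeft_hom_inv_assoc,
        Iso.hom_inv_id_assoc]
      rw [associator_inv_naturality_middle_assoc, reassoc_of% this]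
    · obtain rfl : q = i + 1 := by lia
      obtain ⟨n, rfl⟩ : ∃ m, n = m + 1 := ⟨n - 1, by lia⟩
      have h'' : p + i = n := by lia
      rw [X.cat_succ h', X.cat_succ h'', h'', braidLetter_last, braidLetter_last, lastTwo, lastTwo]
      simp only [MonoidalCategory.whiskerLeft_comp, Category.assoc, whiskerLeft_hom_inv_assoc,
        Iso.hom_inv_id_assoc, Iso.trans_inv, Iso.trans_hom, Iso.symm_hom, Iso.symm_inv,
        whiskerRightIso_hom, whiskerRightIso_inv, comp_whiskerRight, hom_inv_whiskerRight_assoc]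
      rw [associator_naturality_left_assoc, ← whisker_exchange_assoc,
        associator_inv_naturality_left_assoc, associator_inv_naturality_middle_assoc,
        ← comp_whiskerRight_assoc (X.T p ◁ (X.e i).hom), whiskerLeft_hom_inv, id_whiskerRight,
        Category.id_comp, ← associator_inv_naturality_middle_assoc]
      simp

variable (c) in
/-- The tensor powers of a pre-braided object, as words. -/
abbrev words (hc : IsPreBraiding c) : Words D where
  W := X.T
  u := X.o
  g := X.cat
  s := X.braidLetter c
  rels _ :=
    { comm := fun _ _ h => (X.braidLetter_comm c h).symm
      braid := fun _ => X.braidLetter_braid hc }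
  assoc := X.cat_assoc
  unit_left := X.unit_left
  unit_right := X.unit_right
  s_left := X.braidLetter_left
  s_right := X.braidLetter_right

end braid

end TensorPowers

end Formal

section Formal

universe v w

variable {D : Type w} [Category.{v} D] [MonoidalCategory D]

namespace TensorPowers

variable {V : D} (X : TensorPowers V) (c : V ⊗ V ⟶ V ⊗ V)

/-- A word moves past a letter. -/
def braidOne : ∀ n, X.T n ⊗ V ⟶ V ⊗ X.T n
  | 0 => X.o.inv ▷ V ≫ (λ_ V).hom ≫ (ρ_ V).inv ≫ V ◁ X.o.hom
  | n + 1 => (X.e n).inv ▷ V ≫ (α_ _ _ _).hom ≫ X.T n ◁ c ≫ (α_ _ _ _).inv ≫ braidOne n ▷ V ≫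
      (α_ _ _ _).hom ≫ V ◁ (X.e n).hom

/-- A word moves past a word. -/
def braidPow (n : ℕ) : ∀ m, X.T n ⊗ X.T m ⟶ X.T m ⊗ X.T n
  | 0 => X.T n ◁ X.o.inv ≫ (ρ_ _).hom ≫ (λ_ _).inv ≫ X.o.hom ▷ X.T n
  | m + 1 => X.T n ◁ (X.e m).inv ≫ (α_ _ _ _).inv ≫ braidPow n m ▷ V ≫ (α_ _ _ _).hom ≫
      X.T m ◁ X.braidOne c n ≫ (α_ _ _ _).inv ≫ (X.e m).hom ▷ X.T n

lemma tensor_letter {A B : D} (n : ℕ) (f : X.T n ⟶ A) (g : X.T 1 ⟶ B) :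
    f ⊗ₘ X.letter.hom ≫ g = (X.e n).hom ≫ (X.cat (rfl : n + 1 = _)).inv ≫ (f ⊗ₘ g) := by
  rw [← X.cat_letter, Category.assoc, Iso.hom_inv_id_assoc, ← id_tensorHom,
    tensorHom_comp_tensorHom, Category.id_comp]

variable [Preadditive D] [MonoidalPreadditive D] {c} (hc : IsPreBraiding c)

lemma br_e {a p q m : ℕ} (h : a + p + q ≤ m) : (X.words c hc).br m a p q ▷ V ≫ (X.e m).hom =
    (X.e m).hom ≫ (X.words c hc).br (m + 1) a p q := by
  have h₁ := Words.br_left (K := X.words c hc) (rfl : m + 1 = _) h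
  rw [← X.cat_letter, ← whisker_exchange_assoc, Category.assoc]
  exact congrArg (X.T m ◁ X.letter.hom ≫ ·) h₁

omit [Preadditive D] [MonoidalPreadditive D] in
lemma letter_cat (n : ℕ) : (X.letter.hom ▷ (X.T n ⊗ V) ≫ X.T 1 ◁ (X.e n).hom) ≫
    (X.cat (show 1 + (n + 1) = n + 1 + 1 by lia)).hom =
    (α_ _ _ _).inv ≫ (X.letter.hom ▷ X.T n ≫ (X.cat (add_comm 1 n)).hom) ▷ V ≫
      (X.e (n + 1)).hom := by
  rw [X.cat_succ (add_comm 1 n)]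
  simp

lemma braidOne_cat : ∀ n, X.braidOne c n ≫ X.letter.hom ▷ X.T n ≫ (X.cat (add_comm 1 n)).hom =
    (X.e n).hom ≫ (X.words c hc).br (n + 1) 0 n 1
  | 0 => by
    rw [braidOne]
    simp only [Category.assoc, whisker_exchange_assoc]
    rw [show (X.cat (add_comm 1 0)).hom = (X.cat (add_zero 1)).hom from rfl, X.unit_right 1,
      rightUnitor_naturality, Iso.inv_hom_id_assoc, letter, Words.br, BraidWord.br_zero_left]
    simp only [Iso.trans_hom, Iso.symm_hom, Iso.hom_inv_id_assoc, whiskerRightIso_hom,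
      inv_hom_whiskerRight_assoc]
    exact (Category.comp_id _).symm
  | n + 1 => by
    have h₁ : (X.words c hc).br (n + 1 + 1) 0 (n + 1) 1 =
        X.braidLetter c (n + 2) n ≫ (X.words c hc).br (n + 1 + 1) 0 n 1 := by
      rw [Words.br, Words.br, BraidWord.br_one_right, BraidWord.br_one_right, BraidWord.mv_succ,
        zero_add]
      rfl
    have h₂ := congrArg (· ▷ V) (braidOne_cat n)
    rw [braidOne]
    simp only [Category.assoc, comp_whiskerRight] at h₂ ⊢
    rw [whisker_exchange_assoc, ← Category.assoc (X.letter.hom ▷ _), letter_cat, h₁,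
      Iso.hom_inv_id_assoc, comp_whiskerRight, Category.assoc, reassoc_of% h₂, X.br_e hc (by lia),
      braidLetter_last, lastTwo]
    simp

lemma braidPow_cat (p : ℕ) : ∀ {q n : ℕ} (h : p + q = n),
    X.braidPow c p q ≫ (X.cat (show q + p = n by lia)).hom =
      (X.cat h).hom ≫ (X.words c hc).br n 0 p q
  | 0, n, h => by
    obtain rfl : p = n := h
    have h₁ := X.unit_left p
    rw [braidPow, Words.br, BraidWord.br_zero, cat_zero]
    simp only [Category.assoc]
    rw [h₁, Iso.inv_hom_id]
    rfl
  | q + 1, n, h => by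
    obtain ⟨n, rfl⟩ : ∃ m, n = m + 1 := ⟨n - 1, by lia⟩
    have h' : p + q = n := by lia
    have h₁ : (X.words c hc).br (n + 1) 0 p (q + 1) =
        (X.words c hc).br (n + 1) 0 p q ≫ (X.words c hc).br (n + 1) q p 1 := by
      rw [Words.br, Words.br, Words.br, BraidWord.br_one_right, BraidWord.br, zero_add]
      rfl
    have h₂ := congrArg (· ▷ V) (braidPow_cat p h')
    have h₃ := congrArg (X.T q ◁ ·) (X.braidOne_cat hc p)
    have h₄ := Words.br_right (K := X.words c hc) (show q + (p + 1) = n + 1 by lia) (a := 0)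
      (b := p) (c := 1) (by lia)
    have h₅ : (X.e q).hom ▷ X.T p ≫ (X.cat (show q + 1 + p = n + 1 by lia)).hom =
        (X.T q ◁ X.letter.hom) ▷ X.T p ≫ (α_ _ _ _).hom ≫ X.T q ◁ (X.cat (add_comm 1 p)).hom ≫
          (X.cat (show q + (p + 1) = n + 1 by lia)).hom := by
      rw [← X.cat_letter, comp_whiskerRight, Category.assoc, X.cat_assoc _ _ (add_comm 1 p)]
    rw [braidPow, X.cat_succ h', h₁]
    simp only [Category.assoc, comp_whiskerRight, MonoidalCategory.whiskerLeft_comp] at h₂ h₃ h₄ ⊢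
    rw [h₅]
    simp only [whisker_assoc, Category.assoc, Iso.inv_hom_id_assoc]
    rw [reassoc_of% h₃]
    rw [add_zero] at h₄
    erw [h₄]
    rw [← Category.assoc (X.T q ◁ (X.e p).hom)]
    have h₆ : X.T q ◁ (X.e p).hom ≫ (X.cat (show q + (p + 1) = n + 1 by lia)).hom =
        (α_ _ _ _).inv ≫ (X.cat (show q + p = n by lia)).hom ▷ V ≫ (X.e n).hom := by
      rw [X.cat_succ (show q + p = n by lia)]
      simp
    rw [h₆]
    simp only [Category.assoc, Iso.hom_inv_id_assoc]
    rw [reassoc_of% h₂, ← Category.assoc (_ ▷ V) (X.e n).hom, X.br_e hc (by lia)]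
    simp

end TensorPowers

end Formal

namespace Ban

variable {k : Type u} [NormedField k] [CompleteSpace k]

instance : MonoidalPreadditive (Ban k) where
  whiskerLeft_zero := ext₂ fun x y => by
    rw [whiskerLeft_otm, zero_apply, zero_apply]
    exact map_zero (tmulLeft x).lin
  zero_whiskerRight := ext₂ fun x y => by
    rw [whiskerRight_otm, zero_apply, zero_apply]
    exact map_zero (tmulRight y).lin
  whiskerLeft_add f g := ext₂ fun x y => by
    rw [whiskerLeft_otm, add_apply, add_apply, whiskerLeft_otm, whiskerLeft_otm]
    exact tmul_add _ _ _
  add_whiskerRight f g := ext₂ fun x y => by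
    rw [whiskerRight_otm, add_apply, add_apply, whiskerRight_otm, whiskerRight_otm]
    exact add_tmul _ _ _

section

variable (V : Ban k)

/-- The tensor powers of a Banach space. -/
abbrev powers : TensorPowers V where
  T := tpow V
  o := Iso.refl _
  e _ := Iso.refl _

lemma powers_catIso (p : ℕ) : ∀ q, ((powers V).catIso p q).hom = concat V p q
  | 0 => by
    rw [TensorPowers.catIso, concat]
    exact (congrArg (· ≫ _) (whiskerLeft_id (tpow V p) (𝟙_ (Ban k)))).trans (Category.id_comp _)
  | q + 1 => by
    rw [TensorPowers.catIso, concat, ← powers_catIso p q]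
    refine (congrArg (· ≫ _) (whiskerLeft_id (tpow V p) (tpow V q ⊗ V))).trans
      ((Category.id_comp _).trans (congrArg ((α_ _ _ _).inv ≫ ·) (Category.comp_id _)))

lemma powers_cat (p q : ℕ) : ((powers V).cat (rfl : p + q = _)).hom = concat V p q := by
  rw [TensorPowers.cat_rfl, powers_catIso]

variable {V} (c : V ⊗ V ⟶ V ⊗ V)

lemma powers_braidOne : ∀ n, (powers V).braidOne c n = braidOne c n
  | 0 => by
    rw [TensorPowers.braidOne, braidOne]
    refine (congrArg (· ≫ _) (id_whiskerRight (𝟙_ (Ban k)) V)).trans ((Category.id_comp _).trans ?_)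
    refine congrArg (_ ≫ ·) ((congrArg (_ ≫ ·) (whiskerLeft_id V (𝟙_ (Ban k)))).trans
      (Category.comp_id _))
  | n + 1 => by
    rw [TensorPowers.braidOne, braidOne, powers_braidOne n]
    refine (congrArg (· ≫ _) (id_whiskerRight (tpow V n ⊗ V) V)).trans
      ((Category.id_comp _).trans ?_)
    refine congrArg (_ ≫ ·) (congrArg (_ ≫ ·) (congrArg (_ ≫ ·) (congrArg (_ ≫ ·) ?_)))
    exact (congrArg (_ ≫ ·) (whiskerLeft_id V (tpow V n ⊗ V))).trans (Category.comp_id _)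

lemma powers_braidPow (n : ℕ) : ∀ m, (powers V).braidPow c n m = braidPow c n m
  | 0 => by
    rw [TensorPowers.braidPow, braidPow]
    refine (congrArg (· ≫ _) (whiskerLeft_id (tpow V n) (𝟙_ (Ban k)))).trans
      ((Category.id_comp _).trans ?_)
    refine congrArg (_ ≫ ·) ((congrArg (_ ≫ ·) (id_whiskerRight (𝟙_ (Ban k)) (tpow V n))).trans
      (Category.comp_id _))
  | m + 1 => by
    rw [TensorPowers.braidPow, braidPow, powers_braidPow n m, powers_braidOne]
    refine (congrArg (· ≫ _) (whiskerLeft_id (tpow V n) (tpow V m ⊗ V))).trans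
      ((Category.id_comp _).trans ?_)
    refine congrArg (_ ≫ ·) (congrArg (_ ≫ ·) (congrArg (_ ≫ ·) (congrArg (_ ≫ ·) ?_)))
    exact (congrArg (_ ≫ ·) (id_whiskerRight (tpow V m ⊗ V) (tpow V n))).trans (Category.comp_id _)

variable {c} (hc : IsPreBraiding c) (hc1 : NormLE c 1)

/-- Words in `V`. -/
abbrev words : Words (Ban k) := (powers V).words c hc

lemma words_g (p q : ℕ) : ((words hc).g (rfl : p + q = _)).hom = concat V p q := powers_cat V p q

lemma braidPow_words (p q n : ℕ) (h : p + q = n) :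
    braidPow c p q ≫ ((words hc).g (show q + p = n by lia)).hom =
      ((words hc).g h).hom ≫ (words hc).br n 0 p q := by
  rw [← powers_braidPow]
  exact (powers V).braidPow_cat hc p h

lemma tensMul_isMul (r : Radius.{u}) : (words hc).IsMul (incl r (tpow V)) (tensMul V r) := by
  rintro _ p q rfl
  rw [Words.J2_pos _ _ rfl, Category.assoc, Iso.inv_comp_eq, words_g]
  exact ext₂ fun x y => (congrArg _ (tensorHom_otm _ _ x y)).trans (geomMul_incl _ _ _ _ _ _ _ _)

/-- The pre-braiding of tensor algebras of different radii. -/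
lemma words_tensBraid (r s : Radius.{u}) (n p q : ℕ) (h : p + q = n) :
    ((words hc).g h).inv ≫ (incl r (tpow V) p ⊗ₘ incl s (tpow V) q) ≫ tensBraid hc1 r s =
      (words hc).br n 0 p q ≫ ((words hc).g (show q + p = n by lia)).inv ≫
        (incl s (tpow V) q ⊗ₘ incl r (tpow V) p) := by
  rw [Iso.inv_comp_eq, ← Category.assoc _ ((words hc).br n 0 p q), ← braidPow_words,
    Category.assoc, Iso.hom_inv_id_assoc]
  exact ext₂ fun x y => (congrArg _ (tensorHom_otm _ _ x y)).trans
    (tensBraid_incl _ _ _ _ _ _ _ _)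

lemma tensBraid_isBraid (r : Radius.{u}) :
    (words hc).IsBraid (incl r (tpow V)) (tensBraid hc1 r r) := fun n p q h => by
  rw [Words.J2_pos _ _ h, Words.J2_pos _ _ (show q + p = n by lia), Category.assoc]
  exact words_tensBraid hc hc1 r r n p q h

lemma tensOne_isOne (r : Radius.{u}) : (words hc).IsOne (incl r (tpow V)) (tensOne V r) :=
  (Category.id_comp _).symm

lemma letter_incl (r : Radius.{u}) : (powers V).letter.hom ≫ incl r (tpow V) 1 = tensGen V r := by
  have : (powers V).letter.hom = (λ_ V).inv :=
    (congrArg (_ ≫ ·) ((Category.comp_id _).trans (id_whiskerRight (𝟙_ (Ban k)) V))).trans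
      (Category.comp_id _)
  rw [this]
  rfl

lemma comulGen_eq (r : Radius.{u}) :
    comulGen V r = (powers V).letter.hom ≫ (words hc).shuffle (incl r (tpow V)) 1 := by
  have h₁ := (tensOne_isOne hc r).left 1
  have h₂ := (tensOne_isOne hc r).right 1
  rw [Words.shuffle, Finset.Nat.sum_antidiagonal_succ, Finset.Nat.antidiagonal_zero,
    Finset.sum_singleton]
  simp only [zero_add, Words.sh, BraidWord.sh_zero_left, BraidWord.sh_zero_right]
  have h₃ : ∀ {Z} (f : (words hc).W 1 ⟶ Z), (1 : End ((words hc).W 1)) ≫ f = f :=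
    fun f => Category.id_comp f
  rw [h₃, h₃, ← h₁, ← h₂, Preadditive.comp_add]
  have h₄ := letter_incl (V := V) r
  have h₅ : ∀ {Z} (f : tens V r ⟶ Z), (powers V).letter.hom ≫ incl r (tpow V) 1 ≫ f =
    tensGen V r ≫ f := fun f => by rw [← h₄]; rfl
  erw [h₅, h₅]
  rw [comulGen, leftUnitor_inv_naturality_assoc, rightUnitor_inv_naturality_assoc,
    whisker_exchange, ← MonoidalCategory.tensorHom_def, ← MonoidalCategory.tensorHom_def]

lemma comulPow_eq (r : Radius.{u}) :
    ∀ n, comulPow hc1 r n = (words hc).shuffle (incl r (tpow V)) n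
  | 0 => by
    rw [comulPow, comulOne, Words.shuffle, Finset.Nat.antidiagonal_zero, Finset.sum_singleton]
    simp only [Words.sh, BraidWord.sh_zero_left]
    have h₃ : ∀ {Z} (f : (words hc).W 0 ⟶ Z), (1 : End ((words hc).W 0)) ≫ f = f :=
      fun f => Category.id_comp f
    rw [h₃, ← (tensOne_isOne hc r).left 0]
    have : (λ_ (𝟙_ (Ban k))).inv ≫ (tensOne V r ⊗ₘ tensOne V r) =
      tensOne V r ≫ (λ_ (tens V r)).inv ≫ tensOne V r ▷ tens V r := by
        rw [leftUnitor_inv_naturality_assoc, whisker_exchange, MonoidalCategory.tensorHom_def]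
    exact this
  | n + 1 => by
    rw [← Words.shuffle_mul (tensBraid_isBraid hc hc1 r) (tensMul_isMul hc r)
      (rfl : n + 1 = _), comulPow, comulStep, comulPow_eq r n, comulGen_eq hc]
    have h₁ : (words hc).shuffle (incl r (tpow V)) n ⊗ₘ
        (powers V).letter.hom ≫ (words hc).shuffle (incl r (tpow V)) 1 =
        ((words hc).g (rfl : n + 1 = _)).inv ≫ ((words hc).shuffle (incl r (tpow V)) n ⊗ₘ
          (words hc).shuffle (incl r (tpow V)) 1) :=
      ((powers V).tensor_letter n _ _).trans (Category.id_comp _)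
    exact (congrArg (· ≫ _) h₁).trans (Category.assoc _ _ _)

end

end Ban

/-! ### Constant ind-objects and germs -/

namespace IndObj

variable {C : Type (u + 1)} [LargeCategory C]

lemma Germ.exact {A : C} {Y : IndObj C} {j j' : Y.I} {f : A ⟶ Y.at' j} {g : A ⟶ Y.at' j'}
    (h : Germ.mk j f = Germ.mk j' g) :
    ∃ (l : Y.I) (w : j ⟶ l) (w' : j' ⟶ l), f ≫ Y.F.map w = g ≫ Y.F.map w' := by
  have h := Quot.eqvGen_exact h
  suffices H : ∀ p q : Σ j, A ⟶ Y.at' j, Relation.EqvGen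
      (fun p q : Σ j, A ⟶ Y.at' j => ∃ w : p.1 ⟶ q.1, p.2 ≫ Y.F.map w = q.2) p q →
      ∃ (l : Y.I) (w : p.1 ⟶ l) (w' : q.1 ⟶ l), p.2 ≫ Y.F.map w = q.2 ≫ Y.F.map w' from H _ _ h
  intro p q h
  induction h with
  | rel p q h =>
    obtain ⟨w, h⟩ := h
    exact ⟨q.1, w, 𝟙 _, by rw [h, Y.F.map_id, Category.comp_id]⟩
  | refl p => exact ⟨p.1, 𝟙 _, 𝟙 _, rfl⟩
  | symm p q _ ih =>
    obtain ⟨l, w, w', h⟩ := ih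
    exact ⟨l, w', w, h.symm⟩
  | trans p q r _ _ ih ih' =>
    obtain ⟨l, w, w', h⟩ := ih
    obtain ⟨m, v, v', h'⟩ := ih'
    obtain ⟨t, a, b, e⟩ := IsFiltered.span w' v
    refine ⟨t, w ≫ a, v' ≫ b, ?_⟩
    rw [Functor.map_comp, Functor.map_comp, reassoc_of% h, ← reassoc_of% h', ← Functor.map_comp,
      ← Functor.map_comp, e]

lemma constMap_id (A : C) : constMap (𝟙 A) = 𝟙 (const A) := rfl

lemma constMap_comp {A B E : C} (f : A ⟶ B) (g : B ⟶ E) :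
    constMap (f ≫ g) = constMap f ≫ constMap g := rfl

lemma constMap_ofConst {A B : C} {Y : IndObj C} (f : A ⟶ B) (j : Y.I) (g : B ⟶ Y.at' j) :
    constMap f ≫ ofConst j g = ofConst j (f ≫ g) := rfl

/-- The isomorphism of constant ind-objects given by an isomorphism. -/
def constIso {A B : C} (e : A ≅ B) : const A ≅ const B where
  hom := constMap e.hom
  inv := constMap e.inv
  hom_inv_id := by rw [← constMap_comp, e.hom_inv_id, constMap_id]
  inv_hom_id := by rw [← constMap_comp, e.inv_hom_id, constMap_id]

lemma exists_ofConst {A : C} {Y : IndObj C} (f : const A ⟶ Y) : ∃ i h, f = ofConst i h := by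
  obtain ⟨i, h, e⟩ : ∃ i h, f.app ⟨⟨⟩⟩ = Germ.mk i h := by
    generalize f.app ⟨⟨⟩⟩ = x
    induction x using Germ.ind with | h i h => exact ⟨i, h, rfl⟩
  exact ⟨i, h, hom_ext fun ⟨⟨⟩⟩ => e⟩

lemma ofConst_comp {A : C} {Y Z : IndObj C} {i : Y.I} (h : A ⟶ Y.at' i) (f : Y ⟶ Z) {l : Z.I}
    {a : Y.at' i ⟶ Z.at' l} (e : f.app i = Germ.mk l a) : ofConst i h ≫ f = ofConst l (h ≫ a) :=
  hom_ext fun _ => by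
    rw [comp_app]
    show (f.app i).precomp h = _
    rw [e]
    rfl

lemma ofConst_map {A : C} {Y : IndObj C} {i i' : Y.I} (w : i ⟶ i') (h : A ⟶ Y.at' i) :
    ofConst i' (h ≫ Y.F.map w) = ofConst i h := hom_ext fun _ => Germ.mk_map w h

lemma ofConst_exact {A : C} {Y : IndObj C} {i i' : Y.I} {h : A ⟶ Y.at' i} {h' : A ⟶ Y.at' i'}
    (e : ofConst i h = ofConst i' h') :
    ∃ (l : Y.I) (w : i ⟶ l) (w' : i' ⟶ l), h ≫ Y.F.map w = h' ≫ Y.F.map w' :=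
  Germ.exact (congrArg (fun f : const A ⟶ Y => f.app ⟨⟨⟩⟩) e)

lemma constMap_injective {A B : C} {f g : A ⟶ B} (h : constMap f = constMap g) : f = g := by
  obtain ⟨l, w, w', e⟩ := ofConst_exact h
  exact (Category.comp_id f).symm.trans (e.trans (Category.comp_id g))

section

variable [Preadditive C]

lemma constMap_add {A B : C} (f g : A ⟶ B) : constMap (f + g) = constMap f + constMap g :=
  hom_ext fun _ => (Germ.mk_add (Y := const B) ⟨⟨⟩⟩ f g).symm

lemma constMap_zero (A B : C) : constMap (0 : A ⟶ B) = 0 :=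
  hom_ext fun _ => Germ.mk_zero (Y := const B) ⟨⟨⟩⟩

lemma ofConst_zero {A : C} {Y : IndObj C} (j : Y.I) : ofConst j (0 : A ⟶ Y.at' j) = 0 :=
  hom_ext fun _ => Germ.mk_zero j

lemma ofConst_add {A : C} {Y : IndObj C} (j : Y.I) (f g : A ⟶ Y.at' j) :
    ofConst j (f + g) = ofConst j f + ofConst j g :=
  hom_ext fun _ => (Germ.mk_add j f g).symm

variable [MonoidalCategory C] [MonoidalPreadditive C]

lemma Germ.tensor_zero {A B : C} {X Y : IndObj C} (x : Germ A X) :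
    x.tensor (0 : Germ B Y) = 0 := by
  induction x using Germ.ind with | h i a => _
  rw [← Germ.mk_zero (IsFiltered.nonempty (C := Y.I)).some, Germ.tensor_mk,
    MonoidalPreadditive.tensor_zero]
  exact Germ.mk_zero (Y := X.tensor Y) _

lemma Germ.zero_tensor {A B : C} {X Y : IndObj C} (y : Germ B Y) :
    (0 : Germ A X).tensor y = 0 := by
  induction y using Germ.ind with | h i a => _
  rw [← Germ.mk_zero (IsFiltered.nonempty (C := X.I)).some, Germ.tensor_mk,
    MonoidalPreadditive.zero_tensor]
  exact Germ.mk_zero (Y := X.tensor Y) _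

lemma Germ.tensor_add {A B : C} {X Y : IndObj C} (x : Germ A X) (y z : Germ B Y) :
    x.tensor (y + z) = x.tensor y + x.tensor z := by
  induction x using Germ.ind with | h i a => _
  obtain ⟨j, b, b', rfl, rfl⟩ := Germ.exists_rep₂ y z
  rw [Germ.mk_add, Germ.tensor_mk, Germ.tensor_mk, Germ.tensor_mk, MonoidalPreadditive.tensor_add]
  exact (Germ.mk_add (Y := X.tensor Y) (i, j) _ _).symm

lemma Germ.add_tensor {A B : C} {X Y : IndObj C} (x z : Germ A X) (y : Germ B Y) :
    (x + z).tensor y = x.tensor y + z.tensor y := by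
  induction y using Germ.ind with | h i a => _
  obtain ⟨j, b, b', rfl, rfl⟩ := Germ.exists_rep₂ x z
  rw [Germ.mk_add, Germ.tensor_mk, Germ.tensor_mk, Germ.tensor_mk, MonoidalPreadditive.add_tensor]
  exact (Germ.mk_add (Y := X.tensor Y) (j, i) _ _).symm

instance : MonoidalPreadditive (IndObj C) where
  whiskerLeft_zero {X _ _} := hom_ext fun p =>
    Germ.tensor_zero ((𝟙 X : X ⟶ X).app p.1)
  zero_whiskerRight {X _ _} := hom_ext fun p =>
    Germ.zero_tensor ((𝟙 X : X ⟶ X).app p.2)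
  whiskerLeft_add {X _ _} f g := hom_ext fun p =>
    Germ.tensor_add ((𝟙 X : X ⟶ X).app p.1) (f.app p.2) (g.app p.2)
  add_whiskerRight {X _ _} f g := hom_ext fun p =>
    Germ.add_tensor (f.app p.1) (g.app p.1) ((𝟙 X : X ⟶ X).app p.2)

end

section

variable [MonoidalCategory C]

lemma constTensor_natural {A B A' B' : C} (f : A ⟶ A') (g : B ⟶ B') :
    (constMap f ⊗ₘ constMap g) ≫ (constTensor A' B').hom =
      (constTensor A B).hom ≫ constMap (f ⊗ₘ g) :=
  hom_ext fun _ => congrArg (Germ.mk (Y := const (A' ⊗ B')) ⟨⟨⟩⟩)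
    ((Category.comp_id _).trans (Category.id_comp _).symm)

lemma constTensor_left {A B A' : C} (f : A ⟶ A') : constMap f ▷ const B ≫ (constTensor A' B).hom =
    (constTensor A B).hom ≫ constMap (f ▷ B) := by
  rw [← tensorHom_id, ← tensorHom_id, ← constTensor_natural, constMap_id]

lemma constTensor_right {A B B' : C} (f : B ⟶ B') : const A ◁ constMap f ≫ (constTensor A B').hom =
    (constTensor A B).hom ≫ constMap (A ◁ f) := by
  rw [← id_tensorHom, ← id_tensorHom, ← constTensor_natural, constMap_id]

lemma constTensor_assoc (A B E : C) : (constTensor A B).hom ▷ const E ≫ (constTensor (A ⊗ B) E).hom ≫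
    constMap (α_ A B E).hom = (α_ (const A) (const B) (const E)).hom ≫
      const A ◁ (constTensor B E).hom ≫ (constTensor A (B ⊗ E)).hom :=
  hom_ext fun _ => congrArg (Germ.mk (Y := const (A ⊗ (B ⊗ E))) ⟨⟨⟩⟩)
    (show (𝟙 (A ⊗ B) ⊗ₘ 𝟙 E) ≫ 𝟙 _ ≫ (α_ A B E).hom =
      (α_ A B E).hom ≫ (𝟙 A ⊗ₘ 𝟙 (B ⊗ E)) ≫ 𝟙 _ by simp)

lemma constTensor_unit_left (A : C) : (constTensor (𝟙_ C) A).hom ≫ constMap (λ_ A).hom =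
    (λ_ (const A)).hom := hom_ext fun _ => congrArg (Germ.mk (Y := const A) ⟨⟨⟩⟩)
      (Category.id_comp _)

lemma constTensor_unit_right (A : C) : (constTensor A (𝟙_ C)).hom ≫ constMap (ρ_ A).hom =
    (ρ_ (const A)).hom := hom_ext fun _ => congrArg (Germ.mk (Y := const A) ⟨⟨⟩⟩)
      (Category.id_comp _)

lemma ofConst_tensor {A B : C} {X Y : IndObj C} {i : X.I} {j : Y.I} (f : A ⟶ X.at' i)
    (g : B ⟶ Y.at' j) : ofConst i f ⊗ₘ ofConst j g =
      (constTensor A B).hom ≫ ofConst (Y := X ⊗ Y) (i, j) (f ⊗ₘ g) :=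
  hom_ext fun _ => congrArg (Germ.mk (Y := X.tensor Y) (i, j)) (Category.id_comp _).symm

end

/-! ### Words of constant ind-objects -/

section words

variable [MonoidalCategory C] [Preadditive C] (K : Words C)

/-- Words, as constant ind-objects. -/
abbrev constWords : Words (IndObj C) where
  W n := const (K.W n)
  u := constIso K.u
  g h := constTensor _ _ ≪≫ constIso (K.g h)
  s n i := constMap (K.s n i)
  rels n :=
    { comm := fun i l h => congrArg constMap ((K.rels n).comm i l h)
      braid := fun i => congrArg constMap ((K.rels n).braid i) }
  assoc {p q r m n N} h₁ h₂ h₃ h₄ := by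
    have h := congrArg constMap (K.assoc h₁ h₂ h₃ h₄)
    have e₁ := constTensor_left (B := K.W r) (K.g h₁).hom
    have e₂ := constTensor_right (A := K.W p) (K.g h₃).hom
    have e₃ := constTensor_assoc (K.W p) (K.W q) (K.W r)
    simp only [Iso.trans_hom, comp_whiskerRight, MonoidalCategory.whiskerLeft_comp,
      Category.assoc, constIso, constMap_comp] at h ⊢
    rw [reassoc_of% e₁, reassoc_of% e₂, h, reassoc_of% e₃]
  unit_left n := by
    have h := congrArg constMap (K.unit_left n)
    have e := constTensor_left (B := K.W n) K.u.hom
    simp only [Iso.trans_hom, constIso, constMap_comp] at h ⊢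
    rw [← Category.assoc]
    exact (congrArg (· ≫ _) e).trans ((Category.assoc _ _ _).trans
      ((congrArg (_ ≫ ·) h).trans (constTensor_unit_left _)))
  unit_right n := by
    have h := congrArg constMap (K.unit_right n)
    have e := constTensor_right (A := K.W n) K.u.hom
    simp only [Iso.trans_hom, constIso, constMap_comp] at h ⊢
    rw [← Category.assoc]
    exact (congrArg (· ≫ _) e).trans ((Category.assoc _ _ _).trans
      ((congrArg (_ ≫ ·) h).trans (constTensor_unit_right _)))
  s_left {p q n i} h hi := by
    have h' := congrArg constMap (K.s_left h hi)
    have e := constTensor_left (B := K.W q) (K.s p i)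
    simp only [Iso.trans_hom, constIso, Category.assoc, constMap_comp] at h' ⊢
    rw [reassoc_of% e, h']
  s_right {p q n i} h hi := by
    have h' := congrArg constMap (K.s_right h hi)
    have e := constTensor_right (A := K.W p) (K.s q i)
    simp only [Iso.trans_hom, constIso, Category.assoc, constMap_comp] at h' ⊢
    rw [reassoc_of% e, h']

variable (n a p q : ℕ)

lemma constWords_br : (constWords K).br n a p q = constMap (K.br n a p q) :=
  (BraidWord.br_rel (A := End (K.W n)) (A' := End (const (K.W n)))
    (s := K.s n) (s' := (constWords K).s n)
    (Q := fun x x' => constMap (End.asHom x) = x') rfl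
    (fun h h' => by rw [← h, ← h']; rfl) fun i _ => rfl).symm

lemma constWords_tw : (constWords K).tw n a p = constMap (K.tw n a p) :=
  (BraidWord.tw_rel (A := End (K.W n)) (A' := End (const (K.W n)))
    (s := K.s n) (s' := (constWords K).s n)
    (Q := fun x x' => constMap (End.asHom x) = x') rfl
    (fun h h' => by rw [← h, ← h']; rfl) fun i _ => rfl).symm

lemma constWords_sh : (constWords K).sh n a p q = constMap (K.sh n a p q) :=
  (BraidWord.sh_rel (A := End (K.W n)) (A' := End (const (K.W n)))
    (s := K.s n) (s' := (constWords K).s n)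
    (Q := fun x x' => constMap (End.asHom x) = x') rfl
    (fun h h' => by rw [← h, ← h']; rfl)
    (fun h h' => by rw [← h, ← h']; exact constMap_add _ _) fun i _ => rfl).symm

lemma constWords_sym : (constWords K).sym n a p = constMap (K.sym n a p) :=
  (BraidWord.sym_rel (A := End (K.W n)) (A' := End (const (K.W n)))
    (s := K.s n) (s' := (constWords K).s n)
    (Q := fun x x' => constMap (End.asHom x) = x') rfl
    (fun h h' => by rw [← h, ← h']; rfl)
    (fun h h' => by rw [← h, ← h']; exact constMap_add _ _) fun i _ => rfl).symm

lemma constWords_J2 {R : IndObj C} {j : ∀ n, const (K.W n) ⟶ R} {p q n : ℕ} (h : p + q = n)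
    {i i' : R.I} {f : K.W p ⟶ R.at' i} {g : K.W q ⟶ R.at' i'} (hf : j p = ofConst i f)
    (hg : j q = ofConst i' g) : (constWords K).J2 j n p q =
      ofConst (Y := R ⊗ R) (i, i') ((K.g h).inv ≫ (f ⊗ₘ g)) := by
  rw [Words.J2_pos _ _ h, hf, hg, ofConst_tensor]
  simp only [Iso.trans_inv, constIso, Category.assoc, Iso.inv_hom_id_assoc]
  rfl

end words

end IndObj

namespace Ban

variable {k : Type u} [NormedField k] [CompleteSpace k]

/-! ### Generation at each level -/

open IndObj in
/-- The maps `j n : W n ⟶ R` generate every term of `R`. -/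
def LevelGen {W : ℕ → Ban k} {R : IndObj (Ban k)} (j : ∀ n, const (W n) ⟶ R) : Prop :=
  ∀ (i : R.I) {X : Ban k} (a b : R.at' i ⟶ X),
    (∀ n (h : W n ⟶ R.at' i), j n = ofConst i h → h ≫ a = h ≫ b) → a = b

section

open IndObj

variable {W : ℕ → Ban k} {R : IndObj (Ban k)} {j : ∀ n, const (W n) ⟶ R}

lemma LevelGen.two (hj : LevelGen j) {E : Ban k} (T : ∀ {A : Ban k}, (A ⟶ E) → Prop)
    (hT : ∀ {X : Ban k} (a b : E ⟶ X), (∀ A (h : A ⟶ E), T h → h ≫ a = h ≫ b) → a = b)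
    (i : R.I) {X : Ban k} {a b : E ⊗ R.at' i ⟶ X}
    (H : ∀ A (h : A ⟶ E), T h → ∀ n (h' : W n ⟶ R.at' i), j n = ofConst i h' →
      (h ⊗ₘ h') ≫ a = (h ⊗ₘ h') ≫ b) : a = b := by
  refine ext₂ fun x y => congrArg (fun f : E ⟶ X => f x)
    (show tmulRight y ≫ a = tmulRight y ≫ b from hT _ _ fun A h hh => hom_ext fun x' => ?_)
  refine congrArg (fun f : R.at' i ⟶ X => f y) (show tmulLeft (h x') ≫ a = tmulLeft (h x') ≫ b from
    hj i _ _ fun n h' hh' => hom_ext fun y' => ?_)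
  have := congrArg (fun f : A ⊗ W n ⟶ X => f (otm x' y')) (H A h hh n h' hh')
  simp only [comp_apply, tensorHom_otm] at this
  exact this

omit [CompleteSpace k] in
lemma eq_of_germ {Z : IndObj (Ban k)} (hZ : IsMonomorphic Z) {A : Ban k} {l : Z.I}
    {a b : A ⟶ Z.at' l} (h : ofConst l a = ofConst l b) : a = b := by
  obtain ⟨m, w, w', e⟩ := ofConst_exact h
  obtain ⟨t, v, hv⟩ : ∃ (t : Z.I) (v : m ⟶ t), w ≫ v = w' ≫ v :=
    ⟨_, IsFiltered.coeqHom w w', IsFiltered.coeq_condition w w'⟩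
  have := hZ (w ≫ v)
  rw [← cancel_mono (Z.F.map (w ≫ v))]
  nth_rw 2 [hv]
  rw [Functor.map_comp, Functor.map_comp, reassoc_of% e]

omit [CompleteSpace k] in
lemma eq_of_germ_comp {Z : IndObj (Ban k)} (hZ : IsMonomorphic Z) {Y : IndObj (Ban k)} {A : Ban k}
    {f g : Y ⟶ Z} {i : Y.I} {l : Z.I} {a b : Y.at' i ⟶ Z.at' l} (hf : f.app i = Germ.mk l a)
    (hg : g.app i = Germ.mk l b) {h : A ⟶ Y.at' i} (e : ofConst i h ≫ f = ofConst i h ≫ g) :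
    h ≫ a = h ≫ b := by
  rw [ofConst_comp h f hf, ofConst_comp h g hg] at e
  exact eq_of_germ hZ e

omit [CompleteSpace k] in
lemma LevelGen.ext₁ (hj : LevelGen j) {Z : IndObj (Ban k)} (hZ : IsMonomorphic Z) {f g : R ⟶ Z}
    (h : ∀ n, j n ≫ f = j n ≫ g) : f = g := IndObj.hom_ext fun i => by
  obtain ⟨l, a, b, hf, hg⟩ := Germ.exists_rep₂ (f.app i) (g.app i)
  rw [hf, hg]
  refine congrArg _ (hj i a b fun n h' hh => ?_)
  exact eq_of_germ_comp hZ hf hg (by rw [← hh, h n])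

lemma LevelGen.ext₂ (hj : LevelGen j) {Z : IndObj (Ban k)} (hZ : IsMonomorphic Z) {f g : R ⊗ R ⟶ Z}
    (h : ∀ p q, (j p ⊗ₘ j q) ≫ f = (j p ⊗ₘ j q) ≫ g) : f = g := IndObj.hom_ext fun i => by
  obtain ⟨l, a, b, hf, hg⟩ := Germ.exists_rep₂ (f.app i) (g.app i)
  rw [hf, hg]
  refine congrArg _ (hj.two (fun {A} h => ∃ (p : ℕ) (e : A = W p), j p = ofConst i.1
    (eqToHom e.symm ≫ h)) (fun a b H => hj i.1 a b fun n h hh => H _ h ⟨n, rfl, by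
      rw [hh, eqToHom_refl, Category.id_comp]⟩) i.2 ?_)
  rintro _ h₁ ⟨p, rfl, hp⟩ q h₂ hq
  rw [eqToHom_refl, Category.id_comp] at hp
  refine eq_of_germ_comp hZ hf hg ?_
  have := h p q
  rw [hp, hq, ofConst_tensor, Category.assoc, Category.assoc] at this
  exact (cancel_epi _).1 this

lemma LevelGen.ext₃ (hj : LevelGen j) {Z : IndObj (Ban k)} (hZ : IsMonomorphic Z)
    {f g : (R ⊗ R) ⊗ R ⟶ Z}
    (h : ∀ p q r, ((j p ⊗ₘ j q) ⊗ₘ j r) ≫ f = ((j p ⊗ₘ j q) ⊗ₘ j r) ≫ g) : f = g :=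
  IndObj.hom_ext fun i => by
  obtain ⟨l, a, b, hf, hg⟩ := Germ.exists_rep₂ (f.app i) (g.app i)
  rw [hf, hg]
  refine congrArg _ (hj.two (fun {A} h => ∃ (p q : ℕ) (e : A = W p ⊗ W q)
    (h₁ : W p ⟶ R.at' i.1.1) (h₂ : W q ⟶ R.at' i.1.2), j p = ofConst i.1.1 h₁ ∧
      j q = ofConst i.1.2 h₂ ∧ h = eqToHom e ≫ (h₁ ⊗ₘ h₂)) (fun a b H => ?_) i.2 ?_)
  · refine hj.two (fun {A} h => ∃ (p : ℕ) (e : A = W p), j p = ofConst i.1.1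
      (eqToHom e.symm ≫ h)) (fun a b H => hj i.1.1 a b fun n h hh => H _ h ⟨n, rfl, by
        rw [hh, eqToHom_refl, Category.id_comp]⟩) i.1.2 ?_
    rintro _ h₁ ⟨p, rfl, hp⟩ q h₂ hq
    rw [eqToHom_refl, Category.id_comp] at hp
    exact H _ _ ⟨p, q, rfl, h₁, h₂, hp, hq, by rw [eqToHom_refl, Category.id_comp]⟩
  · rintro _ _ ⟨p, q, rfl, h₁, h₂, hp, hq, rfl⟩ r h₃ hr
    rw [eqToHom_refl, Category.id_comp]
    refine eq_of_germ_comp hZ hf hg ?_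
    have := h p q r
    rw [hp, hq, hr, ofConst_tensor] at this
    have e : (constTensor (W p) (W q)).hom ≫ ofConst (Y := R ⊗ R) (i.1.1, i.1.2) (h₁ ⊗ₘ h₂) ⊗ₘ
        ofConst i.2 h₃ = (constTensor (W p) (W q)).hom ▷ const (W r) ≫
          (constTensor (W p ⊗ W q) (W r)).hom ≫
          ofConst (Y := (R ⊗ R) ⊗ R) ((i.1.1, i.1.2), i.2) ((h₁ ⊗ₘ h₂) ⊗ₘ h₃) := by
      have e' := ofConst_tensor (X := R ⊗ R) (Y := R) (i := (i.1.1, i.1.2)) (j := i.2)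
        (h₁ ⊗ₘ h₂) h₃
      refine Eq.trans ?_ (congrArg (_ ≫ ·) e')
      rw [← tensorHom_id, tensorHom_comp_tensorHom, Category.id_comp]
    rw [e] at this
    simp only [Category.assoc] at this
    exact (cancel_epi _).1 ((cancel_epi _).1 this)

end

/-! ### Approximation of the identity -/

lemma tensor_induction {E F : Ban k} {p : (E ⊗ F : Ban k) → Prop} (h₀ : p 0)
    (h₁ : ∀ x y, p (otm x y)) (h₂ : ∀ x y, p x → p y → p (x + y)) (h₃ : IsClosed {z | p z})
    (z : (E ⊗ F : Ban k)) : p z := by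
  refine (denseRange_toTensor E F).induction_on (p := p) z h₃ fun a => ?_
  induction a using TensorProduct.induction_on with
  | zero => exact (congrArg p (map_zero (toTensor E F))).mpr h₀
  | tmul x y => exact h₁ x y
  | add a b ha hb => exact (congrArg p (map_add (toTensor E F) a b)).mpr (h₂ _ _ ha hb)

omit [CompleteSpace k] in
open Filter Topology in
lemma isClosed_tendsto {E : Ban k} {e : ℕ → (E ⟶ E)} {C : ℝ} (hC : 0 ≤ C)
    (he : ∀ n, NormLE (e n) C) : IsClosed {x : E | Tendsto (fun n => e n x) atTop (𝓝 x)} := by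
  refine isClosed_of_closure_subset fun x hx => ?_
  rw [Set.mem_ofPred_eq, Metric.tendsto_atTop]
  intro δ hδ
  obtain ⟨y, hy, hxy⟩ := Metric.mem_closure_iff.1 hx (δ / (C + 2)) (by positivity)
  obtain ⟨N, hN⟩ := Metric.tendsto_atTop.1 hy (δ / (C + 2)) (by positivity)
  refine ⟨N, fun n hn => ?_⟩
  have h₁ := hN n hn
  rw [dist_eq_norm] at h₁ hxy ⊢
  have h₂ : e n x - x = e n (x - y) + (e n y - y) + (y - x) := by
    rw [show e n (x - y) = e n x - e n y from map_sub (e n).lin x y]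
    abel
  have h₃ : (C + 2) * (δ / (C + 2)) = δ := by field_simp
  have h₄ := he n (x - y)
  have h₅ : C * ‖x - y‖ ≤ C * (δ / (C + 2)) := by gcongr
  rw [h₂]
  refine (norm_add₃_le).trans_lt ?_
  rw [norm_sub_rev y x]
  nlinarith

open Filter Topology in
/-- The identity of every term is a limit of a bounded sequence of operators which factor through
all transition maps. -/
def Approximable (Z : IndObj (Ban k)) : Prop :=
  ∀ i, ∃ (C : ℝ) (e : ℕ → (Z.at' i ⟶ Z.at' i)), 0 ≤ C ∧ (∀ n, NormLE (e n) C) ∧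
    (∀ x, Tendsto (fun n => e n x) atTop (𝓝 x)) ∧
    ∀ n {i' : Z.I} (w : i ⟶ i'), ∃ h, Z.F.map w ≫ h = e n

omit [CompleteSpace k] in
lemma Approximable.isMonomorphic {Z : IndObj (Ban k)} (hZ : Approximable Z) : IsMonomorphic Z :=
  fun {i i'} w => ⟨fun {A} f g h => by
    obtain ⟨C, e, -, -, he, hw⟩ := hZ i
    refine hom_ext fun x => tendsto_nhds_unique (he (f x)) ?_
    have : (fun n => e n (f x)) = fun n => e n (g x) := funext fun n => by
      obtain ⟨h', hh⟩ := hw n w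
      rw [← hh]
      exact congrArg h' (congrArg (fun φ : A ⟶ Z.at' i' => φ x) h)
    rw [this]
    exact he (g x)⟩

lemma Approximable.tensor {X Y : IndObj (Ban k)} (hX : Approximable X) (hY : Approximable Y) :
    Approximable (X ⊗ Y) := fun i => by
  obtain ⟨C, e, hC, h₁, h₂, h₃⟩ := hX i.1
  obtain ⟨C', e', hC', h₁', h₂', h₃'⟩ := hY i.2
  have hb : ∀ n, NormLE (e n ⊗ₘ e' n) (C * C') := fun n => normLE_tensorHom hC hC' (h₁ n) (h₁' n)
  refine ⟨C * C', fun n => e n ⊗ₘ e' n, mul_nonneg hC hC', hb, fun z => ?_, fun n i' w => ?_⟩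
  · refine tensor_induction (p := fun z => Filter.Tendsto (fun n => (e n ⊗ₘ e' n) z) Filter.atTop
      (nhds z)) ?_ (fun x y => ?_) (fun x y hx hy => ?_)
      (isClosed_tendsto (mul_nonneg hC hC') hb) z
    · have : (fun n => (e n ⊗ₘ e' n) (0 : (X.at' i.1 ⊗ Y.at' i.2 : Ban k))) = fun _ => 0 :=
        funext fun n => map_zero (e n ⊗ₘ e' n).lin
      rw [this]
      exact tendsto_const_nhds
    · simp only [tensorHom_otm]
      have h₄ : ∀ n, ‖otm (e n x) (e' n y) - otm x y‖ ≤
          ‖e n x - x‖ * (C' * ‖y‖) + ‖x‖ * ‖e' n y - y‖ := fun n => by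
        have : otm (e n x) (e' n y) - otm x y = otm (e n x - x) (e' n y) + otm x (e' n y - y) := by
          rw [show otm (e n x - x) (e' n y) = otm (e n x) (e' n y) - otm x (e' n y) from
            map_sub (tmulRight (e' n y)).lin _ _, show otm x (e' n y - y) = otm x (e' n y) - otm x y
            from map_sub (tmulLeft x).lin _ _]
          abel
        rw [this]
        refine (norm_add_le _ _).trans (add_le_add ((norm_tmul_le _ _).trans ?_) (norm_tmul_le _ _))
        gcongr
        exact h₁' n y
      rw [tendsto_iff_norm_sub_tendsto_zero]
      refine squeeze_zero (fun n => norm_nonneg _) h₄ ?_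
      have h₅ := (tendsto_iff_norm_sub_tendsto_zero.1 (h₂ x)).mul_const (C' * ‖y‖)
      have h₆ := (tendsto_iff_norm_sub_tendsto_zero.1 (h₂' y)).const_mul ‖x‖
      simpa using h₅.add h₆
    · have : (fun n => (e n ⊗ₘ e' n) (x + y)) =
          fun n => (e n ⊗ₘ e' n) x + (e n ⊗ₘ e' n) y := funext fun n =>
        map_add (e n ⊗ₘ e' n).lin x y
      rw [this]
      exact hx.add hy
  · obtain ⟨h, hh⟩ := h₃ n w.1
    obtain ⟨h', hh'⟩ := h₃' n w.2
    exact ⟨h ⊗ₘ h', (tensorHom_comp_tensorHom _ _ _ _).trans (by rw [hh, hh'])⟩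

omit [CompleteSpace k] in
lemma Approximable.of_split {Z : IndObj (Ban k)}
    (h : ∀ {i i' : Z.I} (w : i ⟶ i'), ∃ h, Z.F.map w ≫ h = 𝟙 _) : Approximable Z := fun _ =>
  ⟨1, fun _ => 𝟙 _, zero_le_one, fun _ => normLE_id _, fun _ => tendsto_const_nhds, fun _ _ w => h w⟩

omit [CompleteSpace k] in
lemma approximable_const (A : Ban k) : Approximable (IndObj.const A) :=
  Approximable.of_split fun _ => ⟨𝟙 _, Category.comp_id _⟩

lemma separating {K : Words (Ban k)} {R : IndObj (Ban k)}
    {j : ∀ n, IndObj.const (K.W n) ⟶ R} (hj : LevelGen j) (hR : Approximable R) :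
    (IndObj.constWords K).Separating j Approximable where
  unit := approximable_const _
  self := hR
  tensor := Approximable.tensor
  ext₁ hZ := fun h => hj.ext₁ hZ.isMonomorphic h
  ext₂ hZ := fun h => hj.ext₂ hZ.isMonomorphic h
  ext₃ hZ := fun h => hj.ext₃ hZ.isMonomorphic h

end Ban

namespace Ban

variable {k : Type u} [NormedField k]

section geom

variable {r s : Radius.{u}} {E : ℕ → Ban k}

/-- The projection to the `n`-th component. -/
def coeffHom (r : Radius.{u}) (E : ℕ → Ban k) (n : ℕ) : geom r E ⟶ E n :=
  ofLin ⟨⟨coeff n, coeff_add n⟩, coeff_smul n⟩ ⟨(r.val ^ n)⁻¹, fun x => by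
    rw [inv_mul_eq_div, le_div_iff₀' (r.pow_pos n)]
    exact le_hasSum (geom_hasSum_norm x) n fun i _ => by have := r.pow_pos i; positivity⟩

@[simp] lemma coeffHom_apply (n : ℕ) (x : geom r E) : coeffHom r E n x = coeff n x := rfl

lemma incl_coeffHom (n : ℕ) : incl r E n ≫ coeffHom r E n = 𝟙 _ :=
  hom_ext fun x => coeff_incl_self n x

lemma incl_coeffHom_ne {m n : ℕ} (h : m ≠ n) : incl r E m ≫ coeffHom r E n = 0 :=
  hom_ext fun x => coeff_incl_ne h.symm x

lemma incl_res (h : r ≤ s) (n : ℕ) : incl r E n ≫ res E h = incl s E n :=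
  hom_ext fun x => res_incl E h n x

lemma res_coeffHom (h : r ≤ s) (n : ℕ) : res E h ≫ coeffHom s E n = coeffHom r E n :=
  geom_ext fun m => by
    rw [← Category.assoc, incl_res]
    by_cases hm : m = n
    · subst hm
      rw [incl_coeffHom, incl_coeffHom]
    · rw [incl_coeffHom_ne hm, incl_coeffHom_ne hm]

lemma coeff_res (h : r ≤ s) (n : ℕ) (x : geom r E) : coeff n (res E h x) = coeff n x :=
  congrArg (fun φ : geom r E ⟶ E n => φ x) (res_coeffHom h n)

lemma sum_apply {X Y : Ban k} {ι : Type*} (t : Finset ι) (f : ι → (X ⟶ Y)) (x : X) :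
    (∑ i ∈ t, f i) x = ∑ i ∈ t, f i x := by
  classical
  induction t using Finset.induction_on with
  | empty => rfl
  | insert i t hi ih => rw [Finset.sum_insert hi, Finset.sum_insert hi, add_apply, ih]

/-- Truncation at order `n`. -/
def trunc (r s : Radius.{u}) (E : ℕ → Ban k) (n : ℕ) : geom r E ⟶ geom s E :=
  ∑ m ∈ Finset.range n, coeffHom r E m ≫ incl s E m

lemma trunc_apply (n : ℕ) (x : geom r E) :
    trunc r s E n x = ∑ m ∈ Finset.range n, incl s E m (coeff m x) := sum_apply _ _ _

lemma normLE_trunc (n : ℕ) : NormLE (trunc r r E n) 1 := fun x => by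
  rw [trunc_apply, one_mul]
  refine (norm_sum_le _ _).trans ((Finset.sum_le_sum fun m _ => normLE_incl m _).trans ?_)
  exact sum_le_hasSum _ (fun m _ => by have := r.pow_pos m; positivity) (geom_hasSum_norm x)

open Filter Topology in
lemma tendsto_trunc (x : geom r E) : Tendsto (fun n => trunc r r E n x) atTop (𝓝 x) := by
  simp only [trunc_apply]
  exact (hasSum_incl x).tendsto_sum_nat

lemma res_trunc (h : r ≤ s) (q : Radius.{u}) (n : ℕ) : res E h ≫ trunc s q E n = trunc r q E n := by
  simp only [trunc, Preadditive.comp_sum, ← Category.assoc, res_coeffHom]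

lemma single_eq {a : ℝ} (r : Above.{u} a) (n : ℕ) : single a E n =
    IndObj.ofConst (Y := dagger a (geomFunctor E)) r (incl r.1 E n) := by
  have h : ∀ {r s : Above.{u} a} (h : r ≤ s),
      IndObj.ofConst (Y := dagger a (geomFunctor E)) s (incl s.1 E n) =
        IndObj.ofConst (Y := dagger a (geomFunctor E)) r (incl r.1 E n) := fun {r s} h =>
    (congrArg (IndObj.ofConst (Y := dagger a (geomFunctor E)) s) (incl_res h n).symm).trans
      (IndObj.ofConst_map (Y := dagger a (geomFunctor E)) (homOfLE (X := Above.{u} a) h) _)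
  exact (h (show Above.base a ≤ Above.inf (Above.base a) r from Radius.le_inf_left _ _)).symm.trans
    (h (show r ≤ Above.inf (Above.base a) r from Radius.le_inf_right _ _))

variable [CompleteSpace k]

omit [CompleteSpace k] in
lemma approximable_geom (a : ℝ) (E : ℕ → Ban k) : Approximable (dagger a (geomFunctor E)) :=
  fun i => ⟨1, trunc i.1 i.1 E, zero_le_one, normLE_trunc, tendsto_trunc, fun n i' w =>
    ⟨trunc i'.1 i.1 E n, res_trunc (leOfHom (X := Above.{u} a) w) _ n⟩⟩

end geom

/-! ### The monomials of `k{t/a}†` -/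

section disk

variable [CompleteSpace k] (a : ℝ)

lemma approximable_disk : Approximable (diskAlg k a) := approximable_geom a (diskPow k)

/-- The generalised element `t ^ n` of `k{t/a}†`. -/
def tPow (n : ℕ) : 𝟙_ (IndObj (Ban k)) ⟶ diskAlg k a := single a (diskPow k) n

/-- The coefficient of `t ^ n`. -/
def tCoeff (n : ℕ) : diskAlg k a ⟶ 𝟙_ (IndObj (Ban k)) :=
  IndObj.ofLevel (X := diskAlg k a) (Y := IndObj.const (𝟙_ (Ban k))) (fun _ => ⟨⟨⟩⟩)
    (fun r => coeffHom r.1 (diskPow k) n) fun w => ⟨𝟙 _, (res_coeffHom (E := diskPow k)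
      (leOfHom (X := Above.{u} a) w) n).trans (Category.comp_id _).symm⟩

lemma tPow_tCoeff (n : ℕ) : tPow a n ≫ tCoeff (k := k) a n = 𝟙 _ :=
  IndObj.hom_ext fun _ => congrArg (IndObj.Germ.mk (Y := IndObj.const (𝟙_ (Ban k))) ⟨⟨⟩⟩)
    (incl_coeffHom n)

lemma tPow_tCoeff_ne {m n : ℕ} (h : m ≠ n) : tPow a m ≫ tCoeff (k := k) a n = 0 :=
  (IndObj.hom_ext fun _ => congrArg (IndObj.Germ.mk (Y := IndObj.const (𝟙_ (Ban k))) ⟨⟨⟩⟩)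
    (incl_coeffHom_ne h)).trans (IndObj.constMap_zero _ _)

lemma tPow_mul (p q : ℕ) : (tPow (k := k) a p ⊗ₘ tPow a q) ≫ MonObj.mul =
    (λ_ (𝟙_ (IndObj (Ban k)))).hom ≫ tPow a (p + q) := by
  have hl : Above.base.{u} a ≤ Above.inf (Above.base a) (Above.base a) := Radius.le_inf_left _ _
  rw [show tPow (k := k) a (p + q) = _ from single_eq (E := diskPow k)
    (Above.inf (Above.base a) (Above.base a)) (p + q)]
  exact IndObj.hom_ext fun _ => congrArg (IndObj.Germ.mk (Y := diskAlg k a) _)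
    (show (incl _ (diskPow k) p ⊗ₘ incl _ (diskPow k) q) ≫ diskMulAux hl hl =
      (λ_ (𝟙_ (Ban k))).hom ≫ incl _ (diskPow k) (p + q) from Ban.ext₂ fun x y =>
        (congrArg _ (tensorHom_otm _ _ x y)).trans (geomMul_incl _ _ _ _ _ _ _ _))

lemma tPow_comul (h0 : 0 ≤ a) (h1 : a ≤ 1) (n : ℕ) : tPow (k := k) a n ≫ diskComul a h0 h1 =
    (λ_ (𝟙_ (IndObj (Ban k)))).inv ≫ (tPow a n ⊗ₘ tPow a n) := by
  rw [show tPow (k := k) a n = _ from single_eq (E := diskPow k) ((Above.base a).sqrt h0 h1) n]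
  rw [← show tPow (k := k) a n = _ from single_eq (E := diskPow k) ((Above.base a).sqrt h0 h1) n]
  nth_rw 2 [show tPow (k := k) a n = _ from single_eq (E := diskPow k)
    ((Above.base a).sqrt h0 h1) n]
  nth_rw 2 [show tPow (k := k) a n = _ from single_eq (E := diskPow k)
    ((Above.base a).sqrt h0 h1) n]
  exact IndObj.hom_ext fun _ => congrArg (IndObj.Germ.mk (Y := (diskAlg k a).tensor (diskAlg k a)) _)
    (show incl _ (diskPow k) n ≫ diskComulAux _ = (λ_ (𝟙_ (Ban k))).inv ≫
      (incl _ (diskPow k) n ⊗ₘ incl _ (diskPow k) n) from Ban.hom_ext fun x =>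
        (diskComulAux_incl _ _ _).trans (tensorHom_otm _ _ _ _).symm)

lemma tPow_counit (n : ℕ) : tPow (k := k) 1 n ≫ ComonObj.counit = 𝟙 _ :=
  IndObj.hom_ext fun _ => congrArg (IndObj.Germ.mk (Y := IndObj.const (𝟙_ (Ban k))) ⟨⟨⟩⟩)
    (show incl _ (diskPow k) n ≫ diskCounitAux _ (Above.base 1).2.le = 𝟙 _ from Ban.hom_ext fun x =>
      diskCounitAux_incl _ (Above.base 1).2.le n x)

lemma tPow_res (n : ℕ) : tPow (k := k) 1 n ≫ diskRes k = tPow 0 n := by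
  rw [show tPow (k := k) 0 n = _ from single_eq (E := diskPow k)
    ⟨(Above.base.{u} 1).1, zero_lt_one.trans (Above.base.{u} 1).2⟩ n]
  exact IndObj.hom_ext fun _ => congrArg (IndObj.Germ.mk (Y := diskAlg k 0) _) (Category.comp_id _)

end disk

/-- Coactions over `k{t}†` which are homogeneous on words. -/
theorem isDaggerZeroNicholsUngenerated [CompleteSpace k] {K : Words (Ban k)} {R : IndObj (Ban k)}
    {j : ∀ n, IndObj.const (K.W n) ⟶ R} (hj : LevelGen j) (hA : Approximable R)
    [MonObj R] [ComonObj R] {c : R ⊗ R ⟶ R ⊗ R} {S : R ⟶ R}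
    (hμ : (IndObj.constWords K).IsMul j MonObj.mul) (hη : (IndObj.constWords K).IsOne j MonObj.one)
    (hΔ : (IndObj.constWords K).IsComul j ComonObj.comul)
    (hε : (IndObj.constWords K).IsCounit j ComonObj.counit)
    (hc : (IndObj.constWords K).IsBraid j c) (hS : (IndObj.constWords K).IsAntipode j S)
    {σ : ∀ n, R ⟶ IndObj.const (K.W n)} (hσ : (IndObj.constWords K).IsSymmetrizer j σ)
    {ρ : R ⟶ diskAlg k 1 ⊗ R} (hρ : ∀ n, IsHomogeneous (tPow 1) ρ n (j n)) {V : IndObj (Ban k)}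
    (w : V ≅ (IndObj.constWords K).W 1) {c₀ : V ⊗ V ⟶ V ⊗ V}
    (h₀ : c₀ ≫ (w.hom ⊗ₘ w.hom) ≫ ((IndObj.constWords K).g (rfl : 1 + 1 = 2)).hom =
      (w.hom ⊗ₘ w.hom) ≫ ((IndObj.constWords K).g rfl).hom ≫ (IndObj.constWords K).s 2 0)
    (hc₀ : IsPreBraiding c₀) (hV : IsFlat V) (hR : IsFlat R) :
    IsDaggerZeroNicholsUngenerated c₀ R c ρ (w.hom ≫ j 1) where
  counital := hj.ext₁ ((approximable_const _).tensor hA).isMonomorphic fun n => by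
    have h := hρ n
    unfold IsHomogeneous at h
    rw [← Category.assoc, h, Category.assoc, ← tensorHom_id, tensorHom_comp_tensorHom, tPow_counit,
      Category.comp_id, id_tensorHom, leftUnitor_inv_naturality]
  over_one := Words.isNicholsOver (separating hj hA) (fun _ => approximable_const _) hμ hη hΔ hε hc
    hS hσ (approximable_disk 1) rfl (tPow_mul 1) (tPow_comul 1 zero_le_one le_rfl) (tPow_tCoeff 1)
    (fun _ _ h => tPow_tCoeff_ne 1 h) hρ w h₀ hc₀ hV hR
  over_zero := Words.isNicholsOver (separating hj hA) (fun _ => approximable_const _) hμ hη hΔ hε hc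
    hS hσ (approximable_disk 0) rfl (tPow_mul 0) (tPow_comul 0 le_rfl zero_le_one) (tPow_tCoeff 0)
    (fun _ _ h => tPow_tCoeff_ne 0 h) (fun n => by
      have h := hρ n
      unfold IsHomogeneous at h ⊢
      rw [← Category.assoc, h, Category.assoc, ← tensorHom_id, tensorHom_comp_tensorHom, tPow_res,
        Category.comp_id]) w h₀ hc₀ hV hR

end Ban

section bounded

variable {k : Type*} [NormedField k] {E : Type*} [NormedAddCommGroup E] [NormedSpace k E]

lemma LinearMap.exists_bound_of_basis {F : Type*} [SeminormedAddCommGroup F] [NormedSpace k F]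
    {ι : Type*} [Fintype ι] (b : Module.Basis ι k E) (hb : ∀ i, ∃ C, ∀ x, ‖b.repr x i‖ ≤ C * ‖x‖)
    (f : E →ₗ[k] F) : ∃ C, ∀ x, ‖f x‖ ≤ C * ‖x‖ := by
  choose C hC using hb
  refine ⟨∑ i, C i * ‖f (b i)‖, fun x => ?_⟩
  have h : f x = ∑ i, b.repr x i • f (b i) := by
    conv_lhs => rw [← b.sum_repr x]
    simp only [map_sum, map_smul]
  rw [h, Finset.sum_mul]
  refine (norm_sum_le _ _).trans (Finset.sum_le_sum fun i _ => ?_)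
  rw [norm_smul]
  calc ‖b.repr x i‖ * ‖f (b i)‖ ≤ C i * ‖x‖ * ‖f (b i)‖ := by gcongr; exact hC i x
    _ = _ := by ring

lemma completeSpace_of_basis [CompleteSpace k] {ι : Type*} [Fintype ι] (b : Module.Basis ι k E)
    (hb : ∀ i, ∃ C, ∀ x, ‖b.repr x i‖ ≤ C * ‖x‖) : CompleteSpace E := by
  obtain ⟨C, hC⟩ := LinearMap.exists_bound_of_basis b hb b.equivFun.toLinearMap
  have h : ∀ x : ι → k, ‖b.equivFun.symm x‖ ≤ (∑ i, ‖b i‖) * ‖x‖ := fun x => by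
    rw [b.equivFun_symm_apply, Finset.sum_mul]
    refine (norm_sum_le _ _).trans (Finset.sum_le_sum fun i _ => ?_)
    rw [norm_smul, mul_comm]
    gcongr
    exact norm_le_pi_norm x i
  exact (completeSpace_congr (e := b.equivFun.toEquiv)
    (b.equivFun.toContinuousLinearEquivOfBounds C _ hC h).isUniformEmbedding).2 inferInstance

lemma LinearMap.exists_bound_functional [CompleteSpace k] (n : ℕ) : ∀ (E : Type*)
    [NormedAddCommGroup E] [NormedSpace k E] [FiniteDimensional k E], Module.finrank k E = n →
    ∀ f : E →ₗ[k] k, ∃ C, ∀ x, ‖f x‖ ≤ C * ‖x‖ := by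
  induction n with
  | zero =>
    intro E _ _ _ hE f
    have := Module.finrank_zero_iff.1 hE
    exact ⟨0, fun x => by rw [Subsingleton.elim x 0]; simp⟩
  | succ n ih =>
    intro E _ _ _ hE f
    rcases eq_or_ne f 0 with rfl | hf
    · exact ⟨0, fun x => by simp⟩
    obtain ⟨v, hv⟩ : ∃ v, f v = 1 := LinearMap.surjective hf 1
    have hH : Module.finrank k (LinearMap.ker f) = n := by
      have := Module.Dual.finrank_ker_add_one_of_ne_zero hf
      omega
    have : CompleteSpace (LinearMap.ker f) := completeSpace_of_basis
      (Module.finBasis k (LinearMap.ker f)) fun i =>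
        ih _ hH ((Module.finBasis k (LinearMap.ker f)).coord i)
    have hcl : IsClosed ((LinearMap.ker f : Submodule k E) : Set E) :=
      (completeSpace_coe_iff_isComplete.1 this).isClosed
    obtain ⟨ε, hε, h⟩ := Metric.isOpen_iff.1 hcl.isOpen_compl v (by simp [hv])
    refine ⟨ε⁻¹, fun x => ?_⟩
    rcases eq_or_ne (f x) 0 with h0 | h0
    · rw [h0, norm_zero]; positivity
    · have : ε ≤ ‖(f x)⁻¹ • x‖ := by
        by_contra! hlt
        exact h (show v - (f x)⁻¹ • x ∈ Metric.ball v ε by simpa [dist_eq_norm] using hlt)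
          (by simp [hv, h0])
      rw [norm_smul, norm_inv, inv_mul_eq_div, le_div_iff₀ (norm_pos_iff.2 h0)] at this
      rw [inv_mul_eq_div, le_div_iff₀' hε]
      exact this

/-- Linear maps out of a finite-dimensional normed space are bounded. -/
lemma LinearMap.exists_bound [CompleteSpace k] [FiniteDimensional k E] {F : Type*}
    [SeminormedAddCommGroup F] [NormedSpace k F] (f : E →ₗ[k] F) : ∃ C, ∀ x, ‖f x‖ ≤ C * ‖x‖ :=
  LinearMap.exists_bound_of_basis (Module.finBasis k E)
    (fun i => LinearMap.exists_bound_functional _ E rfl ((Module.finBasis k E).coord i)) f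

end bounded

namespace Ban

variable {k : Type u} [NormedField k] [CompleteSpace k]

/-- The operator `x ↦ ξ x • y` of rank one. -/
def rankOne {X Y : Ban k} (ξ : X ⟶ 𝟙_ (Ban k)) (y : Y) : X ⟶ Y :=
  ofLin ((show X →ₗ[k] k from ξ.lin).smulRight y) (by
    obtain ⟨C, -, hC⟩ := exists_normLE ξ
    refine ⟨C * ‖y‖, fun x => (norm_smul_le (toScalar (ξ x)) y).trans ?_⟩
    calc ‖toScalar (ξ x)‖ * ‖y‖ ≤ C * ‖x‖ * ‖y‖ := by gcongr; exact hC x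
      _ = _ := by ring)

lemma rankOne_apply {X Y : Ban k} (ξ : X ⟶ 𝟙_ (Ban k)) (y : Y) (x : X) :
    rankOne ξ y x = toScalar (ξ x) • y := rfl

lemma comp_rankOne {W X Y : Ban k} (f : W ⟶ X) (ξ : X ⟶ 𝟙_ (Ban k)) (y : Y) :
    f ≫ rankOne ξ y = rankOne (f ≫ ξ) y := rfl

lemma rankOne_comp {X Y Z : Ban k} (ξ : X ⟶ 𝟙_ (Ban k)) (y : Y) (f : Y ⟶ Z) :
    rankOne ξ y ≫ f = rankOne ξ (f y) := hom_ext fun _ => map_smul f.lin _ _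

lemma normLE_rankOne {X Y : Ban k} {ξ : X ⟶ 𝟙_ (Ban k)} {y : Y} {C D : ℝ} (hξ : NormLE ξ C)
    (hy : ‖y‖ ≤ D) : NormLE (rankOne ξ y) (C * D) := fun x => by
  rw [rankOne_apply, norm_smul]
  calc ‖toScalar (ξ x)‖ * ‖y‖ ≤ (C * ‖x‖) * D :=
        mul_le_mul (hξ x) hy (norm_nonneg _) ((norm_nonneg _).trans (hξ x))
    _ = _ := by ring

lemma exists_ofLin {X Y : Ban k} [FiniteDimensional k X] (f : X →ₗ[k] Y) :
    ∃ g : X ⟶ Y, ∀ x, g x = f x := ⟨ofLin f (LinearMap.exists_bound f), fun _ => rfl⟩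

/-- `E` is a retract of `k ^ N` through maps with entries bounded by `C`. -/
def HasFrame (E : Ban k) (N : ℕ) (C : ℝ) : Prop :=
  ∃ (e : Fin N → E) (ξ : Fin N → (E ⟶ 𝟙_ (Ban k))), (∀ i, ‖e i‖ ≤ C) ∧ (∀ i, NormLE (ξ i) C) ∧
    ∑ i, rankOne (ξ i) (e i) = 𝟙 E

lemma hasFrame_unit : HasFrame (𝟙_ (Ban k)) 1 1 :=
  ⟨fun _ => scalar 1, fun _ => 𝟙 _, fun _ => (norm_one (α := k)).le, fun _ => normLE_id _, by
    rw [Fin.sum_univ_one]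
    exact hom_ext fun x => mul_one (toScalar x)⟩

lemma HasFrame.tensor {E F : Ban k} {N M : ℕ} {C D : ℝ} (hC : 0 ≤ C) (hD : 0 ≤ D)
    (hE : HasFrame E N C) (hF : HasFrame F M D) : HasFrame (E ⊗ F) (N * M) (C * D) := by
  obtain ⟨e, ξ, he, hξ, h⟩ := hE
  obtain ⟨f, η, hf, hη, h'⟩ := hF
  refine ⟨fun i => otm (e (finProdFinEquiv.symm i).1) (f (finProdFinEquiv.symm i).2),
    fun i => (ξ (finProdFinEquiv.symm i).1 ⊗ₘ η (finProdFinEquiv.symm i).2) ≫ (λ_ _).hom,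
    fun i => (norm_tmul_le _ _).trans (mul_le_mul (he _) (hf _) (norm_nonneg _) hC),
    fun i => ((normLE_tensorHom hC hD (hξ _) (hη _)).comp (normLE_leftUnitor_hom _)
      zero_le_one).mono (one_mul _).le, ?_⟩
  rw [Equiv.sum_comp finProdFinEquiv.symm (fun p : Fin N × Fin M =>
    rankOne ((ξ p.1 ⊗ₘ η p.2) ≫ (λ_ _).hom) (otm (e p.1) (f p.2))), Fintype.sum_prod_type]
  have h₁ : ∀ i j, rankOne ((ξ i ⊗ₘ η j) ≫ (λ_ _).hom) (otm (e i) (f j)) =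
      (rankOne (ξ i) (e i) ⊗ₘ rankOne (η j) (f j)) := fun i j => ext₂ fun x y => by
    rw [rankOne_apply, comp_apply, tensorHom_otm, tensorHom_otm, rankOne_apply, rankOne_apply,
      smul_otm, otm_smul, smul_smul]
    refine congrArg (fun a : k => a • otm (e i) (f j)) ?_
    exact (congrArg toScalar (lunitHom_tmul _ _)).trans rfl
  simp only [h₁]
  rw [← id_tensorHom_id, ← h, ← h']
  refine ext₂ fun x y => ?_
  simp only [sum_apply, tensorHom_otm]
  have hl : ∀ (t : Finset (Fin N)) (g : Fin N → E) (y : F),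
      otm (∑ i ∈ t, g i) y = ∑ i ∈ t, otm (g i) y := fun t g y => map_sum (tmulRight y).lin _ _
  have hr : ∀ (t : Finset (Fin M)) (x : E) (g : Fin M → F),
      otm x (∑ i ∈ t, g i) = ∑ i ∈ t, otm x (g i) := fun t x g => map_sum (tmulLeft x).lin _ _
  simp only [hl, hr]

lemma HasFrame.finiteDimensional {E : Ban k} {N : ℕ} {C : ℝ} (h : HasFrame E N C) :
    FiniteDimensional k E := by
  obtain ⟨e, ξ, -, -, h⟩ := h
  refine FiniteDimensional.of_surjective (Fintype.linearCombination k e) fun x =>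
    ⟨fun i => toScalar (ξ i x), ?_⟩
  rw [Fintype.linearCombination_apply]
  have := congrArg (fun f : E ⟶ E => f x) h
  simp only [sum_apply, rankOne_apply, id_apply] at this
  exact this

lemma hasFrame_of_finiteDimensional (V : Ban k) [FiniteDimensional k V] :
    ∃ N C, 0 ≤ C ∧ HasFrame V N C := by
  have hξ : ∀ i, ∃ ξ : V ⟶ 𝟙_ (Ban k), ∀ x, ξ x = scalar ((Module.finBasis k V).repr x i) :=
    fun i => exists_ofLin (Y := 𝟙_ (Ban k)) (show V →ₗ[k] 𝟙_ (Ban k) from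
      (Module.finBasis k V).coord i)
  choose ξ hξ using hξ
  choose C hC0 hC using fun i => exists_normLE (ξ i)
  have h0 : ∀ i, C i + ‖Module.finBasis k V i‖ ≤ ∑ j, (C j + ‖Module.finBasis k V j‖) := fun i =>
    Finset.single_le_sum (f := fun j => C j + ‖Module.finBasis k V j‖)
      (fun j _ => by have := hC0 j; positivity) (Finset.mem_univ i)
  refine ⟨_, ∑ j, (C j + ‖Module.finBasis k V j‖),
    Finset.sum_nonneg fun j _ => by have := hC0 j; positivity, Module.finBasis k V, ξ,
    fun i => by linarith [h0 i, hC0 i], fun i => (hC i).mono (by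
      linarith [h0 i, norm_nonneg (Module.finBasis k V i)]), hom_ext fun x => ?_⟩
  rw [sum_apply]
  simp only [rankOne_apply, hξ]
  exact (Module.finBasis k V).sum_repr x

lemma HasFrame.tpow {V : Ban k} {N : ℕ} {C : ℝ} (hC : 0 ≤ C) (h : HasFrame V N C) :
    ∀ n, HasFrame (tpow V n) (N ^ n) (C ^ n)
  | 0 => by
    rw [pow_zero, pow_zero]
    exact hasFrame_unit
  | n + 1 => by
    rw [pow_succ, pow_succ]
    exact (HasFrame.tpow hC h n).tensor (pow_nonneg hC n) hC h

/-- An endomorphism `S` of a space with a frame is a sum of at most `N` bounded operators of rank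
one followed by `S`, with functionals factoring through `S`, and with a bound which does not
depend on `S`. -/
lemma HasFrame.exists_factor {E : Ban k} {N : ℕ} {C : ℝ} (h : HasFrame E N C) (S : E ⟶ E) :
    ∃ (d : ℕ) (ξ : Fin d → (E ⟶ 𝟙_ (Ban k))) (y : Fin d → E), d ≤ N ∧
      (∀ b, NormLE (S ≫ ξ b) (N * C)) ∧ (∀ b, ‖y b‖ ≤ C) ∧
      ∑ b, S ≫ rankOne (ξ b) (y b) ≫ S = S := by
  have hE := h.finiteDimensional
  obtain ⟨e, ξ, he, hξ, h⟩ := h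
  set W := Submodule.span k (Set.range fun i => S (e i)) with hW
  have hSW : ∀ x, S x = ∑ i, toScalar (ξ i x) • S (e i) := fun x => by
    have := congrArg (fun f : E ⟶ E => S (f x)) h
    simp only [sum_apply, rankOne_apply, id_apply] at this
    rw [← this]
    exact (map_sum S.lin _ _).trans (Finset.sum_congr rfl fun i _ => map_smul S.lin _ _)
  have hmem : ∀ x, S x ∈ W := fun x => by
    rw [hSW]
    exact Submodule.sum_mem _ fun i _ => Submodule.smul_mem _ _ (Submodule.subset_span ⟨i, rfl⟩)
  let u : Fin N → W := fun i => ⟨S (e i), hmem _⟩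
  obtain ⟨f, hf, hspan, hli⟩ := Submodule.exists_fun_fin_finrank_span_eq k
    (Set.range fun i => S (e i))
  choose v₀ hv₀ using hf
  let b0 : Module.Basis (Fin (Module.finrank k W)) k W := Module.finBasis k W
  have hdet₀ : b0.det (u ∘ v₀) ≠ 0 := by
    have hli' : LinearIndependent k (u ∘ v₀) := by
      refine LinearIndependent.of_comp W.subtype ?_
      have : W.subtype ∘ u ∘ v₀ = f := funext fun i => hv₀ i
      rw [this]
      exact hli
    have := (b0.is_basis_iff_det (v := u ∘ v₀)).1 ⟨hli', by
      exact hli'.span_eq_top_of_card_eq_finrank' (Fintype.card_fin _)⟩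
    exact this.ne_zero
  have : Nonempty (Fin (Module.finrank k W) → Fin N) := ⟨v₀⟩
  obtain ⟨v, hv⟩ := Finite.exists_max fun v : Fin (Module.finrank k W) → Fin N =>
    ‖b0.det (u ∘ v)‖
  have hdet : b0.det (u ∘ v) ≠ 0 := fun h0 => hdet₀ (by
    have := hv v₀
    rw [h0, norm_zero] at this
    exact norm_le_zero_iff.1 this)
  obtain ⟨hli', hsp⟩ := (b0.is_basis_iff_det (v := u ∘ v)).2 (isUnit_iff_ne_zero.2 hdet)
  let B := Module.Basis.mk hli' hsp.ge
  have hcoord : ∀ b i, ‖B.coord b (u i)‖ ≤ 1 := fun b i => by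
    have h₁ := congrArg (fun φ : W →ₗ[k] k => φ (u i))
      (b0.det_smul_mk_coord_eq_det_update hli' hsp.ge b)
    have h₂ : ‖b0.det (u ∘ v)‖ * ‖B.coord b (u i)‖ ≤ ‖b0.det (u ∘ v)‖ := by
      rw [← norm_mul]
      refine (congrArg norm h₁).trans_le ?_
      refine le_trans (le_of_eq ?_) (hv (Function.update v b i))
      rw [Function.comp_update]
      rfl
    exact (mul_le_iff_le_one_right (norm_pos_iff.2 hdet)).1 h₂
  choose ψ hψ using fun b => LinearMap.exists_extend (B.coord b)
  choose χ hχ using fun b => exists_ofLin (Y := 𝟙_ (Ban k)) (show E →ₗ[k] 𝟙_ (Ban k) from ψ b)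
  have hψ' : ∀ b x, χ b (S x) = scalar (B.coord b ⟨S x, hmem x⟩) := fun b x => by
    rw [hχ, ← hψ]
    rfl
  refine ⟨_, χ, fun b => e (v b), ?_, fun b x => ?_, fun b => he _, hom_ext fun x => ?_⟩
  · have := finrank_range_le_card (R := k) (b := fun i => S (e i))
    simpa [Set.finrank] using this
  · have h₁ : B.coord b ⟨S x, hmem x⟩ = ∑ i, toScalar (ξ i x) * B.coord b (u i) := by
      have : (⟨S x, hmem x⟩ : W) = ∑ i, toScalar (ξ i x) • u i := Subtype.ext (by
        rw [Submodule.coe_sum]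
        exact hSW x)
      rw [this, map_sum]
      simp only [map_smul, smul_eq_mul]
    rw [comp_apply, hψ']
    refine (congrArg norm h₁).trans_le ((norm_sum_le _ _).trans ?_)
    have : ∀ i ∈ Finset.univ, ‖toScalar (ξ i x) * B.coord b (u i)‖ ≤ C * ‖x‖ := fun i _ => by
      rw [norm_mul]
      exact (mul_le_of_le_one_right (norm_nonneg _) (hcoord b i)).trans (hξ i x)
    exact (Finset.sum_le_sum this).trans (by simp [mul_assoc])
  · have h₁ := congrArg Subtype.val (B.sum_repr ⟨S x, hmem x⟩)
    rw [sum_apply]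
    refine Eq.trans ?_ h₁
    rw [Submodule.coe_sum]
    refine Finset.sum_congr rfl fun b _ => ?_
    rw [rankOne_comp, comp_apply, rankOne_apply, hψ']
    show _ = B.repr ⟨S x, hmem x⟩ b • (B b : E)
    rw [show (B b : E) = S (e (v b)) from congrArg Subtype.val (Module.Basis.mk_apply hli' hsp.ge b)]
    rfl

end Ban

namespace Ban

variable {k : Type u} [NormedField k]

/-- The kernel of a morphism. -/
def ker {X Y : Ban k} (f : X ⟶ Y) : Ban k :=
  haveI : IsClosed ((LinearMap.ker f.lin : Submodule k X) : Set X) :=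
    isClosed_singleton.preimage (hom_continuous f)
  ⟨LinearMap.ker f.lin⟩

/-- The inclusion of the kernel. -/
def kerι {X Y : Ban k} (f : X ⟶ Y) : ker f ⟶ X :=
  ofLin (V := ker f) (LinearMap.ker f.lin).subtype ⟨1, fun x => (one_mul ‖x‖).ge⟩

lemma kerι_comp {X Y : Ban k} (f : X ⟶ Y) : kerι f ≫ f = 0 := hom_ext fun x => x.2

/-- The factorisation through the kernel. -/
def kerLift {A X Y : Ban k} (f : X ⟶ Y) (g : A ⟶ X) (h : g ≫ f = 0) : A ⟶ ker f :=
  ofLin (W := ker f) (g.lin.codRestrict (LinearMap.ker f.lin)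
    fun a => congrArg (fun φ : A ⟶ Y => φ a) h) g.bdd

lemma kerLift_ι {A X Y : Ban k} (f : X ⟶ Y) (g : A ⟶ X) (h : g ≫ f = 0) :
    kerLift f g h ≫ kerι f = g := rfl

lemma normLE_kerLift {A X Y : Ban k} (f : X ⟶ Y) (g : A ⟶ X) (h : g ≫ f = 0) {C : ℝ}
    (hg : NormLE g C) : NormLE (kerLift f g h) C := hg

lemma exists_hasSum {ι : Type*} {A B : Ban k} (f : ι → (A ⟶ B)) (c : ι → ℝ)
    (hf : ∀ i, NormLE (f i) (c i)) (hc : Summable c) :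
    ∃ s : A ⟶ B, ∀ x, HasSum (fun i => f i x) (s x) := by
  have hs : ∀ x, Summable fun i => f i x := fun x =>
    Summable.of_norm_bounded (hc.mul_right ‖x‖) fun i => hf i x
  refine ⟨ofLin ⟨⟨fun x => ∑' i, f i x, fun x y => ?_⟩, fun a x => ?_⟩ ⟨∑' i, c i, fun x => ?_⟩,
    fun x => (hs x).hasSum⟩
  · rw [← (hs x).tsum_add (hs y)]
    exact tsum_congr fun i => map_add (f i).lin _ _
  · rw [RingHom.id_apply]
    show _ = a • ∑' i, f i x
    rw [← (hs x).tsum_const_smul a]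
    exact tsum_congr fun i => map_smul (f i).lin _ _
  · exact tsum_of_norm_bounded (hc.hasSum.mul_right ‖x‖) fun i => hf i x

lemma eq_of_hasSum {ι : Type*} {A B C : Ban k} {f : ι → (A ⟶ B)} {s : A ⟶ B}
    (hs : ∀ x, HasSum (fun i => f i x) (s x)) {f' : ι → (A ⟶ C)} {s' : A ⟶ C}
    (hs' : ∀ x, HasSum (fun i => f' i x) (s' x)) (g : B ⟶ C) (h : ∀ i, f i ≫ g = f' i) :
    s ≫ g = s' := hom_ext fun x => by
  have h₁ := (hs x).map g.lin (hom_continuous g)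
  have h₂ : (fun i => f' i x) = g.lin ∘ fun i => f i x := funext fun i => by
    rw [← h]
    rfl
  have h₃ := hs' x
  rw [h₂] at h₃
  exact h₁.unique h₃

variable [CompleteSpace k]

/-- Operators with a rapidly converging expansion in operators of rank one. -/
def IsNuclear {X Y : Ban k} (u : X ⟶ Y) : Prop :=
  ∃ (ι : Type) (ξ : ι → (X ⟶ 𝟙_ (Ban k))) (y : ι → Y) (a : ι → ℝ), (∀ i, 0 ≤ a i) ∧
    (∀ i, NormLE (ξ i) (a i)) ∧ (Summable fun i => a i * ‖y i‖) ∧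
    ∀ x, HasSum (fun i => rankOne (ξ i) (y i) x) (u x)

/-- Contraction with a functional. -/
def contract {X : Ban k} (ξ : X ⟶ 𝟙_ (Ban k)) (E : Ban k) : X ⊗ E ⟶ E := ξ ▷ E ≫ (λ_ E).hom

lemma contract_natural {X E F : Ban k} (ξ : X ⟶ 𝟙_ (Ban k)) (f : E ⟶ F) :
    contract ξ E ≫ f = X ◁ f ≫ contract ξ F := by
  rw [contract, contract, Category.assoc, ← leftUnitor_naturality, whisker_exchange_assoc]

lemma normLE_contract {X : Ban k} {ξ : X ⟶ 𝟙_ (Ban k)} (E : Ban k) {a : ℝ} (ha : 0 ≤ a)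
    (h : NormLE ξ a) : NormLE (contract ξ E) a :=
  ((h.map ha zero_le_one (normLE_id E)).comp (normLE_leftUnitor_hom E) zero_le_one).mono (by simp)

lemma contract_otm {X E : Ban k} (ξ : X ⟶ 𝟙_ (Ban k)) (x : X) (e : E) :
    contract ξ E (otm x e) = toScalar (ξ x) • e :=
  (congrArg _ (map_tmul _ _ _ _)).trans (lunitHom_tmul _ _)

/-- Tensoring with an element. -/
def inserted {Y : Ban k} (y : Y) (E : Ban k) : E ⟶ Y ⊗ E := tmulLeft y

lemma inserted_apply {Y E : Ban k} (y : Y) (e : E) : inserted y E e = otm y e := rfl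

lemma normLE_inserted {Y : Ban k} (y : Y) (E : Ban k) : NormLE (inserted y E) ‖y‖ := norm_tmul_le y

lemma inserted_natural {Y E F : Ban k} (y : Y) (f : E ⟶ F) :
    inserted y E ≫ Y ◁ f = f ≫ inserted y F := hom_ext fun _ => map_tmul _ _ _ _

lemma IsNuclear.whisker {X Y E : Ban k} {ι : Type} {ξ : ι → (X ⟶ 𝟙_ (Ban k))} {y : ι → Y}
    {a : ι → ℝ} (ha : ∀ i, 0 ≤ a i) (hξ : ∀ i, NormLE (ξ i) (a i))
    (hs : Summable fun i => a i * ‖y i‖) {u : X ⟶ Y}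
    (hu : ∀ x, HasSum (fun i => rankOne (ξ i) (y i) x) (u x)) (z : (X ⊗ E : Ban k)) :
    HasSum (fun i => (contract (ξ i) E ≫ inserted (y i) E) z) ((u ▷ E) z) := by
  obtain ⟨s, hs⟩ := exists_hasSum (fun i => contract (ξ i) E ≫ inserted (y i) E)
    (fun i => ‖y i‖ * a i) (fun i => (normLE_contract E (ha i) (hξ i)).comp (normLE_inserted _ _)
      (norm_nonneg _)) (by simpa only [mul_comm] using hs)
  have : s = u ▷ E := ext₂ fun x e => by
    refine (hs (otm x e)).unique ?_
    have h₁ := (hu x).map (tmulRight e : Y ⟶ tensor Y E).lin (hom_continuous _)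
    have h₂ : (fun i => (contract (ξ i) E ≫ inserted (y i) E) (otm x e)) =
        (tmulRight e : Y ⟶ tensor Y E).lin ∘ fun i => rankOne (ξ i) (y i) x := funext fun i => by
      rw [comp_apply, contract_otm, inserted_apply, otm_smul, ← smul_otm]
      rfl
    rw [h₂]
    convert h₁ using 1
    exact map_tmul _ _ _ _
  rw [← this]
  exact hs z

lemma IsNuclear.exists_lift {X Y : Ban k} {u : X ⟶ Y} (hu : IsNuclear u) {A E F : Ban k}
    (f : E ⟶ F) (g : A ⟶ X ⊗ E) (h : g ≫ X ◁ f = 0) :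
    ∃ l : A ⟶ Y ⊗ ker f, l ≫ Y ◁ kerι f = g ≫ u ▷ E := by
  obtain ⟨ι, ξ, y, a, ha, hξ, hs, hu⟩ := hu
  obtain ⟨C, hC, hg⟩ := exists_normLE g
  have h₀ : ∀ i, (g ≫ contract (ξ i) E) ≫ f = 0 := fun i => by
    rw [Category.assoc, contract_natural, ← Category.assoc, h, Limits.zero_comp]
  obtain ⟨l, hl⟩ := exists_hasSum (fun i => kerLift f _ (h₀ i) ≫ inserted (y i) (ker f))
    (fun i => ‖y i‖ * (a i * C)) (fun i => (normLE_kerLift f _ (h₀ i)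
      (hg.comp (normLE_contract E (ha i) (hξ i)) (ha i))).comp (normLE_inserted _ _)
      (norm_nonneg _)) ((hs.mul_right C).congr fun i => by ring)
  refine ⟨l, eq_of_hasSum hl (f' := fun i => g ≫ contract (ξ i) E ≫ inserted (y i) E) (fun x =>
    IsNuclear.whisker ha hξ hs hu (g x)) _ fun i => ?_⟩
  rw [Category.assoc, inserted_natural, ← Category.assoc, kerLift_ι, Category.assoc]

lemma isNuclear_id (V : Ban k) [FiniteDimensional k V] : IsNuclear (𝟙 V) := by
  obtain ⟨N, C, hC, e, ξ, he, hξ, h⟩ := hasFrame_of_finiteDimensional V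
  refine ⟨Fin N, ξ, e, fun _ => C, fun _ => hC, hξ, (hasSum_fintype _).summable, fun x => ?_⟩
  rw [← h, sum_apply]
  exact hasSum_fintype _

end Ban

namespace IndObj

variable {k : Type u} [NormedField k] [CompleteSpace k]

/-- The ind-objects with nuclear transition maps. -/
def IsNuclear (R : IndObj (Ban k)) : Prop := ∀ i, ∃ (i' : R.I) (w : i ⟶ i'), Ban.IsNuclear (R.F.map w)

lemma comp_whisker_tensor {A P P' Q Q' Q'' : Ban k} (g : A ⟶ P ⊗ Q) (a : P ⟶ P') (f : Q ⟶ Q')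
    (b : Q' ⟶ Q'') : (g ≫ P ◁ f) ≫ (a ⊗ₘ b) = (g ≫ a ▷ Q) ≫ P' ◁ (f ≫ b) := by
  rw [MonoidalCategory.tensorHom_def, MonoidalCategory.whiskerLeft_comp, Category.assoc, Category.assoc,
    whisker_exchange_assoc]

lemma IsNuclear.exists_factor {R : IndObj (Ban k)} (hR : R.IsNuclear) {X Y : IndObj (Ban k)}
    (m : X ⟶ Y) {A : Ban k} (φ : const A ⟶ R ⊗ X) (h : φ ≫ R ◁ m = 0) :
    ∃ (B : Ban k) (κ : const B ⟶ X) (θ : const A ⟶ R ⊗ const B), κ ≫ m = 0 ∧ θ ≫ R ◁ κ = φ := by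
  obtain ⟨⟨i, x⟩, g, rfl⟩ := exists_ofConst φ
  obtain ⟨y, f₀, hf₀⟩ : ∃ y f₀, m.app x = Germ.mk y f₀ := by
    generalize m.app x = t
    induction t using Germ.ind with | h i h => exact ⟨i, h, rfl⟩
  have hm : (R ◁ m).app (i, x) = Germ.mk (Y := R.tensor Y) (i, y) (R.at' i ◁ f₀) := by
    show (tensorMap (𝟙 R) m).app (i, x) = _
    rw [tensorMap_app, hf₀]
    exact congrArg (Germ.mk (Y := R.tensor Y) (i, y)) (id_tensorHom _ _)
  rw [ofConst_comp (Y := R ⊗ X) (Z := R ⊗ Y) (l := (i, y)) g (R ◁ m) hm,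
    ← ofConst_zero (Y := R ⊗ Y) (i, y)] at h
  obtain ⟨⟨i₁, y₁⟩, w, w', e⟩ := ofConst_exact (Y := R ⊗ Y) h
  rw [Limits.zero_comp] at e
  obtain ⟨i₂, v, hv⟩ := hR i₁
  have e' : (g ≫ R.F.map w.1 ▷ X.at' x) ≫ R.at' i₁ ◁ (f₀ ≫ Y.F.map w.2) = 0 := by
    exact (comp_whisker_tensor _ _ _ _).symm.trans e
  obtain ⟨l, hl⟩ := hv.exists_lift _ _ e'
  refine ⟨_, ofConst x (Ban.kerι (f₀ ≫ Y.F.map w.2)),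
    ofConst (Y := R ⊗ const (Ban.ker (f₀ ≫ Y.F.map w.2))) (i₂, ⟨⟨⟩⟩) l, ?_, ?_⟩
  · rw [ofConst_comp _ _ hf₀]
    refine (ofConst_map w.2 _).symm.trans ?_
    rw [Category.assoc, Ban.kerι_comp, ofConst_zero]
  · refine (ofConst_comp (Y := R ⊗ const (Ban.ker (f₀ ≫ Y.F.map w.2))) (Z := R ⊗ X)
      (i := (i₂, ⟨⟨⟩⟩)) (l := (i₂, x)) l (R ◁ ofConst x (Ban.kerι _))
      (a := R.at' i₂ ◁ Ban.kerι (f₀ ≫ Y.F.map w.2))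
      (congrArg (Germ.mk (Y := R.tensor X) (i₂, x)) (id_tensorHom _ _))).trans ?_
    refine (congrArg (ofConst (Y := R ⊗ X) (i₂, x)) (?_ : _ =
      g ≫ (R ⊗ X).F.map (show ((i, x) : (R ⊗ X).I) ⟶ (i₂, x) from (w.1 ≫ v, 𝟙 x)))).trans
        (ofConst_map (Y := R ⊗ X) _ g)
    refine hl.trans ?_
    show _ = g ≫ (R.F.map (w.1 ≫ v) ⊗ₘ X.F.map (𝟙 x))
    rw [X.F.map_id, R.F.map_comp, tensorHom_id, comp_whiskerRight]
    exact Category.assoc _ _ _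

lemma IsNuclear.isFlat {R : IndObj (Ban k)} (hR : R.IsNuclear) : IsFlat R := by
  intro X Y f
  refine ⟨fun {c} hc => ?_⟩
  let ι := Limits.Fork.ι c
  have hι : ι ≫ f = ι ≫ 0 := Limits.Fork.condition c
  have hc' : Limits.IsLimit (Limits.Fork.ofι ι hι) := hc.ofIsoLimit (Limits.Fork.isoForkOfι c)
  suffices H : Limits.IsLimit ((tensorLeft R).mapCone (Limits.Fork.ofι ι hι)) from
    (Limits.preservesLimit_of_preserves_limit_cone hc' H).preserves hc
  have hzero : ∀ {A : Ban k} (ψ : const A ⟶ R ⊗ c.pt), ψ ≫ R ◁ ι = 0 → ψ = 0 := by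
    intro A ψ h
    obtain ⟨B, κ, θ, hκ, rfl⟩ := hR.exists_factor ι ψ h
    have : κ = 0 := Limits.Fork.IsLimit.hom_ext hc' (by
      rw [Limits.zero_comp]
      exact hκ)
    rw [this, MonoidalPreadditive.whiskerLeft_zero, Limits.comp_zero]
  have huniq : ∀ {A : Ban k} (ψ ψ' : const A ⟶ R ⊗ c.pt), ψ ≫ R ◁ ι = ψ' ≫ R ◁ ι → ψ = ψ' :=
    fun ψ ψ' h => sub_eq_zero.1 (hzero _ (by rw [Preadditive.sub_comp, h, sub_self]))
  have hlift : ∀ {A : Ban k} (φ : const A ⟶ R ⊗ X), φ ≫ R ◁ f = 0 →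
      ∃ ψ : const A ⟶ R ⊗ c.pt, ψ ≫ R ◁ ι = φ := by
    intro A φ h
    obtain ⟨B, κ, θ, hκ, rfl⟩ := hR.exists_factor f φ h
    obtain ⟨l, hl⟩ := Limits.Fork.IsLimit.lift' hc' κ (by rw [hκ, Limits.comp_zero])
    refine ⟨θ ≫ R ◁ l, ?_⟩
    rw [Category.assoc, ← whiskerLeft_comp]
    exact congrArg (θ ≫ R ◁ ·) hl
  refine (Limits.isLimitMapConeForkEquiv (tensorLeft R) hι).symm
    (Limits.Fork.IsLimit.ofExistsUnique fun s => ?_)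
  have hs : s.ι ≫ R ◁ f = 0 := s.condition.trans (by
    show s.ι ≫ R ◁ (0 : X ⟶ Y) = 0
    rw [MonoidalPreadditive.whiskerLeft_zero, Limits.comp_zero])
  have h := fun i : s.pt.I => hlift (ofConst i (𝟙 _) ≫ s.ι) (by
    rw [Category.assoc, hs, Limits.comp_zero])
  choose ψ hψ using h
  have hcompat : ∀ {i i' : s.pt.I} (w : i ⟶ i'), constMap (s.pt.F.map w) ≫ ψ i' = ψ i :=
    fun {i i'} w => huniq _ _ (by
      rw [Category.assoc, hψ, hψ, ← Category.assoc, constMap_ofConst, Category.comp_id,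
        ← ofConst_map w, Category.id_comp])
  let Ψ : s.pt ⟶ R ⊗ c.pt := ⟨fun i => (ψ i).app ⟨⟨⟩⟩, fun w =>
    congrArg (fun φ : const _ ⟶ R ⊗ c.pt => φ.app ⟨⟨⟩⟩) (hcompat w)⟩
  refine ⟨Ψ, hom_ext fun i => ?_, fun Ψ' h => hom_ext fun i => ?_⟩
  · exact (congrArg (fun φ : const _ ⟶ R ⊗ X => φ.app ⟨⟨⟩⟩) (hψ i)).trans (Germ.precomp_id _)
  · have : ofConst i (𝟙 _) ≫ Ψ' = ψ i := huniq _ _ (by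
      rw [hψ, Category.assoc]
      exact congrArg (ofConst i (𝟙 _) ≫ ·) h)
    exact (Germ.precomp_id _).symm.trans
      (congrArg (fun φ : const _ ⟶ R ⊗ c.pt => φ.app ⟨⟨⟩⟩) this)

lemma isNuclear_const (V : Ban k) [FiniteDimensional k V] : (const V).IsNuclear := fun i =>
  ⟨i, 𝟙 i, Ban.isNuclear_id V⟩

end IndObj

section Formal

universe v w

variable {D : Type w} [Category.{v} D] [MonoidalCategory D] [Preadditive D] [MonoidalPreadditive D]

namespace Words

variable {K : Words D} {p q n : ℕ}

lemma sym_tensor (h : p + q = n) : (K.sym p 0 p ⊗ₘ K.sym q 0 q) ≫ (K.g h).hom =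
    (K.g h).hom ≫ K.sym n 0 p ≫ K.sym n p q := by
  have h₂ := sym_right (K := K) h (a := 0) (b := q) (by lia)
  rw [add_zero] at h₂
  rw [MonoidalCategory.tensorHom_def, Category.assoc, h₂, ← Category.assoc,
    sym_left h (by lia), Category.assoc]

lemma sym_tensor_inv (h : p + q = n) : (K.g h).inv ≫ (K.sym p 0 p ⊗ₘ K.sym q 0 q) =
    (K.sym n 0 p ≫ K.sym n p q) ≫ (K.g h).inv := by
  rw [Iso.inv_comp_eq, ← Category.assoc, ← sym_tensor h, Category.assoc, Iso.hom_inv_id,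
    Category.comp_id]

omit [MonoidalPreadditive D] in
lemma sym_comm (p q : ℕ) : K.sym n 0 p ≫ K.sym n p q = K.sym n p q ≫ K.sym n 0 p := by
  have := BraidWord.comm_sym (s := K.s n) (A := End (K.W n)) (x := K.sym n 0 p) (a := p) (n := q)
    fun i hi => (BraidWord.comm_sym (s := K.s n) (A := End (K.W n)) (x := K.s n (p + i)) (a := 0)
      (n := p) fun j hj => BraidWord.comm_of (K.rels n) (by lia)).symm
  exact this.symm

lemma exists_sym_mul (h : p + q = n) : ∃ U : K.W n ⟶ K.W n, (K.g h).hom ≫ K.sym n 0 n =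
    (K.sym p 0 p ⊗ₘ K.sym q 0 q) ≫ (K.g h).hom ≫ U := by
  subst h
  refine ⟨BraidWord.unsh (A := End (K.W (p + q))) (K.s (p + q)) 0 p q, ?_⟩
  have := BraidWord.sym_add' (A := End (K.W (p + q))) (K.rels (p + q)) 0 p q
  rw [zero_add] at this
  rw [← Category.assoc, sym_tensor, Category.assoc, sym_comm, Category.assoc]
  exact congrArg ((K.g rfl).hom ≫ ·) (this.trans (Category.assoc (K.sym (p + q) p q)
    (K.sym (p + q) 0 p) _))

lemma sh_sym (h : p + q = n) : K.sh n 0 p q ≫ (K.g h).inv ≫ (K.sym p 0 p ⊗ₘ K.sym q 0 q) =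
    K.sym n 0 n ≫ (K.g h).inv := by
  subst h
  rw [sym_tensor_inv, ← Category.assoc, sym_add]

lemma br_sym (h : p + q = n) (h' : q + p = n) :
    (K.g h).inv ≫ (K.sym p 0 p ⊗ₘ K.sym q 0 q) ≫ (K.g h).hom ≫ K.br n 0 p q =
      K.br n 0 p q ≫ (K.g h').inv ≫ (K.sym q 0 q ⊗ₘ K.sym p 0 p) ≫ (K.g h').hom := by
  have h₁ : K.sym n 0 p ≫ K.br n 0 p q = K.br n 0 p q ≫ K.sym n q p := by
    have := BraidWord.br_sym_left (A := End (K.W n)) (K.rels n) 0 p q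
    rwa [zero_add] at this
  have h₂ : K.sym n p q ≫ K.br n 0 p q = K.br n 0 p q ≫ K.sym n 0 q := by
    have := BraidWord.br_sym_right (A := End (K.W n)) (K.rels n) 0 p q
    rwa [zero_add] at this
  rw [← Category.assoc, sym_tensor_inv, ← Category.assoc (K.g h').inv, sym_tensor_inv]
  simp only [Category.assoc, Iso.inv_hom_id, Iso.inv_hom_id_assoc, Category.comp_id]
  rw [h₂, reassoc_of% h₁, sym_comm]

omit [MonoidalPreadditive D] in
lemma exists_tw_sym (n : ℕ) : ∃ U : K.W n ⟶ K.W n, K.tw n 0 n ≫ K.sym n 0 n = K.sym n 0 n ≫ U :=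
  BraidWord.exists_sym_tw (A := End (K.W n)) (K.rels n) n

end Words

end Formal

namespace Ban

variable {k : Type u} [NormedField k]

lemma geom_eq_zero {r : Radius.{u}} {E : ℕ → Ban k} {X : Ban k} (f : geom r E ⟶ X) (x : geom r E)
    (h : ∀ n, f (incl r E n (coeff n x)) = 0) : f x = 0 := by
  have h₁ := (hasSum_incl x).map f.lin (hom_continuous f)
  rw [show f.lin ∘ (fun n => incl r E n (coeff n x)) = fun _ => 0 from funext h] at h₁
  exact h₁.unique hasSum_zero

variable [CompleteSpace k]

lemma geom_otm_eq_zero {r s : Radius.{u}} {E F : ℕ → Ban k} {X : Ban k}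
    (f : geom r E ⊗ geom s F ⟶ X) (x : geom r E) (y : geom s F)
    (h : ∀ m n, f (otm (incl r E m (coeff m x)) (incl s F n (coeff n y))) = 0) :
    f (otm x y) = 0 :=
  geom_eq_zero ((tmulRight y : geom r E ⟶ tensor (geom r E) (geom s F)) ≫ f) x fun m =>
    geom_eq_zero ((tmulLeft (incl r E m (coeff m x)) : geom s F ⟶ tensor (geom r E) (geom s F)) ≫ f)
      y fun n => h m n

lemma mem_of_otm {V W Z : Ban k} (f : V ⊗ W ⟶ Z) (T : Submodule k Z) (hT : IsClosed (T : Set Z))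
    (h : ∀ x y, f (otm x y) ∈ T) (z : (V ⊗ W : Ban k)) : f z ∈ T := by
  have hc : IsClosed (f.lin ⁻¹' (T : Set Z)) := hT.preimage (hom_continuous f)
  refine (denseRange_toTensor V W).induction_on z hc fun w => ?_
  obtain ⟨l, rfl⟩ := exists_tensorVal w
  induction l with
  | nil => exact (map_zero (f.lin ∘ₗ toTensor V W)).symm ▸ T.zero_mem
  | cons p l ih =>
    rw [tensorVal_cons]
    show (f.lin ∘ₗ toTensor V W) _ ∈ T
    rw [map_add]
    exact T.add_mem (h _ _) ih

section symIdeal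

variable {V : Ban k} {c : V ⊗ V ⟶ V ⊗ V} (hc : IsPreBraiding c) (hc1 : NormLE c 1)

/-- The braided symmetrizer on `V ^ ⊗ n`. -/
def symm (n : ℕ) : tpow V n ⟶ tpow V n := (words hc).sym n 0 n

lemma exists_symm_concat (p q : ℕ) : ∃ U : tpow V (p + q) ⟶ tpow V (p + q),
    concat V p q ≫ symm hc (p + q) = (symm hc p ⊗ₘ symm hc q) ≫ concat V p q ≫ U := by
  obtain ⟨U, hU⟩ := Words.exists_sym_mul (K := words hc) (rfl : p + q = _)
  rw [words_g] at hU
  exact ⟨U, hU⟩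

lemma symm_concat_left {p q : ℕ} {x : tpow V p} (h : symm hc p x = 0) (y : tpow V q) :
    symm hc (p + q) (concat V p q (otm x y)) = 0 := by
  obtain ⟨U, hU⟩ := exists_symm_concat hc p q
  refine (congrArg (fun f : tpow V p ⊗ tpow V q ⟶ _ => f (otm x y)) hU).trans ?_
  rw [comp_apply, tensorHom_otm, h, show otm (0 : tpow V p) (symm hc q y) = 0 from
    map_zero (tmulRight (V := tpow V p) (symm hc q y)).lin, map_zero]

lemma symm_concat_right {p q : ℕ} (x : tpow V p) {y : tpow V q} (h : symm hc q y = 0) :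
    symm hc (p + q) (concat V p q (otm x y)) = 0 := by
  obtain ⟨U, hU⟩ := exists_symm_concat hc p q
  refine (congrArg (fun f : tpow V p ⊗ tpow V q ⟶ _ => f (otm x y)) hU).trans ?_
  rw [comp_apply, tensorHom_otm, h, show otm (symm hc p x) (0 : tpow V q) = 0 from
    map_zero (tmulLeft (W := tpow V q) (symm hc p x)).lin, map_zero]

lemma symm_zero : symm hc 0 = 𝟙 _ := Words.sym_zero (words hc) 0 0
lemma symm_one : symm hc 1 = 𝟙 _ := Words.sym_one (words hc) 1 0

/-- The elements of `T_r(V)` whose components of degree less than `d` are annihilated by the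
symmetrizers. -/
def symIdeal (d : ℕ∞) (r : Radius.{u}) : Submodule k (tens V r) where
  carrier := {x | ∀ n : ℕ, n < d → symm hc n (coeff n x) = 0}
  zero_mem' n _ := map_zero (coeffHom r (tpow V) n ≫ symm hc n).lin
  add_mem' {x y} hx hy n hn := by
    rw [coeff_add, map_add, hx n hn, hy n hn, add_zero]
  smul_mem' a x hx n hn := by
    rw [coeff_smul, map_smul, hx n hn, smul_zero]

lemma isClosed_symIdeal (d : ℕ∞) (r : Radius.{u}) :
    IsClosed (symIdeal hc d r : Set (tens V r)) := by
  have : (symIdeal hc d r : Set (tens V r)) = ⋂ n : ℕ, ⋂ _ : (n : ℕ∞) < d,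
      (coeffHom r (tpow V) n ≫ symm hc n).lin ⁻¹' {0} := by
    ext x
    simp only [Set.mem_iInter]
    rfl
  rw [this]
  exact isClosed_iInter fun n => isClosed_iInter fun _ =>
    isClosed_singleton.preimage (hom_continuous _)

lemma coeff_incl (r : Radius.{u}) (m n : ℕ) (x : tpow V n) (P : tpow V m → Prop) (h0 : P 0)
    (h : ∀ h : n = m, P (h ▸ x)) : P (coeff m (incl r (tpow V) n x)) := by
  by_cases hmn : n = m
  · subst hmn
    rw [coeff_incl_self]
    exact h rfl
  · rw [coeff_incl_ne (Ne.symm hmn)]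
    exact h0

lemma incl_mem_symIdeal {r : Radius.{u}} {n : ℕ} {x : tpow V n} {d : ℕ∞}
    (h : n < d → symm hc n x = 0) : incl r (tpow V) n x ∈ symIdeal hc d r := fun m hm =>
  coeff_incl r m n x (fun y => symm hc m y = 0) (map_zero _) fun e => by
    subst e
    exact h hm

lemma exists_symm_section [FiniteDimensional k V] (n : ℕ) :
    ∃ L : tpow V n ⟶ tpow V n, symm hc n ≫ L ≫ symm hc n = symm hc n := by
  obtain ⟨N, C, hC, hf⟩ := hasFrame_of_finiteDimensional V
  obtain ⟨d, ξ, y, -, -, -, h⟩ := (hf.tpow hC n).exists_factor (symm hc n)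
  refine ⟨∑ b, rankOne (ξ b) (y b), ?_⟩
  rw [Preadditive.sum_comp, Preadditive.comp_sum, h]

omit hc in
lemma incl_tensComul (r : Radius.{u}) (n : ℕ) :
    incl r (tpow V) n ≫ tensComul hc1 r = comulPow hc1 r.half n := hom_ext fun x => by
  rw [comp_apply, tensComul, desc_incl]

lemma comulPow_mem {r : Radius.{u}} {n : ℕ} {x : tpow V n} (T : Submodule k _)
    (h : ∀ p q (h : p + q = n), ((words hc).sh n 0 p q ≫ ((words hc).g h).inv ≫
      (incl r (tpow V) p ⊗ₘ incl r (tpow V) q)) x ∈ T) : comulPow hc1 r n x ∈ T := by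
  rw [comulPow_eq hc hc1, Words.shuffle, sum_apply]
  refine Submodule.sum_mem _ fun y hy => ?_
  rw [Finset.HasAntidiagonal.mem_antidiagonal] at hy
  rw [Words.J2_pos _ _ hy]
  exact h _ _ hy

lemma sh_symm {p q n : ℕ} (h : p + q = n) : (words hc).sh n 0 p q ≫ ((words hc).g h).inv ≫
    (symm hc p ⊗ₘ symm hc q) = symm hc n ≫ ((words hc).g h).inv := Words.sh_sym h

lemma incl_tensor_mem [FiniteDimensional k V] {r : Radius.{u}} {p q : ℕ}
    (z : (tpow V p ⊗ tpow V q : Ban k)) (hz : (symm hc p ⊗ₘ symm hc q) z = 0) (T : Submodule k _)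
    (hT : IsClosed (T : Set (tens V r ⊗ tens V r : Ban k)))
    (h : ∀ a b, (a ∈ symIdeal hc ⊤ r ∨ b ∈ symIdeal hc ⊤ r) → otm a b ∈ T) :
    (incl r (tpow V) p ⊗ₘ incl r (tpow V) q) z ∈ T := by
  obtain ⟨L, hL⟩ := exists_symm_section hc p
  obtain ⟨M, hM⟩ := exists_symm_section hc q
  have h₁ : ∀ z, ((incl r (tpow V) p - symm hc p ≫ L ≫ incl r (tpow V) p) ⊗ₘ
      incl r (tpow V) q) z ∈ T := mem_of_otm _ T hT fun x y => by
    rw [tensorHom_otm]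
    refine h _ _ (Or.inl ?_)
    have : (incl r (tpow V) p - symm hc p ≫ L ≫ incl r (tpow V) p) =
        (𝟙 _ - symm hc p ≫ L) ≫ incl r (tpow V) p := by
      rw [Preadditive.sub_comp, Category.id_comp, Category.assoc]
    rw [this]
    refine incl_mem_symIdeal hc fun _ => ?_
    rw [← comp_apply, Preadditive.sub_comp, Category.id_comp, Category.assoc, hL, sub_self,
      zero_apply]
  have h₂ : ∀ z, ((symm hc p ≫ L ≫ incl r (tpow V) p) ⊗ₘ
      (incl r (tpow V) q - symm hc q ≫ M ≫ incl r (tpow V) q)) z ∈ T :=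
    mem_of_otm _ T hT fun x y => by
      rw [tensorHom_otm]
      refine h _ _ (Or.inr ?_)
      have : (incl r (tpow V) q - symm hc q ≫ M ≫ incl r (tpow V) q) =
          (𝟙 _ - symm hc q ≫ M) ≫ incl r (tpow V) q := by
        rw [Preadditive.sub_comp, Category.id_comp, Category.assoc]
      rw [this]
      refine incl_mem_symIdeal hc fun _ => ?_
      rw [← comp_apply, Preadditive.sub_comp, Category.id_comp, Category.assoc, hM, sub_self,
        zero_apply]
  have h₃ : ((symm hc p ≫ L ≫ incl r (tpow V) p) ⊗ₘ (symm hc q ≫ M ≫ incl r (tpow V) q)) z = 0 := by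
    rw [← tensorHom_comp_tensorHom, comp_apply, hz, map_zero]
  have h₄ : (incl r (tpow V) p ⊗ₘ incl r (tpow V) q) =
      ((incl r (tpow V) p - symm hc p ≫ L ≫ incl r (tpow V) p) ⊗ₘ incl r (tpow V) q) +
      ((symm hc p ≫ L ≫ incl r (tpow V) p) ⊗ₘ
        (incl r (tpow V) q - symm hc q ≫ M ≫ incl r (tpow V) q)) +
      ((symm hc p ≫ L ≫ incl r (tpow V) p) ⊗ₘ (symm hc q ≫ M ≫ incl r (tpow V) q)) := by
    rw [add_assoc, ← MonoidalPreadditive.tensor_add, sub_add_cancel,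
      ← MonoidalPreadditive.add_tensor, sub_add_cancel]
  rw [h₄, add_apply, add_apply, h₃, add_zero]
  exact T.add_mem (h₁ z) (h₂ z)

lemma isCoidealFamily_symIdeal [FiniteDimensional k V] : IsCoidealFamily hc1 (symIdeal hc ⊤) where
  mul_left r x y hy n _ := geom_otm_eq_zero (tensMul V r ≫ coeffHom r (tpow V) n ≫ symm hc n) x y
    fun p q => by
      rw [comp_apply, comp_apply]
      refine (congrArg (fun z => symm hc n (coeff n z)) (geomMul_incl _ _ _ _ _ _ _ _)).trans ?_
      exact coeff_incl r n (p + q) _ (fun y => symm hc n y = 0) (map_zero _) fun e => by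
        subst e
        exact symm_concat_right hc _ (hy q (ENat.natCast_lt_top q))
  mul_right r x y hx n _ := geom_otm_eq_zero (tensMul V r ≫ coeffHom r (tpow V) n ≫ symm hc n) x y
    fun p q => by
      rw [comp_apply, comp_apply]
      refine (congrArg (fun z => symm hc n (coeff n z)) (geomMul_incl _ _ _ _ _ _ _ _)).trans ?_
      exact coeff_incl r n (p + q) _ (fun y => symm hc n y = 0) (map_zero _) fun e => by
        subst e
        exact symm_concat_left hc (hx p (ENat.natCast_lt_top p)) _
  homogeneous r x hx n := incl_mem_symIdeal hc fun h => hx n h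
  coeff_zero r x hx := by
    have := hx 0 (ENat.natCast_lt_top 0)
    rwa [symm_zero] at this
  coeff_one r x hx := by
    have := hx 1 (ENat.natCast_lt_top 1)
    rwa [symm_one] at this
  res_mem h x hx n hn := by
    rw [coeff_res]
    exact hx n hn
  comul_mem r x hx := by
    set T := (Submodule.span k {z | ∃ a b : tens V r.half, (a ∈ symIdeal hc ⊤ r.half ∨
      b ∈ symIdeal hc ⊤ r.half) ∧ z = otm a b}).topologicalClosure with hTdef
    have hT : IsClosed (T : Set (tens V r.half ⊗ tens V r.half : Ban k)) :=
      Submodule.isClosed_topologicalClosure _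
    have h₁ := (hasSum_incl x).map (tensComul hc1 r).lin (hom_continuous _)
    refine hT.mem_of_tendsto h₁ (Filter.Eventually.of_forall fun t => T.sum_mem fun n _ => ?_)
    show (incl r (tpow V) n ≫ tensComul hc1 r) (coeff n x) ∈ T
    rw [incl_tensComul]
    refine comulPow_mem hc hc1 T fun p q hpq => ?_
    refine incl_tensor_mem hc _ ?_ T hT fun a b hab =>
      Submodule.le_topologicalClosure _ (Submodule.subset_span ⟨a, b, hab, rfl⟩)
    have := congrArg (fun f : tpow V n ⟶ _ => f (coeff n x)) (sh_symm hc hpq)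
    refine this.trans ?_
    rw [comp_apply, hx n (ENat.natCast_lt_top n), map_zero]

lemma incl_coeff_tensor {r : Radius.{u}} {p q m n : ℕ} (h : ¬ (p = m ∧ q = n)) {X : Ban k}
    (f : tpow V n ⟶ X) : (incl r (tpow V) p ⊗ₘ incl r (tpow V) q) ≫
      (coeffHom r (tpow V) m ⊗ₘ (coeffHom r (tpow V) n ≫ f)) = 0 := by
  rw [tensorHom_comp_tensorHom, ← Category.assoc]
  by_cases hp : p = m
  · rw [incl_coeffHom_ne (fun hq => h ⟨hp, hq⟩), Limits.zero_comp, MonoidalPreadditive.tensor_zero]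
  · rw [incl_coeffHom_ne hp, MonoidalPreadditive.zero_tensor]

lemma tensComul_coeff (r : Radius.{u}) (n : ℕ) : tensComul hc1 r ≫
    (coeffHom r.half (tpow V) 1 ⊗ₘ (coeffHom r.half (tpow V) n ≫ symm hc n)) =
      coeffHom r (tpow V) (n + 1) ≫ symm hc (n + 1) ≫ ((words hc).g (add_comm 1 n)).inv := by
  refine geom_ext fun m => ?_
  rw [← Category.assoc, incl_tensComul, comulPow_eq hc, Words.shuffle, Preadditive.sum_comp]
  by_cases hm : m = n + 1
  · subst hm
    rw [← Category.assoc, incl_coeffHom, Category.id_comp, Finset.sum_eq_single (1, n)]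
    · rw [Words.J2_pos _ _ (add_comm 1 n), ← sh_symm, symm_one, Category.assoc, Category.assoc,
        tensorHom_comp_tensorHom, incl_coeffHom, ← Category.assoc (incl r.half (tpow V) n),
        incl_coeffHom, Category.id_comp]
    · rintro ⟨p, q⟩ hpq hne
      rw [Finset.HasAntidiagonal.mem_antidiagonal] at hpq
      rw [Words.J2_pos _ _ hpq, Category.assoc, Category.assoc, incl_coeff_tensor, Limits.comp_zero,
        Limits.comp_zero]
      rintro ⟨rfl, rfl⟩
      exact hne rfl
    · intro h
      exact absurd (Finset.HasAntidiagonal.mem_antidiagonal.2 (add_comm 1 n)) h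
  · rw [← Category.assoc, incl_coeffHom_ne hm, Limits.zero_comp]
    refine Finset.sum_eq_zero ?_
    rintro ⟨p, q⟩ hpq
    rw [Finset.HasAntidiagonal.mem_antidiagonal] at hpq
    rw [Words.J2_pos _ _ hpq, Category.assoc, Category.assoc, incl_coeff_tensor, Limits.comp_zero,
      Limits.comp_zero]
    rintro ⟨rfl, rfl⟩
    exact hm (hpq.symm.trans (add_comm 1 q))

lemma IsCoidealFamily.symm_coeff {I : ∀ r : Radius.{u}, Submodule k (tens V r)}
    (hI : IsCoidealFamily hc1 I) (n : ℕ) : ∀ r, ∀ x ∈ I r, symm hc n (coeff n x) = 0 := by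
  induction n with
  | zero =>
    intro r x hx
    rw [symm_zero]
    exact hI.coeff_zero r x hx
  | succ n ih =>
    intro r x hx
    have h := hI.comul_mem r x hx
    let Ψ : tens V r.half ⊗ tens V r.half ⟶ tpow V 1 ⊗ tpow V n :=
      coeffHom r.half (tpow V) 1 ⊗ₘ (coeffHom r.half (tpow V) n ≫ symm hc n)
    have hΨ : ∀ z ∈ (Submodule.span k {z | ∃ a b : tens V r.half, (a ∈ I r.half ∨ b ∈ I r.half) ∧
        z = otm a b}).topologicalClosure, Ψ z = 0 := by
      refine Submodule.topologicalClosure_minimal (t := LinearMap.ker Ψ.lin) _ (Submodule.span_le.2 ?_)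
        (isClosed_singleton.preimage (hom_continuous Ψ))
      rintro _ ⟨a, b, hab, rfl⟩
      show Ψ (otm a b) = 0
      rw [tensorHom_otm]
      rcases hab with ha | hb
      · rw [coeffHom_apply, hI.coeff_one _ a ha]
        exact map_zero (tmulRight (V := tpow V 1) _).lin
      · rw [comp_apply, show (coeffHom r.half (tpow V) n) b = coeff n b from rfl, ih _ b hb]
        exact map_zero (tmulLeft (W := tpow V n) _).lin
    have h₁ := hΨ _ h
    rw [← comp_apply, tensComul_coeff hc hc1] at h₁
    have h₂ := congrArg ((words hc).g (add_comm 1 n)).hom h₁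
    rw [map_zero, ← comp_apply, Category.assoc, Category.assoc, Iso.inv_hom_id,
      Category.comp_id] at h₂
    exact h₂

theorem maxIdeal_eq [FiniteDimensional k V] (r : Radius.{u}) :
    maxIdeal hc1 r = symIdeal hc ⊤ r :=
  le_antisymm (sSup_le (by
    rintro _ ⟨I, hI, rfl⟩ x hx n -
    exact hI.symm_coeff hc hc1 n r x hx))
    (le_sSup ⟨_, isCoidealFamily_symIdeal hc hc1, rfl⟩)

end symIdeal

end Ban

namespace Ban

variable {k : Type u} [NormedField k]

/-- `q` identifies its target with the quotient of its source by the kernel, with the quotient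
norm. -/
def IsQuot {A B : Ban k} (q : A ⟶ B) : Prop :=
  NormLE q 1 ∧ ∀ z (ε : ℝ), 0 < ε → ∃ x, q x = z ∧ ‖x‖ < ‖z‖ + ε

namespace IsQuot

variable {A A' B B' Z : Ban k} {q : A ⟶ B} {q' : A' ⟶ B'}

lemma surjective (hq : IsQuot q) (z : B) : ∃ x, q x = z :=
  (hq.2 z 1 one_pos).imp fun _ h => h.1

lemma ext (hq : IsQuot q) {f g : B ⟶ Z} (h : q ≫ f = q ≫ g) : f = g := hom_ext fun z => by
  obtain ⟨x, rfl⟩ := hq.surjective z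
  exact congrArg (fun φ : A ⟶ Z => φ x) h

lemma exists_desc (hq : IsQuot q) (f : A ⟶ Z) (hf : ∀ x, q x = 0 → f x = 0) {C : ℝ} (hC : 0 ≤ C)
    (hfC : NormLE f C) : ∃ τ : B ⟶ Z, q ≫ τ = f ∧ NormLE τ C := by
  choose s hs using hq.surjective
  have key : ∀ x y, q x = q y → f x = f y := fun x y h => sub_eq_zero.1 (by
    rw [← map_sub]; exact hf _ (by rw [map_sub, h, sub_self]))
  have hb : ∀ z, ‖f (s z)‖ ≤ C * ‖z‖ := fun z => by
    refine le_of_forall_pos_le_add fun ε hε => ?_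
    obtain ⟨x, hx, hn⟩ := hq.2 z (ε / (C + 1)) (by positivity)
    rw [key (s z) x ((hs z).trans hx.symm)]
    have h₂ : C * (ε / (C + 1)) ≤ ε := by
      rw [mul_div_assoc', div_le_iff₀ (by positivity)]; nlinarith
    have := mul_le_mul_of_nonneg_left hn.le hC
    linarith [hfC x]
  refine ⟨ofLin (V := B) (W := Z)
    { toFun := fun z => f (s z)
      map_add' := fun a b => by
        rw [← map_add]; exact key _ _ (by rw [map_add, hs, hs, hs])
      map_smul' := fun a b => by
        rw [RingHom.id_apply, ← map_smul]; exact key _ _ (by rw [map_smul, hs, hs]) } ⟨C, hb⟩,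
    hom_ext fun x => key _ _ (hs _), hb⟩

variable [CompleteSpace k]

lemma ext₂ (hq : IsQuot q) (hq' : IsQuot q') {f g : B ⊗ B' ⟶ Z}
    (h : (q ⊗ₘ q') ≫ f = (q ⊗ₘ q') ≫ g) : f = g := Ban.ext₂ fun x y => by
  obtain ⟨x, rfl⟩ := hq.surjective x
  obtain ⟨y, rfl⟩ := hq'.surjective y
  have := congrArg (fun φ : A ⊗ A' ⟶ Z => φ (otm x y)) h
  simpa using this

open Filter Topology in
lemma exists_desc₂ (hq : IsQuot q) (hq' : IsQuot q') (f : A ⊗ A' ⟶ Z)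
    (hf : ∀ x y, q x = 0 → f (otm x y) = 0) (hf' : ∀ x y, q' y = 0 → f (otm x y) = 0) {C : ℝ}
    (hC : 0 ≤ C) (hfC : NormLE f C) : ∃ τ : B ⊗ B' ⟶ Z, (q ⊗ₘ q') ≫ τ = f ∧ NormLE τ C := by
  choose s hs using hq.surjective
  choose t ht using hq'.surjective
  have key : ∀ x x' y y', q x = q x' → q' y = q' y' → f (otm x y) = f (otm x' y') :=
    fun x x' y y' h h' => by
      have h₁ := hf (x - x') y (by rw [map_sub, h, sub_self])
      have h₂ := hf' x' (y - y') (by rw [map_sub, h', sub_self])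
      have e₁ : otm (x - x') y = otm x y - otm x' y := map_sub (tmulRight y).lin x x'
      have e₂ : otm x' (y - y') = otm x' y - otm x' y' := map_sub (tmulLeft x').lin y y'
      rw [e₁, map_sub, sub_eq_zero] at h₁
      rw [e₂, map_sub, sub_eq_zero] at h₂
      exact h₁.trans h₂
  have hb : ∀ z w, ‖f (otm (s z) (t w))‖ ≤ C * ‖z‖ * ‖w‖ := fun z w => by
    have hl : Tendsto (fun ε : ℝ => C * (‖z‖ + ε) * (‖w‖ + ε)) (𝓝[>] 0) (𝓝 (C * ‖z‖ * ‖w‖)) := by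
      have : Continuous fun ε : ℝ => C * (‖z‖ + ε) * (‖w‖ + ε) := by fun_prop
      have h := (this.tendsto 0).mono_left (nhdsWithin_le_nhds (s := Set.Ioi 0))
      simpa using h
    refine ge_of_tendsto hl (eventually_nhdsWithin_of_forall fun ε (hε : 0 < ε) => ?_)
    obtain ⟨x, hx, hxn⟩ := hq.2 z ε hε
    obtain ⟨y, hy, hyn⟩ := hq'.2 w ε hε
    rw [key (s z) x (t w) y ((hs z).trans hx.symm) ((ht w).trans hy.symm), mul_assoc]
    exact (hfC _).trans (mul_le_mul_of_nonneg_left ((norm_tmul_le x y).trans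
      (mul_le_mul hxn.le hyn.le (norm_nonneg _) (by positivity))) hC)
  have hadd : ∀ x x' y, f (otm (x + x') y) = f (otm x y) + f (otm x' y) := fun x x' y => by
    rw [← map_add]; exact congrArg f (add_tmul x x' y)
  have hadd' : ∀ x y y', f (otm x (y + y')) = f (otm x y) + f (otm x y') := fun x y y' => by
    rw [← map_add]; exact congrArg f (tmul_add x y y')
  refine ⟨lift (LinearMap.mk₂ k (fun z w => f (otm (s z) (t w)))
    (fun z z' w => by
      rw [← hadd]; exact key _ _ _ _ (by rw [map_add, hs, hs, hs]) rfl)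
    (fun a z w => by
      rw [← map_smul, ← smul_otm]; exact key _ _ _ _ (by rw [map_smul, hs, hs]) rfl)
    (fun z w w' => by
      rw [← hadd']; exact key _ _ _ _ rfl (by rw [map_add, ht, ht, ht]))
    (fun a z w => by
      rw [← map_smul, ← otm_smul]; exact key _ _ _ _ rfl (by rw [map_smul, ht, ht])))
    ⟨C, hC, hb⟩, Ban.ext₂ fun x y => ?_, normLE_lift _ _ hC hb⟩
  rw [comp_apply, tensorHom_otm]
  exact (lift_tmul _ _ _ _).trans (key _ _ _ _ (hs _) (ht _))

end IsQuot

lemma incl_trunc (r s : Radius.{u}) (E : ℕ → Ban k) (m n : ℕ) :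
    incl r E m ≫ trunc r s E n = if m < n then incl s E m else 0 := hom_ext fun x => by
  rw [comp_apply, trunc_apply]
  split_ifs with h
  · rw [Finset.sum_eq_single_of_mem m (Finset.mem_range.2 h) fun b _ hb => by
      rw [coeff_incl_ne hb, map_zero], coeff_incl_self]
  · exact Finset.sum_eq_zero fun b hb => by
      rw [coeff_incl_ne fun e : b = m => h (by rw [← e]; exact Finset.mem_range.1 hb), map_zero]

open IndObj in
/-- A morphism of ind-objects is determined by compatible values on test maps which separate
morphisms out of every term. -/
lemma exists_hom_of_tests {X Z : IndObj (Ban k)} (hZ : IsMonomorphic Z) {ι : Type*} (A : ι → Ban k)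
    (T : X.I → Set ι) (w : ∀ i a, A a ⟶ X.at' i)
    (hT : ∀ {i i'} (_ : i ⟶ i'), T i ⊆ T i')
    (hw : ∀ {i i'} (v : i ⟶ i'), ∀ a ∈ T i, w i a ≫ X.F.map v = w i' a)
    (ext : ∀ i {Y : Ban k} (f g : X.at' i ⟶ Y), (∀ a ∈ T i, w i a ≫ f = w i a ≫ g) → f = g)
    (t : ∀ a, const (A a) ⟶ Z)
    (H : ∀ i, ∃ (l : Z.I) (τ : X.at' i ⟶ Z.at' l), ∀ a ∈ T i, ofConst l (w i a ≫ τ) = t a) :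
    ∃ f : X ⟶ Z, ∀ i, ∀ a ∈ T i, ofConst i (w i a) ≫ f = t a := by
  choose l τ hτ using H
  refine ⟨⟨fun i => Germ.mk (l i) (τ i), fun {i i'} v => ?_⟩, fun i a ha => hτ i a ha⟩
  rw [Germ.precomp_mk, ← Germ.mk_map (IsFiltered.leftToMax (l i') (l i)),
    ← Germ.mk_map (IsFiltered.rightToMax (l i') (l i))]
  refine congrArg (Germ.mk _) (ext i _ _ fun a ha => eq_of_germ hZ ?_)
  rw [← Category.assoc, ← Category.assoc, ← Category.assoc, ofConst_map, ofConst_map, hw v a ha,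
    hτ i a ha, hτ i' a (hT v ha)]

variable [CompleteSpace k] {V : Ban k} {c : V ⊗ V ⟶ V ⊗ V}

/-- An ind-object whose terms are quotients of Banach tensor algebras, truncated in degrees
`≥ deg i`, by the kernels of the quantum symmetrizers. -/
structure NicholsModel (hc : IsPreBraiding c) where
  R : IndObj (Ban k)
  rad : R.I → Radius.{u}
  deg : R.I → ℕ∞
  π : ∀ i, tens V (rad i) ⟶ R.at' i
  isQuot : ∀ i, IsQuot (π i)
  π_eq_zero : ∀ i x, π i x = 0 ↔ x ∈ symIdeal hc (deg i) (rad i)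
  deg_mono : ∀ {i i'} (_ : i ⟶ i'), deg i ≤ deg i'
  rad_mono : ∀ {i i'} (_ : i ⟶ i'), rad i ≤ rad i'
  map_π : ∀ {i i'} (w : i ⟶ i') (n : ℕ), n < deg i →
    (incl (rad i) (tpow V) n ≫ π i) ≫ R.F.map w = incl (rad i') (tpow V) n ≫ π i'
  exists_deg : ∀ n : ℕ, ∃ i, n < deg i
  exists_mul : ∀ i i', ∃ l, rad i ≤ rad l ∧ rad i' ≤ rad l ∧ deg i + deg i' ≤ deg l
  exists_small : ∀ i (ε : ℝ), 0 < ε → ∃ l, Nonempty (i ⟶ l) ∧ (rad l).val ≤ ε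

namespace NicholsModel

variable {hc : IsPreBraiding c} (M : NicholsModel hc)

/-- The image of words of length `n` in a term. -/
def word (i : M.R.I) (n : ℕ) : tpow V n ⟶ M.R.at' i := incl (M.rad i) (tpow V) n ≫ M.π i

lemma normLE_word (i : M.R.I) (n : ℕ) : NormLE (M.word i n) ((M.rad i).val ^ n) := by
  simpa [word] using (normLE_incl (r := M.rad i) (E := tpow V) n).comp (M.isQuot i).1 zero_le_one

lemma word_eq_zero {i : M.R.I} {n : ℕ} (h : M.deg i ≤ n) : M.word i n = 0 := hom_ext fun _ =>
  (M.π_eq_zero i _).2 (incl_mem_symIdeal hc fun h' => absurd h' h.not_gt)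

lemma word_map {i i' : M.R.I} (w : i ⟶ i') {n : ℕ} (h : n < M.deg i) :
    M.word i n ≫ M.R.F.map w = M.word i' n := M.map_π w n h

lemma word_ext {i : M.R.I} {X : Ban k} {f g : M.R.at' i ⟶ X}
    (h : ∀ n : ℕ, n < M.deg i → M.word i n ≫ f = M.word i n ≫ g) : f = g :=
  (M.isQuot i).ext (geom_ext fun n => by
    rw [← Category.assoc, ← Category.assoc]
    by_cases hn : n < M.deg i
    · exact h n hn
    · have := M.word_eq_zero (not_lt.1 hn)
      rw [word] at this
      rw [this, Limits.zero_comp, Limits.zero_comp])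

lemma word_ext₂ {i i' : M.R.I} {X : Ban k} {f g : M.R.at' i ⊗ M.R.at' i' ⟶ X}
    (h : ∀ p q : ℕ, p < M.deg i → q < M.deg i' →
      (M.word i p ⊗ₘ M.word i' q) ≫ f = (M.word i p ⊗ₘ M.word i' q) ≫ g) : f = g := by
  have h' : ∀ p q : ℕ, (M.word i p ⊗ₘ M.word i' q) ≫ f = (M.word i p ⊗ₘ M.word i' q) ≫ g := by
    intro p q
    by_cases hp : p < M.deg i
    · by_cases hq : q < M.deg i'
      · exact h p q hp hq
      · rw [M.word_eq_zero (not_lt.1 hq)]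
        simp [MonoidalCategory.tensorHom_def]
    · rw [M.word_eq_zero (not_lt.1 hp)]
      simp [MonoidalCategory.tensorHom_def]
  refine (M.isQuot i).ext₂ (M.isQuot i') (geom_ext_otm fun p q a b => ?_)
  have := congrArg (fun φ : tpow V p ⊗ tpow V q ⟶ X => φ (otm a b)) (h' p q)
  simpa [word] using this

section desc

variable {Z : Ban k} {C : ℝ} (hC : 0 ≤ C)
include hC

lemma exists_desc (i : M.R.I) (g : ∀ n, tpow V n ⟶ Z)
    (hg : ∀ n : ℕ, n < M.deg i → NormLE (g n) (C * (M.rad i).val ^ n))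
    (hs : ∀ n : ℕ, n < M.deg i → ∃ U, g n = symm hc n ≫ U) :
    ∃ τ : M.R.at' i ⟶ Z, NormLE τ C ∧ ∀ n : ℕ, n < M.deg i → M.word i n ≫ τ = g n := by
  classical
  have hb : ∀ n : ℕ, NormLE (if n < M.deg i then g n else 0) (C * (M.rad i).val ^ n) := fun n => by
    split_ifs with h
    · exact hg n h
    · intro x
      rw [zero_apply, norm_zero]
      have := (M.rad i).pow_pos n
      positivity
  obtain ⟨τ, hτ, hn⟩ := (M.isQuot i).exists_desc (desc _ ⟨C, hb⟩) (fun x hx => by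
    refine geom_eq_zero _ _ fun n => ?_
    rw [desc_incl]
    split_ifs with h
    · obtain ⟨U, hU⟩ := hs n h
      rw [hU, comp_apply, (M.π_eq_zero i x).1 hx n h, map_zero]
    · rfl) hC (normLE_desc _ _ hb)
  refine ⟨τ, hn, fun n h => ?_⟩
  rw [word, Category.assoc, hτ]
  exact hom_ext fun x => (desc_incl _ ⟨C, hb⟩ _ _).trans (by rw [if_pos h])

lemma exists_desc₂ (i i' : M.R.I) (g : ∀ p q, tpow V p ⊗ tpow V q ⟶ Z)
    (hg : ∀ p q : ℕ, p < M.deg i → q < M.deg i' →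
      NormLE (g p q) (C * (M.rad i).val ^ p * (M.rad i').val ^ q))
    (hs : ∀ p q : ℕ, p < M.deg i → q < M.deg i' → ∃ U, g p q = (symm hc p ⊗ₘ symm hc q) ≫ U) :
    ∃ τ : M.R.at' i ⊗ M.R.at' i' ⟶ Z, ∀ p q : ℕ, p < M.deg i → q < M.deg i' →
      (M.word i p ⊗ₘ M.word i' q) ≫ τ = g p q := by
  classical
  have hb : ∀ p q : ℕ, NormLE (if p < M.deg i ∧ q < M.deg i' then g p q else 0)
      (C * (M.rad i).val ^ p * (M.rad i').val ^ q) := fun p q => by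
    split_ifs with h
    · exact hg p q h.1 h.2
    · intro x
      rw [zero_apply, norm_zero]
      have := (M.rad i).pow_pos p
      have := (M.rad i').pow_pos q
      positivity
  have hi : ∀ p q x y, desc₂ _ C hC hb (otm (incl (M.rad i) (tpow V) p x)
      (incl (M.rad i') (tpow V) q y)) =
      (if p < M.deg i ∧ q < M.deg i' then g p q else 0) (otm x y) :=
    fun p q x y => desc₂_incl _ C hC hb p q x y
  obtain ⟨τ, hτ, -⟩ := (M.isQuot i).exists_desc₂ (M.isQuot i') (desc₂ _ C hC hb)
    (fun x y hx => geom_otm_eq_zero _ _ _ fun p q => by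
      rw [hi]
      split_ifs with h
      · obtain ⟨U, hU⟩ := hs p q h.1 h.2
        rw [hU, comp_apply, tensorHom_otm, (M.π_eq_zero i x).1 hx p h.1]
        exact (congrArg U (map_zero (tmulRight _).lin)).trans (map_zero _)
      · rfl)
    (fun x y hy => geom_otm_eq_zero _ _ _ fun p q => by
      rw [hi]
      split_ifs with h
      · obtain ⟨U, hU⟩ := hs p q h.1 h.2
        rw [hU, comp_apply, tensorHom_otm, (M.π_eq_zero i' y).1 hy q h.2]
        exact (congrArg U (map_zero (tmulLeft _).lin)).trans (map_zero _)
      · rfl) hC (normLE_desc₂ _ _ _ _)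
  refine ⟨τ, fun p q hp hq => ?_⟩
  rw [word, word, ← tensorHom_comp_tensorHom, Category.assoc, hτ]
  refine Ban.ext₂ fun x y => ?_
  rw [comp_apply, tensorHom_otm, hi, if_pos ⟨hp, hq⟩]

end desc

lemma exists_word_factor [FiniteDimensional k V] (n : ℕ) :
    ∃ L : tpow V n ⟶ tpow V n, ∀ i, M.word i n = symm hc n ≫ L ≫ M.word i n := by
  obtain ⟨L, hL⟩ := exists_symm_section hc n
  refine ⟨L, fun i => hom_ext fun x => sub_eq_zero.1 ?_⟩
  rw [comp_apply, comp_apply, ← map_sub]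
  refine (M.π_eq_zero i _).2 (incl_mem_symIdeal hc fun _ => ?_)
  rw [map_sub, sub_eq_zero]
  exact congrArg (fun φ : tpow V n ⟶ tpow V n => φ x) hL.symm

open IndObj

/-- The morphism from words of length `n`. -/
def j (n : ℕ) : const (tpow V n) ⟶ M.R :=
  ofConst (M.exists_deg n).choose (M.word (M.exists_deg n).choose n)

lemma j_eq {i : M.R.I} {n : ℕ} (h : n < M.deg i) : M.j n = ofConst i (M.word i n) := by
  have h' := (M.exists_deg n).choose_spec
  rw [j]
  generalize (M.exists_deg n).choose = i' at h' ⊢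
  rw [← ofConst_map (IsFiltered.leftToMax i' i), ← ofConst_map (IsFiltered.rightToMax i' i),
    M.word_map _ h, M.word_map _ h']

lemma levelGen : LevelGen M.j := fun _ _ _ _ h =>
  M.word_ext fun n hn => h n _ (M.j_eq hn)

lemma exists_hom {Z : IndObj (Ban k)} (hZ : IsMonomorphic Z) (t : ∀ n, const (tpow V n) ⟶ Z)
    (H : ∀ i, ∃ (l : Z.I) (τ : M.R.at' i ⟶ Z.at' l), ∀ n : ℕ, n < M.deg i →
      ofConst l (M.word i n ≫ τ) = t n) : ∃ f : M.R ⟶ Z, ∀ n, M.j n ≫ f = t n := by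
  obtain ⟨f, hf⟩ := exists_hom_of_tests hZ (tpow V) (fun i => {n | (n : ℕ∞) < M.deg i}) M.word
    (fun w n hn => lt_of_lt_of_le hn (M.deg_mono w)) (fun w n hn => M.word_map w hn)
    (fun i _ f g h => M.word_ext h) t H
  refine ⟨f, fun n => ?_⟩
  obtain ⟨i, hi⟩ := M.exists_deg n
  rw [M.j_eq hi, hf i n hi]

/-- The morphism from pairs of words. -/
def j₂ (p q : ℕ) : const (tpow V p ⊗ tpow V q) ⟶ M.R ⊗ M.R :=
  (constTensor (tpow V p) (tpow V q)).inv ≫ (M.j p ⊗ₘ M.j q)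

lemma j₂_eq {i i' : M.R.I} {p q : ℕ} (h : p < M.deg i) (h' : q < M.deg i') :
    M.j₂ p q = ofConst (Y := M.R ⊗ M.R) (i, i') (M.word i p ⊗ₘ M.word i' q) := by
  rw [j₂, M.j_eq h, M.j_eq h', ofConst_tensor, Iso.inv_hom_id_assoc]

lemma j_tensor (p q : ℕ) : M.j p ⊗ₘ M.j q = (constTensor (tpow V p) (tpow V q)).hom ≫ M.j₂ p q := by
  rw [j₂, Iso.hom_inv_id_assoc]

lemma J2_eq {p q n : ℕ} (h : p + q = n) : (constWords (words hc)).J2 M.j n p q =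
    constMap ((words hc).g h).inv ≫ M.j₂ p q := by
  obtain ⟨i, hi⟩ := M.exists_deg p
  obtain ⟨i', hi'⟩ := M.exists_deg q
  rw [constWords_J2 (words hc) h (M.j_eq hi) (M.j_eq hi'), M.j₂_eq hi hi']
  rfl

lemma exists_hom₂ {Z : IndObj (Ban k)} (hZ : IsMonomorphic Z)
    (t : ∀ p q, const (tpow V p ⊗ tpow V q) ⟶ Z)
    (H : ∀ i i', ∃ (l : Z.I) (τ : M.R.at' i ⊗ M.R.at' i' ⟶ Z.at' l), ∀ p q : ℕ, p < M.deg i →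
      q < M.deg i' → ofConst l ((M.word i p ⊗ₘ M.word i' q) ≫ τ) = t p q) :
    ∃ f : M.R ⊗ M.R ⟶ Z, ∀ p q, M.j₂ p q ≫ f = t p q := by
  obtain ⟨f, hf⟩ := exists_hom_of_tests (X := M.R.tensor M.R) hZ
    (fun a : ℕ × ℕ => tpow V a.1 ⊗ tpow V a.2)
    (fun i => {a | (a.1 : ℕ∞) < M.deg i.1 ∧ (a.2 : ℕ∞) < M.deg i.2})
    (fun i a => M.word i.1 a.1 ⊗ₘ M.word i.2 a.2)
    (fun w a ha => ⟨lt_of_lt_of_le ha.1 (M.deg_mono w.1), lt_of_lt_of_le ha.2 (M.deg_mono w.2)⟩)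
    (fun w a ha => (tensorHom_comp_tensorHom _ _ _ _).trans
      (congrArg₂ (· ⊗ₘ ·) (M.word_map w.1 ha.1) (M.word_map w.2 ha.2)))
    (fun i _ f g h => M.word_ext₂ fun p q hp hq => h (p, q) ⟨hp, hq⟩) (fun a => t a.1 a.2)
    fun i => (H i.1 i.2).imp fun l => Exists.imp fun τ h a ha => h a.1 a.2 ha.1 ha.2
  refine ⟨f, fun p q => ?_⟩
  obtain ⟨i, hi⟩ := M.exists_deg p
  obtain ⟨i', hi'⟩ := M.exists_deg q
  rw [M.j₂_eq hi hi']
  exact hf (i, i') (p, q) ⟨hi, hi'⟩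

end NicholsModel

end Ban

namespace IndObj

variable {C : Type (u + 1)} [LargeCategory C] [Preadditive C]

lemma ofConst_sum {A : C} {Y : IndObj C} (j : Y.I) {ι : Type*} (s : Finset ι)
    (f : ι → (A ⟶ Y.at' j)) : ofConst j (∑ i ∈ s, f i) = ∑ i ∈ s, ofConst j (f i) :=
  map_sum (AddMonoidHom.mk' (ofConst (A := A) (Y := Y) j) (ofConst_add j)) f s

lemma ofConst_zsmul {A : C} {Y : IndObj C} (j : Y.I) (m : ℤ) (f : A ⟶ Y.at' j) :
    ofConst j (m • f) = m • ofConst j f :=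
  map_zsmul (AddMonoidHom.mk' (ofConst (A := A) (Y := Y) j) (ofConst_add j)) m f

end IndObj

namespace Ban

variable {k : Type u} [NormedField k]

lemma normLE_zero {X Y : Ban k} {C : ℝ} (hC : 0 ≤ C) : NormLE (0 : X ⟶ Y) C := fun x => by
  rw [zero_apply, norm_zero]
  positivity

lemma NormLE.neg_one_pow_zsmul {X Y : Ban k} {f : X ⟶ Y} {C : ℝ} (hf : NormLE f C) (n : ℕ) :
    NormLE ((-1 : ℤ) ^ n • f) C := by
  rcases neg_one_pow_eq_or ℤ n with h | h
  · rwa [h, one_smul]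
  · rw [h, neg_one_zsmul]
    exact fun x => by
      rw [neg_apply, norm_neg]
      exact hf x

variable [CompleteSpace k] {V : Ban k} {c : V ⊗ V ⟶ V ⊗ V}

section

variable (hc : IsPreBraiding c) (hc1 : NormLE c 1)
include hc1

lemma normLE_braidLetter : ∀ n i, NormLE ((powers V).braidLetter c n i) 1
  | 0, _ => normLE_zero zero_le_one
  | 1, _ => normLE_zero zero_le_one
  | n + 2, i => by
    rw [TensorPowers.braidLetter]
    split_ifs with h
    · have h₁ : NormLE ((powers V).lastTwo n).inv 1 :=
        ((normLE_id _).comp_one (normLE_whiskerRight (normLE_id _) V)).comp_one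
          (normLE_associator_hom _ _ _)
      have h₂ : NormLE ((powers V).lastTwo n).hom 1 :=
        (normLE_associator_inv _ _ _).comp_one ((normLE_whiskerRight (normLE_id _) V).comp_one
          (normLE_id _))
      exact h₁.comp_one ((normLE_whiskerLeft _ hc1).comp_one h₂)
    · exact (normLE_id _).comp_one ((normLE_whiskerRight (normLE_braidLetter (n + 1) i) V).comp_one
        (normLE_id _))

lemma normLE_tw (n : ℕ) : NormLE ((words hc).tw n 0 n) 1 :=
  BraidWord.tw_rel (A := End (tpow V n)) (A' := End (tpow V n))
    (Q := fun x _ => NormLE (show tpow V n ⟶ tpow V n from x) 1)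
    (normLE_id _) (fun h h' => NormLE.comp_one h' h) (s' := (words hc).s n) (a' := 0)
    fun _ _ => normLE_braidLetter hc1 n _

end

section

variable (hc : IsPreBraiding c)

lemma braidPow_symm (p q : ℕ) : (symm hc p ⊗ₘ symm hc q) ≫ braidPow c p q =
    braidPow c p q ≫ (symm hc q ⊗ₘ symm hc p) := by
  have h₁ := braidPow_words hc p q (p + q) rfl
  have h₂ := (words hc).br_sym (rfl : p + q = _) (add_comm q p)
  have h₃ : ((words hc).g (rfl : p + q = _)).inv ≫ braidPow c p q = (words hc).br (p + q) 0 p q ≫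
      ((words hc).g (add_comm q p)).inv := by
    rw [Iso.inv_comp_eq, ← Category.assoc, Iso.eq_comp_inv, h₁]
  rw [← cancel_mono ((words hc).g (add_comm q p)).hom, Category.assoc, h₁,
    ← cancel_epi ((words hc).g (rfl : p + q = _)).inv, Category.assoc,
    ← Category.assoc _ (braidPow c p q), h₃, Category.assoc]
  exact h₂

end

namespace NicholsModel

variable {hc : IsPreBraiding c} (M : NicholsModel hc) [FiniteDimensional k V]

open IndObj

open Filter Topology in
lemma approximable : Approximable M.R := fun i => by
  classical
  choose L hL using M.exists_word_factor
  have h : ∀ n : ℕ, ∃ e : M.R.at' i ⟶ M.R.at' i, NormLE e 1 ∧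
      ∀ m : ℕ, m < M.deg i → M.word i m ≫ e = if m < n then M.word i m else 0 := fun n =>
    M.exists_desc zero_le_one i _ (fun m _ => by
      rw [one_mul]
      split_ifs
      · exact M.normLE_word i m
      · exact normLE_zero ((M.rad i).pow_pos m).le) fun m _ => by
      split_ifs
      · exact ⟨_, hL m i⟩
      · exact ⟨0, Limits.comp_zero.symm⟩
  choose e he hw using h
  have hπ : ∀ n, M.π i ≫ e n = trunc (M.rad i) (M.rad i) (tpow V) n ≫ M.π i := fun n =>
    geom_ext fun m => by
      rw [← Category.assoc, ← Category.assoc, incl_trunc]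
      by_cases hm : m < M.deg i
      · refine (hw n m hm).trans ?_
        split_ifs
        · rfl
        · exact Limits.zero_comp.symm
      · have h₀ := M.word_eq_zero (not_lt.1 hm)
        rw [word] at h₀
        rw [h₀, Limits.zero_comp]
        split_ifs
        · exact h₀.symm
        · exact Limits.zero_comp.symm
  refine ⟨1, e, zero_le_one, he, fun z => ?_, fun n i' w => ?_⟩
  · obtain ⟨x, rfl⟩ := (M.isQuot i).surjective z
    have := ((hom_continuous (M.π i)).tendsto x).comp (tendsto_trunc x)
    refine this.congr fun n => ?_
    exact congrArg (fun φ : tens V (M.rad i) ⟶ M.R.at' i => φ x) (hπ n).symm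
  · have hr : (M.rad i').val ≤ (M.rad i).val := M.rad_mono w
    have h₁ : 1 ≤ (M.rad i).val / (M.rad i').val := (one_le_div (M.rad i').pos).2 hr
    obtain ⟨τ, -, hτ⟩ := M.exists_desc (Z := M.R.at' i) (C := ((M.rad i).val / (M.rad i').val) ^ n)
      (by positivity) i' (fun m => if m < n then M.word i m else 0) (fun m _ => by
        split_ifs with hm
        · refine (M.normLE_word i m).mono ?_
          rw [← div_le_iff₀ ((M.rad i').pow_pos m), ← div_pow]
          exact pow_le_pow_right₀ h₁ hm.le
        · exact normLE_zero (mul_nonneg (by positivity) ((M.rad i').pow_pos m).le)) fun m _ => by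
        split_ifs
        · exact ⟨_, hL m i⟩
        · exact ⟨0, Limits.comp_zero.symm⟩
    refine ⟨τ, M.word_ext fun m hm => ?_⟩
    rw [← Category.assoc, M.word_map w hm, hτ m (hm.trans_le (M.deg_mono w)), hw n m hm]

lemma separating : (constWords (words hc)).Separating M.j Approximable :=
  Ban.separating M.levelGen M.approximable

lemma exists_mul_hom : ∃ μ : M.R ⊗ M.R ⟶ M.R, (constWords (words hc)).IsMul M.j μ := by
  obtain ⟨μ, hμ⟩ := M.exists_hom₂ M.approximable.isMonomorphic
    (fun p q => constMap (concat V p q) ≫ M.j (p + q)) fun i i' => by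
      obtain ⟨l, hl, hl', hd⟩ := M.exists_mul i i'
      obtain ⟨τ, hτ⟩ := M.exists_desc₂ (C := 1) zero_le_one i i'
        (fun p q => concat V p q ≫ M.word l (p + q)) (fun p q _ _ => by
          have h := (normLE_concat V p q).comp (M.normLE_word l (p + q)) ((M.rad l).pow_pos _).le
          refine h.mono ?_
          rw [mul_one, one_mul, pow_add]
          exact mul_le_mul (pow_le_pow_left₀ (M.rad l).pos.le hl p)
            (pow_le_pow_left₀ (M.rad l).pos.le hl' q) ((M.rad l).pow_pos q).le
            ((M.rad i).pow_pos p).le) fun p q _ _ => by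
          obtain ⟨L, hL⟩ := M.exists_word_factor (p + q)
          obtain ⟨U, hU⟩ := exists_symm_concat hc p q
          refine ⟨concat V p q ≫ U ≫ L ≫ M.word l (p + q), ?_⟩
          rw [hL l, ← Category.assoc, hU]
          simp only [Category.assoc]
          rw [← hL l]
      refine ⟨l, τ, fun p q hp hq => ?_⟩
      have h : ((p + q : ℕ) : ℕ∞) < M.deg l := by
        rw [Nat.cast_add]
        exact (ENat.add_lt_add hp hq).trans_le hd
      rw [hτ p q hp hq, M.j_eq h, constMap_ofConst]
  refine ⟨μ, fun {n p q} h => ?_⟩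
  subst h
  rw [M.J2_eq rfl, Category.assoc, hμ, ← words_g hc, ← Category.assoc, ← constMap_comp,
    Iso.inv_hom_id, constMap_id, Category.id_comp]

omit [FiniteDimensional k V] in
lemma exists_hom_const {A : Ban k} (g : ∀ n, tpow V n ⟶ A)
    (hg : ∀ i, ∃ C, 0 ≤ C ∧ ∀ n : ℕ, n < M.deg i → NormLE (g n) (C * (M.rad i).val ^ n))
    (hs : ∀ n, ∃ U, g n = symm hc n ≫ U) : ∃ f : M.R ⟶ const A, ∀ n, M.j n ≫ f = constMap (g n) :=
  M.exists_hom (approximable_const _).isMonomorphic _ fun i => by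
    obtain ⟨C, hC, hgC⟩ := hg i
    obtain ⟨τ, -, hτ⟩ := M.exists_desc hC i g hgC fun n _ => hs n
    exact ⟨⟨⟨⟩⟩, τ, fun n hn => congrArg (ofConst (Y := const A) ⟨⟨⟩⟩) (hτ n hn)⟩

omit [FiniteDimensional k V] in
lemma exists_counit : ∃ ε : M.R ⟶ 𝟙_ (IndObj (Ban k)), (constWords (words hc)).IsCounit M.j ε := by
  obtain ⟨ε, hε⟩ := M.exists_hom_const (A := 𝟙_ (Ban k)) (fun n => match n with
      | 0 => 𝟙 _
      | _ + 1 => 0) (fun i => ⟨1, zero_le_one, fun n _ => match n with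
        | 0 => (normLE_id _).mono (by simp)
        | n + 1 => normLE_zero (by rw [one_mul]; exact ((M.rad i).pow_pos _).le)⟩)
        (fun n => match n with
          | 0 => ⟨𝟙 _, by rw [symm_zero]; exact (Category.id_comp _).symm⟩
          | n + 1 => ⟨0, Limits.comp_zero.symm⟩)
  exact ⟨ε, hε 0, fun n => (hε (n + 1)).trans (constMap_zero _ _)⟩

omit [FiniteDimensional k V] in
lemma exists_symmetrizer : ∃ σ : ∀ n, M.R ⟶ const (tpow V n),
    (constWords (words hc)).IsSymmetrizer M.j σ := by
  classical
  have h : ∀ m, ∃ σ : M.R ⟶ const (tpow V m), ∀ n, M.j n ≫ σ =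
      constMap (if h : n = m then symm hc n ≫ eqToHom (congrArg (tpow V) h) else 0) := fun m => by
    refine M.exists_hom_const _ (fun i => ?_) fun n => ?_
    · obtain ⟨C, hC, h⟩ := exists_normLE (symm hc m)
      have hr := (M.rad i).pow_pos m
      refine ⟨C / (M.rad i).val ^ m, by positivity, fun n _ => ?_⟩
      split_ifs with hn
      · subst hn
        rw [div_mul_cancel₀ _ hr.ne']
        simpa using h
      · have := (M.rad i).pow_pos n
        exact normLE_zero (by positivity)
    · split_ifs with hn
      · exact ⟨_, rfl⟩
      · exact ⟨0, Limits.comp_zero.symm⟩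
  choose σ hσ using h
  refine ⟨σ, fun n => ?_, fun m n h => ?_, fun {Z} f g hfg => ?_⟩
  · rw [hσ, constWords_sym, dif_pos rfl]
    exact congrArg constMap (Category.comp_id _)
  · rw [hσ, dif_neg h]
    exact constMap_zero _ _
  · refine IndObj.hom_ext fun z => ?_
    have hz : ∀ n, (f.app z).bind (σ n) = (g.app z).bind (σ n) := fun n =>
      congrArg (fun φ : Z ⟶ const (tpow V n) => φ.app z) (hfg n)
    obtain ⟨i, a, b, ha, hb⟩ := Germ.exists_rep₂ (f.app z) (g.app z)
    rw [ha, hb] at hz ⊢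
    refine congrArg (Germ.mk i) (hom_ext fun x => sub_eq_zero.1 ?_)
    obtain ⟨y, hy⟩ := (M.isQuot i).surjective (a x - b x)
    rw [← hy]
    refine (M.π_eq_zero i y).2 fun n hn => ?_
    obtain ⟨τ, hτ⟩ : ∃ τ : M.R.at' i ⟶ tpow V n,
        (σ n).app i = Germ.mk (Y := const (tpow V n)) ⟨⟨⟩⟩ τ := by
      induction (σ n).app i using Germ.ind with | h l τ => exact ⟨τ, rfl⟩
    have h₁ : a ≫ τ = b ≫ τ := by
      have := hz n
      rw [Germ.bind_mk, Germ.bind_mk, hτ] at this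
      exact constMap_injective (IndObj.hom_ext fun _ => this)
    have h₂ : M.π i ≫ τ = coeffHom (M.rad i) (tpow V) n ≫ symm hc n := geom_ext fun m => by
      by_cases hm : m < M.deg i
      · have h₃ := hσ n m
        rw [M.j_eq hm, ofConst_comp _ _ hτ] at h₃
        refine (constMap_injective h₃).trans ?_
        split_ifs with hmn
        · subst hmn
          rw [← Category.assoc, incl_coeffHom, Category.id_comp]
          exact Category.comp_id _
        · rw [← Category.assoc, incl_coeffHom_ne hmn, Limits.zero_comp]
      · have h₃ := M.word_eq_zero (not_lt.1 hm)
        rw [word] at h₃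
        rw [← Category.assoc, ← Category.assoc, h₃,
          incl_coeffHom_ne (fun e => hm (by rw [e]; exact hn)), Limits.zero_comp, Limits.zero_comp]
    refine (congrArg (fun φ : tens V (M.rad i) ⟶ tpow V n => φ y) h₂).symm.trans ?_
    rw [comp_apply, hy]
    refine (map_sub τ.lin _ _).trans (sub_eq_zero.2 ?_)
    exact congrArg (fun φ : Z.at' z ⟶ tpow V n => φ x) h₁

lemma exists_factor₂ (p q : ℕ) : ∃ U : tpow V p ⊗ tpow V q ⟶ tpow V p ⊗ tpow V q,
    ∀ i i', M.word i p ⊗ₘ M.word i' q =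
      (symm hc p ⊗ₘ symm hc q) ≫ U ≫ (M.word i p ⊗ₘ M.word i' q) := by
  obtain ⟨L, hL⟩ := M.exists_word_factor p
  obtain ⟨L', hL'⟩ := M.exists_word_factor q
  refine ⟨L ⊗ₘ L', fun i i' => ?_⟩
  rw [tensorHom_comp_tensorHom, tensorHom_comp_tensorHom, ← hL, ← hL']

omit [FiniteDimensional k V] in
lemma normLE_word₂ (i l : M.R.I) (p q : ℕ) :
    NormLE (M.word i p ⊗ₘ M.word l q) ((M.rad i).val ^ p * (M.rad l).val ^ q) :=
  normLE_tensorHom ((M.rad i).pow_pos p).le ((M.rad l).pow_pos q).le (M.normLE_word i p)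
    (M.normLE_word l q)

/-- A family of maps exchanging words, compatible with the symmetrizers. -/
lemma exists_exchange (T : ∀ p q, tpow V p ⊗ tpow V q ⟶ tpow V q ⊗ tpow V p)
    (hT : ∀ i i', ∃ C, 0 ≤ C ∧ ∀ p q : ℕ, p < M.deg i → q < M.deg i' → NormLE (T p q) C)
    (hs : ∀ p q, T p q ≫ (symm hc q ⊗ₘ symm hc p) = (symm hc p ⊗ₘ symm hc q) ≫ T p q) :
    ∃ b : M.R ⊗ M.R ⟶ M.R ⊗ M.R, ∀ p q, M.j₂ p q ≫ b = constMap (T p q) ≫ M.j₂ q p :=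
  M.exists_hom₂ (M.approximable.tensor M.approximable).isMonomorphic _ fun i i' => by
    obtain ⟨C, hC, hTC⟩ := hT i i'
    obtain ⟨τ, hτ⟩ := M.exists_desc₂ hC i i' (fun p q => T p q ≫ (M.word i' q ⊗ₘ M.word i p))
      (fun p q hp hq => by
        have h := (hTC p q hp hq).comp (M.normLE_word₂ i' i q p)
          (mul_pos ((M.rad i').pow_pos q) ((M.rad i).pow_pos p)).le
        exact h.mono (le_of_eq (by ring))) fun p q _ _ => by
      obtain ⟨U, hU⟩ := M.exists_factor₂ q p
      refine ⟨T p q ≫ U ≫ (M.word i' q ⊗ₘ M.word i p), ?_⟩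
      rw [hU i' i, ← Category.assoc, hs, Category.assoc, ← hU i' i]
    refine ⟨(i', i), τ, fun p q hp hq => ?_⟩
    rw [M.j₂_eq hq hp]
    exact congrArg (ofConst (Y := M.R ⊗ M.R) (i', i)) (hτ p q hp hq)

lemma exists_braid (hc1 : NormLE c 1) : ∃ b : M.R ⊗ M.R ⟶ M.R ⊗ M.R,
    (∀ p q, M.j₂ p q ≫ b = constMap (braidPow c p q) ≫ M.j₂ q p) ∧
    (constWords (words hc)).IsBraid M.j b := by
  obtain ⟨b, hb⟩ := M.exists_exchange (braidPow c)
    (fun _ _ => ⟨1, zero_le_one, fun p q _ _ => normLE_braidPow hc1 p q⟩)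
    fun p q => (braidPow_symm hc p q).symm
  refine ⟨b, hb, fun n p q h => ?_⟩
  rw [M.J2_eq h, Category.assoc, hb, M.J2_eq (show q + p = n by lia), constWords_br,
    ← Category.assoc, ← Category.assoc, ← constMap_comp, ← constMap_comp]
  refine congrArg (constMap · ≫ _) ?_
  rw [Iso.inv_comp_eq, ← Category.assoc, Iso.eq_comp_inv]
  exact braidPow_words hc p q n h

/-- An inverse of the braiding of words, bounded on every pair of terms, yields an inverse of the
braiding. -/
lemma isIso_braid {b : M.R ⊗ M.R ⟶ M.R ⊗ M.R}
    (hb : ∀ p q, M.j₂ p q ≫ b = constMap (braidPow c p q) ≫ M.j₂ q p)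
    (T : ∀ p q, tpow V p ⊗ tpow V q ⟶ tpow V q ⊗ tpow V p)
    (hT : ∀ i i', ∃ C, 0 ≤ C ∧ ∀ p q : ℕ, p < M.deg i → q < M.deg i' → NormLE (T p q) C)
    (h₁ : ∀ p q, braidPow c p q ≫ T q p = 𝟙 _) (h₂ : ∀ p q, T p q ≫ braidPow c q p = 𝟙 _) :
    IsIso b := by
  obtain ⟨b', hb'⟩ := M.exists_exchange T hT fun p q => by
    have := congrArg (fun f => T p q ≫ f ≫ T p q) (braidPow_symm hc q p)
    simp only [Category.assoc, h₁, Category.comp_id] at this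
    rw [this, ← Category.assoc, h₂, Category.id_comp]
  have key : ∀ {f g : M.R ⊗ M.R ⟶ M.R ⊗ M.R}, (∀ p q, M.j₂ p q ≫ f = M.j₂ p q ≫ g) → f = g :=
    fun {f g} h => M.levelGen.ext₂ (M.approximable.tensor M.approximable).isMonomorphic fun p q => by
      rw [M.j_tensor, Category.assoc, Category.assoc, h]
  refine ⟨b', key fun p q => ?_, key fun p q => ?_⟩
  · rw [← Category.assoc, hb, Category.assoc, hb', ← Category.assoc, ← constMap_comp, h₁,
      constMap_id, Category.id_comp, Category.comp_id]
  · rw [← Category.assoc, hb', Category.assoc, hb, ← Category.assoc, ← constMap_comp, h₂,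
      constMap_id, Category.id_comp, Category.comp_id]

lemma exists_antipode (hc1 : NormLE c 1) :
    ∃ S : M.R ⟶ M.R, (constWords (words hc)).IsAntipode M.j S :=
  M.exists_hom M.approximable.isMonomorphic _ fun i => by
    obtain ⟨τ, -, hτ⟩ := M.exists_desc zero_le_one i
      (fun n => (-1 : ℤ) ^ n • ((words hc).tw n 0 n ≫ M.word i n)) (fun n _ => by
        refine NormLE.neg_one_pow_zsmul ?_ n
        have := (normLE_tw hc hc1 n).comp (M.normLE_word i n) ((M.rad i).pow_pos n).le
        exact this.mono (le_of_eq (mul_comm _ _))) fun n _ => by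
      obtain ⟨L, hL⟩ := M.exists_word_factor n
      obtain ⟨U, hU⟩ := (words hc).exists_tw_sym n
      refine ⟨(-1 : ℤ) ^ n • (U ≫ L ≫ M.word i n), ?_⟩
      rw [Preadditive.comp_zsmul]
      refine congrArg _ ?_
      conv_lhs => rw [hL i]
      exact (Category.assoc _ _ _).symm.trans ((congrArg (· ≫ L ≫ M.word i n) hU).trans
        (Category.assoc _ _ _))
    refine ⟨i, τ, fun n hn => ?_⟩
    rw [hτ n hn, ofConst_zsmul, constWords_tw, M.j_eq hn, constMap_ofConst]

omit [FiniteDimensional k V] in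
lemma comulPow_π (hc1 : NormLE c 1) (l : M.R.I) (n : ℕ) :
    comulPow hc1 (M.rad l) n ≫ (M.π l ⊗ₘ M.π l) =
      ∑ x ∈ Finset.HasAntidiagonal.antidiagonal n,
        if h : x.1 + x.2 = n then (words hc).sh n 0 x.1 x.2 ≫ ((words hc).g h).inv ≫
          (M.word l x.1 ⊗ₘ M.word l x.2) else 0 := by
  rw [comulPow_eq hc hc1, Words.shuffle, Preadditive.sum_comp]
  refine Finset.sum_congr rfl fun x hx => ?_
  have h := Finset.HasAntidiagonal.mem_antidiagonal.1 hx
  rw [dif_pos h, Words.J2_pos _ _ h, Category.assoc, Category.assoc, tensorHom_comp_tensorHom]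
  rfl

omit [FiniteDimensional k V] in
lemma ofConst_comulPow (hc1 : NormLE c 1) {l : M.R.I} {n : ℕ} (hn : n < M.deg l) :
    ofConst (Y := M.R ⊗ M.R) (l, l) (comulPow hc1 (M.rad l) n ≫ (M.π l ⊗ₘ M.π l)) =
      (constWords (words hc)).shuffle M.j n := by
  refine (congrArg (ofConst (Y := M.R ⊗ M.R) (l, l)) (M.comulPow_π hc1 l n)).trans ?_
  refine (ofConst_sum (Y := M.R ⊗ M.R) (l, l) _ _).trans (Finset.sum_congr rfl fun x hx => ?_)
  have h := Finset.HasAntidiagonal.mem_antidiagonal.1 hx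
  have h₁ : (x.1 : ℕ∞) < M.deg l := (Nat.cast_le.2 (by lia : x.1 ≤ n)).trans_lt hn
  have h₂ : (x.2 : ℕ∞) < M.deg l := (Nat.cast_le.2 (by lia : x.2 ≤ n)).trans_lt hn
  rw [dif_pos h, constWords_sh, M.J2_eq h, M.j₂_eq h₁ h₂]
  rfl

omit [FiniteDimensional k V] in
lemma ofConst_coact {l : M.R.I} {n : ℕ} (hn : n < M.deg l) :
    ofConst (Y := diskAlg k 1 ⊗ M.R) (two.{u}, l)
      ((λ_ (tpow V n)).inv ≫ (incl two.{u}.1 (diskPow k) n ⊗ₘ M.word l n)) =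
    (λ_ (const (tpow V n))).inv ≫ (tPow 1 n ⊗ₘ M.j n) := by
  have ht : tPow (k := k) 1 n = ofConst (Y := diskAlg k 1) two.{u} (incl two.{u}.1 (diskPow k) n) :=
    single_eq two.{u} n
  have hu : (λ_ (const (tpow V n))).inv =
      constMap (λ_ (tpow V n)).inv ≫ (constTensor (𝟙_ (Ban k)) (tpow V n)).inv := by
    rw [← cancel_epi (λ_ (const (tpow V n))).hom, Iso.hom_inv_id, ← constTensor_unit_left,
      Category.assoc, ← Category.assoc (constMap _), ← constMap_comp, Iso.hom_inv_id, constMap_id,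
      Category.id_comp, Iso.hom_inv_id]
  rw [M.j_eq hn, ht, hu, Category.assoc]
  refine Eq.trans ?_ (congrArg (fun f => constMap (λ_ (tpow V n)).inv ≫
    (constTensor (𝟙_ (Ban k)) (tpow V n)).inv ≫ f) (ofConst_tensor _ _)).symm
  rw [Iso.inv_hom_id_assoc]
  rfl

lemma exists_comul (hc1 : NormLE c 1) :
    ∃ Δ : M.R ⟶ M.R ⊗ M.R, (constWords (words hc)).IsComul M.j Δ :=
  M.exists_hom (M.approximable.tensor M.approximable).isMonomorphic _ fun i => by
    obtain ⟨l, ⟨w⟩, hl⟩ := M.exists_small i _ (half_pos (M.rad i).pos)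
    obtain ⟨τ, -, hτ⟩ := M.exists_desc zero_le_one i
      (fun n => comulPow hc1 (M.rad l) n ≫ (M.π l ⊗ₘ M.π l)) (fun n _ => by
        have h := (normLE_comulPow hc1 (M.rad l) n).comp (normLE_tensorHom zero_le_one zero_le_one
          (M.isQuot l).1 (M.isQuot l).1) (by norm_num)
        refine h.mono ?_
        rw [one_mul]
        refine mul_le_mul_of_nonneg_left (pow_le_pow_left₀ ?_ ?_ n) zero_le_one
        · linarith [(M.rad l).pos]
        · linarith) fun n _ => by
      have key : ∀ x : ℕ × ℕ, ∃ U : tpow V n ⟶ M.R.at' l ⊗ M.R.at' l,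
          (if h : x.1 + x.2 = n then (words hc).sh n 0 x.1 x.2 ≫ ((words hc).g h).inv ≫
            (M.word l x.1 ⊗ₘ M.word l x.2) else 0) = symm hc n ≫ U := fun x => by
        split_ifs with h
        · obtain ⟨U, hU⟩ := M.exists_factor₂ x.1 x.2
          refine ⟨((words hc).g h).inv ≫ U ≫ (M.word l x.1 ⊗ₘ M.word l x.2), ?_⟩
          conv_lhs => rw [hU l l]
          have := congrArg (· ≫ U ≫ (M.word l x.1 ⊗ₘ M.word l x.2)) (sh_symm hc h)
          simp only [Category.assoc] at this
          exact this
        · exact ⟨0, Limits.comp_zero.symm⟩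
      choose U hU using key
      exact ⟨∑ x ∈ Finset.HasAntidiagonal.antidiagonal n, U x, by
        rw [M.comulPow_π hc1, Preadditive.comp_sum]
        exact Finset.sum_congr rfl fun x _ => hU x⟩
    refine ⟨(l, l), τ, fun n hn => ?_⟩
    exact (congrArg (ofConst (Y := M.R ⊗ M.R) (l, l)) (hτ n hn)).trans
      (M.ofConst_comulPow hc1 (hn.trans_le (M.deg_mono w)))

lemma exists_coact : ∃ ρ : M.R ⟶ diskAlg k 1 ⊗ M.R, ∀ n, IsHomogeneous (tPow 1) ρ n (M.j n) :=
  M.exists_hom ((approximable_disk 1).tensor M.approximable).isMonomorphic _ fun i => by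
    obtain ⟨l, ⟨w⟩, hl⟩ := M.exists_small i _ (half_pos (M.rad i).pos)
    obtain ⟨τ, -, hτ⟩ := M.exists_desc zero_le_one i
      (fun n => (λ_ (tpow V n)).inv ≫ (incl two.{u}.1 (diskPow k) n ⊗ₘ M.word l n)) (fun n _ => by
        have h := (normLE_leftUnitor_inv (tpow V n)).comp (normLE_tensorHom (two.{u}.1.pow_pos n).le
          ((M.rad l).pow_pos n).le (normLE_incl (E := diskPow k) n) (M.normLE_word l n))
          (mul_pos (two.{u}.1.pow_pos n) ((M.rad l).pow_pos n)).le
        refine h.mono ?_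
        rw [mul_one, one_mul, ← mul_pow]
        refine pow_le_pow_left₀ (mul_pos two.{u}.1.pos (M.rad l).pos).le ?_ n
        show 2 * (M.rad l).val ≤ _
        linarith) fun n _ => by
      obtain ⟨L, hL⟩ := M.exists_word_factor n
      refine ⟨(λ_ _).inv ≫ (incl two.{u}.1 (diskPow k) n ⊗ₘ (L ≫ M.word l n)), ?_⟩
      conv_lhs => rw [hL l]
      rw [leftUnitor_inv_naturality_assoc, ← id_tensorHom, tensorHom_comp_tensorHom,
        Category.id_comp]
    refine ⟨(two.{u}, l), τ, fun n hn => ?_⟩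
    exact (congrArg (ofConst (Y := diskAlg k 1 ⊗ M.R) (two.{u}, l)) (hτ n hn)).trans
      (M.ofConst_coact (hn.trans_le (M.deg_mono w)))
lemma isNuclear : M.R.IsNuclear := fun i => by
  classical
  obtain ⟨N, C, hC, hV⟩ := hasFrame_of_finiteDimensional V
  have hi := (M.rad i).pos
  obtain ⟨l, ⟨w⟩, hl⟩ := M.exists_small i ((M.rad i).val / (2 * (N * C * C * N + 1)))
    (by positivity)
  choose d ξ y hd hξ hy hsum using fun n => (hV.tpow hC n).exists_factor (symm hc n)
  have key : ∀ n (b : Fin (d n)), ∃ ζ : M.R.at' i ⟶ 𝟙_ (Ban k),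
      NormLE ζ ((N * C) ^ n / (M.rad i).val ^ n) ∧ ∀ m : ℕ, m < M.deg i →
        M.word i m ≫ ζ =
          if h : m = n then eqToHom (congrArg (tpow V) h) ≫ symm hc n ≫ ξ n b else 0 :=
    fun n b => M.exists_desc (by positivity) i _ (fun m _ => by
      split_ifs with h
      · subst h
        rw [div_mul_cancel₀ _ ((M.rad i).pow_pos m).ne', mul_pow]
        have := hξ m b
        rw [Nat.cast_pow] at this
        simpa using this
      · have := (M.rad i).pow_pos m
        exact normLE_zero (by positivity)) fun m _ => by
      split_ifs with h
      · subst h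
        exact ⟨ξ m b, by simp⟩
      · exact ⟨0, Limits.comp_zero.symm⟩
  choose ζ hζ hw using key
  have hs : Summable fun x : Σ n, Fin (d n) =>
      (N * C) ^ x.1 / (M.rad i).val ^ x.1 * ‖M.word l x.1 (y x.1 x.2)‖ := by
    refine (summable_sigma_of_nonneg fun x => by positivity).2 ⟨fun n => .of_finite, ?_⟩
    refine Summable.of_nonneg_of_le (fun n => tsum_nonneg fun b => by positivity) (fun n => ?_)
      (summable_geometric_of_lt_one (r := 1 / 2) (by norm_num) (by norm_num))
    rw [tsum_fintype]
    have hrl := (M.rad l).pos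
    have h₁ : ∀ b, (N * C) ^ n / (M.rad i).val ^ n * ‖M.word l n (y n b)‖ ≤
        (N * C * C * (M.rad l).val / (M.rad i).val) ^ n := fun b => by
      have h₂ : ‖M.word l n (y n b)‖ ≤ (M.rad l).val ^ n * C ^ n :=
        (M.normLE_word l n _).trans (mul_le_mul_of_nonneg_left (hy n b) (by positivity))
      refine (mul_le_mul_of_nonneg_left h₂ (by positivity)).trans (le_of_eq ?_)
      rw [div_pow]
      ring
    refine (Finset.sum_le_sum fun b _ => h₁ b).trans ?_
    rw [Finset.sum_const, Finset.card_univ, Fintype.card_fin, nsmul_eq_mul]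
    have h₃ : (d n : ℝ) ≤ (N : ℝ) ^ n := by exact_mod_cast hd n
    refine (mul_le_mul_of_nonneg_right h₃ (by positivity)).trans ?_
    rw [← mul_pow]
    refine pow_le_pow_left₀ (by positivity) ?_ n
    rw [le_div_iff₀ (by positivity)] at hl
    rw [mul_div_assoc', div_le_div_iff₀ hi two_pos]
    nlinarith
  obtain ⟨s, hs'⟩ := exists_hasSum (fun x : Σ n, Fin (d n) => rankOne (ζ x.1 x.2)
    (M.word l x.1 (y x.1 x.2))) _ (fun x => normLE_rankOne (hζ x.1 x.2) le_rfl) hs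
  refine ⟨l, w, Σ n, Fin (d n), fun x => ζ x.1 x.2, fun x => M.word l x.1 (y x.1 x.2),
    fun x => (N * C) ^ x.1 / (M.rad i).val ^ x.1, fun x => by positivity, fun x => hζ x.1 x.2, hs, ?_⟩
  suffices M.R.F.map w = s by rwa [this]
  refine M.word_ext fun n hn => ?_
  rw [M.word_map w hn]
  obtain ⟨L, hL⟩ := M.exists_word_factor n
  have hn' : M.word l n = ∑ b, rankOne (symm hc n ≫ ξ n b) (M.word l n (y n b)) := by
    conv_lhs => rw [hL l, ← hsum n, Preadditive.sum_comp]
    refine Finset.sum_congr rfl fun b _ => ?_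
    rw [Category.assoc, Category.assoc, ← hL l, rankOne_comp, comp_rankOne]
  refine hom_ext fun x => ?_
  refine HasSum.unique ?_ (hs' (M.word i n x))
  have hv : M.word l n x = ∑ z ∈ Finset.univ.map ⟨Sigma.mk (β := fun n => Fin (d n)) n,
      sigma_mk_injective⟩, rankOne (ζ z.1 z.2) (M.word l z.1 (y z.1 z.2)) (M.word i n x) := by
    rw [Finset.sum_map]
    conv_lhs => rw [hn', sum_apply]
    refine Finset.sum_congr rfl fun b _ => ?_
    show rankOne (symm hc n ≫ ξ n b) _ x = (M.word i n ≫ rankOne (ζ n b) _) x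
    rw [comp_rankOne, hw n b n hn, dif_pos rfl, eqToHom_refl, Category.id_comp]
    rfl
  rw [hv]
  refine hasSum_sum_of_ne_finset_zero fun z hz => ?_
  show (M.word i n ≫ rankOne (ζ z.1 z.2) _) x = 0
  have hz' : n ≠ z.1 := fun e => hz (by
    obtain ⟨m, b⟩ := z
    subst e
    simp)
  rw [comp_rankOne, hw _ _ n hn, dif_neg hz']
  exact zero_smul _ _

end NicholsModel

end Ban

namespace Ban

variable {k : Type u} [NormedField k] [CompleteSpace k]

open IndObj

section constBraid

variable {V : Ban k} {c : V ⊗ V ⟶ V ⊗ V}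

lemma constBraid_eq (c : V ⊗ V ⟶ V ⊗ V) : constBraid c = ofLevel (X := (const V).tensor (const V))
    (Y := (const V).tensor (const V)) id (fun _ => c) (fun w => ⟨w, by
      refine (congrArg (· ≫ c) (id_tensorHom_id V V)).trans ((Category.id_comp c).trans ?_)
      exact ((congrArg (c ≫ ·) (id_tensorHom_id V V)).trans (Category.comp_id c)).symm⟩) :=
  IndObj.hom_ext fun _ => congrArg (Germ.mk (Y := (const V).tensor (const V)) (⟨⟨⟩⟩, ⟨⟨⟩⟩))
    (show (𝟙 (V ⊗ V) ≫ c) ≫ 𝟙 (V ⊗ V) = c by simp)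

lemma isPreBraiding_constBraid (hc : IsPreBraiding c) : IsPreBraiding (constBraid c) := by
  rw [constBraid_eq]
  have h := hc
  unfold IsPreBraiding at h
  simp only [← tensorHom_id, ← id_tensorHom] at h
  refine IndObj.hom_ext fun _ => congrArg
    (Germ.mk (Y := (const V ⊗ const V) ⊗ const V) ((⟨⟨⟩⟩, ⟨⟨⟩⟩), ⟨⟨⟩⟩)) ?_
  exact h

lemma letter_hom (V : Ban k) : (powers V).letter.hom = (λ_ V).inv :=
  (congrArg (_ ≫ ·) ((Category.comp_id _).trans (id_whiskerRight (𝟙_ (Ban k)) V))).trans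
    (Category.comp_id _)

lemma letter_braid (hc : IsPreBraiding c) : c ≫ ((powers V).letter.hom ⊗ₘ (powers V).letter.hom) ≫
    ((words hc).g (rfl : 1 + 1 = 2)).hom = ((powers V).letter.hom ⊗ₘ (powers V).letter.hom) ≫
      ((words hc).g (rfl : 1 + 1 = 2)).hom ≫ (words hc).s 2 0 := by
  have h : ((powers V).letter.hom ⊗ₘ (powers V).letter.hom) ≫
      ((words hc).g (rfl : 1 + 1 = 2)).hom = (λ_ (V ⊗ V)).inv ≫ (α_ (𝟙_ (Ban k)) V V).inv := by
    rw [words_g hc 1 1]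
    refine ext₂ fun x y => ?_
    rw [letter_hom]
    refine (congrArg (concat V 1 1) (tensorHom_otm (λ_ V).inv (λ_ V).inv x y)).trans ?_
    show ((ρ_ (𝟙_ (Ban k) ⊗ V)).hom ▷ V) ((α_ (𝟙_ (Ban k) ⊗ V) (𝟙_ (Ban k)) V).inv
      (otm (otm (scalar 1) x) (otm (scalar 1) y))) =
        (α_ (𝟙_ (Ban k)) V V).inv ((λ_ (V ⊗ V)).inv (otm x y))
    simp
  have h₂ : (words hc).s 2 0 =
      (α_ (𝟙_ (Ban k)) V V).hom ≫ 𝟙_ (Ban k) ◁ c ≫ (α_ (𝟙_ (Ban k)) V V).inv := by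
    rw [show (words hc).s 2 0 = _ from (powers V).braidLetter_last c 0]
    have h₃ : ((powers V).lastTwo 0).hom = (α_ (𝟙_ (Ban k)) V V).inv :=
      (congrArg (_ ≫ ·) ((Category.comp_id _).trans (id_whiskerRight (𝟙_ (Ban k) ⊗ V) V))).trans
        (Category.comp_id _)
    have h₄ : ((powers V).lastTwo 0).inv = (α_ (𝟙_ (Ban k)) V V).hom :=
      (congrArg (· ≫ _) ((Category.id_comp _).trans (id_whiskerRight (𝟙_ (Ban k) ⊗ V) V))).trans
        (Category.id_comp _)
    rw [h₃, h₄]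
    rfl
  refine (congrArg (c ≫ ·) h).trans (Eq.trans ?_ (congrArg₂ (· ≫ ·) h h₂).symm |>.trans
    (Category.assoc _ _ _))
  show c ≫ (λ_ (V ⊗ V)).inv ≫ (α_ (𝟙_ (Ban k)) V V).inv =
    ((λ_ (V ⊗ V)).inv ≫ (α_ (𝟙_ (Ban k)) V V).inv) ≫
      (α_ (𝟙_ (Ban k)) V V).hom ≫ 𝟙_ (Ban k) ◁ c ≫ (α_ (𝟙_ (Ban k)) V V).inv
  simp

lemma constBraid_letter (hc : IsPreBraiding c) :
    constBraid c ≫ ((constIso (powers V).letter).hom ⊗ₘ (constIso (powers V).letter).hom) ≫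
      ((constWords (words hc)).g (rfl : 1 + 1 = 2)).hom =
    ((constIso (powers V).letter).hom ⊗ₘ (constIso (powers V).letter).hom) ≫
      ((constWords (words hc)).g (rfl : 1 + 1 = 2)).hom ≫ (constWords (words hc)).s 2 0 := by
  have h : ((constIso (powers V).letter).hom ⊗ₘ (constIso (powers V).letter).hom) ≫
      ((constWords (words hc)).g (rfl : 1 + 1 = 2)).hom = (constTensor V V).hom ≫
        constMap (((powers V).letter.hom ⊗ₘ (powers V).letter.hom) ≫
          ((words hc).g (rfl : 1 + 1 = 2)).hom) := by
    rw [constMap_comp, ← Category.assoc, ← constTensor_natural, Category.assoc]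
    rfl
  rw [← Category.assoc _ _ ((constWords (words hc)).s 2 0), h, constBraid, Category.assoc,
    Category.assoc, Iso.inv_hom_id_assoc, ← constMap_comp, letter_braid hc, ← Category.assoc _ _ ((words hc).s 2 0),
    constMap_comp, Category.assoc]

end constBraid

section inverse

variable {V : Ban k} {c d : V ⊗ V ⟶ V ⊗ V} (h : c ≫ d = 𝟙 _) (h' : d ≫ c = 𝟙 _)
include h h'

lemma exists_braidOne_iso : ∀ n, ∃ E : tpow V n ⊗ V ≅ V ⊗ tpow V n, E.hom = braidOne c n ∧
    (NormLE d 1 → NormLE E.inv 1)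
  | 0 => ⟨(λ_ V) ≪≫ (ρ_ V).symm, rfl,
      fun _ => (normLE_rightUnitor_hom _).comp_one (normLE_leftUnitor_inv _)⟩
  | n + 1 => by
    obtain ⟨E, h₁, h₂⟩ := exists_braidOne_iso n
    refine ⟨α_ (tpow V n) V V ≪≫ whiskerLeftIso (tpow V n) ⟨c, d, h, h'⟩ ≪≫
      (α_ (tpow V n) V V).symm ≪≫ whiskerRightIso E V ≪≫ α_ V (tpow V n) V, ?_, fun hd => ?_⟩
    · rw [braidOne, ← h₁]
      rfl
    · exact ((((normLE_associator_inv _ _ _).comp_one (normLE_whiskerRight (h₂ hd) V)).comp_one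
        (normLE_associator_hom _ _ _)).comp_one (normLE_whiskerLeft _ hd)).comp_one
          (normLE_associator_inv _ _ _)

lemma exists_braidPow_iso (n : ℕ) : ∀ m, ∃ E : tpow V n ⊗ tpow V m ≅ tpow V m ⊗ tpow V n,
    E.hom = braidPow c n m ∧ (NormLE d 1 → NormLE E.inv 1)
  | 0 => ⟨(ρ_ (tpow V n)) ≪≫ (λ_ (tpow V n)).symm, rfl,
      fun _ => (normLE_leftUnitor_hom _).comp_one (normLE_rightUnitor_inv _)⟩
  | m + 1 => by
    obtain ⟨E, h₁, h₂⟩ := exists_braidPow_iso n m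
    obtain ⟨E', e₁, e₂⟩ := exists_braidOne_iso h h' n
    refine ⟨(α_ (tpow V n) (tpow V m) V).symm ≪≫ whiskerRightIso E V ≪≫
      α_ (tpow V m) (tpow V n) V ≪≫ whiskerLeftIso (tpow V m) E' ≪≫
      (α_ (tpow V m) V (tpow V n)).symm, ?_, fun hd => ?_⟩
    · rw [braidPow, ← h₁, ← e₁]
      rfl
    · exact ((((normLE_associator_hom _ _ _).comp_one (normLE_whiskerLeft _ (e₂ hd))).comp_one
        (normLE_associator_inv _ _ _)).comp_one (normLE_whiskerRight (h₂ hd) V)).comp_one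
          (normLE_associator_hom _ _ _)

end inverse

namespace NicholsModel

variable {V : Ban k} {c : V ⊗ V ⟶ V ⊗ V} {hc : IsPreBraiding c} (M : NicholsModel hc)
  [FiniteDimensional k V] (hc1 : NormLE c 1)

/-- The inclusion of the generators. -/
def gen : const V ⟶ M.R := (constIso (powers V).letter).hom ≫ M.j 1

include hc1 in
theorem exists_structure : ∃ (_ : MonObj M.R) (_ : ComonObj M.R) (b : M.R ⊗ M.R ⟶ M.R ⊗ M.R)
    (ρ : M.R ⟶ diskAlg k 1 ⊗ M.R), (constWords (words hc)).IsMul M.j (MonObj.mul (X := M.R)) ∧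
      (constWords (words hc)).IsOne M.j (MonObj.one (X := M.R)) ∧
      (constWords (words hc)).IsComul M.j (ComonObj.comul (X := M.R)) ∧
      (constWords (words hc)).IsCounit M.j (ComonObj.counit (X := M.R)) ∧
      (∀ p q, M.j₂ p q ≫ b = constMap (braidPow c p q) ≫ M.j₂ q p) ∧
      (∀ n, IsHomogeneous (tPow 1) ρ n (M.j n)) ∧
      IsDaggerZeroNicholsUngenerated (constBraid c) M.R b ρ M.gen := by
  obtain ⟨μ, hμ⟩ := M.exists_mul_hom
  obtain ⟨ε, hε⟩ := M.exists_counit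
  obtain ⟨Δ, hΔ⟩ := M.exists_comul hc1
  obtain ⟨b, hb, hb'⟩ := M.exists_braid hc1
  obtain ⟨ρ, hρ⟩ := M.exists_coact
  obtain ⟨S, hS⟩ := M.exists_antipode hc1
  obtain ⟨σ, hσ⟩ := M.exists_symmetrizer
  have hη : (constWords (words hc)).IsOne M.j ((constWords (words hc)).u.hom ≫ M.j 0) := rfl
  let _ := Words.monObj M.separating hμ hη
  let _ := Words.comonObj M.separating hΔ hε
  exact ⟨inferInstance, inferInstance, b, ρ, hμ, hη, hΔ, hε, hb, hρ,
    isDaggerZeroNicholsUngenerated M.levelGen M.approximable hμ hη hΔ hε hb' hS hσ hρ _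
      (constBraid_letter hc) (isPreBraiding_constBraid hc) (isNuclear_const V).isFlat
      M.isNuclear.isFlat⟩

end NicholsModel

end Ban

namespace Ban

variable {k : Type u} [NormedField k]

lemma quotπ_eq_zero {A : Ban k} {S : Submodule k A} (hS : IsClosed (S : Set A)) (x : A) :
    quotπ A S x = 0 ↔ x ∈ S := by
  have h : S.topologicalClosure = S := hS.submodule_topologicalClosure_eq
  refine Iff.trans ?_ (iff_of_eq (congrArg (x ∈ ·) h))
  exact Submodule.Quotient.mk_eq_zero _

lemma trunc_comp (r s q : Radius.{u}) (E : ℕ → Ban k) {m n : ℕ} (h : m ≤ n) :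
    trunc r s E m ≫ trunc s q E n = trunc r q E m := geom_ext fun l => by
  rw [← Category.assoc, incl_trunc, incl_trunc]
  split_ifs with hl
  · rw [incl_trunc, if_pos (hl.trans_le h)]
  · rw [Limits.zero_comp]

variable [CompleteSpace k]

lemma isQuot_quotπ {A : Ban k} (S : Submodule k A) : IsQuot (quotπ A S) :=
  ⟨normLE_quotπ S, fun z _ hε => quot_exists S z hε⟩

variable {V : Ban k} {c : V ⊗ V ⟶ V ⊗ V} (hc : IsPreBraiding c)

/-- The index set of the radii and the degrees. -/
structure Cutoff : Type u where
  rad : Radius.{u}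
  deg : ℕ

namespace Cutoff

instance : Preorder Cutoff.{u} where
  le i i' := i.rad ≤ i'.rad ∧ i.deg ≤ i'.deg
  le_refl _ := ⟨le_refl _, le_refl _⟩
  le_trans _ _ _ h h' := ⟨h.1.trans h'.1, h.2.trans h'.2⟩

instance : Nonempty Cutoff.{u} := ⟨⟨⟨1, one_pos⟩, 0⟩⟩

instance : IsDirectedOrder Cutoff.{u} where
  directed i i' := ⟨⟨i.rad.inf i'.rad, i.deg + i'.deg⟩,
    ⟨Radius.le_inf_left _ _, Nat.le_add_right _ _⟩, ⟨Radius.le_inf_right _ _, Nat.le_add_left _ _⟩⟩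

end Cutoff

lemma trunc_mem_symIdeal {r s : Radius.{u}} {n : ℕ} {d : ℕ∞} {x : tens V r}
    (hx : x ∈ symIdeal hc n r) : trunc r s (tpow V) n x ∈ symIdeal hc d s := by
  rw [trunc_apply]
  exact Submodule.sum_mem _ fun m hm => incl_mem_symIdeal hc fun _ =>
    hx m (Nat.cast_lt.2 (Finset.mem_range.1 hm))

lemma trunc_quotπ (r : Radius.{u}) (n : ℕ) :
    trunc r r (tpow V) n ≫ quotπ (tens V r) (symIdeal hc n r) = quotπ _ _ := geom_ext fun m => by
  rw [← Category.assoc, incl_trunc]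
  split_ifs with h
  · rfl
  · rw [Limits.zero_comp]
    exact hom_ext fun x => ((quotπ_eq_zero (isClosed_symIdeal hc _ _) _).2
      (incl_mem_symIdeal hc fun h' => absurd (Nat.cast_lt.1 h') h)).symm

/-- The system of the truncated quotients of the Banach tensor algebras by the kernels of the
quantum symmetrizers. -/
def cutoffFunctor : Cutoff.{u} ⥤ Ban k where
  obj i := quot (tens V i.rad) (symIdeal hc i.deg i.rad)
  map {i i'} _ := quotMap (trunc i.rad i'.rad (tpow V) i.deg) fun _ => trunc_mem_symIdeal hc
  map_id i := quot_ext ((quotπ_map _ _).trans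
    ((trunc_quotπ hc i.rad i.deg).trans (Category.comp_id _).symm))
  map_comp {i i' i''} v _ := quot_ext ((quotπ_map _ _).trans
    (congrArg (· ≫ quotπ _ (symIdeal hc i''.deg i''.rad))
      (trunc_comp i.rad i'.rad i''.rad (tpow V) (leOfHom v).2).symm))

/-- The colimit of the truncated quotients, over all radii and degrees. -/
def cutoffModel : NicholsModel hc where
  R := ⟨Cutoff.{u}, cutoffFunctor hc⟩
  rad i := i.rad
  deg i := i.deg
  π i := quotπ (tens V i.rad) (symIdeal hc i.deg i.rad)
  isQuot i := isQuot_quotπ (symIdeal hc i.deg i.rad)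
  π_eq_zero i := quotπ_eq_zero (isClosed_symIdeal hc i.deg i.rad)
  deg_mono w := Nat.cast_le.2 (leOfHom (X := Cutoff.{u}) w).2
  rad_mono w := (leOfHom (X := Cutoff.{u}) w).1
  map_π {i i'} _ n h := (congrArg (· ≫ quotπ _ (symIdeal hc i'.deg i'.rad))
    ((incl_trunc i.rad i'.rad (tpow V) n i.deg).trans (if_pos (Nat.cast_lt.1 h))))
  exists_deg n := ⟨⟨⟨1, one_pos⟩, n + 1⟩, Nat.cast_lt.2 n.lt_succ_self⟩
  exists_mul i i' := ⟨⟨i.rad.inf i'.rad, i.deg + i'.deg⟩, Radius.le_inf_left _ _,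
    Radius.le_inf_right _ _, (Nat.cast_add _ _).ge⟩
  exists_small i ε hε := ⟨⟨i.rad.inf ⟨ε, hε⟩, i.deg⟩,
    ⟨homOfLE (X := Cutoff.{u}) ⟨Radius.le_inf_left _ _, le_refl _⟩⟩, min_le_right _ _⟩

variable (hc1 : NormLE c 1) [FiniteDimensional k V]

/-- The colimit of the quotients of the Banach tensor algebras by their largest coideals. -/
def daggerModel : NicholsModel hc where
  R := nicholsDagger hc1
  rad r := r.1
  deg _ := ⊤
  π r := quotπ (tens V r.1) (maxIdeal hc1 r.1)
  isQuot r := isQuot_quotπ (maxIdeal hc1 r.1)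
  π_eq_zero r x := by
    rw [← maxIdeal_eq hc hc1 r.1]
    exact quotπ_eq_zero (by rw [maxIdeal_eq hc hc1 r.1]; exact isClosed_symIdeal hc ⊤ r.1) x
  deg_mono _ := le_refl _
  rad_mono w := leOfHom (X := Above.{u} 0) w
  map_π {r s} w n _ := congrArg (· ≫ quotπ _ (maxIdeal hc1 s.1))
    (incl_res (E := tpow V) (leOfHom (X := Above.{u} 0) w) n)
  exists_deg n := ⟨Above.base 0, ENat.natCast_lt_top n⟩
  exists_mul r s := ⟨Above.inf r s, Radius.le_inf_left _ _, Radius.le_inf_right _ _, le_top⟩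
  exists_small r ε hε := ⟨Above.inf r ⟨⟨ε, hε⟩, hε⟩,
    ⟨homOfLE (X := Above.{u} 0) (Radius.le_inf_left _ _)⟩, min_le_right _ _⟩

section generation

open IndObj

variable {hc} (M : NicholsModel hc)

omit [FiniteDimensional k V] in
/-- If the degrees of all terms are finite, the words generate the ind-object. -/
lemma NicholsModel.hom_ext_of_deg (hM : ∀ i, M.deg i < ⊤) {Z : IndObj (Ban k)} {a b : M.R ⟶ Z}
    (h : ∀ n, M.j n ≫ a = M.j n ≫ b) : a = b := IndObj.hom_ext fun i => by
  obtain ⟨l, α, β, ha, hb⟩ := Germ.exists_rep₂ (a.app i) (b.app i)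
  have key : ∀ m : ℕ, m ≤ M.deg i → ∃ (t : Z.I) (w : l ⟶ t), ∀ n < m,
      M.word i n ≫ α ≫ Z.F.map w = M.word i n ≫ β ≫ Z.F.map w := fun m => by
    induction m with
    | zero => exact fun _ => ⟨l, 𝟙 l, fun n hn => absurd hn n.not_lt_zero⟩
    | succ m ih =>
      intro hm
      have hm' : (m : ℕ∞) < M.deg i := lt_of_lt_of_le (Nat.cast_lt.2 m.lt_succ_self) hm
      obtain ⟨t, w, hw⟩ := ih hm'.le
      have e := h m
      rw [M.j_eq hm', ofConst_comp _ _ ha, ofConst_comp _ _ hb] at e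
      obtain ⟨l', v, v', e⟩ := ofConst_exact e
      let v₁ := IsFiltered.coeqHom v v'
      have e' : (M.word i m ≫ α) ≫ Z.F.map (v ≫ v₁) = (M.word i m ≫ β) ≫ Z.F.map (v ≫ v₁) := by
        conv_rhs => rw [IsFiltered.coeq_condition v v']
        rw [Functor.map_comp, Functor.map_comp, ← Category.assoc, e, Category.assoc]
      obtain ⟨t', x, y, hxy⟩ := IsFiltered.span w (v ≫ v₁)
      refine ⟨t', w ≫ x, fun n hn => ?_⟩
      rcases Nat.lt_succ_iff_lt_or_eq.1 hn with hn | rfl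
      · have := congrArg (· ≫ Z.F.map x) (hw n hn)
        simpa only [Functor.map_comp, Category.assoc] using this
      · have := congrArg (· ≫ Z.F.map y) e'
        rw [hxy]
        simpa only [Functor.map_comp, Category.assoc] using this
  obtain ⟨d, hd⟩ := ENat.ne_top_iff_exists.1 (hM i).ne
  obtain ⟨t, w, hw⟩ := key d hd.le
  rw [ha, hb]
  exact Germ.mk_eq w w (M.word_ext fun n hn => hw n (Nat.cast_lt.1 (by rw [hd]; exact hn)))

variable [MonObj M.R] (hμ : (constWords (words hc)).IsMul M.j (MonObj.mul (X := M.R)))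
  (hη : (constWords (words hc)).IsOne M.j (MonObj.one (X := M.R)))
include hμ hη

omit [FiniteDimensional k V] in
lemma NicholsModel.generates (hM : ∀ i, M.deg i < ⊤) : Generates M.gen :=
  fun _ _ f _ g hg => ⟨fun _ _ h => M.hom_ext_of_deg hM
    (Words.agree_of_agree hμ hη (constIso (powers V).letter) f g hg h)⟩

omit [FiniteDimensional k V] in
lemma NicholsModel.generatesAgainst : GeneratesAgainst IsMonomorphic M.gen :=
  fun _ _ f _ g hg _ hZ _ _ h => M.levelGen.ext₁ hZ
    (Words.agree_of_agree hμ hη (constIso (powers V).letter) f g hg h)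

end generation

end Ban

namespace Ban

variable {k : Type u} [NormedField k] [CompleteSpace k] {V : Ban k} {c : V ⊗ V ⟶ V ⊗ V}

open IndObj

/-- The words in `T_0(V)†`. -/
def tensWord (V : Ban k) (n : ℕ) : const (tpow V n) ⟶ tensDagger V := single 0 (tpow V) n

lemma tensWord_eq (r : Above.{u} 0) (n : ℕ) :
    tensWord V n = ofConst (Y := tensDagger V) r (incl r.1 (tpow V) n) := single_eq r n

lemma levelGen_tensWord : LevelGen (tensWord V) := fun i _ _ _ h =>
  geom_ext (E := tpow V) fun n => h n _ (tensWord_eq i n)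

lemma tensWord_comp {Z : IndObj (Ban k)} (f : tensDagger V ⟶ Z) (r : Above.{u} 0) (l : Z.I)
    (a : tens V r.1 ⟶ Z.at' l) (h : f.app r = Germ.mk l a) (n : ℕ) :
    tensWord V n ≫ f = ofConst l (incl r.1 (tpow V) n ≫ a) :=
  (congrArg (· ≫ f) (tensWord_eq r n)).trans (ofConst_comp (Y := tensDagger V) _ f h)

lemma tensWord_tensor (r s : Above.{u} 0) (p q : ℕ) : tensWord V p ⊗ₘ tensWord V q =
    (constTensor (tpow V p) (tpow V q)).hom ≫ ofConst (Y := tensDagger V ⊗ tensDagger V) (r, s)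
      (incl r.1 (tpow V) p ⊗ₘ incl s.1 (tpow V) q) :=
  (congrArg₂ (· ⊗ₘ ·) (tensWord_eq r p) (tensWord_eq s q)).trans
    (ofConst_tensor (X := tensDagger V) (Y := tensDagger V) _ _)

lemma tensWord_comp₂ {Z : IndObj (Ban k)} (f : tensDagger V ⊗ tensDagger V ⟶ Z) (r s : Above.{u} 0)
    (l : Z.I) (a : tens V r.1 ⊗ tens V s.1 ⟶ Z.at' l) (h : f.app (r, s) = Germ.mk l a) (p q : ℕ) :
    (tensWord V p ⊗ₘ tensWord V q) ≫ f = (constTensor (tpow V p) (tpow V q)).hom ≫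
      ofConst l ((incl r.1 (tpow V) p ⊗ₘ incl s.1 (tpow V) q) ≫ a) :=
  (congrArg (· ≫ f) (tensWord_tensor r s p q)).trans ((Category.assoc _ _ _).trans
    (congrArg (_ ≫ ·) (ofConst_comp (Y := tensDagger V ⊗ tensDagger V) _ f h)))

lemma tensWord_mul (p q : ℕ) : (tensWord V p ⊗ₘ tensWord V q) ≫ daggerTensMul V =
    (constTensor (tpow V p) (tpow V q)).hom ≫ constMap (concat V p q) ≫ tensWord V (p + q) := by
  let r := Above.base.{u} 0
  have h : (incl r.1 (tpow V) p ⊗ₘ incl r.1 (tpow V) q) ≫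
      geomMul (concat V) (normLE_concat V) (q := r.1.inf r.1) (Radius.le_inf_left _ _)
        (Radius.le_inf_right _ _) = concat V p q ≫ incl (r.1.inf r.1) (tpow V) (p + q) :=
    ext₂ fun x y => (congrArg (geomMul (concat V) (normLE_concat V) _ _)
      (tensorHom_otm _ _ x y)).trans (geomMul_incl _ _ _ _ _ _ _ _)
  refine (tensWord_comp₂ (daggerTensMul V) r r (Above.inf r r) _ rfl p q).trans
    (congrArg (_ ≫ ·) ?_)
  exact (congrArg (ofConst (Y := tensDagger V) (Above.inf r r)) h).trans
    (congrArg (constMap (concat V p q) ≫ ·) (tensWord_eq (Above.inf r r) (p + q))).symm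

lemma incl_tensCounit (r : Radius.{u}) : incl r (tpow V) 0 ≫ tensCounit V r = 𝟙 (𝟙_ (Ban k)) ∧
    ∀ n, incl r (tpow V) (n + 1) ≫ tensCounit V r = 0 :=
  ⟨hom_ext fun x => by rw [comp_apply, tensCounit, desc_incl]; rfl, fun n => hom_ext fun x => by
    rw [comp_apply, tensCounit, desc_incl]⟩

lemma tensWord_counit : tensWord V 0 ≫ daggerTensCounit V = 𝟙 _ ∧
    ∀ n, tensWord V (n + 1) ≫ daggerTensCounit V = 0 := by
  let r := Above.base.{u} 0
  have h := tensWord_comp (daggerTensCounit V) r (⟨⟨⟩⟩ : (const (𝟙_ (Ban k))).I) (tensCounit V r.1) rfl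
  refine ⟨(h 0).trans ?_, fun n => (h (n + 1)).trans ?_⟩
  · exact congrArg (ofConst (Y := const (𝟙_ (Ban k))) ⟨⟨⟩⟩) (incl_tensCounit r.1).1
  · exact (congrArg (ofConst (Y := const (𝟙_ (Ban k))) ⟨⟨⟩⟩) ((incl_tensCounit r.1).2 n)).trans
      (ofConst_zero (Y := const (𝟙_ (Ban k))) ⟨⟨⟩⟩)

lemma incl_tensCoact (r : Above.{u} 0) (h) (n : ℕ) :
    incl r.1 (tpow V) n ≫ tensCoact V r.1 two.{u}.1 r.1.half h =
      (λ_ (tpow V n)).inv ≫ (incl two.{u}.1 (diskPow k) n ⊗ₘ incl r.1.half (tpow V) n) :=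
  hom_ext fun x => by rw [comp_apply, tensCoact, desc_incl]

lemma incl_tensBraid (hc1 : NormLE c 1) (r s : Radius.{u}) (p q : ℕ) :
    (incl r (tpow V) p ⊗ₘ incl s (tpow V) q) ≫ tensBraid hc1 r s =
      braidPow c p q ≫ (incl s (tpow V) q ⊗ₘ incl r (tpow V) p) := ext₂ fun x y =>
  (congrArg (tensBraid hc1 r s) (tensorHom_otm _ _ x y)).trans (tensBraid_incl V hc1 _ _ _ _ _ _)

lemma tensWord_braid (hc1 : NormLE c 1) (p q : ℕ) :
    (tensWord V p ⊗ₘ tensWord V q) ≫ daggerTensBraid V hc1 =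
      (constTensor (tpow V p) (tpow V q)).hom ≫ constMap (braidPow c p q) ≫
        (constTensor (tpow V q) (tpow V p)).inv ≫ (tensWord V q ⊗ₘ tensWord V p) := by
  let r := Above.base.{u} 0
  refine (tensWord_comp₂ (Z := tensDagger V ⊗ tensDagger V) (daggerTensBraid V hc1) r r (r, r)
    (tensBraid hc1 r.1 r.1) rfl p q).trans (congrArg (_ ≫ ·) ?_)
  refine (congrArg (ofConst (Y := tensDagger V ⊗ tensDagger V) (r, r))
    (incl_tensBraid hc1 r.1 r.1 p q)).trans ?_
  have h := (congrArg ((constTensor (tpow V q) (tpow V p)).inv ≫ ·)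
    (tensWord_tensor r r q p)).trans (Iso.inv_hom_id_assoc _ _)
  exact (congrArg (constMap (braidPow c p q) ≫ ·) h).symm

variable (hc : IsPreBraiding c) (hc1 : NormLE c 1) [FiniteDimensional k V]

/-- The projection from `T_0(V)†`. -/
def modelπ : tensDagger V ⟶ (daggerModel hc hc1).R := nicholsπ hc1

lemma tensWord_π (n : ℕ) : tensWord V n ≫ modelπ hc hc1 = (daggerModel hc hc1).j n :=
  (tensWord_comp (modelπ hc hc1) (Above.base.{u} 0) (Above.base.{u} 0) _ rfl n).trans
    ((daggerModel hc hc1).j_eq (ENat.natCast_lt_top n)).symm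

lemma tensWord_π₂ (p q : ℕ) : (tensWord V p ⊗ₘ tensWord V q) ≫ (modelπ hc hc1 ⊗ₘ modelπ hc hc1) =
    (constTensor (tpow V p) (tpow V q)).hom ≫ (daggerModel hc hc1).j₂ p q := by
  rw [tensorHom_comp_tensorHom, tensWord_π, tensWord_π, (daggerModel hc hc1).j_tensor]

variable {hc hc1}

lemma modelπ_mul {m : (daggerModel hc hc1).R ⊗ (daggerModel hc hc1).R ⟶ (daggerModel hc hc1).R}
    (hm : (constWords (words hc)).IsMul (daggerModel hc hc1).j m) :
    (modelπ hc hc1 ⊗ₘ modelπ hc hc1) ≫ m = daggerTensMul V ≫ modelπ hc hc1 :=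
  levelGen_tensWord.ext₂ (daggerModel hc hc1).approximable.isMonomorphic fun p q => by
    have h := hm (rfl : p + q = _)
    rw [(daggerModel hc hc1).J2_eq (rfl : p + q = _), Category.assoc] at h
    rw [← Category.assoc, ← Category.assoc, tensWord_π₂, tensWord_mul, Category.assoc,
      Category.assoc, Category.assoc, tensWord_π, ← h, ← words_g hc p q]
    refine congrArg (_ ≫ ·) ?_
    rw [← Category.assoc (constMap _), ← constMap_comp, Iso.hom_inv_id, constMap_id,
      Category.id_comp]

lemma modelπ_one {e : 𝟙_ (IndObj (Ban k)) ⟶ (daggerModel hc hc1).R}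
    (he : (constWords (words hc)).IsOne (daggerModel hc hc1).j e) :
    e = daggerTensOne V ≫ modelπ hc hc1 := by
  refine he.trans (Eq.trans ?_ (tensWord_π hc hc1 0).symm)
  exact Category.id_comp _

lemma modelπ_comul {d : (daggerModel hc hc1).R ⟶ (daggerModel hc hc1).R ⊗ (daggerModel hc hc1).R}
    (hd : (constWords (words hc)).IsComul (daggerModel hc hc1).j d) :
    modelπ hc hc1 ≫ d = daggerTensComul V hc1 ≫ (modelπ hc hc1 ⊗ₘ modelπ hc hc1) :=
  levelGen_tensWord.ext₁ ((daggerModel hc hc1).approximable.tensor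
    (daggerModel hc hc1).approximable).isMonomorphic fun n => by
    let r := Above.base.{u} 0
    rw [← Category.assoc, tensWord_π]
    refine (hd n).trans (((daggerModel hc hc1).ofConst_comulPow hc1 (l := Above.half r)
      (ENat.natCast_lt_top n)).symm.trans ?_)
    refine Eq.trans ?_ (tensWord_comp _ r (Z := (daggerModel hc hc1).R ⊗ (daggerModel hc hc1).R)
      (Above.half r, Above.half r) (tensComul hc1 r.1 ≫ ((daggerModel hc hc1).π (Above.half r) ⊗ₘ
        (daggerModel hc hc1).π (Above.half r))) rfl n).symm
    exact congrArg (ofConst (Y := (daggerModel hc hc1).R ⊗ (daggerModel hc hc1).R)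
      (Above.half r, Above.half r)) ((congrArg (· ≫ _) (incl_tensComul hc1 r.1 n)).symm.trans
        (Category.assoc _ _ _))

lemma modelπ_counit {e : (daggerModel hc hc1).R ⟶ 𝟙_ (IndObj (Ban k))}
    (he : (constWords (words hc)).IsCounit (daggerModel hc hc1).j e) :
    modelπ hc hc1 ≫ e = daggerTensCounit V :=
  levelGen_tensWord.ext₁ (approximable_const (𝟙_ (Ban k))).isMonomorphic fun n => by
    refine (Category.assoc _ _ _).symm.trans ((congrArg (· ≫ e) (tensWord_π hc hc1 n)).trans ?_)
    cases n with
    | zero => exact he.1.trans tensWord_counit.1.symm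
    | succ n => exact (he.2 n).trans (tensWord_counit.2 n).symm

lemma modelπ_braid {b : (daggerModel hc hc1).R ⊗ (daggerModel hc hc1).R ⟶
      (daggerModel hc hc1).R ⊗ (daggerModel hc hc1).R}
    (hb : ∀ p q, (daggerModel hc hc1).j₂ p q ≫ b =
      constMap (braidPow c p q) ≫ (daggerModel hc hc1).j₂ q p) :
    (modelπ hc hc1 ⊗ₘ modelπ hc hc1) ≫ b =
      daggerTensBraid V hc1 ≫ (modelπ hc hc1 ⊗ₘ modelπ hc hc1) :=
  levelGen_tensWord.ext₂ ((daggerModel hc hc1).approximable.tensor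
    (daggerModel hc hc1).approximable).isMonomorphic fun p q => by
    rw [← Category.assoc, tensWord_π₂, Category.assoc, hb, ← Category.assoc _ (daggerTensBraid V hc1),
      tensWord_braid, Category.assoc, Category.assoc, Category.assoc, tensWord_π₂, Iso.inv_hom_id_assoc]

lemma modelπ_coact {ρ : (daggerModel hc hc1).R ⟶ diskAlg k 1 ⊗ (daggerModel hc hc1).R}
    (hρ : ∀ n, IsHomogeneous (tPow 1) ρ n ((daggerModel hc hc1).j n)) :
    modelπ hc hc1 ≫ ρ = daggerTensCoact V ≫ (diskAlg k 1 ◁ modelπ hc hc1) :=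
  levelGen_tensWord.ext₁ ((approximable_disk 1).tensor
    (daggerModel hc hc1).approximable).isMonomorphic fun n => by
    let r := Above.base.{u} 0
    rw [← Category.assoc, tensWord_π]
    refine (hρ n).trans (((daggerModel hc hc1).ofConst_coact (l := Above.half r)
      (ENat.natCast_lt_top n)).symm.trans ?_)
    have h := mul_div_cancel₀ r.1.val two_ne_zero
    refine Eq.trans ?_ (tensWord_comp _ r (Z := diskAlg k 1 ⊗ (daggerModel hc hc1).R)
      (two.{u}, Above.half r) (tensCoact V r.1 two.{u}.1 r.1.half h.le ≫
        (𝟙 (geom two.{u}.1 (diskPow k)) ⊗ₘ (daggerModel hc hc1).π (Above.half r))) rfl n).symm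
    refine congrArg (ofConst (Y := diskAlg k 1 ⊗ (daggerModel hc hc1).R) (two.{u}, Above.half r)) ?_
    refine Eq.trans ?_ (Category.assoc _ _ _)
    refine Eq.trans ?_ (congrArg (· ≫ _) (incl_tensCoact r h.le n)).symm
    refine Eq.trans (congrArg (_ ≫ ·) ?_) (Category.assoc _ _ _).symm
    exact Eq.trans (congrArg (· ⊗ₘ _) (Category.comp_id _).symm)
      (tensorHom_comp_tensorHom _ _ _ _).symm

lemma gen_eq : (daggerModel hc hc1).gen = daggerTensGen V ≫ modelπ hc hc1 := by
  rw [NicholsModel.gen, ← tensWord_π, ← Category.assoc]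
  exact congrArg (fun f => (constMap f ≫ tensWord V 1) ≫ modelπ hc hc1) (letter_hom V)

end Ban

end

/-- Let `k` be a complete valued field (with values in `ℝ` and the usual triangle inequality), `V` a
finite-dimensional Banach space over `k` and `c` a pre-braiding of `V` with `‖c‖ ≤ 1`. -/
theorem proposition4p3 {k : Type u} [NormedField k] [CompleteSpace k] (V : Ban k)
    [FiniteDimensional k V] (c : V ⊗ V ⟶ V ⊗ V) (hc : IsPreBraiding c) (hc1 : Ban.NormLE c 1) :
    -- A dagger-0 Nichols algebra of `V` exists (braided if `c` is invertible).
    (∃ (R : IndObj (Ban k)) (_ : MonObj R) (_ : ComonObj R) (braid : R ⊗ R ⟶ R ⊗ R)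
        (ρ : R ⟶ Ban.diskAlg k 1 ⊗ R) (i : IndObj.const V ⟶ R),
      Ban.IsDaggerZeroNicholsUngenerated (Ban.constBraid c) R braid ρ i ∧ Generates i ∧
        (IsIso c → IsIso braid)) ∧
    -- The sums `I_r(V)` of all compatible families of ideals form such a family of closed ideals.
    (Ban.IsCoidealFamily hc1 (Ban.maxIdeal hc1) ∧
      ∀ r, IsClosed (Ban.maxIdeal hc1 r : Set (Ban.tens V r))) ∧
    -- The colimit over `r > 0` of the quotients `T_r(V) / I_r(V)`, with the structure induced from
    -- `T_0(V)†`, is a dagger-0 Nichols algebra of `V`, which is generated by `V` as tested against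
    -- all ind-Banach spaces with injective transition maps.
    ∃ (_ : MonObj (Ban.nicholsDagger hc1)) (_ : ComonObj (Ban.nicholsDagger hc1))
        (braid : Ban.nicholsDagger hc1 ⊗ Ban.nicholsDagger hc1 ⟶
          Ban.nicholsDagger hc1 ⊗ Ban.nicholsDagger hc1)
        (ρ : Ban.nicholsDagger hc1 ⟶ Ban.diskAlg k 1 ⊗ Ban.nicholsDagger hc1)
        (i : IndObj.const V ⟶ Ban.nicholsDagger hc1),
      Ban.IsDaggerZeroNicholsUngenerated (Ban.constBraid c) (Ban.nicholsDagger hc1) braid ρ i ∧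
      GeneratesAgainst Ban.IsMonomorphic i ∧
      (Ban.nicholsπ hc1 ⊗ₘ Ban.nicholsπ hc1) ≫ MonObj.mul =
        Ban.daggerTensMul V ≫ Ban.nicholsπ hc1 ∧
      MonObj.one = Ban.daggerTensOne V ≫ Ban.nicholsπ hc1 ∧
      Ban.nicholsπ hc1 ≫ ComonObj.comul =
        Ban.daggerTensComul V hc1 ≫ (Ban.nicholsπ hc1 ⊗ₘ Ban.nicholsπ hc1) ∧
      Ban.nicholsπ hc1 ≫ ComonObj.counit = Ban.daggerTensCounit V ∧
      (Ban.nicholsπ hc1 ⊗ₘ Ban.nicholsπ hc1) ≫ braid =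
        Ban.daggerTensBraid V hc1 ≫ (Ban.nicholsπ hc1 ⊗ₘ Ban.nicholsπ hc1) ∧
      Ban.nicholsπ hc1 ≫ ρ = Ban.daggerTensCoact V ≫ (Ban.diskAlg k 1 ◁ Ban.nicholsπ hc1) ∧
      i = Ban.daggerTensGen V ≫ Ban.nicholsπ hc1 ∧
      (∀ d : V ⊗ V ⟶ V ⊗ V, c ≫ d = 𝟙 _ → d ≫ c = 𝟙 _ → Ban.NormLE d 1 → IsIso braid) := by
  refine ⟨?_, ?_, ?_⟩
  · obtain ⟨i₁, i₂, b, ρ, hμ, hη, -, -, hb, -, h⟩ := (Ban.cutoffModel hc).exists_structure hc1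
    refine ⟨(Ban.cutoffModel hc).R, i₁, i₂, b, ρ, _, h,
      (Ban.cutoffModel hc).generates hμ hη fun i => ENat.natCast_lt_top i.deg, fun _ => ?_⟩
    choose E hE hE' using Ban.exists_braidPow_iso (IsIso.hom_inv_id c) (IsIso.inv_hom_id c)
    choose C hC hn using fun p q => Ban.exists_normLE (E q p).inv
    refine (Ban.cutoffModel hc).isIso_braid hb (fun p q => (E q p).inv)
      (fun i i' => ⟨∑ p ∈ Finset.range i.deg, ∑ q ∈ Finset.range i'.deg, C p q,
        Finset.sum_nonneg fun p _ => Finset.sum_nonneg fun q _ => hC p q, fun p q hp hq =>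
        (hn p q).mono ?_⟩) (fun p q => by rw [← hE, Iso.hom_inv_id])
      (fun p q => by rw [← hE, Iso.inv_hom_id])
    refine (Finset.single_le_sum (fun q _ => hC p q)
      (Finset.mem_range.2 (Nat.cast_lt.1 hq))).trans ?_
    exact Finset.single_le_sum (f := fun p => ∑ q ∈ Finset.range i'.deg, C p q)
      (fun p _ => Finset.sum_nonneg fun q _ => hC p q) (Finset.mem_range.2 (Nat.cast_lt.1 hp))
  · have h : Ban.maxIdeal hc1 = Ban.symIdeal hc ⊤ := funext fun r => Ban.maxIdeal_eq hc hc1 r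
    rw [h]
    exact ⟨Ban.isCoidealFamily_symIdeal hc hc1, Ban.isClosed_symIdeal hc ⊤⟩
  · obtain ⟨i₁, i₂, b, ρ, hμ, hη, hΔ, hε, hb, hρ, h⟩ := (Ban.daggerModel hc hc1).exists_structure hc1
    refine ⟨i₁, i₂, b, ρ, (Ban.daggerModel hc hc1).gen, h,
      (Ban.daggerModel hc hc1).generatesAgainst hμ hη, Ban.modelπ_mul hμ, Ban.modelπ_one hη,
      Ban.modelπ_comul hΔ, Ban.modelπ_counit hε, Ban.modelπ_braid hb, Ban.modelπ_coact hρ,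
      Ban.gen_eq, fun d h₁ h₂ hd => ?_⟩
    choose E hE hE' using Ban.exists_braidPow_iso h₁ h₂
    exact (Ban.daggerModel hc hc1).isIso_braid hb (fun p q => (E q p).inv)
      (fun _ _ => ⟨1, zero_le_one, fun p q _ _ => hE' q p hd⟩)
      (fun p q => by rw [← hE, Iso.hom_inv_id]) (fun p q => by rw [← hE, Iso.inv_hom_id])
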